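/- Let $\mathbb D$ be the open unit disk and let $\varphi:\mathbb D\to\mathbb C$ be holomorphic, not identically zero, with $\int_{\mathbb D}|\varphi|\,d\xi\,d\eta<\infty$. For every $w=s+ti$ with $s>0$ let $f_{s+ti}:\mathbb D\to\mathbb D$ be a quasiconformal homeomorphism of $\mathbb D$ onto itself with Beltrami coefficient $$\frac{1-(s+ti)}{1+(s+ti)}\,\frac{\overline{\varphi}}{|\varphi|}$$ (in the natural parameter $z=x+yi=\int\sqrt{\varphi(\zeta)}\,d\zeta$ this is the map $z\mapsto \frac1s x-\frac ts y+yi$, up to a conformal map). Let $B=[a,b]\times[c,d]$ be a box of geodesics, that is, $a,b,c,d\in S^1=\partial\mathbb D$ are distinct points in counterclockwise order and $[a,b]$, $[c,d]$ are the closed counterclockwise arcs between them. Let $\Gamma_B$ be the family of all simple arcs inside $\mathbb D$ that have one end point in $[a,b]$ and the other in $[c,d]$. The modulus of a family $\Gamma$ of arcs is $\mathrm{mod}(\Gamma)=\inf_\rho\iint_{\mathbb C}\rho^2\,dx\,dy$, where $\rho\ge 0$ runs over the Borel measurable functions with $\int_\gamma\rho\,|dz|\ge 1$ for all $\gamma\in\Gamma$.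 Let $\mu_{-\varphi}(B)$ be defined by means of the vertical trajectories of $-\varphi$ (which are the horizontal trajectories of $\varphi$) that have one end point in $[a,b]$ and the other in $[c,d]$: $$\mu_{-\varphi}(B)=\sum_k\int_{J_k}\frac{|dy|}{l(z)},$$ where $\{J_k\}_k$ is an at most countable collection of compact vertical arcs of $\varphi$ that meet each trajectory at most once in total and together meet almost all of the trajectories that connect $[a,b]$ to $[c,d]$, the integral extends over the points of $J_k$ that lie on such connecting trajectories, $y=\mathrm{Im}\int\sqrt{\varphi}\,d\zeta$, and $l(z)$ is the $\varphi$-length of the horizontal trajectory of $\varphi$ through $z$. (Equivalently, $\mu_{-\varphi}(B)$ is the supremum of these sums over all at most countable collections of compact vertical arcs that meet each horizontal trajectory at most once in total.) Then, for every such box $B$, $$\liminf_{s+|t|\to\infty}\ \frac{1}{s+\frac{t^2}{s}}\ \mathrm{mod}\bigl(f_{s+ti}(\Gamma_B)\bigr)\ \ge\ \mu_{-\varphi}(B),$$ where $s+ti$ tends to infinity in the half-plane $s>0$ along arbitrary approaches. -/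

import Mathlib

open Set Filter Topology MeasureTheory
open scoped ENNReal ContDiff

noncomputable section

namespace TeichDisk

/-- The open unit disk. -/
def disk : Set ℂ := Metric.ball 0 1

/-- The closed arc of the unit circle running counterclockwise from `exp (i θ₁)` to
`exp (i θ₂)`, for `θ₁ ≤ θ₂ ≤ θ₁ + 2π`. -/
def circleArc (θ₁ θ₂ : ℝ) : Set ℂ :=
  (fun θ : ℝ => Complex.exp (θ * Complex.I)) '' Icc θ₁ θ₂

/-! ### Modulus of a family of arcs -/

/-- The line integral `∫_γ ρ |dz|` along a simple arc `γ : ℝ → ℂ` (an injective continuous map):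
the integral of `ρ` over the trace of `γ` against arc length, which for a simple arc is the
one-dimensional Hausdorff measure of the trace. -/
def lineIntegral (ρ : ℂ → ℝ≥0∞) (γ : ℝ → ℂ) : ℝ≥0∞ :=
  ∫⁻ z in range γ, ρ z ∂(Measure.hausdorffMeasure 1 : Measure ℂ)

/-- A metric `ρ |dz|` is allowable for the family `Γ` of simple arcs if `ρ` is (Borel) measurable
and every arc of `Γ` has `ρ`-length at least one. -/
def Allowable (Γ : Set (ℝ → ℂ)) (ρ : ℂ → ℝ≥0∞) : Prop :=
  Measurable ρ ∧ ∀ γ ∈ Γ, 1 ≤ lineIntegral ρ γ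

/-- The modulus of a family of simple arcs. -/
def modulus (Γ : Set (ℝ → ℂ)) : ℝ≥0∞ :=
  ⨅ (ρ : ℂ → ℝ≥0∞) (_ : Allowable Γ ρ), ∫⁻ z, ρ z ^ 2

/-- The family of all simple arcs inside the unit disk that connect the subset `E` of the
unit circle to the subset `F`. An arc is parametrized by the whole real line, so that it lies in
the open disk and has its two end points as limits at `-∞` and `+∞`. -/
def connectingArcs (E F : Set ℂ) : Set (ℝ → ℂ) :=
  {γ | Continuous γ ∧ Function.Injective γ ∧ (∀ t, γ t ∈ disk) ∧
    (∃ p ∈ E, Tendsto γ atBot (𝓝 p)) ∧ (∃ q ∈ F, Tendsto γ atTop (𝓝 q))}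

/-- The image `f(Γ)` of a family of arcs under a map. -/
def imageFamily (f : ℂ → ℂ) (Γ : Set (ℝ → ℂ)) : Set (ℝ → ℂ) :=
  (fun γ => f ∘ γ) '' Γ

/-! ### Quasiconformal self-maps of the disk with a given Beltrami coefficient -/

/-- `∂η/∂z = (η_x - i η_y) / 2`. -/
def dz (η : ℂ → ℂ) (z : ℂ) : ℂ :=
  (fderiv ℝ η z 1 - Complex.I * fderiv ℝ η z Complex.I) / 2

/-- `∂η/∂z̄ = (η_x + i η_y) / 2`. -/
def dzbar (η : ℂ → ℂ) (z : ℂ) : ℂ :=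
  (fderiv ℝ η z 1 + Complex.I * fderiv ℝ η z Complex.I) / 2

/-- Smooth functions with compact support in the unit disk. -/
def IsTestFunction (η : ℂ → ℂ) : Prop :=
  ContDiff ℝ ∞ η ∧ HasCompactSupport η ∧ tsupport η ⊆ disk

/-- Local square integrability in the unit disk. -/
def LocallyL2 (p : ℂ → ℂ) : Prop :=
  ∀ K : Set ℂ, IsCompact K → K ⊆ disk → MemLp p 2 (volume.restrict K)

/-- `f` is a quasiconformal map of the unit disk onto itself with Beltrami coefficient `μ`
(analytic definition): `f` is a homeomorphism of the disk onto itself, its distributional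
derivatives `p = ∂f/∂z` and `q = ∂f/∂z̄` in the disk are locally square integrable functions,
the essential supremum of `|μ|` is less than one, and `q = μ p` almost everywhere. -/
def IsQuasiconformal (μ : ℂ → ℂ) (f : OpenPartialHomeomorph ℂ ℂ) : Prop :=
  f.source = disk ∧ f.target = disk ∧
  (∃ k : ℝ, k < 1 ∧ ∀ᵐ z ∂(volume.restrict disk), ‖μ z‖ ≤ k) ∧
  ∃ p q : ℂ → ℂ, LocallyL2 p ∧ LocallyL2 q ∧
    (∀ η, IsTestFunction η → ∫ z, f z * dz η z = - ∫ z, p z * η z) ∧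
    (∀ η, IsTestFunction η → ∫ z, f z * dzbar η z = - ∫ z, q z * η z) ∧
    ∀ᵐ z ∂(volume.restrict disk), q z = μ z * p z

/-- The Beltrami coefficient `((1 - w) / (1 + w)) (conj φ / |φ|)`. -/
def beltrami (φ : ℂ → ℂ) (w : ℂ) (z : ℂ) : ℂ :=
  (1 - w) / (1 + w) * (starRingEnd ℂ (φ z) / (‖φ z‖ : ℂ))

/-! ### Trajectories of a quadratic differential and the measure of a box -/

/-- `γ`, restricted to the open interval `(α, β)` (where `α = -∞` and `β = +∞` are allowed), is a
subarc of a vertical trajectory of the quadratic differential `ψ dz²` in the disk, parametrized by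
its length in the metric `|ψ|^{1/2} |dz|`. The condition `ψ(γ) (γ')² = -1` says that `γ` runs
vertically with unit speed in every local natural parameter `∫ √ψ dz`; in particular `γ` avoids
the zeros of `ψ`. -/
def IsVerticalArc (ψ : ℂ → ℂ) (α β : EReal) (γ : ℝ → ℂ) : Prop :=
  α < β ∧ ∀ t : ℝ, α < t → t < β →
    γ t ∈ disk ∧ ∃ v : ℂ, HasDerivAt γ v t ∧ ψ (γ t) * v ^ 2 = -1

/-- The `ψ`-length of the vertical trajectory of `ψ` through `z`: the trajectory is the longest
vertical arc through `z`, and an arc parametrized by length over `(α, β)` has length `β - α`. -/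
def verticalLength (ψ : ℂ → ℂ) (z : ℂ) : ℝ≥0∞ :=
  ⨆ (α : EReal) (β : EReal) (γ : ℝ → ℂ) (_ : IsVerticalArc ψ α β γ)
    (_ : ∃ t : ℝ, α < t ∧ t < β ∧ γ t = z), (β - α).toENNReal

/-- The union of all vertical trajectories of `ψ` that have one end point in `E` and the other in
`F`, where `E` and `F` are subsets of the unit circle. (A vertical arc whose two ends tend to the
unit circle is a whole trajectory.) -/
def connectingTrajectories (ψ : ℂ → ℂ) (E F : Set ℂ) : Set ℂ :=
  {z | ∃ (α β : EReal) (γ : ℝ → ℂ), IsVerticalArc ψ α β γ ∧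
    (∃ p ∈ E, Tendsto γ (comap ((↑) : ℝ → EReal) (𝓝[>] α)) (𝓝 p)) ∧
    (∃ q ∈ F, Tendsto γ (comap ((↑) : ℝ → EReal) (𝓝[<] β)) (𝓝 q)) ∧
    ∃ t : ℝ, α < t ∧ t < β ∧ γ t = z}

/-- `σ`, restricted to `[0, h]`, is a compact horizontal arc of `ψ` in the disk, parametrized by
length, so that `|Re (√ψ dz)| = dt` along it. (For `h < 0` this is the empty arc.) -/
def IsHorizontalSegment (ψ : ℂ → ℂ) (h : ℝ) (σ : ℝ → ℂ) : Prop :=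
  ∀ t ∈ Icc 0 h, σ t ∈ disk ∧ ∃ v : ℂ, HasDerivWithinAt σ v (Icc 0 h) t ∧ ψ (σ t) * v ^ 2 = 1

/-- An (at most countable) collection of compact horizontal arcs `J k = σ k '' [0, h k]` of `ψ`
such that every vertical trajectory of `ψ` meets at most one of the `J k`, in at most one point.
Members of the sequence with `h k < 0` are empty. -/
def IsTransversalSystem (ψ : ℂ → ℂ) (σ : ℕ → ℝ → ℂ) (h : ℕ → ℝ) : Prop :=
  (∀ k, IsHorizontalSegment ψ (h k) (σ k)) ∧
  ∀ (α β : EReal) (γ : ℝ → ℂ), IsVerticalArc ψ α β γ →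
    ∀ t t' : ℝ, α < t → t < β → α < t' → t' < β →
    ∀ k k' : ℕ, ∀ τ ∈ Icc 0 (h k), ∀ τ' ∈ Icc 0 (h k'),
      γ t = σ k τ → γ t' = σ k' τ' → k = k' ∧ τ = τ'

/-- The measure `μ_ψ(E × F)` of a box of geodesics: `∑ₖ ∫_{J k} |dx| / l`, where `l` is the length
of the vertical trajectory, the integral extends over the vertical trajectories with one end point
in `E` and the other in `F`, and the arcs `J k` meet every trajectory at most once. The sum does
not depend on the arcs as long as they meet (almost) every such trajectory, and is smaller
otherwise; the supremum is therefore the value for a complete collection of arcs. -/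
def trajectoryMeasure (ψ : ℂ → ℂ) (E F : Set ℂ) : ℝ≥0∞ :=
  ⨆ (σ : ℕ → ℝ → ℂ) (h : ℕ → ℝ) (_ : IsTransversalSystem ψ σ h),
    ∑' k, ∫⁻ t in Icc 0 (h k),
      (connectingTrajectories ψ E F).indicator (fun z => (verticalLength ψ z)⁻¹) (σ k t)

/-- The filter `s + |t| → ∞` on the right half-plane `{s + t i | s > 0}`. -/
def toInfinity : Filter ℂ :=
  comap (fun w : ℂ => w.re + |w.im|) atTop ⊓ 𝓟 {w : ℂ | 0 < w.re}

end TeichDisk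

end

noncomputable section
namespace TeichDisk

/-! ### Continuous logarithms along paths -/

/-! In a natural parameter of `φ` the map with parameter `w = s + ti` is, up to a conformal factor,
the real linear map `twist ((1 - w) / (1 + w))`. It contracts one direction most, namely `slant w =
1 + (t / |w|²) i`, and along this direction the square of the stretch is `s / |w|²` times the
Jacobian. Since `s / |w|² = 1 / (s + t² / s)`, this is exactly the normalizing factor of the
theorem, and the slope of the direction tends to zero as `s + |t| → ∞`. The proof is therefore a
length-area argument along straight trajectories in the direction `slant w`.

Let `ρ` be allowable for the image family. If a slanted trajectory of `φ`-time `l'` joins the two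
arcs, the Cauchy-Schwarz inequality bounds `1 / l'` by the integral along it of `(s / |w|²) ρ²`
times the Jacobian (`FullLine.inv_length_le`). The flow of slanted trajectories through short
vertical transversals is injective and takes Lebesgue measure to the area of `φ`. Integration over
the transversals thus bounds the integral of `1 / l'` by `(s / |w|²) ∫ ρ²`
(`sum_lintegral_energy_le`).

It remains to compare slanted with horizontal trajectories through the same point. By
`IsChart.ae_shadow`, for almost every point the slanted trajectories of small slope follow the
horizontal one and end near its end points, provided that slope times length is small; a sequence
with summable slopes has this property almost everywhere. The excess length then lies in a thin
annulus at the unit circle, and its integral is at most the `φ`-area of that annulus. Fatou's lemma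
and integrability of `φ` finish the proof (`sum_lintegral_inv_verticalLength_le`).

Two topological facts carry the comparison. A straight arc never returns to a small chart
(`IsChart.no_return`): otherwise it could be closed to a simple loop along which `φ Γ'²` makes at
most one full turn, whereas the theorem of turning tangents and the argument principle force at
least two. A slanted trajectory cannot escape from the end of a horizontal one (`IsFlowLine.trap`):
it meets only a thin set of horizontal trajectories, so two unmet ones on its sides, a vertical
segment and a piece near the unit circle fence it in. Crossing this fence exactly once contradicts a
count of winding numbers (`IsChart.not_separated`). -/

theorem exists_log_lift {X : Type*} [TopologicalSpace X] [SimplyConnectedSpace X]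
    [LocallyPathConnectedSpace X] {f : X → ℂ} (hf : Continuous f) (h0 : ∀ x, f x ≠ 0) :
    ∃ g : X → ℂ, Continuous g ∧ ∀ x, Complex.exp (g x) = f x := by
  obtain ⟨x₀⟩ : Nonempty X := inferInstance
  have := Complex.isCoveringMap_exp.existsUnique_continuousMap_lifts
    (f := ⟨fun x => (⟨f x, h0 x⟩ : {z : ℂ // z ≠ 0}), by fun_prop⟩) (a₀ := x₀)
    (e₀ := Complex.log (f x₀)) (by ext; simp [Complex.exp_log (h0 x₀)])
  obtain ⟨F, ⟨-, hF⟩, -⟩ := this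
  refine ⟨F, F.continuous, fun x => ?_⟩
  have := congrFun hF x
  exact congrArg Subtype.val this

theorem exists_log_lift_Icc {g : ℝ → ℂ} {a b : ℝ} (hab : a ≤ b) (hg : ContinuousOn g (Icc a b))
    (h0 : ∀ t ∈ Icc a b, g t ≠ 0) :
    ∃ θ : ℝ → ℂ, ContinuousOn θ (Icc a b) ∧ ∀ t ∈ Icc a b, Complex.exp (θ t) = g t := by
  obtain ⟨θ, hθ, h⟩ := exists_log_lift (X := ℝ) (f := IccExtend hab ((Icc a b).domRestrict g))
    (by exact (continuousOn_iff_continuous_domRestrict.1 hg).Icc_extend')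
    (fun x => h0 _ (projIcc a b hab x).2)
  refine ⟨θ, hθ.continuousOn, fun t ht => ?_⟩
  rw [h, IccExtend_of_mem _ _ ht]; rfl

/-- The total change of the logarithm of `g` along `[a, b]`. -/
def dlog (g : ℝ → ℂ) (a b : ℝ) : ℂ :=
  open Classical in
  if h : ∃ θ : ℝ → ℂ, ContinuousOn θ (Icc a b) ∧ ∀ t ∈ Icc a b, Complex.exp (θ t) = g t then
    h.choose b - h.choose a else 0

/-- Two logarithms of one function differ by `2πi` times an integer which depends continuously on
the point, hence is constant on a connected set. This makes `dlog` independent of the lift chosen in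
its definition. -/
theorem sub_const_of_exp_eq {X : Type*} [TopologicalSpace X] {S : Set X} (hS : IsPreconnected S)
    {θ η : X → ℂ} (hθ : ContinuousOn θ S) (hη : ContinuousOn η S)
    (h : ∀ t ∈ S, Complex.exp (θ t) = Complex.exp (η t)) {a b : X} (ha : a ∈ S) (hb : b ∈ S) :
    θ b - θ a = η b - η a := by
  have hc : ContinuousOn (fun t => ((θ t - η t) / (2 * Real.pi * Complex.I)).re) S := by
    fun_prop
  have hint : ∀ t ∈ S, ∃ n : ℤ, (θ t - η t) / (2 * Real.pi * Complex.I) = n := fun t ht => by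
    obtain ⟨n, hn⟩ := Complex.exp_eq_exp_iff_exists_int.1 (h t ht)
    refine ⟨n, ?_⟩
    rw [hn]
    have : (2 * Real.pi * Complex.I : ℂ) ≠ 0 := Complex.two_pi_I_ne_zero
    field_simp
    ring
  have hre : ((θ a - η a) / (2 * Real.pi * Complex.I)).re
      = ((θ b - η b) / (2 * Real.pi * Complex.I)).re := by
    choose! n hn using hint
    have hn' : ContinuousOn (fun t => (n t : ℝ)) S :=
      hc.congr fun t ht => by simp only [hn t ht, Complex.intCast_re]
    have hn'' : ContinuousOn n S := by
      have := Int.isClosedEmbedding_coe_real.isInducing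
      exact this.continuousOn_iff.2 hn'
    have := hS.constant hn'' ha hb
    rw [hn a ha, hn b hb, this]
  obtain ⟨m, hm⟩ := hint a ha
  obtain ⟨n, hn⟩ := hint b hb
  rw [hm, hn] at hre
  have : (m : ℂ) = n := by exact_mod_cast hre
  have e : (θ a - η a) / (2 * Real.pi * Complex.I) = (θ b - η b) / (2 * Real.pi * Complex.I) := by
    rw [hm, hn, this]
  have h2 : (2 * Real.pi * Complex.I : ℂ) ≠ 0 := Complex.two_pi_I_ne_zero
  have := (div_left_inj' h2).1 e
  linear_combination -this

theorem dlog_eq {g θ : ℝ → ℂ} {a b : ℝ} (hab : a ≤ b) (hθ : ContinuousOn θ (Icc a b))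
    (h : ∀ t ∈ Icc a b, Complex.exp (θ t) = g t) : dlog g a b = θ b - θ a := by
  have hex : ∃ θ : ℝ → ℂ, ContinuousOn θ (Icc a b) ∧ ∀ t ∈ Icc a b, Complex.exp (θ t) = g t :=
    ⟨θ, hθ, h⟩
  rw [dlog, dif_pos hex]
  exact sub_const_of_exp_eq isPreconnected_Icc hex.choose_spec.1 hθ
    (fun t ht => by rw [hex.choose_spec.2 t ht, h t ht])
    (left_mem_Icc.2 hab) (right_mem_Icc.2 hab)

theorem dlog_congr {f g : ℝ → ℂ} {a b : ℝ} (h : ∀ t ∈ Icc a b, f t = g t) :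
    dlog f a b = dlog g a b := by
  have : ∀ θ : ℝ → ℂ, (ContinuousOn θ (Icc a b) ∧ ∀ t ∈ Icc a b, Complex.exp (θ t) = f t) ↔
      (ContinuousOn θ (Icc a b) ∧ ∀ t ∈ Icc a b, Complex.exp (θ t) = g t) := fun θ =>
    and_congr_right fun _ => forall₂_congr fun t ht => by rw [h t ht]
  -- `dlog` is defined by choice, so the two defining predicates are first identified; then the
  -- chosen lifts coincide.
  have key : ∀ P Q : (ℝ → ℂ) → Prop, P = Q →
      (open Classical in if h : ∃ θ, P θ then h.choose b - h.choose a else 0)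
        = (open Classical in if h : ∃ θ, Q θ then h.choose b - h.choose a else 0) := by
    rintro P _ rfl; rfl
  exact key _ _ (funext fun θ => propext (this θ))

theorem dlog_mul {f g : ℝ → ℂ} {a b : ℝ} (hab : a ≤ b)
    (hf : ContinuousOn f (Icc a b)) (hf0 : ∀ t ∈ Icc a b, f t ≠ 0)
    (hg : ContinuousOn g (Icc a b)) (hg0 : ∀ t ∈ Icc a b, g t ≠ 0) :
    dlog (fun t => f t * g t) a b = dlog f a b + dlog g a b := by
  obtain ⟨θ, hθ, h⟩ := exists_log_lift_Icc hab hf hf0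
  obtain ⟨η, hη, h'⟩ := exists_log_lift_Icc hab hg hg0
  rw [dlog_eq hab hθ h, dlog_eq hab hη h', dlog_eq (θ := fun t => θ t + η t) hab (hθ.add hη)
    (fun t ht => by rw [Complex.exp_add, h t ht, h' t ht])]
  ring

theorem dlog_add {g : ℝ → ℂ} {a b c : ℝ} (hab : a ≤ b) (hbc : b ≤ c)
    (hg : ContinuousOn g (Icc a c)) (h0 : ∀ t ∈ Icc a c, g t ≠ 0) :
    dlog g a b + dlog g b c = dlog g a c := by
  obtain ⟨θ, hθ, h⟩ := exists_log_lift_Icc (hab.trans hbc) hg h0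
  rw [dlog_eq (hab.trans hbc) hθ h,
    dlog_eq hab (hθ.mono (Icc_subset_Icc le_rfl hbc)) (fun t ht => h t ⟨ht.1, ht.2.trans hbc⟩),
    dlog_eq hbc (hθ.mono (Icc_subset_Icc hab le_rfl)) (fun t ht => h t ⟨hab.trans ht.1, ht.2⟩)]
  ring

theorem dlog_const (k : ℂ) {a b : ℝ} (hab : a ≤ b) (hk : k ≠ 0) : dlog (fun _ => k) a b = 0 := by
  rw [dlog_eq (θ := fun _ => Complex.log k) hab continuousOn_const
    (fun t _ => Complex.exp_log hk), sub_self]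

theorem dlog_const_mul {g : ℝ → ℂ} {a b : ℝ} {k : ℂ} (hk : k ≠ 0) (hab : a ≤ b)
    (hg : ContinuousOn g (Icc a b)) (h0 : ∀ t ∈ Icc a b, g t ≠ 0) :
    dlog (fun t => k * g t) a b = dlog g a b := by
  rw [dlog_mul hab continuousOn_const (fun _ _ => hk) hg h0, dlog_const k hab hk, zero_add]

theorem dlog_of_slitPlane {g : ℝ → ℂ} {a b : ℝ} (hab : a ≤ b) (hg : ContinuousOn g (Icc a b))
    (hs : ∀ t ∈ Icc a b, g t ∈ Complex.slitPlane) :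
    dlog g a b = Complex.log (g b) - Complex.log (g a) :=
  dlog_eq (θ := fun t => Complex.log (g t)) hab (hg.clog hs)
    (fun t ht => Complex.exp_log (Complex.slitPlane_ne_zero (hs t ht)))

theorem dlog_of_re_pos {g : ℝ → ℂ} {a b : ℝ} {k : ℂ} (hab : a ≤ b) (hg : ContinuousOn g (Icc a b))
    (hs : ∀ t ∈ Icc a b, 0 < (k * g t).re) :
    dlog g a b = Complex.log (k * g b) - Complex.log (k * g a) := by
  have hk : k ≠ 0 := fun h => by simpa [h] using hs a (left_mem_Icc.2 hab)
  have h0 : ∀ t ∈ Icc a b, g t ≠ 0 := fun t ht h => by simpa [h] using hs t ht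
  rw [← dlog_const_mul hk hab hg h0]
  exact dlog_of_slitPlane hab (continuousOn_const.mul hg) (fun t ht => Or.inl (hs t ht))

theorem dlog_comp_add (g : ℝ → ℂ) {a b : ℝ} (s : ℝ) (hab : a ≤ b)
    (hg : ContinuousOn g (Icc (a + s) (b + s))) (h0 : ∀ t ∈ Icc (a + s) (b + s), g t ≠ 0) :
    dlog (fun t => g (t + s)) a b = dlog g (a + s) (b + s) := by
  obtain ⟨θ, hθ, h⟩ := exists_log_lift_Icc (by linarith) hg h0
  have hm : MapsTo (fun t => t + s) (Icc a b) (Icc (a + s) (b + s)) := fun t ht =>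
    ⟨by linarith [ht.1], by linarith [ht.2]⟩
  rw [dlog_eq (by linarith) hθ h, dlog_eq (θ := fun t => θ (t + s)) hab
    (hθ.comp (by fun_prop) hm) (fun t ht => h _ (hm ht))]

theorem exists_log_lift_rect {F : ℝ → ℝ → ℂ} {a b c d : ℝ} (hab : a ≤ b) (hcd : c ≤ d)
    (hF : ContinuousOn (fun p : ℝ × ℝ => F p.1 p.2) (Icc a b ×ˢ Icc c d))
    (h0 : ∀ s ∈ Icc a b, ∀ t ∈ Icc c d, F s t ≠ 0) :
    ∃ Θ : ℝ × ℝ → ℂ, Continuous Θ ∧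
      ∀ s ∈ Icc a b, ∀ t ∈ Icc c d, Complex.exp (Θ (s, t)) = F s t := by
  obtain ⟨θ, hθ, h⟩ := exists_log_lift (X := ℝ × ℝ)
    (f := fun p => F (projIcc a b hab p.1) (projIcc c d hcd p.2))
    (by
      have : Continuous fun p : ℝ × ℝ =>
          ((projIcc a b hab p.1 : ℝ), (projIcc c d hcd p.2 : ℝ)) := by
        have h1 : Continuous (projIcc a b hab) := continuous_projIcc
        have h2 : Continuous (projIcc c d hcd) := continuous_projIcc
        fun_prop
      exact hF.comp_continuous this fun p => ⟨(projIcc a b hab p.1).2, (projIcc c d hcd p.2).2⟩)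
    (fun p => h0 _ (projIcc a b hab p.1).2 _ (projIcc c d hcd p.2).2)
  refine ⟨θ, hθ, fun s hs t ht => ?_⟩
  rw [h, projIcc_of_mem hab hs, projIcc_of_mem hcd ht]

/-- A logarithm exists on the whole rectangle, so both ways around the boundary between opposite
corners give the same change. All homotopy arguments below reduce to this. -/
theorem dlog_rect {F : ℝ → ℝ → ℂ} {a b c d : ℝ} (hab : a ≤ b) (hcd : c ≤ d)
    (hF : ContinuousOn (fun p : ℝ × ℝ => F p.1 p.2) (Icc a b ×ˢ Icc c d))
    (h0 : ∀ s ∈ Icc a b, ∀ t ∈ Icc c d, F s t ≠ 0) :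
    dlog (fun s => F s c) a b + dlog (F b) c d = dlog (F a) c d + dlog (fun s => F s d) a b := by
  obtain ⟨Θ, hΘ, h⟩ := exists_log_lift_rect hab hcd hF h0
  have l1 := left_mem_Icc.2 hab
  have l2 := left_mem_Icc.2 hcd
  have r1 := right_mem_Icc.2 hab
  have r2 := right_mem_Icc.2 hcd
  rw [dlog_eq (θ := fun s => Θ (s, c)) hab (by fun_prop) (fun s hs => h s hs c l2),
    dlog_eq (θ := fun s => Θ (s, d)) hab (by fun_prop) (fun s hs => h s hs d r2),
    dlog_eq (θ := fun s => Θ (a, s)) hcd (by fun_prop) (fun s hs => h a l1 s hs),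
    dlog_eq (θ := fun s => Θ (b, s)) hcd (by fun_prop) (fun s hs => h b r1 s hs)]
  ring

theorem dlog_continuousOn {F : ℝ → ℝ → ℂ} {a b c d : ℝ} (hab : a ≤ b) (hcd : c ≤ d)
    (hF : ContinuousOn (fun p : ℝ × ℝ => F p.1 p.2) (Icc a b ×ˢ Icc c d))
    (h0 : ∀ s ∈ Icc a b, ∀ t ∈ Icc c d, F s t ≠ 0) :
    ContinuousOn (fun s => dlog (F s) c d) (Icc a b) := by
  obtain ⟨Θ, hΘ, h⟩ := exists_log_lift_rect hab hcd hF h0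
  refine ContinuousOn.congr (f := fun s => Θ (s, d) - Θ (s, c)) (by fun_prop) fun s hs => ?_
  exact dlog_eq (θ := fun t => Θ (s, t)) hcd (by fun_prop) (h s hs)

/-- Invariance under free homotopy of loops: the contributions of the two sides traced by the base
point cancel. -/
theorem dlog_loop_eq {F : ℝ → ℝ → ℂ} {a b c d : ℝ} (hab : a ≤ b) (hcd : c ≤ d)
    (hF : ContinuousOn (fun p : ℝ × ℝ => F p.1 p.2) (Icc a b ×ˢ Icc c d))
    (h0 : ∀ s ∈ Icc a b, ∀ t ∈ Icc c d, F s t ≠ 0) (hl : ∀ s ∈ Icc a b, F s c = F s d) :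
    dlog (F a) c d = dlog (F b) c d := by
  have := dlog_rect hab hcd hF h0
  rw [dlog_congr hl] at this
  linear_combination -this

end TeichDisk
end

noncomputable section
namespace TeichDisk

/-! ### Simple closed curves of class `C¹` -/

/-- `Γ` is a `T`-periodic immersed curve of class `C¹` without double points. -/
structure IsSimpleLoop (Γ Γ' : ℝ → ℂ) (T : ℝ) : Prop where
  pos : 0 < T
  hasDerivAt : ∀ t, HasDerivAt Γ (Γ' t) t
  cont_deriv : Continuous Γ'
  deriv_ne : ∀ t, Γ' t ≠ 0
  periodic : ∀ t, Γ (t + T) = Γ t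
  simple : ∀ s t, s < t → t < s + T → Γ s ≠ Γ t

namespace IsSimpleLoop

variable {Γ Γ' : ℝ → ℂ} {T : ℝ}

theorem cont (h : IsSimpleLoop Γ Γ' T) : Continuous Γ :=
  continuous_iff_continuousAt.2 fun t => (h.hasDerivAt t).continuousAt

theorem shift (h : IsSimpleLoop Γ Γ' T) (s : ℝ) :
    IsSimpleLoop (fun t => Γ (t + s)) (fun t => Γ' (t + s)) T where
  pos := h.pos
  hasDerivAt t := (h.hasDerivAt (t + s)).comp_add_const t s
  cont_deriv := h.cont_deriv.comp (by fun_prop)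
  deriv_ne t := h.deriv_ne _
  periodic t := by rw [add_right_comm]; exact h.periodic _
  simple a b hab hb := h.simple _ _ (by linarith) (by linarith)

theorem deriv_periodic (h : IsSimpleLoop Γ Γ' T) (t : ℝ) : Γ' (t + T) = Γ' t := by
  have h1 := (h.hasDerivAt (t + T)).comp_add_const t T
  simp only [h.periodic] at h1
  exact h1.unique (h.hasDerivAt t)

/-- The piece over `[0, s]` that is lost at the beginning reappears over `[T, T + s]`, by
periodicity. -/
theorem dlog_shift {g : ℝ → ℂ} (hT : 0 ≤ T) (hg : Continuous g) (h0 : ∀ t, g t ≠ 0)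
    (hp : ∀ t, g (t + T) = g t) {s : ℝ} (hs : 0 ≤ s) :
    dlog (fun t => g (t + s)) 0 T = dlog g 0 T := by
  rw [dlog_comp_add g s hT hg.continuousOn (fun t _ => h0 t), zero_add]
  have h1 := dlog_add (a := 0) (b := s) (c := T + s) hs (by linarith) hg.continuousOn
    (fun t _ => h0 t)
  have h2 := dlog_add (a := 0) (b := T) (c := T + s) hT (by linarith) hg.continuousOn
    (fun t _ => h0 t)
  have h3 := dlog_comp_add g T hs hg.continuousOn (fun t _ => h0 t)
  rw [zero_add, add_comm s T] at h3
  simp only [hp] at h3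
  linear_combination h1 - h2 - h3

/-- The mean value of `Γ'` over `[s, s + d]`. -/
def mean (Γ' : ℝ → ℂ) (s d : ℝ) : ℂ := ∫ θ in (0 : ℝ)..1, Γ' (s + θ * d)

theorem mean_continuous (h : IsSimpleLoop Γ Γ' T) :
    Continuous fun p : ℝ × ℝ => mean Γ' p.1 p.2 := by
  unfold mean
  have := h.cont_deriv
  apply intervalIntegral.continuous_parametric_intervalIntegral_of_continuous'
  fun_prop

theorem mul_mean (h : IsSimpleLoop Γ Γ' T) (s d : ℝ) : d * mean Γ' s d = Γ (s + d) - Γ s := by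
  have : ∀ θ ∈ uIcc (0 : ℝ) 1,
      HasDerivAt (fun θ : ℝ => Γ (s + θ * d)) (d • Γ' (s + θ * d)) θ := fun θ _ => by
    have h1 : HasDerivAt (fun θ : ℝ => s + θ * d) d θ := by
      simpa using ((hasDerivAt_id θ).mul_const d).const_add s
    exact (h.hasDerivAt (s + θ * d)).scomp θ h1
  have h2 := intervalIntegral.integral_eq_sub_of_hasDerivAt this
    (by have := h.cont_deriv; exact Continuous.intervalIntegrable (by fun_prop) _ _)
  rw [intervalIntegral.integral_smul] at h2
  simpa [mean] using h2

/-- The normalized secant `(Γ (s + d) - Γ s) / (d (T - d))`, extended to `d = 0` and `d = T`. -/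
def secant (Γ' : ℝ → ℂ) (T s d : ℝ) : ℂ := (mean Γ' s d - mean Γ' (s + d) (T - d)) / T

theorem secant_continuous (h : IsSimpleLoop Γ Γ' T) :
    Continuous fun p : ℝ × ℝ => secant Γ' T p.1 p.2 := by
  unfold secant
  have := h.mean_continuous
  refine Continuous.div_const (this.sub ?_) _
  exact this.comp (by fun_prop : Continuous fun p : ℝ × ℝ => (p.1 + p.2, T - p.2))

theorem mul_secant (h : IsSimpleLoop Γ Γ' T) (s d : ℝ) :
    d * (T - d) * secant Γ' T s d = Γ (s + d) - Γ s := by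
  have h1 := h.mul_mean s d
  have h2 := h.mul_mean (s + d) (T - d)
  rw [add_assoc, add_sub_cancel, h.periodic] at h2
  push_cast at h2
  have hT : (T : ℂ) ≠ 0 := by exact_mod_cast h.pos.ne'
  unfold secant
  field_simp
  linear_combination (T - d : ℂ) * h1 - d * h2

theorem mean_zero (s : ℝ) : mean Γ' s 0 = Γ' s := by simp [mean]

theorem mean_period (h : IsSimpleLoop Γ Γ' T) (s : ℝ) : mean Γ' s T = 0 := by
  have := h.mul_mean s T
  rw [h.periodic, sub_self] at this
  simpa [h.pos.ne'] using this

theorem mean_shift (h : IsSimpleLoop Γ Γ' T) (s d : ℝ) : mean Γ' (s + T) d = mean Γ' s d := by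
  simp only [mean, add_right_comm s T, h.deriv_periodic]

theorem secant_zero (h : IsSimpleLoop Γ Γ' T) (s : ℝ) : secant Γ' T s 0 = Γ' s / T := by
  simp [secant, mean_zero, h.mean_period]

theorem secant_period (h : IsSimpleLoop Γ Γ' T) (s : ℝ) : secant Γ' T s T = -(Γ' s / T) := by
  simp only [secant, h.mean_period, sub_self, mean_zero, h.deriv_periodic]
  ring

theorem secant_symm (h : IsSimpleLoop Γ Γ' T) (d : ℝ) :
    secant Γ' T d (T - d) = -secant Γ' T 0 d := by
  have := h.mean_shift 0 d
  simp only [zero_add] at this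
  simp only [secant, sub_sub_cancel, add_sub_cancel, zero_add, this]
  ring

/-- The factor `d (T - d)` removes the two trivial zeros of the chord. At these the quotient is `±
Γ' / T`; in between it vanishes only at a double point. -/
theorem secant_ne (h : IsSimpleLoop Γ Γ' T) (s : ℝ) {d : ℝ} (hd : d ∈ Icc 0 T) :
    secant Γ' T s d ≠ 0 := by
  have hT : (T : ℂ) ≠ 0 := by exact_mod_cast h.pos.ne'
  rcases hd.1.eq_or_lt with rfl | h1
  · rw [h.secant_zero]; exact div_ne_zero (h.deriv_ne s) hT
  rcases hd.2.eq_or_lt with rfl | h2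
  · rw [h.secant_period]; exact neg_ne_zero.2 (div_ne_zero (h.deriv_ne s) hT)
  intro h0
  have := h.mul_secant s d
  rw [h0, mul_zero] at this
  exact h.simple s (s + d) (by linarith) (by linarith) (sub_eq_zero.1 this.symm).symm

/-- Half of the total rotation of the tangent is the rotation of the secants from one point. -/
theorem dlog_deriv_eq (h : IsSimpleLoop Γ Γ' T) :
    dlog Γ' 0 T = 2 * dlog (secant Γ' T 0) 0 T := by
  have hT := h.pos
  have hTc : (T : ℂ) ≠ 0 := by exact_mod_cast h.pos.ne'
  have hm : ∀ u ∈ Icc 0 T, ∀ v ∈ Icc 0 T, v * (T - u) / T ∈ Icc 0 T := fun u hu v hv => by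
    have h1 : 0 ≤ T - u := by linarith [hu.2]
    refine ⟨div_nonneg (mul_nonneg hv.1 h1) hT.le, ?_⟩
    rw [div_le_iff₀ hT]
    nlinarith [hv.2, hu.1, hv.1]
  have hc := h.secant_continuous
  -- Hopf's triangle of chords, parametrized by a square: the side `v = 0` gives the tangents, the
  -- sides `u = 0` and `v = T` give the secants from the base point and their negatives, and the
  -- side `u = T` degenerates to a point.
  have key := dlog_rect (F := fun u v => secant Γ' T u (v * (T - u) / T)) hT.le hT.le
    (by
      refine Continuous.continuousOn ?_
      exact hc.comp (by fun_prop : Continuous fun p : ℝ × ℝ => (p.1, p.2 * (T - p.1) / T)))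
    (fun u hu v hv => h.secant_ne _ (hm u hu v hv))
  have hs : Continuous (secant Γ' T 0) :=
    hc.comp (by fun_prop : Continuous fun d : ℝ => ((0 : ℝ), d))
  simp only [zero_mul, zero_div, h.secant_zero, sub_self, mul_zero, sub_zero,
    mul_div_cancel_right₀ _ hT.ne', mul_div_cancel_left₀ _ hT.ne', h.secant_symm] at key
  rw [dlog_const _ hT.le (div_ne_zero (h.deriv_ne T) hTc), add_zero,
    dlog_congr (f := fun s => Γ' s / T) (g := fun s => (T : ℂ)⁻¹ * Γ' s)
      (fun t _ => by rw [div_eq_inv_mul]),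
    dlog_const_mul (inv_ne_zero hTc) hT.le h.cont_deriv.continuousOn (fun t _ => h.deriv_ne t),
    dlog_congr (f := fun s => -secant Γ' T 0 s) (g := fun s => (-1 : ℂ) * secant Γ' T 0 s)
      (fun t _ => by ring),
    dlog_const_mul (by norm_num) hT.le hs.continuousOn (fun t ht => h.secant_ne _ ht)] at key
  linear_combination key

theorem log_I_mul_sub {r : ℝ} (hr : r ≠ 0) :
    ∃ σ : ℤ, (σ = 1 ∨ σ = -1) ∧
      Complex.log (r * Complex.I) - Complex.log (-(r * Complex.I)) = σ * (Real.pi * Complex.I) := by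
  rcases lt_or_gt_of_ne hr with h | h
  · refine ⟨-1, Or.inr rfl, ?_⟩
    have e1 : (r * Complex.I : ℂ) = ((-r : ℝ) : ℂ) * (-Complex.I) := by push_cast; ring
    have e2 : -(r * Complex.I : ℂ) = ((-r : ℝ) : ℂ) * Complex.I := by push_cast; ring
    rw [e2, e1, Complex.log_ofReal_mul (by linarith) (by simp),
      Complex.log_ofReal_mul (by linarith) (by simp), Complex.log_I, Complex.log_neg_I]
    push_cast; ring
  · refine ⟨1, Or.inl rfl, ?_⟩
    have e2 : -(r * Complex.I : ℂ) = (r : ℂ) * (-Complex.I) := by ring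
    rw [e2, Complex.log_ofReal_mul h (by simp),
      Complex.log_ofReal_mul h (by simp), Complex.log_I, Complex.log_neg_I]
    push_cast; ring

/-- The point `a` is moved along the normal towards the nearest point `Γ 0` without touching the
curve. Seen from a point very close to `Γ 0`, the curve turns like the secants from `Γ 0`, apart
from a half turn whose sign tells on which side of the curve the point lies. -/
theorem two_mul_dlog_sub_of_nearest (h : IsSimpleLoop Γ Γ' T) {a : ℂ} (ha : ∀ t, Γ t ≠ a)
    (hmin : ∀ t, ‖Γ 0 - a‖ ≤ ‖Γ t - a‖) :
    ∃ σ : ℤ, (σ = 1 ∨ σ = -1) ∧ 2 * dlog (fun t => Γ t - a) 0 T =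
      dlog Γ' 0 T + σ * (2 * Real.pi * Complex.I) := by
  have hT := h.pos
  have hs : Continuous (secant Γ' T 0) :=
    h.secant_continuous.comp (by fun_prop : Continuous fun d : ℝ => ((0 : ℝ), d))
  set v₀ := a - Γ 0 with hv
  have hv0 : v₀ ≠ 0 := sub_ne_zero.2 (ha 0).symm
  have hG0 := h.deriv_ne 0
  -- the segment from the nearest point is normal to the curve
  have hre : (v₀ / Γ' 0).re = 0 := by
    have h1 : HasDerivAt (fun t => ‖Γ t - a‖ ^ 2)
        (2 * inner ℝ (Γ 0 - a) (Γ' 0)) 0 := ((h.hasDerivAt 0).sub_const a).norm_sq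
    have h2 : IsLocalMin (fun t => ‖Γ t - a‖ ^ 2) 0 :=
      Filter.Eventually.of_forall fun t => pow_le_pow_left₀ (norm_nonneg _) (hmin t) 2
    have h3 := h2.hasDerivAt_eq_zero h1
    rw [Complex.inner] at h3
    simp only [Complex.mul_re, Complex.conj_re, Complex.conj_im, Complex.sub_re,
      Complex.sub_im] at h3
    rw [Complex.div_re, hv, Complex.sub_re, Complex.sub_im]
    have h4 : Complex.normSq (Γ' 0) ≠ 0 := by simpa using hG0
    field_simp
    linarith
  set l := (v₀ / Γ' 0).im with hl
  have hvl : v₀ = l * Complex.I * Γ' 0 := by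
    have : v₀ / Γ' 0 = l * Complex.I := by
      apply Complex.ext <;> simp [hre, hl]
    rw [← this, div_mul_cancel₀ _ hG0]
  have hl0 : l ≠ 0 := fun h0 => hv0 (by rw [hvl, h0]; simp)
  -- `R` compares the secants with the initial tangent; it runs from `T` to `-T`, and its real part
  -- has a known sign near both ends.
  set R : ℝ → ℂ := fun d => Γ' 0 / secant Γ' T 0 d with hR
  have hRc : ContinuousOn R (Icc 0 T) :=
    continuousOn_const.div hs.continuousOn fun d hd => h.secant_ne 0 hd
  have hTc : (T : ℂ) ≠ 0 := by exact_mod_cast h.pos.ne'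
  have hR0 : R 0 = T := by
    simp only [hR, h.secant_zero]
    field_simp
  have hRT : R T = -T := by
    simp only [hR, h.secant_period]
    field_simp
  obtain ⟨ε₁, hε₁, hp⟩ : ∃ ε > 0, ∀ d ∈ Icc 0 T, d < ε → 0 < (R d).re := by
    have h1 : ∀ᶠ d in 𝓝[Icc 0 T] (0 : ℝ), 0 < (R d).re := by
      refine (Complex.continuous_re.continuousAt.tendsto.comp
        (hRc 0 (left_mem_Icc.2 hT.le))).eventually (lt_mem_nhds ?_)
      rw [hR0]; simpa using hT
    obtain ⟨ε, hε, h2⟩ := Metric.mem_nhdsWithin_iff.1 h1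
    refine ⟨ε, hε, fun d hd hd' => h2 ⟨?_, hd⟩⟩
    rwa [Metric.mem_ball, Real.dist_eq, sub_zero, abs_of_nonneg hd.1]
  obtain ⟨ε₂, hε₂, hn⟩ : ∃ ε > 0, ∀ d ∈ Icc 0 T, T - ε < d → (R d).re < 0 := by
    have h1 : ∀ᶠ d in 𝓝[Icc 0 T] T, (R d).re < 0 := by
      refine (Complex.continuous_re.continuousAt.tendsto.comp
        (hRc T (right_mem_Icc.2 hT.le))).eventually (gt_mem_nhds ?_)
      rw [hRT]; simpa using hT
    obtain ⟨ε, hε, h2⟩ := Metric.mem_nhdsWithin_iff.1 h1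
    refine ⟨ε, hε, fun d hd hd' => h2 ⟨?_, hd⟩⟩
    rw [Metric.mem_ball, Real.dist_eq, abs_lt]
    constructor <;> linarith [hd.2]
  obtain ⟨B, hB⟩ := isCompact_Icc.exists_bound_of_continuousOn hRc
  set ε := min (min ε₁ ε₂) (T / 2) with hε
  have hεpos : 0 < ε := by positivity
  have hεT : ε ≤ T / 2 := min_le_right _ _
  have hBpos : 0 ≤ B := (norm_nonneg _).trans (hB 0 (left_mem_Icc.2 hT.le))
  set u := min 1 (ε * (T - ε) / (2 * |l| * (B + 1))) with hu
  have hm : 0 < ε * (T - ε) := mul_pos hεpos (by linarith)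
  have hl' : 0 < |l| := abs_pos.2 hl0
  have hupos : 0 < u := by positivity
  have hu1 : u ≤ 1 := min_le_left _ _
  have huB : |l| * u * B < ε * (T - ε) := by
    have : u ≤ ε * (T - ε) / (2 * |l| * (B + 1)) := min_le_right _ _
    rw [le_div_iff₀ (by positivity)] at this
    have : 0 < |l| * u := by positivity
    nlinarith
  have hcont := h.cont
  have hne : ∀ s ∈ Icc u 1, ∀ d, Γ d - Γ 0 - s * v₀ ≠ 0 := fun s hs d h0 => by
    have e : Γ d - a = ((s - 1 : ℝ) : ℂ) * v₀ := by
      push_cast; rw [hv] at h0 ⊢; linear_combination h0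
    have h1 := hmin d
    rw [e, norm_mul, Complex.norm_real, Real.norm_eq_abs, ← norm_neg (Γ 0 - a), neg_sub, ← hv] at h1
    have h2 : 0 < ‖v₀‖ := norm_pos_iff.2 hv0
    have h3 : |s - 1| < 1 := by rw [abs_lt]; constructor <;> linarith [hs.1, hs.2]
    nlinarith
  -- The segment from `a` to `Γ 0` meets the curve only at `Γ 0`, because no point of the curve is
  -- nearer to `a`.
  have e1 : dlog (fun t => Γ t - a) 0 T = dlog (fun d => Γ d - Γ 0 - u * v₀) 0 T := by
    have := dlog_loop_eq (F := fun s d => Γ d - Γ 0 - s * v₀) hu1 hT.le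
      (by fun_prop) (fun s hs d _ => hne s hs d)
      (fun s _ => by have := h.periodic 0; rw [zero_add] at this; simp only [this])
    rw [this]
    exact dlog_congr fun t _ => by rw [hv]; push_cast; ring
  -- After division by the secant the moving vector avoids the negative real axis: in the middle the
  -- real part is positive, near the ends the imaginary part is not zero. So its change is read off
  -- from the principal logarithm.
  set Q : ℝ → ℂ := fun d => d * (T - d) - (l * u * Complex.I) * R d with hQ
  have hQs : ∀ d ∈ Icc 0 T, Q d ∈ Complex.slitPlane := fun d hd => by
    have hre : (Q d).re = d * (T - d) + l * u * (R d).im := by simp [hQ]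
    have him : (Q d).im = -(l * u * (R d).re) := by simp [hQ]
    rw [Complex.mem_slitPlane_iff, hre, him]
    rcases lt_or_ge d ε with h1 | h1
    · right
      have := hp d hd (h1.trans_le ((min_le_left _ _).trans (min_le_left _ _)))
      exact neg_ne_zero.2 (mul_ne_zero (mul_ne_zero hl0 hupos.ne') this.ne')
    rcases lt_or_ge (T - ε) d with h2 | h2
    · right
      have := hn d hd (by linarith [(min_le_left (min ε₁ ε₂) (T / 2)).trans (min_le_right ε₁ ε₂)])
      exact neg_ne_zero.2 (mul_ne_zero (mul_ne_zero hl0 hupos.ne') this.ne)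
    · left
      have h3 : ε * (T - ε) ≤ d * (T - d) := by nlinarith
      have h4 : |l * u * (R d).im| ≤ |l| * u * B := by
        rw [abs_mul, abs_mul, abs_of_pos hupos]
        gcongr
        exact (Complex.abs_im_le_norm _).trans (hB d hd)
      linarith [neg_abs_le (l * u * (R d).im)]
  have hQc : ContinuousOn Q (Icc 0 T) := by fun_prop
  have e2 : dlog (fun d => Γ d - Γ 0 - u * v₀) 0 T = dlog (secant Γ' T 0) 0 T + dlog Q 0 T := by
    rw [← dlog_mul hT.le hs.continuousOn (fun d hd => h.secant_ne 0 hd) hQc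
      (fun d hd => Complex.slitPlane_ne_zero (hQs d hd))]
    refine dlog_congr fun d hd => ?_
    have h1 := h.mul_secant 0 d
    rw [zero_add] at h1
    have h2 := h.secant_ne 0 hd
    simp only [hQ, hR]
    rw [hvl, ← h1]
    field_simp
  have e3 := dlog_of_slitPlane hT.le hQc hQs
  have hr : l * u * T ≠ 0 := mul_ne_zero (mul_ne_zero hl0 hupos.ne') hT.ne'
  obtain ⟨σ, hσ, hlog⟩ := log_I_mul_sub hr
  refine ⟨σ, hσ, ?_⟩
  have q0 : Q 0 = -(((l * u * T : ℝ) : ℂ) * Complex.I) := by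
    simp only [hQ, hR0]; push_cast; ring
  have qT : Q T = ((l * u * T : ℝ) : ℂ) * Complex.I := by
    simp only [hQ, hRT]; push_cast; ring
  rw [q0, qT, hlog] at e3
  rw [e1, e2, e3, h.dlog_deriv_eq]
  ring

/-- The base point may be moved to the point of the curve nearest to `a`, since changes over a full
period do not depend on it. -/
theorem two_mul_dlog_sub (h : IsSimpleLoop Γ Γ' T) {a : ℂ} (ha : ∀ t, Γ t ≠ a) :
    ∃ σ : ℤ, (σ = 1 ∨ σ = -1) ∧ 2 * dlog (fun t => Γ t - a) 0 T =
      dlog Γ' 0 T + σ * (2 * Real.pi * Complex.I) := by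
  have hT := h.pos
  have hcont := h.cont
  obtain ⟨s, hs, hmin⟩ := isCompact_Icc.exists_isMinOn (nonempty_Icc.2 hT.le)
    (f := fun t => ‖Γ t - a‖) (by fun_prop)
  have hmin' : ∀ t, ‖Γ s - a‖ ≤ ‖Γ t - a‖ := fun t => by
    have hp : Function.Periodic Γ T := h.periodic
    obtain ⟨y, hy, hy'⟩ := hp.exists_mem_Ico₀ hT t
    rw [hy']
    exact hmin ⟨hy.1, hy.2.le⟩
  obtain ⟨σ, hσ, e⟩ := (h.shift s).two_mul_dlog_sub_of_nearest (a := a) (fun t => ha _)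
    (fun t => by simpa using hmin' (t + s))
  refine ⟨σ, hσ, ?_⟩
  rw [dlog_shift (g := fun t => Γ t - a) hT.le (by fun_prop) (fun t => sub_ne_zero.2 (ha t))
    (fun t => by rw [h.periodic]) hs.1,
    dlog_shift hT.le h.cont_deriv h.deriv_ne h.deriv_periodic hs.1] at e
  exact e

/-- The tangent of a simple closed curve makes one full turn. -/
theorem dlog_deriv (h : IsSimpleLoop Γ Γ' T) :
    ∃ τ : ℤ, (τ = 1 ∨ τ = -1) ∧ dlog Γ' 0 T = τ * (2 * Real.pi * Complex.I) := by
  have hT := h.pos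
  have hcont := h.cont
  obtain ⟨B, hB⟩ := isCompact_Icc.exists_bound_of_continuousOn (s := Icc 0 T) hcont.continuousOn
  have hB' : ∀ t, ‖Γ t‖ ≤ B := fun t => by
    have hp : Function.Periodic Γ T := h.periodic
    obtain ⟨y, hy, hy'⟩ := hp.exists_mem_Ico₀ hT t
    rw [hy']
    exact hB y ⟨hy.1, hy.2.le⟩
  -- From a point far to the right the whole curve is seen in a half plane, so the winding number
  -- there is zero and the relation for twice the winding number gives the turning number.
  have hpos : ∀ t, 0 < (-1 * (Γ t - ((B + 1 : ℝ) : ℂ))).re := fun t => by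
    have := (Complex.re_le_norm (Γ t)).trans (hB' t)
    simp only [Complex.mul_re, Complex.neg_re, Complex.one_re, Complex.neg_im, Complex.one_im,
      Complex.sub_re, Complex.ofReal_re]
    linarith
  obtain ⟨σ, hσ, e⟩ := h.two_mul_dlog_sub (a := ((B + 1 : ℝ) : ℂ)) (fun t h0 => by
    have := hpos t
    rw [h0] at this; simp at this)
  rw [dlog_of_re_pos (k := -1) hT.le (by fun_prop) (fun t _ => hpos t)] at e
  have hp0 := h.periodic 0
  rw [zero_add] at hp0
  rw [hp0, sub_self, mul_zero] at e
  refine ⟨-σ, by omega, ?_⟩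
  push_cast
  linear_combination -e

/-- The winding number of a simple closed curve about a point is zero or the turning number. -/
theorem exists_winding (h : IsSimpleLoop Γ Γ' T) {a : ℂ} (ha : ∀ t, Γ t ≠ a) :
    ∃ n : ℕ, dlog (fun t => Γ t - a) 0 T = n * dlog Γ' 0 T := by
  obtain ⟨τ, hτ, e⟩ := h.dlog_deriv
  obtain ⟨σ, hσ, e'⟩ := h.two_mul_dlog_sub ha
  rw [e] at e'
  rw [e]
  -- Twice the winding number is `τ + σ` turns with both signs `± 1`: the multiple is `1` for equal
  -- signs and `0` for opposite ones.
  by_cases hs : σ = τ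
  · refine ⟨1, ?_⟩
    rw [hs] at e'
    push_cast
    linear_combination e' / 2
  · have : σ = -τ := by omega
    refine ⟨0, ?_⟩
    rw [this] at e'
    push_cast at e' ⊢
    linear_combination e' / 2

end IsSimpleLoop
end TeichDisk
end

/-! ### The argument principle for holomorphic functions along simple loops -/

noncomputable section
namespace TeichDisk

theorem isOpen_disk : IsOpen disk := Metric.isOpen_ball

theorem analyticOnNhd_disk {ψ : ℂ → ℂ} (hψ : DifferentiableOn ℂ ψ disk) : AnalyticOnNhd ℂ ψ disk :=
  hψ.analyticOnNhd isOpen_disk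

theorem eventually_ne_zero_of_disk {ψ : ℂ → ℂ} (hψ : DifferentiableOn ℂ ψ disk)
    (hne : ∃ z ∈ disk, ψ z ≠ 0) {a : ℂ} (ha : a ∈ disk) : ∀ᶠ z in 𝓝[≠] a, ψ z ≠ 0 := by
  rcases (analyticOnNhd_disk hψ a ha).eventually_eq_zero_or_eventually_ne_zero with h | h
  · obtain ⟨z, hz, hz0⟩ := hne
    exact absurd ((analyticOnNhd_disk hψ).eqOn_zero_of_preconnected_of_eventuallyEq_zero
      (convex_ball 0 1).isPreconnected ha h hz) hz0
  · exact h

theorem exists_factor_zero {ψ : ℂ → ℂ} (hψ : DifferentiableOn ℂ ψ disk)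
    (hne : ∃ z ∈ disk, ψ z ≠ 0) {a : ℂ} (ha : a ∈ disk) :
    ∃ (m : ℕ) (g : ℂ → ℂ), DifferentiableOn ℂ g disk ∧ g a ≠ 0 ∧
      ∀ z ∈ disk, z ≠ a → ψ z = (z - a) ^ m * g z := by
  have han := analyticOnNhd_disk hψ a ha
  have hnz : ¬ ∀ᶠ z in 𝓝 a, ψ z = 0 := fun h => by
    obtain ⟨z, h1, h2⟩ := ((eventually_ne_zero_of_disk hψ hne ha).and
      (h.filter_mono nhdsWithin_le_nhds)).exists
    exact h1 h2
  obtain ⟨m, g₀, hg₀, hg₀a, he⟩ := han.exists_eventuallyEq_pow_smul_nonzero_iff.2 hnz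
  refine ⟨m, fun z => if z = a then g₀ a else ψ z / (z - a) ^ m, ?_, by simpa using hg₀a, ?_⟩
  · intro z hz
    refine DifferentiableAt.differentiableWithinAt ?_
    by_cases hza : z = a
    · subst hza
      refine hg₀.differentiableAt.congr_of_eventuallyEq ?_
      filter_upwards [he] with w hw
      by_cases hwa : w = z
      · simp [hwa]
      · rw [if_neg hwa, hw, smul_eq_mul, mul_div_cancel_left₀]
        exact pow_ne_zero _ (sub_ne_zero.2 hwa)
    · have h1 : DifferentiableAt ℂ (fun z => ψ z / (z - a) ^ m) z :=
        ((hψ z hz).differentiableAt (isOpen_disk.mem_nhds hz)).div (by fun_prop)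
          (pow_ne_zero _ (sub_ne_zero.2 hza))
      refine h1.congr_of_eventuallyEq ?_
      filter_upwards [isOpen_ne.mem_nhds hza] with w hw
      rw [if_neg hw]
  · intro z _ hza
    simp only [if_neg hza]
    rw [mul_div_cancel₀]
    exact pow_ne_zero _ (sub_ne_zero.2 hza)

theorem finite_zeros {ψ : ℂ → ℂ} (hψ : DifferentiableOn ℂ ψ disk)
    (hne : ∃ z ∈ disk, ψ z ≠ 0) {R : ℝ} (hR : R < 1) :
    {z | z ∈ Metric.closedBall (0 : ℂ) R ∧ ψ z = 0}.Finite := by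
  by_contra hinf
  obtain ⟨a, ha, hacc⟩ := Set.Infinite.exists_accPt_of_subset_isCompact hinf
    (isCompact_closedBall (0 : ℂ) R) (fun z hz => hz.1)
  have had : a ∈ disk := by
    rw [Metric.mem_closedBall] at ha
    exact Metric.mem_ball.2 (ha.trans_lt hR)
  rw [accPt_iff_frequently_nhdsNE] at hacc
  exact hacc ((eventually_ne_zero_of_disk hψ hne had).mono fun z h1 h2 => h1 h2.2)

/-- Zeros are split off one at a time. Each factor `(z - a)^m` contributes `m` times the winding
number about `a`, a nonnegative multiple of the turning number, and a function without zeros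
contributes nothing. What matters is that the multiple `n` is not negative. -/
theorem IsSimpleLoop.exists_winding_holomorphic {Γ Γ' : ℝ → ℂ} {T : ℝ} (h : IsSimpleLoop Γ Γ' T)
    {R : ℝ} (hR : R < 1) (hΓ : ∀ t, ‖Γ t‖ ≤ R) : ∀ (N : ℕ) (ψ : ℂ → ℂ),
    DifferentiableOn ℂ ψ disk → (∀ t, ψ (Γ t) ≠ 0) →
    {z | z ∈ Metric.closedBall (0 : ℂ) R ∧ ψ z = 0}.ncard = N →
    ∃ n : ℕ, dlog (fun t => ψ (Γ t)) 0 T = n * dlog Γ' 0 T := by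
  have hT := h.pos
  have hcont := h.cont
  have hmem : ∀ t, Γ t ∈ disk := fun t => by
    simpa [disk] using (hΓ t).trans_lt hR
  intro N
  induction N with
  | zero =>
    intro ψ hψ hψ0 hcard
    rw [Set.ncard_eq_zero (finite_zeros hψ ⟨Γ 0, hmem 0, hψ0 0⟩ hR)] at hcard
    refine ⟨0, ?_⟩
    have hsm : ∀ s ∈ Icc (0 : ℝ) 1, ∀ t, (s * Γ t : ℂ) ∈ Metric.closedBall (0 : ℂ) R :=
      fun s hs t => by
        rw [mem_closedBall_zero_iff, norm_mul, Complex.norm_real, Real.norm_of_nonneg hs.1]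
        exact (mul_le_of_le_one_left (norm_nonneg _) hs.2).trans (hΓ t)
    -- Without zeros in the closed ball, the loop is contracted radially to the origin.
    have := dlog_loop_eq (F := fun s t => ψ (s * Γ t)) zero_le_one hT.le
      (by
        refine hψ.continuousOn.comp (by fun_prop) fun p hp => ?_
        exact Metric.closedBall_subset_ball hR (hsm p.1 hp.1 p.2))
      (fun s hs t _ h0 => by
        have : (s * Γ t : ℂ) ∈ ({z | z ∈ Metric.closedBall (0 : ℂ) R ∧ ψ z = 0} : Set ℂ) :=
          ⟨hsm s hs t, h0⟩
        rw [hcard] at this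
        exact this)
      (fun s _ => by have := h.periodic 0; rw [zero_add] at this; simp only [this])
    simp only [Complex.ofReal_zero, zero_mul, Complex.ofReal_one, one_mul] at this
    rw [← this, dlog_const _ hT.le]
    · simp
    · intro h0
      have : (0 : ℂ) ∈ ({z | z ∈ Metric.closedBall (0 : ℂ) R ∧ ψ z = 0} : Set ℂ) :=
        ⟨by simpa using (norm_nonneg _).trans (hΓ 0), h0⟩
      rw [hcard] at this
      exact this
  | succ N ih =>
    intro ψ hψ hψ0 hcard
    have hne : ∃ z ∈ disk, ψ z ≠ 0 := ⟨Γ 0, hmem 0, hψ0 0⟩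
    have hfin := finite_zeros hψ hne hR
    obtain ⟨a, ha⟩ : {z | z ∈ Metric.closedBall (0 : ℂ) R ∧ ψ z = 0}.Nonempty := by
      rw [← Set.ncard_pos hfin]; omega
    have had : a ∈ disk := Metric.closedBall_subset_ball hR ha.1
    obtain ⟨m, g, hg, hga, hfac⟩ := exists_factor_zero hψ hne had
    have hΓa : ∀ t, Γ t ≠ a := fun t h0 => hψ0 t (h0 ▸ ha.2)
    have hg0 : ∀ t, g (Γ t) ≠ 0 := fun t h0 => hψ0 t (by
      rw [hfac _ (hmem t) (hΓa t), h0, mul_zero])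
    have hset : {z | z ∈ Metric.closedBall (0 : ℂ) R ∧ g z = 0}
        = {z | z ∈ Metric.closedBall (0 : ℂ) R ∧ ψ z = 0} \ {a} := by
      ext z
      simp only [mem_ofPred_eq, Set.mem_sdiff, mem_singleton_iff]
      by_cases hza : z = a
      · subst hza; simp [hga]
      · simp only [hza, not_false_eq_true, and_true]
        refine and_congr_right fun hz => ?_
        rw [hfac z (Metric.closedBall_subset_ball hR hz) hza, mul_eq_zero]
        simp [sub_ne_zero.2 hza]
    obtain ⟨n, hn⟩ := ih g hg hg0 (by
      rw [hset, Set.ncard_sdiff_singleton_of_mem ha, hcard]; rfl)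
    obtain ⟨k, hk⟩ := h.exists_winding hΓa
    have hsub : Continuous fun t => Γ t - a := by fun_prop
    have hsub0 : ∀ t, Γ t - a ≠ 0 := fun t => sub_ne_zero.2 (hΓa t)
    have hpow : ∀ j : ℕ, dlog (fun t => (Γ t - a) ^ j) 0 T = j * dlog (fun t => Γ t - a) 0 T := by
      intro j
      induction j with
      | zero => simp [dlog_const 1 hT.le one_ne_zero]
      | succ j ihj =>
        simp only [pow_succ]
        rw [dlog_mul (f := fun t => (Γ t - a) ^ j) hT.le (hsub.pow j).continuousOn (fun t _ => pow_ne_zero _ (hsub0 t))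
          hsub.continuousOn (fun t _ => hsub0 t), ihj]
        push_cast; ring
    have hgc : Continuous fun t => g (Γ t) := hg.continuousOn.comp_continuous hcont hmem
    refine ⟨m * k + n, ?_⟩
    rw [dlog_congr (f := fun t => ψ (Γ t)) (g := fun t => (Γ t - a) ^ m * g (Γ t))
      (fun t _ => hfac _ (hmem t) (hΓa t)),
      dlog_mul (f := fun t => (Γ t - a) ^ m) hT.le (hsub.pow m).continuousOn (fun t _ => pow_ne_zero _ (hsub0 t))
        hgc.continuousOn (fun t _ => hg0 t), hpow, hk, hn]
    push_cast; ring

/-- A simple closed curve in the disk along which `ψ Γ'²` turns by less than two full turns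
does not exist, when `ψ` is holomorphic. -/
theorem IsSimpleLoop.dlog_quadratic_ne {Γ Γ' : ℝ → ℂ} {T : ℝ} (h : IsSimpleLoop Γ Γ' T)
    {ψ : ℂ → ℂ} (hψ : DifferentiableOn ℂ ψ disk) (hΓ : ∀ t, Γ t ∈ disk) (hψ0 : ∀ t, ψ (Γ t) ≠ 0)
    {k : ℤ} (hk : |k| ≤ 1) :
    dlog (fun t => ψ (Γ t) * Γ' t ^ 2) 0 T ≠ k * (2 * Real.pi * Complex.I) := by
  have hT := h.pos
  have hcont := h.cont
  obtain ⟨s, hs, hmax⟩ := isCompact_Icc.exists_isMaxOn (nonempty_Icc.2 hT.le)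
    (f := fun t => ‖Γ t‖) (by fun_prop)
  have hmax' : ∀ t, ‖Γ t‖ ≤ ‖Γ s‖ := fun t => by
    have hp : Function.Periodic Γ T := h.periodic
    obtain ⟨y, hy, hy'⟩ := hp.exists_mem_Ico₀ hT t
    rw [hy']
    exact hmax ⟨hy.1, hy.2.le⟩
  have hs1 : ‖Γ s‖ < 1 := by simpa [disk] using hΓ s
  obtain ⟨n, hn⟩ := h.exists_winding_holomorphic hs1 hmax' _ ψ hψ hψ0 rfl
  obtain ⟨τ, hτ, e⟩ := h.dlog_deriv
  have hψc : Continuous fun t => ψ (Γ t) := hψ.continuousOn.comp_continuous hcont hΓ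
  have hd := h.cont_deriv
  intro hcontra
  simp only [sq] at hcontra
  rw [dlog_mul (g := fun t => Γ' t * Γ' t) hT.le hψc.continuousOn (fun t _ => hψ0 t) (hd.mul hd).continuousOn
    (fun t _ => mul_ne_zero (h.deriv_ne t) (h.deriv_ne t)),
    dlog_mul (f := Γ') (g := Γ') hT.le hd.continuousOn (fun t _ => h.deriv_ne t) hd.continuousOn
      (fun t _ => h.deriv_ne t), hn, e] at hcontra
  have h2 : (2 * Real.pi * Complex.I : ℂ) ≠ 0 := Complex.two_pi_I_ne_zero
  -- `ψ Γ` turns `n τ` times and `Γ'²` turns `2 τ` times, of the same sign; the total has absolute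
  -- value at least two.
  have h3 : (((n : ℤ) * τ + 2 * τ : ℤ) : ℂ) = (k : ℂ) := by
    have : ((((n : ℤ) * τ + 2 * τ : ℤ) : ℂ) - k) * (2 * Real.pi * Complex.I) = 0 := by
      push_cast; linear_combination hcontra
    exact sub_eq_zero.1 ((mul_eq_zero.1 this).resolve_right h2)
  have h4 : (n : ℤ) * τ + 2 * τ = k := by exact_mod_cast h3
  rw [abs_le] at hk
  rcases hτ with rfl | rfl <;> omega

end TeichDisk
end

noncomputable section
namespace TeichDisk

/-! ### Closing up an arc to a simple closed curve -/

theorem hasDerivAt_of_left_right {Γ L R : ℝ → ℂ} {t : ℝ} {v : ℂ} (hL : HasDerivAt L v t)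
    (hR : HasDerivAt R v t) (eL : ∀ᶠ s in 𝓝[≤] t, Γ s = L s) (eR : ∀ᶠ s in 𝓝[≥] t, Γ s = R s) :
    HasDerivAt Γ v t := by
  have h1 : HasDerivWithinAt Γ v (Iic t) t :=
    hL.hasDerivWithinAt.congr_of_eventuallyEq eL (eL.self_of_nhdsWithin self_mem_Iic)
  have h2 : HasDerivWithinAt Γ v (Ici t) t :=
    hR.hasDerivWithinAt.congr_of_eventuallyEq eR (eR.self_of_nhdsWithin self_mem_Ici)
  have := h1.union h2
  rwa [Iic_union_Ici, hasDerivWithinAt_univ] at this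

theorem continuousAt_of_left_right {Γ L R : ℝ → ℂ} {t : ℝ} (hL : ContinuousAt L t)
    (hR : ContinuousAt R t) (eL : ∀ᶠ s in 𝓝[≤] t, Γ s = L s) (eR : ∀ᶠ s in 𝓝[≥] t, Γ s = R s) :
    ContinuousAt Γ t :=
  continuousAt_iff_continuous_left_right.2
    ⟨hL.continuousWithinAt.congr_of_eventuallyEq eL (eL.self_of_nhdsWithin self_mem_Iic),
     hR.continuousWithinAt.congr_of_eventuallyEq eR (eR.self_of_nhdsWithin self_mem_Ici)⟩

/-- The `T₁ + T₂`-periodic function which is `f` on `[0, T₁)` and `g (· - T₁)` on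
`[T₁, T₁ + T₂)`. -/
def periodicConcat (f g : ℝ → ℂ) (T₁ T₂ : ℝ) (hT : 0 < T₁ + T₂) (t : ℝ) : ℂ :=
  if toIcoMod hT 0 t < T₁ then f (toIcoMod hT 0 t) else g (toIcoMod hT 0 t - T₁)

section concat

variable {f g : ℝ → ℂ} {T₁ T₂ : ℝ} (hT : 0 < T₁ + T₂)

theorem periodicConcat_add (t : ℝ) :
    periodicConcat f g T₁ T₂ hT (t + (T₁ + T₂)) = periodicConcat f g T₁ T₂ hT t := by
  simp [periodicConcat]

theorem periodicConcat_of_mem {t : ℝ} (h1 : 0 ≤ t) (h2 : t < T₁ + T₂) :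
    periodicConcat f g T₁ T₂ hT t = if t < T₁ then f t else g (t - T₁) := by
  have : toIcoMod hT 0 t = t := (toIcoMod_eq_self hT).2 ⟨h1, by simpa using h2⟩
  simp [periodicConcat, this]

/-- On both sides of every point `periodicConcat f g` is a translate of `f` or `g`. -/
theorem periodicConcat_local (h1 : 0 < T₁) (h2 : 0 < T₂) {t : ℝ} (ht : t ∈ Ico 0 (T₁ + T₂)) :
    (t = 0 ∧ (∀ F G : ℝ → ℂ, ∀ᶠ s in 𝓝[<] t, periodicConcat F G T₁ T₂ hT s = G (s + T₂)) ∧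
      ∀ F G : ℝ → ℂ, ∀ᶠ s in 𝓝[≥] t, periodicConcat F G T₁ T₂ hT s = F s) ∨
    (t ∈ Ioo 0 T₁ ∧ ∀ F G : ℝ → ℂ, ∀ᶠ s in 𝓝 t, periodicConcat F G T₁ T₂ hT s = F s) ∨
    (t = T₁ ∧ (∀ F G : ℝ → ℂ, ∀ᶠ s in 𝓝[<] t, periodicConcat F G T₁ T₂ hT s = F s) ∧
      ∀ F G : ℝ → ℂ, ∀ᶠ s in 𝓝[≥] t, periodicConcat F G T₁ T₂ hT s = G (s - T₁)) ∨
    (t ∈ Ioo T₁ (T₁ + T₂) ∧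
      ∀ F G : ℝ → ℂ, ∀ᶠ s in 𝓝 t, periodicConcat F G T₁ T₂ hT s = G (s - T₁)) := by
  rcases ht.1.eq_or_lt with h | h
  · subst h
    refine Or.inl ⟨rfl, fun F G => ?_, fun F G => ?_⟩
    · filter_upwards [Ioo_mem_nhdsLT (show -T₂ < 0 by linarith)] with s hs
      rw [← periodicConcat_add, periodicConcat_of_mem hT (by linarith [hs.1]) (by linarith [hs.2]),
        if_neg (by linarith [hs.1])]
      congr 1; ring
    · filter_upwards [Ico_mem_nhdsGE h1] with s hs
      rw [periodicConcat_of_mem hT hs.1 (by linarith [hs.2]), if_pos hs.2]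
  rcases lt_trichotomy t T₁ with h' | h' | h'
  · refine Or.inr (Or.inl ⟨⟨h, h'⟩, fun F G => ?_⟩)
    filter_upwards [Ioo_mem_nhds h h'] with s hs
    rw [periodicConcat_of_mem hT hs.1.le (by linarith [hs.2]), if_pos hs.2]
  · subst h'
    refine Or.inr (Or.inr (Or.inl ⟨rfl, fun F G => ?_, fun F G => ?_⟩))
    · filter_upwards [Ioo_mem_nhdsLT h1] with s hs
      rw [periodicConcat_of_mem hT hs.1.le (by linarith [hs.2]), if_pos hs.2]
    · filter_upwards [Ico_mem_nhdsGE (show t < t + T₂ by linarith)] with s hs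
      rw [periodicConcat_of_mem hT (by linarith [hs.1]) (by linarith [hs.2]),
        if_neg (by linarith [hs.1])]
  · refine Or.inr (Or.inr (Or.inr ⟨⟨h', ht.2⟩, fun F G => ?_⟩))
    filter_upwards [Ioo_mem_nhds h' ht.2] with s hs
    rw [periodicConcat_of_mem hT (by linarith [hs.1]) (by linarith [hs.2]),
      if_neg (by linarith [hs.1])]

variable {f' g' : ℝ → ℂ}

/-- Only the matching of values and derivatives at the two junctions needs care; by periodicity
everything is checked at points of one period, where the curve is locally a translate of `f` or `g`
on each side. -/
theorem isSimpleLoop_concat (h1 : 0 < T₁) (h2 : 0 < T₂)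
    (hf : ∀ t ∈ Icc 0 T₁, HasDerivAt f (f' t) t) (hg : ∀ t ∈ Icc 0 T₂, HasDerivAt g (g' t) t)
    (hf' : ∀ t ∈ Icc 0 T₁, ContinuousAt f' t) (hg' : ∀ t ∈ Icc 0 T₂, ContinuousAt g' t)
    (hf0 : ∀ t ∈ Icc 0 T₁, f' t ≠ 0) (hg0 : ∀ t ∈ Icc 0 T₂, g' t ≠ 0)
    (e1 : f T₁ = g 0) (e1' : f' T₁ = g' 0) (e2 : g T₂ = f 0) (e2' : g' T₂ = f' 0)
    (fi : InjOn f (Icc 0 T₁)) (gi : InjOn g (Icc 0 T₂))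
    (fg : ∀ s ∈ Icc 0 T₁, ∀ t ∈ Ioo 0 T₂, f s ≠ g t) :
    IsSimpleLoop (periodicConcat f g T₁ T₂ hT) (periodicConcat f' g' T₁ T₂ hT) (T₁ + T₂) := by
  have hper : ∀ (F G : ℝ → ℂ) (k : ℤ) (t : ℝ),
      periodicConcat F G T₁ T₂ hT (t + k * (T₁ + T₂)) = periodicConcat F G T₁ T₂ hT t := by
    intro F G k t
    have h : Function.Periodic (periodicConcat F G T₁ T₂ hT) (T₁ + T₂) := periodicConcat_add hT
    simpa using h.int_mul k t
  have hred : ∀ t : ℝ, ∃ k : ℤ, t + k * (T₁ + T₂) ∈ Ico 0 (T₁ + T₂) := by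
    intro t
    obtain ⟨k, hk, -⟩ := existsUnique_add_zsmul_mem_Ico hT t 0
    refine ⟨k, ?_⟩
    rw [zsmul_eq_mul, zero_add] at hk
    exact hk
  have hl0 : (0 : ℝ) ∈ Icc 0 T₁ := ⟨le_rfl, h1.le⟩
  have hr0 : T₁ ∈ Icc 0 T₁ := ⟨h1.le, le_rfl⟩
  have hl0' : (0 : ℝ) ∈ Icc 0 T₂ := ⟨le_rfl, h2.le⟩
  have hr0' : T₂ ∈ Icc 0 T₂ := ⟨h2.le, le_rfl⟩
  have hval : ∀ (F G : ℝ → ℂ) t (ht : t ∈ Ico 0 (T₁ + T₂)),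
      periodicConcat F G T₁ T₂ hT t = if t < T₁ then F t else G (t - T₁) := fun F G t ht =>
    periodicConcat_of_mem hT ht.1 ht.2
  have hle : ∀ {Γ L : ℝ → ℂ} {t : ℝ}, (∀ᶠ s in 𝓝[<] t, Γ s = L s) → Γ t = L t →
      ∀ᶠ s in 𝓝[≤] t, Γ s = L s := by
    intro Γ L t h e
    rw [← Iio_insert, nhdsWithin_insert]
    exact eventually_sup.2 ⟨by simpa using e, h⟩
  constructor
  · exact hT
  · intro t
    obtain ⟨k, hk⟩ := hred t
    set x := t + k * (T₁ + T₂) with hx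
    suffices h : HasDerivAt (periodicConcat f g T₁ T₂ hT) (periodicConcat f' g' T₁ T₂ hT x) x by
      have := h.comp_add_const t (k * (T₁ + T₂))
      simp only [hper] at this
      rwa [hx, hper] at this
    rw [hval _ _ _ hk]
    rcases periodicConcat_local hT h1 h2 hk with ⟨h, a, b⟩ | ⟨h, a⟩ | ⟨h, a, b⟩ | ⟨h, a⟩
    · rw [h] at a b ⊢
      rw [if_pos h1]
      refine hasDerivAt_of_left_right (L := fun s => g (s + T₂)) ?_ (hf 0 hl0)
        (hle (a f g) ?_) (b f g)
      · rw [← e2']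
        have := hg T₂ hr0'
        rw [← zero_add T₂] at this
        simpa using this.comp_add_const 0 T₂
      · rw [hval _ _ _ ⟨le_rfl, hT⟩, if_pos h1]; simp [e2]
    · rw [if_pos h.2]
      exact (hf x ⟨h.1.le, h.2.le⟩).congr_of_eventuallyEq (a f g)
    · rw [h] at a b ⊢
      rw [if_neg (lt_irrefl _), sub_self]
      refine hasDerivAt_of_left_right (R := fun s => g (s - T₁)) (e1' ▸ hf T₁ hr0) ?_
        (hle (a f g) ?_) (b f g)
      · have := hg 0 hl0'
        rw [← sub_self T₁] at this
        simpa using this.comp_sub_const T₁ T₁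
      · rw [hval _ _ _ ⟨h1.le, by linarith⟩, if_neg (lt_irrefl _), sub_self, e1]
    · rw [if_neg h.1.not_gt]
      exact ((hg (x - T₁) ⟨by linarith [h.1], by linarith [h.2]⟩).comp_sub_const x T₁).congr_of_eventuallyEq
        (a f g)
  · rw [continuous_iff_continuousAt]
    intro t
    obtain ⟨k, hk⟩ := hred t
    set x := t + k * (T₁ + T₂) with hx
    suffices h : ContinuousAt (periodicConcat f' g' T₁ T₂ hT) x by
      have h3 : ContinuousAt (fun s => periodicConcat f' g' T₁ T₂ hT (s + k * (T₁ + T₂))) t :=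
        ContinuousAt.comp (f := fun s => s + k * (T₁ + T₂)) h (by fun_prop)
      simpa only [hper] using h3
    rcases periodicConcat_local hT h1 h2 hk with ⟨h, a, b⟩ | ⟨h, a⟩ | ⟨h, a, b⟩ | ⟨h, a⟩
    · rw [h] at a b ⊢
      refine continuousAt_of_left_right (L := fun s => g' (s + T₂)) ?_ (hf' 0 hl0)
        (hle (a f' g') ?_) (b f' g')
      · exact ContinuousAt.comp (f := fun s => s + T₂) (by rw [zero_add]; exact hg' T₂ hr0')
          (by fun_prop)
      · rw [hval _ _ _ ⟨le_rfl, hT⟩, if_pos h1]; simp [e2']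
    · exact (hf' x ⟨h.1.le, h.2.le⟩).congr (EventuallyEq.symm (a f' g'))
    · rw [h] at a b ⊢
      refine continuousAt_of_left_right (R := fun s => g' (s - T₁)) (hf' T₁ hr0) ?_
        (hle (a f' g') ?_) (b f' g')
      · exact ContinuousAt.comp (f := fun s => s - T₁) (by rw [sub_self]; exact hg' 0 hl0')
          (by fun_prop)
      · rw [hval _ _ _ ⟨h1.le, by linarith⟩, if_neg (lt_irrefl _), sub_self, e1']
    · refine ContinuousAt.congr ?_ (EventuallyEq.symm (a f' g'))
      exact ContinuousAt.comp (f := fun s => s - T₁)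
        (hg' (x - T₁) ⟨by linarith [h.1], by linarith [h.2]⟩) (by fun_prop)
  · intro t
    obtain ⟨k, hk⟩ := hred t
    rw [← hper f' g' k t, hval _ _ _ hk]
    split_ifs with h
    · exact hf0 _ ⟨hk.1, h.le⟩
    · exact hg0 _ ⟨by linarith, by linarith [hk.2]⟩
  · exact periodicConcat_add hT
  · have key : ∀ s ∈ Ico 0 (T₁ + T₂), ∀ t ∈ Ico 0 (T₁ + T₂),
        periodicConcat f g T₁ T₂ hT s = periodicConcat f g T₁ T₂ hT t → s = t := by
      intro s hs t ht e
      rw [hval _ _ _ hs, hval _ _ _ ht] at e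
      have hgf : ∀ a ∈ Ico 0 (T₁ + T₂), ∀ b ∈ Ico 0 (T₁ + T₂), a < T₁ → ¬ b < T₁ →
          f a ≠ g (b - T₁) := by
        intro a ha b hb h3 h4 e
        rw [not_lt] at h4
        rcases h4.eq_or_lt with h5 | h5
        · rw [← h5, sub_self, ← e1] at e
          exact h3.ne (fi ⟨ha.1, h3.le⟩ hr0 e)
        · exact fg a ⟨ha.1, h3.le⟩ _ ⟨by linarith, by linarith [hb.2]⟩ e
      split_ifs at e with h3 h4 h4
      · exact fi ⟨hs.1, h3.le⟩ ⟨ht.1, h4.le⟩ e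
      · exact absurd e (hgf s hs t ht h3 h4)
      · exact absurd e.symm (hgf t ht s hs h4 h3)
      · have := gi ⟨by linarith, by linarith [hs.2]⟩ ⟨by linarith, by linarith [ht.2]⟩ e
        linarith
    intro s t hst hts e
    -- Equal values reduce to equal representatives modulo the period, so `t - s` is an integer
    -- multiple of it, strictly between `0` and one period.
    obtain ⟨k, hk⟩ := hred s
    obtain ⟨j, hj⟩ := hred t
    rw [← hper f g k s, ← hper f g j t] at e
    have h3 := key _ hk _ hj e
    have h4 : t - s = ((k - j : ℤ) : ℝ) * (T₁ + T₂) := by push_cast; linear_combination -h3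
    have h5 : 0 < ((k - j : ℤ) : ℝ) * (T₁ + T₂) := by rw [← h4]; linarith
    have h6 : ((k - j : ℤ) : ℝ) * (T₁ + T₂) < 1 * (T₁ + T₂) := by rw [← h4]; linarith
    have h7 : (0 : ℝ) < ((k - j : ℤ) : ℝ) := pos_of_mul_pos_left h5 hT.le
    have h8 : ((k - j : ℤ) : ℝ) < 1 := lt_of_mul_lt_mul_right h6 hT.le
    have h9 : 0 < k - j := by exact_mod_cast h7
    have h10 : k - j < 1 := by exact_mod_cast h8
    omega

end concat

end TeichDisk
end

noncomputable section
namespace TeichDisk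

/-! ### Natural parameters and straight arcs of a quadratic differential -/

/-- `γ` is a straight arc of `φ dz²` on `I`, with velocity `± c` in every natural parameter. -/
def IsTraj (φ : ℂ → ℂ) (c : ℂ) (I : Set ℝ) (γ : ℝ → ℂ) : Prop :=
  ∀ t ∈ I, γ t ∈ disk ∧ ∃ v : ℂ, HasDerivAt γ v t ∧ φ (γ t) * v ^ 2 = c ^ 2

/-- `Ξ` is a holomorphic map on `U` with `φ (Ξ) (Ξ')² = c²`. -/
def IsFlat (φ : ℂ → ℂ) (c : ℂ) (U : Set ℂ) (Ξ : ℂ → ℂ) : Prop :=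
  ∀ ζ ∈ U, Ξ ζ ∈ disk ∧ ∃ v : ℂ, HasDerivAt Ξ v ζ ∧ φ (Ξ ζ) * v ^ 2 = c ^ 2

/-- `Φ` is a natural parameter on `U` with `Φ' = S = √φ` and inverse `Ψ` near zero. -/
structure IsCoord (φ : ℂ → ℂ) (z₀ : ℂ) (U : Set ℂ) (Φ S Ψ : ℂ → ℂ) (r : ℝ) : Prop where
  isOpen : IsOpen U
  mem : z₀ ∈ U
  subset : U ⊆ disk
  pos : 0 < r
  map_center : Φ z₀ = 0
  deriv : ∀ z ∈ U, HasDerivAt Φ (S z) z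
  sq : ∀ z ∈ U, S z ^ 2 = φ z
  ne : ∀ z ∈ U, S z ≠ 0
  cont : ContinuousOn S U
  inj : InjOn Φ U
  map_inv : ∀ ζ ∈ Metric.ball (0 : ℂ) r, Ψ ζ ∈ U
  inv : ∀ ζ ∈ Metric.ball (0 : ℂ) r, Φ (Ψ ζ) = ζ
  deriv_inv : ∀ ζ ∈ Metric.ball (0 : ℂ) r, HasDerivAt Ψ (S (Ψ ζ))⁻¹ ζ

section coord

variable {φ : ℂ → ℂ} {z₀ : ℂ}

/-- Near a regular point `φ / φ z₀` has positive real part, so a holomorphic square root comes from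
the principal logarithm. Its primitive has nonzero derivative and is inverted locally. -/
theorem exists_coord (hφ : DifferentiableOn ℂ φ disk) (hz : z₀ ∈ disk) (h0 : φ z₀ ≠ 0) :
    ∃ U Φ S Ψ r, IsCoord φ z₀ U Φ S Ψ r := by
  have hc : ContinuousAt φ z₀ := (hφ.differentiableAt (isOpen_disk.mem_nhds hz)).continuousAt
  have h1 : ∀ᶠ z in 𝓝 z₀, 0 < (φ z / φ z₀).re := by
    have : ContinuousAt (fun z => (φ z / φ z₀).re) z₀ :=
      Complex.continuous_re.continuousAt.comp (hc.div_const _)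
    refine this.eventually (lt_mem_nhds ?_)
    simp [h0]
  obtain ⟨ε, hε, hball⟩ := Metric.mem_nhds_iff.1 (h1.and (isOpen_disk.mem_nhds hz))
  obtain ⟨s₀, hs₀⟩ := IsAlgClosed.exists_pow_nat_eq (φ z₀) (n := 2) (by norm_num)
  have hs₀0 : s₀ ≠ 0 := fun h => h0 (by rw [← hs₀, h]; simp)
  set S : ℂ → ℂ := fun z => s₀ * Complex.exp (Complex.log (φ z / φ z₀) / 2) with hS
  have hSd : DifferentiableOn ℂ S (Metric.ball z₀ ε) := by
    have h2 : DifferentiableOn ℂ φ (Metric.ball z₀ ε) := hφ.mono fun z hz => (hball hz).2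
    have h3 : DifferentiableOn ℂ (fun z => Complex.log (φ z / φ z₀)) (Metric.ball z₀ ε) :=
      (h2.div_const _).clog fun z hz => Or.inl (hball hz).1
    exact (h3.div_const 2).cexp.const_mul _
  have hSsq : ∀ z ∈ Metric.ball z₀ ε, S z ^ 2 = φ z := fun z hz => by
    have h3 : φ z / φ z₀ ≠ 0 := fun h => by have := (hball hz).1; simp [h] at this
    simp only [hS]
    rw [mul_pow, hs₀, ← Complex.exp_nat_mul]
    rw [show ((2 : ℕ) : ℂ) * (Complex.log (φ z / φ z₀) / 2) = Complex.log (φ z / φ z₀) by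
      push_cast; ring, Complex.exp_log h3, mul_div_cancel₀ _ h0]
  have hS0 : ∀ z, S z ≠ 0 := fun z => mul_ne_zero hs₀0 (Complex.exp_ne_zero _)
  obtain ⟨Φ, hΦ0, hΦ⟩ := hSd.isExactOn_ball.with_val_at z₀ 0
  have hz0 : z₀ ∈ Metric.ball z₀ ε := Metric.mem_ball_self hε
  have hΦd : DifferentiableOn ℂ Φ (Metric.ball z₀ ε) := fun z hz =>
    (hΦ z hz).differentiableAt.differentiableWithinAt
  have hstrict : HasStrictDerivAt Φ (S z₀) z₀ := by
    have := (hΦd.analyticAt (Metric.ball_mem_nhds z₀ hε)).hasStrictDerivAt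
    rwa [(hΦ z₀ hz0).deriv] at this
  have hf := hstrict.hasStrictFDerivAt_equiv (hS0 z₀)
  set P := hf.toOpenPartialHomeomorph Φ with hP
  have hPm : z₀ ∈ P.source := hf.mem_toOpenPartialHomeomorph_source
  have hPc : (P : ℂ → ℂ) = Φ := hf.toOpenPartialHomeomorph_coe
  set U := P.source ∩ Metric.ball z₀ ε with hU
  have hUo : IsOpen U := P.open_source.inter Metric.isOpen_ball
  have hVo : IsOpen (P.target ∩ P.symm ⁻¹' (Metric.ball z₀ ε)) :=
    P.isOpen_inter_preimage_symm Metric.isOpen_ball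
  have hP0 : P z₀ = 0 := by rw [hPc, hΦ0]
  have h0V : (0 : ℂ) ∈ P.target ∩ P.symm ⁻¹' (Metric.ball z₀ ε) := by
    rw [← hP0]
    refine ⟨P.map_source hPm, ?_⟩
    rw [mem_preimage, P.left_inv hPm]
    exact hz0
  obtain ⟨r, hr, hrV⟩ := Metric.isOpen_iff.1 hVo 0 h0V
  refine ⟨U, Φ, S, P.symm, r, hUo, ⟨hPm, hz0⟩, fun z hz => (hball hz.2).2, hr, hΦ0,
    fun z hz => hΦ z hz.2, fun z hz => hSsq z hz.2, fun z _ => hS0 z,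
    hSd.continuousOn.mono inter_subset_right, ?_, ?_, ?_, ?_⟩
  · rw [← hPc]; exact P.injOn.mono inter_subset_left
  · exact fun ζ hζ => ⟨P.map_target (hrV hζ).1, (hrV hζ).2⟩
  · intro ζ hζ
    rw [← hPc]; exact P.right_inv (hrV hζ).1
  · intro ζ hζ
    have := (hΦ (P.symm ζ) (hrV hζ).2)
    rw [← hPc] at this
    exact P.hasDerivAt_symm (hrV hζ).1 (hS0 _) this

variable {U : Set ℂ} {Φ S Ψ : ℂ → ℂ} {r : ℝ}

theorem IsCoord.left_inv (h : IsCoord φ z₀ U Φ S Ψ r) {z : ℂ} (hz : z ∈ U)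
    (hr : Φ z ∈ Metric.ball (0 : ℂ) r) : Ψ (Φ z) = z :=
  h.inj (h.map_inv _ hr) hz (h.inv _ hr)

theorem IsCoord.isFlat (h : IsCoord φ z₀ U Φ S Ψ r) : IsFlat φ 1 (Metric.ball 0 r) Ψ := by
  intro ζ hζ
  refine ⟨h.subset (h.map_inv ζ hζ), _, h.deriv_inv ζ hζ, ?_⟩
  rw [inv_pow, h.sq _ (h.map_inv ζ hζ), one_pow, mul_inv_cancel₀]
  rw [← h.sq _ (h.map_inv ζ hζ)]
  exact pow_ne_zero _ (h.ne _ (h.map_inv ζ hζ))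

end coord

section traj

variable {φ : ℂ → ℂ} {c : ℂ} {I : Set ℝ} {γ : ℝ → ℂ}

theorem IsTraj.hasDerivAt (h : IsTraj φ c I γ) {t : ℝ} (ht : t ∈ I) :
    HasDerivAt γ (deriv γ t) t := by
  obtain ⟨-, v, hv, -⟩ := h t ht
  rwa [hv.deriv]

theorem IsTraj.sq (h : IsTraj φ c I γ) {t : ℝ} (ht : t ∈ I) :
    φ (γ t) * deriv γ t ^ 2 = c ^ 2 := by
  obtain ⟨-, v, hv, e⟩ := h t ht
  rwa [hv.deriv]

theorem IsTraj.mono (h : IsTraj φ c I γ) {J : Set ℝ} (hJ : J ⊆ I) : IsTraj φ c J γ :=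
  fun t ht => h t (hJ ht)

theorem IsTraj.ne (h : IsTraj φ c I γ) (hc : c ≠ 0) {t : ℝ} (ht : t ∈ I) : φ (γ t) ≠ 0 :=
  fun h0 => by
    have := h.sq ht
    rw [h0, zero_mul] at this
    exact pow_ne_zero 2 hc this.symm

theorem IsTraj.deriv_ne (h : IsTraj φ c I γ) (hc : c ≠ 0) {t : ℝ} (ht : t ∈ I) :
    deriv γ t ≠ 0 := fun h0 => by
  have := h.sq ht
  rw [h0] at this
  exact pow_ne_zero 2 hc (by rw [← this]; simp)

theorem IsTraj.congr_of_isOpen (hI : IsOpen I) (h : IsTraj φ c I γ) {γ' : ℝ → ℂ}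
    (he : EqOn γ' γ I) : IsTraj φ c I γ' := by
  intro t ht
  obtain ⟨h1, v, hv, e⟩ := h t ht
  rw [he ht]
  exact ⟨h1, v, hv.congr_of_eventuallyEq (he.eventuallyEq_of_mem (hI.mem_nhds ht)), e⟩

theorem IsTraj.continuousOn (h : IsTraj φ c I γ) : ContinuousOn γ I := fun _ ht =>
  (h.hasDerivAt ht).continuousAt.continuousWithinAt

/-- In a natural parameter a straight arc is a straight segment. -/
theorem IsTraj.local_form (hI : IsOpen I) (hc : c ≠ 0) (h : IsTraj φ c I γ) {t₀ : ℝ}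
    (ht₀ : t₀ ∈ I) {z₀ : ℂ} {U : Set ℂ} {Φ S Ψ : ℂ → ℂ} {r : ℝ} (hco : IsCoord φ z₀ U Φ S Ψ r)
    (hz₀ : γ t₀ ∈ U) :
    ∀ᶠ t in 𝓝 t₀, γ t ∈ U ∧ Φ (γ t) = Φ (γ t₀) + S (γ t₀) * deriv γ t₀ * (t - t₀) ∧
      S (γ t) * deriv γ t = S (γ t₀) * deriv γ t₀ := by
  have hnear : ∀ᶠ t in 𝓝 t₀, t ∈ I ∧ γ t ∈ U := by
    filter_upwards [hI.mem_nhds ht₀, (h.hasDerivAt ht₀).continuousAt (hco.isOpen.mem_nhds hz₀)]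
      with t h1 h2 using ⟨h1, h2⟩
  obtain ⟨δ, hδ, hb⟩ := Metric.mem_nhds_iff.1 hnear
  set e : ℝ → ℂ := fun t => S (γ t) * deriv γ t with he
  have hd : ∀ t ∈ Metric.ball t₀ δ, HasDerivAt (fun t => Φ (γ t)) (e t) t := fun t ht =>
    (hco.deriv _ (hb ht).2).comp_of_eq t (h.hasDerivAt (hb ht).1) rfl
  have hsq : ∀ t ∈ Metric.ball t₀ δ, e t = c ∨ e t = -c := fun t ht => by
    have h1 : e t ^ 2 = c ^ 2 := by
      rw [← h.sq (hb ht).1, ← hco.sq _ (hb ht).2]; simp only [he]; ring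
    exact sq_eq_sq_iff_eq_or_eq_neg.1 h1
  have hd' : ∀ t ∈ Metric.ball t₀ δ, HasDerivWithinAt (fun t => (Φ (γ t) / c).re) (e t / c).re
      (Metric.ball t₀ δ) t := fun t ht => by
    have h1 := ((hd t ht).div_const c)
    have h2 := (Complex.reCLM.hasFDerivAt (x := Φ (γ t) / c)).comp_hasDerivAt t h1
    exact h2.hasDerivWithinAt
  -- The velocity in the natural parameter is `c` or `-c` at each time, but its continuity is not
  -- assumed. Darboux's intermediate value property of derivatives excludes a change of sign.
  have hoc := (convex_ball t₀ δ).ordConnected.image_hasDerivWithinAt hd'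
  have ht₀b : t₀ ∈ Metric.ball t₀ δ := Metric.mem_ball_self hδ
  have hconst : ∀ t ∈ Metric.ball t₀ δ, e t = e t₀ := fun t ht => by
    have hcc : c / c = 1 := div_self hc
    have hval : ∀ t ∈ Metric.ball t₀ δ, (e t / c).re = 1 ∨ (e t / c).re = -1 := fun t ht => by
      rcases hsq t ht with h1 | h1 <;> rw [h1]
      · left; simp [hcc]
      · right; simp [neg_div, hcc]
    have hnz : (0 : ℝ) ∉ (fun t => (e t / c).re) '' Metric.ball t₀ δ := by
      rintro ⟨s, hs, h0⟩
      rcases hval s hs with h1 | h1 <;> simp only [h1] at h0 <;> norm_num at h0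
    have hm1 : (e t / c).re ∈ (fun t => (e t / c).re) '' Metric.ball t₀ δ := ⟨t, ht, rfl⟩
    have hm2 : (e t₀ / c).re ∈ (fun t => (e t / c).re) '' Metric.ball t₀ δ := ⟨t₀, ht₀b, rfl⟩
    rcases hsq t ht with h1 | h1 <;> rcases hsq t₀ ht₀b with h2 | h2
    · rw [h1, h2]
    · exfalso; rw [h1] at hm1; rw [h2] at hm2
      refine hnz (hoc.out hm2 hm1 ⟨?_, ?_⟩) <;> simp [neg_div, hcc]
    · exfalso; rw [h1] at hm1; rw [h2] at hm2
      refine hnz (hoc.out hm1 hm2 ⟨?_, ?_⟩) <;> simp [neg_div, hcc]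
    · rw [h1, h2]
  filter_upwards [Metric.ball_mem_nhds t₀ hδ] with t ht
  refine ⟨(hb ht).2, ?_, hconst t ht⟩
  have h1 : ∀ s ∈ Metric.ball t₀ δ, HasDerivWithinAt (fun s => Φ (γ s) - e t₀ * s) 0
      (Metric.ball t₀ δ) s := fun s hs => by
    have h2 := (hd s hs).sub ((Complex.ofRealCLM.hasDerivAt (x := s)).const_mul (e t₀))
    rw [hconst s hs] at h2
    refine HasDerivAt.hasDerivWithinAt ?_
    have h4 : e t₀ - e t₀ * Complex.ofRealCLM 1 = 0 := by simp
    rw [← h4]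
    exact h2
  have h3 := (convex_ball t₀ δ).norm_image_sub_le_of_norm_hasDerivWithin_le (C := 0) h1
    (fun s _ => by simp) ht₀b ht
  rw [zero_mul, norm_le_zero_iff] at h3
  simp only [he] at h3
  linear_combination h3

/-- `IsTraj` only demands a derivative at each time; its continuity follows because the velocity is
constant in a natural parameter. -/
theorem IsTraj.continuousAt_deriv (hφ : DifferentiableOn ℂ φ disk) (hI : IsOpen I) (hc : c ≠ 0)
    (h : IsTraj φ c I γ) {t₀ : ℝ} (ht₀ : t₀ ∈ I) : ContinuousAt (deriv γ) t₀ := by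
  obtain ⟨U, Φ, S, Ψ, r, hco⟩ := exists_coord hφ (h t₀ ht₀).1 (h.ne hc ht₀)
  have h1 := h.local_form hI hc ht₀ hco hco.mem
  have h2 : deriv γ =ᶠ[𝓝 t₀] fun t => S (γ t₀) * deriv γ t₀ / S (γ t) := by
    filter_upwards [h1] with t ht
    rw [← ht.2.2, mul_div_cancel_left₀ _ (hco.ne _ ht.1)]
  refine ContinuousAt.congr ?_ h2.symm
  refine continuousAt_const.div ?_ (hco.ne _ hco.mem)
  exact (hco.cont.continuousAt (hco.isOpen.mem_nhds hco.mem)).comp (h.hasDerivAt ht₀).continuousAt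

theorem IsTraj.eventuallyEq (hφ : DifferentiableOn ℂ φ disk) {J : Set ℝ} (hI : IsOpen I)
    (hJ : IsOpen J) (hc : c ≠ 0) {γ' : ℝ → ℂ} (h : IsTraj φ c I γ) (h' : IsTraj φ c J γ') {t₀ : ℝ}
    (ht₀ : t₀ ∈ I) (ht₀' : t₀ ∈ J) (e : γ t₀ = γ' t₀) (e' : deriv γ t₀ = deriv γ' t₀) :
    γ =ᶠ[𝓝 t₀] γ' := by
  obtain ⟨U, Φ, S, Ψ, r, hco⟩ := exists_coord hφ (h t₀ ht₀).1 (h.ne hc ht₀)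
  filter_upwards [h.local_form hI hc ht₀ hco hco.mem,
    h'.local_form hJ hc ht₀' hco (e ▸ hco.mem)] with t h1 h2
  refine hco.inj h1.1 h2.1 ?_
  rw [h1.2.1, h2.2.1, e, e']

/-- Straight arcs are determined by one point and the direction there. -/
theorem IsTraj.eqOn (hφ : DifferentiableOn ℂ φ disk) (hI : IsOpen I)
    (hIc : IsPreconnected I) (hc : c ≠ 0) {γ' : ℝ → ℂ} (h : IsTraj φ c I γ) (h' : IsTraj φ c I γ')
    {t₀ : ℝ} (ht₀ : t₀ ∈ I) (e : γ t₀ = γ' t₀) (e' : deriv γ t₀ = deriv γ' t₀) :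
    EqOn γ γ' I := by
  -- The set of times near which both arcs agree is open by definition and closed in `I`, as values
  -- and velocities are continuous.
  set u := {t | t ∈ I ∧ γ =ᶠ[𝓝 t] γ'} with hu
  have huo : IsOpen u := hI.inter isOpen_setOfPred_eventually_nhds
  have hsub : I ⊆ u := by
    refine hIc.subset_of_closure_inter_subset huo
      ⟨t₀, ht₀, ht₀, h.eventuallyEq hφ hI hI hc h' ht₀ ht₀ e e'⟩ ?_
    rintro t ⟨hcl, ht⟩
    refine ⟨ht, ?_⟩
    have hfr : ∃ᶠ s in 𝓝 t, s ∈ u := mem_closure_iff_frequently.1 hcl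
    refine h.eventuallyEq hφ hI hI hc h' ht ht ?_ ?_
    · by_contra hne
      have := (((h.hasDerivAt ht).continuousAt.prodMk (h'.hasDerivAt ht).continuousAt).eventually
        (isOpen_ne_fun continuous_fst continuous_snd |>.mem_nhds hne))
      obtain ⟨s, hs, hs'⟩ := (hfr.and_eventually this).exists
      exact hs' hs.2.self_of_nhds
    · by_contra hne
      have := (((h.continuousAt_deriv hφ hI hc ht).prodMk
        (h'.continuousAt_deriv hφ hI hc ht)).eventually
        (isOpen_ne_fun continuous_fst continuous_snd |>.mem_nhds hne))
      obtain ⟨s, hs, hs'⟩ := (hfr.and_eventually this).exists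
      exact hs' hs.2.deriv_eq
  exact fun t ht => (hsub ht).2.self_of_nhds

theorem IsTraj.comp_add (h : IsTraj φ c I γ) (s : ℝ) :
    IsTraj φ c ((fun t => t + s) ⁻¹' I) (fun t => γ (t + s)) := fun t ht => by
  obtain ⟨h1, v, hv, e⟩ := h (t + s) ht
  exact ⟨h1, v, hv.comp_add_const t s, e⟩

theorem IsTraj.comp_sub (h : IsTraj φ c I γ) (s : ℝ) :
    IsTraj φ c ((fun t => s - t) ⁻¹' I) (fun t => γ (s - t)) := fun t ht => by
  obtain ⟨h1, v, hv, e⟩ := h (s - t) ht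
  refine ⟨h1, -v, ?_, by rw [neg_sq]; exact e⟩
  exact hv.comp_const_sub s t

/-! ### Flat maps -/

variable {U : Set ℂ} {Ξ : ℂ → ℂ}

theorem IsFlat.hasDerivAt (h : IsFlat φ c U Ξ) {ζ : ℂ} (hζ : ζ ∈ U) :
    HasDerivAt Ξ (deriv Ξ ζ) ζ := by
  obtain ⟨-, v, hv, -⟩ := h ζ hζ
  rwa [hv.deriv]

theorem IsFlat.sq (h : IsFlat φ c U Ξ) {ζ : ℂ} (hζ : ζ ∈ U) :
    φ (Ξ ζ) * deriv Ξ ζ ^ 2 = c ^ 2 := by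
  obtain ⟨-, v, hv, e⟩ := h ζ hζ
  rwa [hv.deriv]

theorem IsFlat.mono (h : IsFlat φ c U Ξ) {V : Set ℂ} (hV : V ⊆ U) : IsFlat φ c V Ξ :=
  fun ζ hζ => h ζ (hV hζ)

theorem IsFlat.continuousOn (h : IsFlat φ c U Ξ) : ContinuousOn Ξ U := fun _ hζ =>
  (h.hasDerivAt hζ).continuousAt.continuousWithinAt

theorem IsFlat.differentiableOn (h : IsFlat φ c U Ξ) : DifferentiableOn ℂ Ξ U := fun _ hζ =>
  (h.hasDerivAt hζ).differentiableAt.differentiableWithinAt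

theorem IsFlat.deriv_ne (h : IsFlat φ c U Ξ) (hc : c ≠ 0) {ζ : ℂ} (hζ : ζ ∈ U) :
    deriv Ξ ζ ≠ 0 := fun h0 => by
  have := h.sq hζ
  rw [h0] at this
  exact pow_ne_zero 2 hc (by rw [← this]; simp)

theorem IsFlat.ne (h : IsFlat φ c U Ξ) (hc : c ≠ 0) {ζ : ℂ} (hζ : ζ ∈ U) : φ (Ξ ζ) ≠ 0 :=
  fun h0 => by
    have := h.sq hζ
    rw [h0, zero_mul] at this
    exact pow_ne_zero 2 hc this.symm

/-- Precomposition with an affine map. -/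
theorem IsFlat.comp_affine (h : IsFlat φ c U Ξ) (a e : ℂ) :
    IsFlat φ (c * e) ((fun ζ => a + e * ζ) ⁻¹' U) (fun ζ => Ξ (a + e * ζ)) := fun ζ hζ => by
  obtain ⟨h1, v, hv, e1⟩ := h (a + e * ζ) hζ
  refine ⟨h1, v * e, ?_, by rw [mul_pow, mul_pow, ← e1]; ring⟩
  have h2 : HasDerivAt (fun ζ => a + e * ζ) e ζ := by
    simpa using ((hasDerivAt_id ζ).const_mul e).const_add a
  exact hv.comp_of_eq ζ h2 rfl

theorem IsFlat.hasDerivAt_line (h : IsFlat φ c U Ξ) (a e : ℂ) {t : ℝ} (ht : a + e * t ∈ U) :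
    HasDerivAt (fun t : ℝ => Ξ (a + e * t)) (deriv Ξ (a + e * t) * e) t := by
  have h2 : HasDerivAt (fun ζ => a + e * ζ) e (t : ℂ) := by
    simpa using ((hasDerivAt_id (t : ℂ)).const_mul e).const_add a
  exact ((h.hasDerivAt ht).comp_of_eq (t : ℂ) h2 rfl).comp_ofReal

/-- Flat maps take straight lines to straight arcs. -/
theorem IsFlat.line (h : IsFlat φ c U Ξ) (a e : ℂ) :
    IsTraj φ (c * e) {t : ℝ | a + e * t ∈ U} (fun t => Ξ (a + e * t)) := fun t ht => by
  refine ⟨(h _ ht).1, _, h.hasDerivAt_line a e ht, ?_⟩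
  rw [mul_pow, mul_pow, ← h.sq ht]; ring

/-- Along the segment from `ζ₀` to any other point both maps are straight arcs with the same initial
data, so uniqueness of straight arcs applies. -/
theorem IsFlat.eqOn (hφ : DifferentiableOn ℂ φ disk) (hU : IsOpen U) (hUc : Convex ℝ U)
    (hc : c ≠ 0) {Ξ' : ℂ → ℂ} (h : IsFlat φ c U Ξ) (h' : IsFlat φ c U Ξ') {ζ₀ : ℂ} (hζ₀ : ζ₀ ∈ U)
    (e : Ξ ζ₀ = Ξ' ζ₀) (e' : deriv Ξ ζ₀ = deriv Ξ' ζ₀) : EqOn Ξ Ξ' U := by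
  intro ζ hζ
  by_cases hne : ζ = ζ₀
  · rw [hne, e]
  have hd : ζ - ζ₀ ≠ 0 := sub_ne_zero.2 hne
  set I := {t : ℝ | ζ₀ + (ζ - ζ₀) * t ∈ U} with hI
  have hIo : IsOpen I := hU.preimage (by fun_prop)
  have hIc : Convex ℝ I := by
    intro s hs t ht a b ha hb hab
    have := hUc hs ht ha hb hab
    simp only [hI, mem_ofPred_eq, Complex.real_smul, smul_eq_mul] at this ⊢
    convert this using 1
    push_cast
    have : (a : ℂ) + b = 1 := by exact_mod_cast hab
    linear_combination (-ζ₀) * this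
  have h0 : (0 : ℝ) ∈ I := by simp [hI, hζ₀]
  have := IsTraj.eqOn hφ hIo hIc.isPreconnected (mul_ne_zero hc hd) (h.line ζ₀ (ζ - ζ₀))
    (h'.line ζ₀ (ζ - ζ₀)) h0 (by simpa using e)
    (by
      rw [(h.hasDerivAt_line ζ₀ (ζ - ζ₀) h0).deriv, (h'.hasDerivAt_line ζ₀ (ζ - ζ₀) h0).deriv]
      simp [e'])
  have h1 := this (x := 1) (by simp [hI, hζ])
  simpa using h1

/-- Natural parameters exist on disks of uniform size about the points of a compact set. -/
theorem exists_uniform_flat (hφ : DifferentiableOn ℂ φ disk) (hc : c ≠ 0) {K : Set ℂ}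
    (hK : IsCompact K) (hKd : ∀ z ∈ K, z ∈ disk ∧ φ z ≠ 0) :
    ∃ r > 0, ∀ z ∈ K, ∀ v, φ z * v ^ 2 = c ^ 2 →
      ∃ Ξ, IsFlat φ c (Metric.ball 0 r) Ξ ∧ Ξ 0 = z ∧ deriv Ξ 0 = v := by
  -- Compactness: a uniform radius survives passage to subsets and finite unions, so a radius valid
  -- near each single point suffices.
  refine hK.induction_on (p := fun s => ∃ r > 0, ∀ z ∈ s, ∀ v, φ z * v ^ 2 = c ^ 2 →
      ∃ Ξ, IsFlat φ c (Metric.ball 0 r) Ξ ∧ Ξ 0 = z ∧ deriv Ξ 0 = v) ?_ ?_ ?_ ?_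
  · exact ⟨1, one_pos, fun z hz => absurd hz (Set.notMem_empty z)⟩
  · rintro s t hst ⟨r, hr, h⟩
    exact ⟨r, hr, fun z hz => h z (hst hz)⟩
  · rintro s t ⟨r, hr, h⟩ ⟨r', hr', h'⟩
    refine ⟨min r r', lt_min hr hr', ?_⟩
    rintro z (hz | hz) v hv
    · obtain ⟨Ξ, h1, h2⟩ := h z hz v hv
      exact ⟨Ξ, h1.mono (Metric.ball_subset_ball (min_le_left _ _)), h2⟩
    · obtain ⟨Ξ, h1, h2⟩ := h' z hz v hv
      exact ⟨Ξ, h1.mono (Metric.ball_subset_ball (min_le_right _ _)), h2⟩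
  · intro z₁ hz₁
    obtain ⟨U, Φ, S, Ψ, r, hco⟩ := exists_coord hφ (hKd z₁ hz₁).1 (hKd z₁ hz₁).2
    have hcn : 0 < ‖c‖ := norm_pos_iff.2 hc
    have hr := hco.pos
    have hn : {z | z ∈ U ∧ Φ z ∈ Metric.ball (0 : ℂ) (r / 2)} ∈ 𝓝 z₁ := by
      filter_upwards [hco.isOpen.mem_nhds hco.mem,
        (hco.deriv z₁ hco.mem).continuousAt (Metric.ball_mem_nhds _ (half_pos hr))] with z h1 h2
      rw [hco.map_center] at h2
      exact ⟨h1, h2⟩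
    -- For `z` in the half-size coordinate disk, the affine map with linear part of modulus `‖c‖`
    -- keeps the ball of radius `r / (2 ‖c‖)` inside the domain of the inverse `Ψ`.
    refine ⟨_, mem_nhdsWithin_of_mem_nhds hn, r / (2 * ‖c‖), by positivity, ?_⟩
    rintro z ⟨hzU, hzr⟩ v hv
    have he : (S z * v) ^ 2 = c ^ 2 := by rw [mul_pow, hco.sq z hzU, hv]
    have hen : ‖S z * v‖ = ‖c‖ := by
      have := congrArg norm he
      rw [norm_pow, norm_pow] at this
      exact (pow_left_inj₀ (norm_nonneg _) (norm_nonneg _) two_ne_zero).1 this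
    have hmap : ∀ ζ ∈ Metric.ball (0 : ℂ) (r / (2 * ‖c‖)),
        Φ z + S z * v * ζ ∈ Metric.ball (0 : ℂ) r := fun ζ hζ => by
      rw [mem_ball_zero_iff] at hζ hzr ⊢
      calc ‖Φ z + S z * v * ζ‖ ≤ ‖Φ z‖ + ‖S z * v‖ * ‖ζ‖ := by
            rw [← norm_mul]; exact norm_add_le _ _
        _ < r / 2 + ‖c‖ * (r / (2 * ‖c‖)) := by
            rw [hen]; gcongr
        _ = r := by field_simp; ring
    have hzr' : Φ z ∈ Metric.ball (0 : ℂ) r := Metric.ball_subset_ball (by linarith) hzr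
    have h1 : IsFlat φ (1 * (S z * v)) (Metric.ball 0 (r / (2 * ‖c‖)))
        (fun ζ => Ψ (Φ z + S z * v * ζ)) :=
      (hco.isFlat.comp_affine (Φ z) (S z * v)).mono hmap
    have h0 : (0 : ℂ) ∈ Metric.ball (0 : ℂ) (r / (2 * ‖c‖)) := Metric.mem_ball_self (by positivity)
    refine ⟨fun ζ => Ψ (Φ z + S z * v * ζ), ?_, by simp [hco.left_inv hzU hzr'], ?_⟩
    · intro ζ hζ
      obtain ⟨a1, w, a2, a3⟩ := h1 ζ hζ
      exact ⟨a1, w, a2, by rw [a3, one_mul, he]⟩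
    · have h2 : HasDerivAt (fun ζ => Φ z + S z * v * ζ) (S z * v) 0 := by
        simpa using ((hasDerivAt_id (0 : ℂ)).const_mul (S z * v)).const_add (Φ z)
      have h3 : HasDerivAt Ψ (S z)⁻¹ (Φ z + S z * v * 0) := by
        have := hco.deriv_inv (Φ z) hzr'
        rw [hco.left_inv hzU hzr'] at this
        simpa using this
      refine (h3.comp_of_eq (0 : ℂ) h2 rfl).deriv.trans ?_
      field_simp [hco.ne z hzU]

end traj

end TeichDisk
end

noncomputable section
namespace TeichDisk

/-! ### Charts -/

/-- A natural parameter `Ψ⁻¹` whose inverse is defined on a disk and has nearly constant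
direction. -/
structure IsChart (φ : ℂ → ℂ) (r : ℝ) (Ψ : ℂ → ℂ) : Prop where
  pos : 0 < r
  flat : IsFlat φ 1 (Metric.ball 0 r) Ψ
  re_pos : ∀ ζ ∈ Metric.ball (0 : ℂ) r, 0 < (deriv Ψ ζ / deriv Ψ 0).re

variable {φ : ℂ → ℂ} {r : ℝ} {Ψ : ℂ → ℂ} {c : ℂ}

theorem IsTraj.congr_sq {I : Set ℝ} {γ : ℝ → ℂ} {c' : ℂ} (h : IsTraj φ c I γ)
    (e : c ^ 2 = c' ^ 2) : IsTraj φ c' I γ := fun ζ hζ => by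
  obtain ⟨h1, v, h2, h3⟩ := h ζ hζ
  exact ⟨h1, v, h2, h3.trans e⟩

theorem IsChart.deriv_ne (h : IsChart φ r Ψ) {ζ : ℂ} (hζ : ‖ζ‖ < r) : deriv Ψ ζ ≠ 0 :=
  h.flat.deriv_ne one_ne_zero (mem_ball_zero_iff.2 hζ)

/-- The mean value theorem for the real part along the segment from `b` to `a`. This gives
injectivity of the chart, and later control of the arguments of its chords. -/
theorem IsChart.re_slope_pos (h : IsChart φ r Ψ) {a b : ℂ} (ha : ‖a‖ < r) (hb : ‖b‖ < r)
    (hab : a ≠ b) : 0 < ((Ψ a - Ψ b) / ((a - b) * deriv Ψ 0)).re := by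
  have hd : a - b ≠ 0 := sub_ne_zero.2 hab
  have h0 : deriv Ψ 0 ≠ 0 := h.deriv_ne (by simpa using h.pos)
  have hmem : ∀ t ∈ Icc (0 : ℝ) 1, b + (a - b) * t ∈ Metric.ball (0 : ℂ) r := fun t ht => by
    have := (convex_ball (0 : ℂ) r) (mem_ball_zero_iff.2 hb) (mem_ball_zero_iff.2 ha)
      (sub_nonneg.2 ht.2) ht.1 (by ring)
    convert this using 1
    simp only [Complex.real_smul]; push_cast; ring
  have hder : ∀ t ∈ Icc (0 : ℝ) 1,
      HasDerivAt (fun t : ℝ => (Ψ (b + (a - b) * t) / ((a - b) * deriv Ψ 0)).re)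
        (deriv Ψ (b + (a - b) * t) / deriv Ψ 0).re t := fun t ht => by
    have h1 := (h.flat.hasDerivAt_line b (a - b) (hmem t ht)).div_const ((a - b) * deriv Ψ 0)
    have h2 : HasDerivAt (fun t : ℝ => (Ψ (b + (a - b) * t) / ((a - b) * deriv Ψ 0)).re)
        (deriv Ψ (b + (a - b) * t) * (a - b) / ((a - b) * deriv Ψ 0)).re t :=
      HasFDerivAt.comp_hasDerivAt t (l := Complex.re) Complex.reCLM.hasFDerivAt h1
    rwa [mul_comm (a - b) (deriv Ψ 0), mul_div_mul_right _ _ hd, mul_comm (deriv Ψ 0)] at h2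
  obtain ⟨s, hs, e⟩ := exists_hasDerivAt_eq_slope _ _ zero_lt_one
    (fun t ht => (hder t ht).continuousAt.continuousWithinAt)
    (fun t ht => hder t (Ioo_subset_Icc_self ht))
  have h3 := h.re_pos _ (hmem s (Ioo_subset_Icc_self hs))
  rw [e] at h3
  simpa [sub_div] using h3

theorem IsChart.inj (h : IsChart φ r Ψ) {a b : ℂ} (ha : ‖a‖ < r) (hb : ‖b‖ < r)
    (e : Ψ a = Ψ b) : a = b := by
  by_contra hab
  have := h.re_slope_pos ha hb hab
  simp [e] at this

theorem IsFlat.hasDerivAt_affine {U : Set ℂ} {Ξ : ℂ → ℂ} (h : IsFlat φ c U Ξ) (a e : ℂ) {ζ : ℂ}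
    (hζ : a + e * ζ ∈ U) :
    HasDerivAt (fun ζ => Ξ (a + e * ζ)) (deriv Ξ (a + e * ζ) * e) ζ := by
  have h2 : HasDerivAt (fun ζ => a + e * ζ) e ζ := by
    simpa using ((hasDerivAt_id ζ).const_mul e).const_add a
  exact (h.hasDerivAt hζ).comp_of_eq ζ h2 rfl

theorem IsFlat.exists_chart {U : Set ℂ} {Ξ : ℂ → ℂ} (hU : IsOpen U) (h : IsFlat φ 1 U Ξ) {ζ₀ : ℂ}
    (h0 : ζ₀ ∈ U) : ∃ r > 0, Metric.ball ζ₀ r ⊆ U ∧ IsChart φ r (fun ζ => Ξ (ζ₀ + ζ)) := by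
  have hc : ContinuousAt (deriv Ξ) ζ₀ :=
    ((h.differentiableOn.analyticAt (hU.mem_nhds h0)).deriv).continuousAt
  have hne := h.deriv_ne one_ne_zero h0
  have h1 : ∀ᶠ ζ in 𝓝 ζ₀, 0 < (deriv Ξ ζ / deriv Ξ ζ₀).re := by
    have : ContinuousAt (fun z => (deriv Ξ z / deriv Ξ ζ₀).re) ζ₀ :=
      Complex.continuous_re.continuousAt.comp (hc.div_const _)
    refine this.eventually (lt_mem_nhds ?_)
    simp [hne]
  obtain ⟨r, hr, hb⟩ := Metric.mem_nhds_iff.1 (h1.and (hU.mem_nhds h0))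
  have hm : ∀ ζ ∈ Metric.ball (0 : ℂ) r, ζ₀ + 1 * ζ ∈ Metric.ball ζ₀ r := fun ζ hζ => by
    simpa using hζ
  have hd : ∀ ζ ∈ Metric.ball (0 : ℂ) r, deriv (fun ζ => Ξ (ζ₀ + ζ)) ζ = deriv Ξ (ζ₀ + ζ) :=
    fun ζ hζ => by
      have := (h.hasDerivAt_affine ζ₀ 1 (hb (hm ζ hζ)).2).deriv
      simpa using this
  refine ⟨r, hr, fun ζ hζ => (hb hζ).2, hr, ?_, fun ζ hζ => ?_⟩
  · have := (h.comp_affine ζ₀ 1).mono (V := Metric.ball 0 r) fun ζ hζ => (hb (hm ζ hζ)).2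
    simpa using this
  · rw [hd ζ hζ, hd 0 (Metric.mem_ball_self hr), add_zero]
    have := (hb (hm ζ hζ)).1
    simpa using this

theorem exists_chart (hφ : DifferentiableOn ℂ φ disk) {z v : ℂ} (hz : z ∈ disk)
    (hv : φ z * v ^ 2 = 1) : ∃ r Ψ, IsChart φ r Ψ ∧ Ψ 0 = z ∧ deriv Ψ 0 = v := by
  have h0 : φ z ≠ 0 := fun h => by simp [h] at hv
  obtain ⟨r, hr, h⟩ := exists_uniform_flat hφ (c := 1) one_ne_zero (isCompact_singleton (x := z))
    (by rintro _ rfl; exact ⟨hz, h0⟩)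
  obtain ⟨Ξ, h1, h2, h3⟩ := h z rfl v (by rw [hv]; norm_num)
  obtain ⟨r', hr', -, h4⟩ := h1.exists_chart Metric.isOpen_ball (Metric.mem_ball_self hr)
  exact ⟨r', Ξ, by simpa using h4, h2, h3⟩

/-- Passing from `φ` to `φ / c²` turns the direction `c` into the horizontal one, so results for
unit speed horizontal arcs carry over to all directions. -/
theorem IsChart.comp_mul (h : IsChart φ r Ψ) (hc : c ≠ 0) :
    IsChart (fun z => φ z / c ^ 2) (r / ‖c‖) (fun ζ => Ψ (c * ζ)) := by
  have hcn : 0 < ‖c‖ := norm_pos_iff.2 hc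
  have hm : ∀ ζ ∈ Metric.ball (0 : ℂ) (r / ‖c‖), 0 + c * ζ ∈ Metric.ball (0 : ℂ) r := fun ζ hζ => by
    rw [mem_ball_zero_iff, lt_div_iff₀ hcn] at hζ
    rw [mem_ball_zero_iff, zero_add, norm_mul, mul_comm]; exact hζ
  have hd : ∀ ζ ∈ Metric.ball (0 : ℂ) (r / ‖c‖),
      HasDerivAt (fun ζ => Ψ (c * ζ)) (deriv Ψ (c * ζ) * c) ζ := fun ζ hζ => by
    simpa using h.flat.hasDerivAt_affine 0 c (hm ζ hζ)
  have hp : 0 < r / ‖c‖ := div_pos h.pos hcn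
  refine ⟨hp, fun ζ hζ => ?_, fun ζ hζ => ?_⟩
  · have hm' := hm ζ hζ
    rw [zero_add] at hm'
    refine ⟨(h.flat _ hm').1, _, hd ζ hζ, ?_⟩
    have := h.flat.sq hm'
    field_simp
    linear_combination this
  · rw [(hd ζ hζ).deriv, (hd 0 (Metric.mem_ball_self hp)).deriv, mul_zero,
      mul_div_mul_right _ _ hc]
    have := hm ζ hζ
    rw [zero_add] at this
    exact h.re_pos _ this

theorem IsChart.neg (h : IsChart φ r Ψ) : IsChart φ r (fun ζ => Ψ (-ζ)) := by
  simpa using h.comp_mul (c := -1) (by norm_num)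

theorem IsChart.deriv_neg (h : IsChart φ r Ψ) {ζ : ℂ} (hζ : ‖ζ‖ < r) :
    deriv (fun ζ => Ψ (-ζ)) ζ = - deriv Ψ (-ζ) := by
  have := (h.flat.hasDerivAt_affine 0 (-1) (ζ := ζ) (by simpa using hζ)).deriv
  simpa using this

/-- In a chart a straight arc is a straight segment. -/
theorem IsChart.traj_eq (hφ : DifferentiableOn ℂ φ disk) (h : IsChart φ r Ψ) (hc : c ≠ 0)
    {a b : ℝ} {γ : ℝ → ℂ} (hγ : IsTraj φ c (Ioo a b) γ) {t₀ : ℝ} (ht₀ : t₀ ∈ Ioo a b) {ζ₀ : ℂ}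
    (hζ₀ : ‖ζ₀‖ < r) (e₀ : γ t₀ = Ψ ζ₀) {e : ℂ} (he : deriv γ t₀ = deriv Ψ ζ₀ * e) {t : ℝ}
    (ht : t ∈ Ioo a b) (htr : ‖ζ₀ + e * (t - t₀)‖ < r) :
    γ t = Ψ (ζ₀ + e * (t - t₀)) ∧ deriv γ t = deriv Ψ (ζ₀ + e * (t - t₀)) * e := by
  have hesq : e ^ 2 = c ^ 2 := by
    have h1 := hγ.sq ht₀
    have h2 := h.flat.sq (mem_ball_zero_iff.2 hζ₀)
    rw [he, e₀] at h1
    linear_combination h1 - e ^ 2 * h2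
  have he0 : e ≠ 0 := fun h0 => by
    rw [h0] at hesq; exact pow_ne_zero 2 hc (by rw [← hesq]; simp)
  -- `J` consists of the times at which the straight segment of the chart is inside the ball; it is
  -- an interval, so uniqueness holds on its intersection with the domain of `γ`.
  set J := {t : ℝ | (ζ₀ - e * t₀) + e * t ∈ Metric.ball (0 : ℂ) r} with hJ
  have hline : ∀ s : ℝ, (ζ₀ - e * t₀) + e * s = ζ₀ + e * (s - t₀) := fun s => by ring
  have hJo : IsOpen J := Metric.isOpen_ball.preimage (by fun_prop)
  have hJc : Convex ℝ J := by
    intro s hs t ht x y hx hy hxy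
    have := (convex_ball (0 : ℂ) r) hs ht hx hy hxy
    simp only [hJ, mem_ofPred_eq, Complex.real_smul, smul_eq_mul] at this ⊢
    convert this using 1
    push_cast
    have : (x : ℂ) + y = 1 := by exact_mod_cast hxy
    linear_combination (-(ζ₀ - e * t₀)) * this
  have hl : IsTraj φ c J (fun t : ℝ => Ψ ((ζ₀ - e * t₀) + e * t)) :=
    (h.flat.line (ζ₀ - e * t₀) e).congr_sq (by rw [one_mul, hesq])
  have ht₀J : t₀ ∈ J := by simpa [hJ] using hζ₀
  have htJ : t ∈ J := by simpa only [hJ, mem_ofPred_eq, hline, mem_ball_zero_iff] using htr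
  have hI : IsOpen (Ioo a b ∩ J) := isOpen_Ioo.inter hJo
  have := (hγ.mono (J := Ioo a b ∩ J) inter_subset_left).eqOn hφ hI
    ((convex_Ioo a b).inter hJc).isPreconnected hc (hl.mono inter_subset_right) ⟨ht₀, ht₀J⟩
    (by simp [e₀]) (by
      rw [(h.flat.hasDerivAt_line (ζ₀ - e * t₀) e ht₀J).deriv, he]; simp)
  refine ⟨by rw [this ⟨ht, htJ⟩]; simp only [hline], ?_⟩
  rw [(this.eventuallyEq_of_mem (hI.mem_nhds ⟨ht, htJ⟩)).deriv_eq,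
    (h.flat.hasDerivAt_line (ζ₀ - e * t₀) e htJ).deriv, hline]

/-- Two overlapping straight arcs which are tangent at one point form a straight arc. -/
theorem IsTraj.exists_union (hφ : DifferentiableOn ℂ φ disk) (hc : c ≠ 0) {a b a' b' : ℝ}
    {γ γ' : ℝ → ℂ} (h : IsTraj φ c (Ioo a b) γ) (h' : IsTraj φ c (Ioo a' b') γ') {t₀ : ℝ}
    (ht : t₀ ∈ Ioo a b) (ht' : t₀ ∈ Ioo a' b') (e : γ t₀ = γ' t₀)
    (e' : deriv γ t₀ = deriv γ' t₀) :
    ∃ γ₁, IsTraj φ c (Ioo (min a a') (max b b')) γ₁ ∧ EqOn γ₁ γ (Ioo a b) ∧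
      EqOn γ₁ γ' (Ioo a' b') := by
  classical
  have hov : EqOn γ γ' (Ioo a b ∩ Ioo a' b') :=
    (h.mono inter_subset_left).eqOn hφ (isOpen_Ioo.inter isOpen_Ioo)
      ((convex_Ioo a b).inter (convex_Ioo a' b')).isPreconnected hc (h'.mono inter_subset_right)
      ⟨ht, ht'⟩ e e'
  have h1 : EqOn (fun t => if t ∈ Ioo a b then γ t else γ' t) γ (Ioo a b) := fun t ht => if_pos ht
  have h2 : EqOn (fun t => if t ∈ Ioo a b then γ t else γ' t) γ' (Ioo a' b') := fun t ht => by
    by_cases hm : t ∈ Ioo a b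
    · simp only [if_pos hm]; exact hov ⟨hm, ht⟩
    · simp only [if_neg hm]
  refine ⟨_, fun t htt => ?_, h1, h2⟩
  have : t ∈ Ioo a b ∨ t ∈ Ioo a' b' := by
    by_contra hno
    simp only [not_or, mem_Ioo, not_and, not_lt] at hno
    rcases le_total t t₀ with hle | hle
    · rcases min_lt_iff.1 htt.1 with h3 | h3
      · linarith [hno.1 h3, ht.2]
      · linarith [hno.2 h3, ht'.2]
    · rcases lt_max_iff.1 htt.2 with h3 | h3
      · have := hno.1 (by linarith [ht.1]); linarith
      · have := hno.2 (by linarith [ht'.1]); linarith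
  rcases this with h3 | h3
  · exact h.congr_of_isOpen isOpen_Ioo h1 t h3
  · exact h'.congr_of_isOpen isOpen_Ioo h2 t h3

/-- Flat coordinates along a straight arc. -/
theorem IsTraj.exists_flat (hφ : DifferentiableOn ℂ φ disk) (hc : c ≠ 0) {a b x₀ x₁ : ℝ}
    {γ : ℝ → ℂ} (h : IsTraj φ c (Ioo a b) γ) (ha : a < x₀) (hx : x₀ ≤ x₁) (hb : x₁ < b) :
    ∃ δ > 0, a < x₀ - δ ∧ x₁ + δ < b ∧ ∃ Ξ,
      IsFlat φ c {ζ | x₀ - δ < ζ.re ∧ ζ.re < x₁ + δ ∧ |ζ.im| < δ} Ξ ∧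
      ∀ x ∈ Ioo (x₀ - δ) (x₁ + δ), Ξ x = γ x ∧ deriv Ξ x = deriv γ x := by
  set a' := (a + x₀) / 2 with ha'
  set b' := (x₁ + b) / 2 with hb'
  have hsub : Icc a' b' ⊆ Ioo a b := fun t ht => ⟨by linarith [ht.1], by linarith [ht.2]⟩
  have hK : IsCompact (γ '' Icc a' b') := isCompact_Icc.image_of_continuousOn
    (h.continuousOn.mono hsub)
  obtain ⟨r, hr, hu⟩ := exists_uniform_flat hφ hc hK (by
    rintro _ ⟨t, ht, rfl⟩; exact ⟨(h t (hsub ht)).1, h.ne hc (hsub ht)⟩)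
  have hex : ∀ t : ℝ, ∃ Ξ, t ∈ Icc a' b' → IsFlat φ c (Metric.ball 0 r) Ξ ∧ Ξ 0 = γ t ∧
      deriv Ξ 0 = deriv γ t := fun t => by
    by_cases ht : t ∈ Icc a' b'
    · obtain ⟨Ξ, h1⟩ := hu (γ t) ⟨t, ht, rfl⟩ (deriv γ t) (h.sq (hsub ht))
      exact ⟨Ξ, fun _ => h1⟩
    · exact ⟨0, fun h => absurd h ht⟩
  choose P hP using hex
  set δ := min (r / 2) (min ((x₀ - a) / 3) ((b - x₁) / 3)) with hδ
  have hδ0 : 0 < δ := lt_min (by linarith) (lt_min (by linarith) (by linarith))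
  have hδr : δ ≤ r / 2 := min_le_left _ _
  have hδa : δ ≤ (x₀ - a) / 3 := (min_le_right _ _).trans (min_le_left _ _)
  have hδb : δ ≤ (b - x₁) / 3 := (min_le_right _ _).trans (min_le_right _ _)
  have hmem : ∀ t ∈ Ioo (x₀ - δ) (x₁ + δ), t ∈ Icc a' b' := fun t ht =>
    ⟨by linarith [ht.1], by linarith [ht.2]⟩
  -- The flat maps centred at nearby points of `γ` differ by a translation: both continue `γ`, hence
  -- have equal value and derivative at one common point.
  have hchange : ∀ t ∈ Ioo (x₀ - δ) (x₁ + δ), ∀ s ∈ Ioo (x₀ - δ) (x₁ + δ), |s - t| < r / 2 →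
      ∀ y : ℝ, |y| < r / 2 → P s (y * Complex.I) = P t ((s - t : ℝ) + y * Complex.I) := by
    intro t ht s hs hst y hy
    obtain ⟨f1, f2, f3⟩ := hP t (hmem t ht)
    obtain ⟨g1, g2, g3⟩ := hP s (hmem s hs)
    have h0 : (0 : ℂ) ∈ Metric.ball (0 : ℂ) r := Metric.mem_ball_self hr
    -- `P t` continues `γ`
    set J := Metric.ball t r ∩ Ioo a b with hJ
    have hJm : ∀ x ∈ J, (-t : ℂ) + 1 * x ∈ Metric.ball (0 : ℂ) r := fun x hx => by
      have := hx.1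
      rw [Metric.mem_ball, Real.dist_eq] at this
      rw [mem_ball_zero_iff, show (-t : ℂ) + 1 * x = ((x - t : ℝ) : ℂ) by push_cast; ring,
        Complex.norm_real]
      exact this
    have htJ : t ∈ J := ⟨Metric.mem_ball_self hr, hsub (hmem t ht)⟩
    have hsJ : s ∈ J := ⟨by rw [Metric.mem_ball, Real.dist_eq]; linarith, hsub (hmem s hs)⟩
    have hl : IsTraj φ c J (fun x : ℝ => P t (-t + 1 * x)) := by
      have := (f1.line (-t) 1).mono (J := J) hJm
      rwa [mul_one] at this
    have hJo : IsOpen J := Metric.isOpen_ball.inter isOpen_Ioo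
    have heq : EqOn γ (fun x : ℝ => P t (-t + 1 * x)) J := (h.mono inter_subset_right).eqOn hφ hJo
      ((convex_ball t r).inter (convex_Ioo a b)).isPreconnected hc hl htJ (by simp [f2])
      (by rw [(f1.hasDerivAt_line (-t) 1 (hJm t htJ)).deriv]; simp [f3])
    have hsr : ((s - t : ℝ) : ℂ) ∈ Metric.ball (0 : ℂ) r := by
      rw [mem_ball_zero_iff, Complex.norm_real]; exact hst.trans (by linarith)
    have hst' : (-t : ℂ) + 1 * s = ((s - t : ℝ) : ℂ) := by push_cast; ring
    have hsr' : ((s - t : ℝ) : ℂ) + 1 * 0 ∈ Metric.ball (0 : ℂ) r := by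
      rwa [mul_zero, add_zero]
    have v0 : P s 0 = P t ((s - t : ℝ) + 1 * 0) := by
      rw [g2, heq hsJ]
      change P t (-t + 1 * s) = _
      rw [hst', mul_zero, add_zero]
    have v1 : deriv (P s) 0 = deriv (fun ζ => P t ((s - t : ℝ) + 1 * ζ)) 0 := by
      rw [g3, (heq.eventuallyEq_of_mem (hJo.mem_nhds hsJ)).deriv_eq,
        (f1.hasDerivAt_line (-t) 1 (hJm s hsJ)).deriv,
        (f1.hasDerivAt_affine ((s - t : ℝ) : ℂ) 1 hsr').deriv, hst']
      simp
    set U := Metric.ball (0 : ℂ) r ∩ (fun ζ => ((s - t : ℝ) : ℂ) + 1 * ζ) ⁻¹' Metric.ball 0 r with hU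
    have hUo : IsOpen U := Metric.isOpen_ball.inter (Metric.isOpen_ball.preimage (by fun_prop))
    have hUc : Convex ℝ U := by
      refine (convex_ball _ _).inter ?_
      have : ((fun ζ => ((s - t : ℝ) : ℂ) + 1 * ζ) ⁻¹' Metric.ball (0 : ℂ) r) =
          Metric.ball (-((s - t : ℝ) : ℂ)) r := by
        ext ζ
        rw [mem_preimage, mem_ball_zero_iff, mem_ball_iff_norm, one_mul, sub_neg_eq_add, add_comm]
      rw [this]; exact convex_ball _ _
    have hf : IsFlat φ c U (fun ζ => P t ((s - t : ℝ) + 1 * ζ)) := by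
      have := (f1.comp_affine ((s - t : ℝ) : ℂ) 1).mono (V := U) inter_subset_right
      rwa [mul_one] at this
    have := (g1.mono (V := U) inter_subset_left).eqOn hφ hUo hUc hc hf
      ⟨h0, hsr'⟩ v0 v1
    have hy' : ‖(y : ℂ) * Complex.I‖ < r / 2 := by simpa using hy
    have hmU : (y : ℂ) * Complex.I ∈ U := by
      refine ⟨by rw [mem_ball_zero_iff]; linarith, ?_⟩
      rw [mem_preimage, mem_ball_zero_iff, one_mul]
      refine (norm_add_le _ _).trans_lt ?_
      rw [Complex.norm_real, Real.norm_eq_abs]; linarith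
    have h3 := this hmU
    simpa only [one_mul] using h3
  -- The flat maps are glued: at `ζ` the one centred at `γ (Re ζ)` is used, evaluated on the
  -- imaginary axis. It need not be injective, as nothing is claimed about self-intersections of
  -- `γ`.
  refine ⟨δ, hδ0, by linarith, by linarith, fun ζ => P ζ.re (ζ.im * Complex.I), ?_, ?_⟩
  · rintro ζ₁ ⟨h1, h2, h3⟩
    obtain ⟨f1, f2, f3⟩ := hP ζ₁.re (hmem _ ⟨h1, h2⟩)
    have hb1 : (-ζ₁.re : ℂ) + 1 * ζ₁ ∈ Metric.ball (0 : ℂ) r := by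
      have : (-ζ₁.re : ℂ) + 1 * ζ₁ = ζ₁.im * Complex.I := by
        linear_combination -Complex.re_add_im ζ₁
      rw [this, mem_ball_zero_iff]
      simp only [norm_mul, Complex.norm_real, Complex.norm_I, mul_one, Real.norm_eq_abs]
      linarith
    have hev : (fun ζ : ℂ => P ζ.re (ζ.im * Complex.I)) =ᶠ[𝓝 ζ₁]
        fun ζ => P ζ₁.re (-ζ₁.re + 1 * ζ) := by
      have o1 : ∀ᶠ ζ : ℂ in 𝓝 ζ₁, x₀ - δ < ζ.re := Complex.continuous_re.continuousAt.eventually (lt_mem_nhds h1)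
      have o2 : ∀ᶠ ζ : ℂ in 𝓝 ζ₁, ζ.re < x₁ + δ := Complex.continuous_re.continuousAt.eventually (gt_mem_nhds h2)
      have o3 : ∀ᶠ ζ : ℂ in 𝓝 ζ₁, |ζ.im| < δ :=
        (continuous_abs.comp Complex.continuous_im).continuousAt.eventually (gt_mem_nhds h3)
      have o4 : ∀ᶠ ζ : ℂ in 𝓝 ζ₁, |ζ.re - ζ₁.re| < r / 2 := by
        have : ContinuousAt (fun ζ : ℂ => |ζ.re - ζ₁.re|) ζ₁ := by fun_prop
        refine this.eventually (gt_mem_nhds ?_)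
        simpa using hr
      filter_upwards [o1, o2, o3, o4] with ζ p1 p2 p3 p4
      rw [hchange ζ₁.re ⟨h1, h2⟩ ζ.re ⟨p1, p2⟩ p4 ζ.im (p3.trans_le hδr)]
      congr 1
      conv_rhs => rw [← Complex.re_add_im ζ]
      push_cast; ring
    obtain ⟨k1, v, k2, k3⟩ := (f1.comp_affine (-ζ₁.re : ℂ) 1) ζ₁ hb1
    refine ⟨by rw [hev.self_of_nhds]; exact k1, v, k2.congr_of_eventuallyEq hev, ?_⟩
    rw [hev.self_of_nhds, k3, mul_one]
  · intro x hx
    obtain ⟨f1, f2, f3⟩ := hP x (hmem _ hx)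
    refine ⟨by simp [f2], ?_⟩
    have hev : (fun ζ : ℂ => P ζ.re (ζ.im * Complex.I)) =ᶠ[𝓝 (x : ℂ)]
        fun ζ => P x (-x + 1 * ζ) := by
      have o1 : ∀ᶠ ζ : ℂ in 𝓝 (x : ℂ), x₀ - δ < ζ.re := Complex.continuous_re.continuousAt.eventually (lt_mem_nhds (by simpa using hx.1))
      have o2 : ∀ᶠ ζ : ℂ in 𝓝 (x : ℂ), ζ.re < x₁ + δ := Complex.continuous_re.continuousAt.eventually (gt_mem_nhds (by simpa using hx.2))
      have o3 : ∀ᶠ ζ : ℂ in 𝓝 (x : ℂ), |ζ.im| < δ :=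
        (continuous_abs.comp Complex.continuous_im).continuousAt.eventually
          (gt_mem_nhds (by simpa using hδ0))
      have o4 : ∀ᶠ ζ : ℂ in 𝓝 (x : ℂ), |ζ.re - x| < r / 2 := by
        have : ContinuousAt (fun ζ : ℂ => |ζ.re - x|) x := by fun_prop
        refine this.eventually (gt_mem_nhds ?_)
        simpa using hr
      filter_upwards [o1, o2, o3, o4] with ζ p1 p2 p3 p4
      rw [hchange x hx ζ.re ⟨p1, p2⟩ p4 ζ.im (p3.trans_le hδr)]
      congr 1
      conv_rhs => rw [← Complex.re_add_im ζ]
      push_cast; ring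
    rw [hev.deriv_eq, (f1.hasDerivAt_affine (-x : ℂ) 1 (by simpa using hr)).deriv]
    simp [f3]

end TeichDisk
end

noncomputable section
namespace TeichDisk

/-! ### Straight arcs do not return to a short transversal -/

variable {φ : ℂ → ℂ} {r : ℝ} {Ψ : ℂ → ℂ} {c : ℂ}

/-- The arc `γ` on `[p, q]` and the curve `Ψ ∘ κ` form a simple loop of class `C¹`. On `γ` the
quantity `φ Γ'²` equals `1`, on the closing piece it equals `κ'²`, so its whole turning is that of
`κ'²`, and `IsSimpleLoop.dlog_quadratic_ne` forbids at most one turn. -/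
theorem IsChart.no_closing (hφ : DifferentiableOn ℂ φ disk) (h : IsChart φ r Ψ) {a b p q : ℝ}
    {γ : ℝ → ℂ} (hγ : IsTraj φ 1 (Ioo a b) γ) (hap : a < p) (hpq : p < q) (hqb : q < b)
    {κ κ' : ℝ → ℂ} {T : ℝ} (hT : 0 < T) (hκ : ∀ s ∈ Icc 0 T, HasDerivAt κ (κ' s) s)
    (hκc : Continuous κ') (hκ0 : ∀ s ∈ Icc 0 T, κ' s ≠ 0) (hκr : ∀ s ∈ Icc 0 T, ‖κ s‖ < r)
    (e1 : γ q = Ψ (κ 0)) (e1' : deriv γ q = deriv Ψ (κ 0) * κ' 0)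
    (e2 : Ψ (κ T) = γ p) (e2' : deriv Ψ (κ T) * κ' T = deriv γ p)
    (γi : InjOn γ (Icc p q)) (κi : InjOn κ (Icc 0 T))
    (hav : ∀ t ∈ Icc p q, ∀ s ∈ Ioo 0 T, γ t ≠ Ψ (κ s)) {k : ℤ} (hk : |k| ≤ 1)
    (hdl : dlog (fun s => κ' s ^ 2) 0 T = k * (2 * Real.pi * Complex.I)) : False := by
  have h1 : 0 < q - p := sub_pos.2 hpq
  have hTT : 0 < (q - p) + T := by linarith
  have hm : ∀ t ∈ Icc 0 (q - p), t + p ∈ Ioo a b := fun t ht =>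
    ⟨by linarith [ht.1], by linarith [ht.2]⟩
  have hm' : ∀ t ∈ Icc 0 (q - p), t + p ∈ Icc p q := fun t ht =>
    ⟨by linarith [ht.1], by linarith [ht.2]⟩
  have hbl : ∀ s ∈ Icc 0 T, κ s ∈ Metric.ball (0 : ℂ) r := fun s hs => mem_ball_zero_iff.2 (hκr s hs)
  have han : AnalyticOnNhd ℂ Ψ (Metric.ball 0 r) := h.flat.differentiableOn.analyticOnNhd
    Metric.isOpen_ball
  have hl : IsSimpleLoop _ _ _ := isSimpleLoop_concat (f := fun t => γ (t + p))
    (f' := fun t => deriv γ (t + p)) (g := fun s => Ψ (κ s)) (g' := fun s => deriv Ψ (κ s) * κ' s)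
    hTT h1 hT (fun t ht => (hγ.hasDerivAt (hm t ht)).comp_add_const t p)
    (fun s hs => (h.flat.hasDerivAt (hbl s hs)).scomp_of_eq s (hκ s hs) rfl |>.congr_deriv
      (by simp [mul_comm]))
    (fun t ht => ContinuousAt.comp (f := fun t => t + p)
      (hγ.continuousAt_deriv hφ isOpen_Ioo one_ne_zero (hm t ht)) (by fun_prop))
    (fun s hs => (ContinuousAt.comp (f := κ) (han _ (hbl s hs)).deriv.continuousAt
      (hκ s hs).continuousAt).mul hκc.continuousAt)
    (fun t ht => hγ.deriv_ne one_ne_zero (hm t ht))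
    (fun s hs => mul_ne_zero (h.deriv_ne (hκr s hs)) (hκ0 s hs))
    (by simpa using e1) (by simpa using e1') (by simpa using e2) (by simpa using e2')
    (fun s hs t ht e => by simpa using γi (hm' s hs) (hm' t ht) e)
    (fun s hs t ht e => κi hs ht (h.inj (hκr s hs) (hκr t ht) e))
    (fun s hs t ht => hav _ (hm' s hs) t ht)
  set Γ := periodicConcat (fun t => γ (t + p)) (fun s => Ψ (κ s)) (q - p) T hTT with hΓ
  set Γ' := periodicConcat (fun t => deriv γ (t + p)) (fun s => deriv Ψ (κ s) * κ' s) (q - p) T hTT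
    with hΓ'
  have hval : ∀ t, (∃ s ∈ Icc 0 (q - p), Γ t = γ (s + p)) ∨ (∃ s ∈ Icc 0 T, Γ t = Ψ (κ s)) := by
    intro t
    have hb := toIcoMod_mem_Ico hTT 0 t
    simp only [hΓ, periodicConcat]
    split_ifs with hlt
    · exact Or.inl ⟨_, ⟨hb.1, hlt.le⟩, rfl⟩
    · refine Or.inr ⟨_, ⟨by linarith, by linarith [hb.2]⟩, rfl⟩
  have hdisk : ∀ t, Γ t ∈ disk := fun t => by
    rcases hval t with ⟨s, hs, e⟩ | ⟨s, hs, e⟩ <;> rw [e]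
    exacts [(hγ _ (hm s hs)).1, (h.flat _ (hbl s hs)).1]
  have hne : ∀ t, φ (Γ t) ≠ 0 := fun t => by
    rcases hval t with ⟨s, hs, e⟩ | ⟨s, hs, e⟩ <;> rw [e]
    exacts [hγ.ne one_ne_zero (hm s hs), h.flat.ne one_ne_zero (hbl s hs)]
  refine hl.dlog_quadratic_ne hφ hdisk hne hk ?_
  have hΓc : Continuous Γ := continuous_iff_continuousAt.2 fun t => (hl.hasDerivAt t).continuousAt
  have hcont : Continuous fun t => φ (Γ t) * Γ' t ^ 2 :=
    (hφ.continuousOn.comp_continuous hΓc hdisk).mul (hl.cont_deriv.pow 2)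
  have hne' : ∀ t, φ (Γ t) * Γ' t ^ 2 ≠ 0 := fun t =>
    mul_ne_zero (hne t) (pow_ne_zero 2 (hl.deriv_ne t))
  rw [← dlog_add h1.le (by linarith : q - p ≤ q - p + T) hcont.continuousOn fun t _ => hne' t,
    dlog_congr (g := fun _ => (1 : ℂ)), dlog_const 1 h1.le one_ne_zero, zero_add, ← hdl]
  · have hv : ∀ t ∈ Icc (q - p) (q - p + T), φ (Γ t) * Γ' t ^ 2 = κ' (t - (q - p)) ^ 2 := by
      have key : ∀ s ∈ Icc 0 T, φ (Ψ (κ s)) * (deriv Ψ (κ s) * κ' s) ^ 2 = κ' s ^ 2 := fun s hs => by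
        have := h.flat.sq (hbl s hs)
        linear_combination κ' s ^ 2 * this
      intro t ht
      rcases ht.2.eq_or_lt with e | hlt
      · have hp1 : Γ t = Ψ (κ T) := by
          rw [e, hΓ, ← zero_add (q - p + T), periodicConcat_add,
            periodicConcat_of_mem hTT le_rfl hTT, if_pos h1, zero_add, e2]
        have hp2 : Γ' t = deriv Ψ (κ T) * κ' T := by
          rw [e, hΓ', ← zero_add (q - p + T), periodicConcat_add,
            periodicConcat_of_mem hTT le_rfl hTT, if_pos h1, zero_add, e2']
        rw [hp1, hp2, key T ⟨hT.le, le_rfl⟩, e, add_sub_cancel_left]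
      · have h0t : 0 ≤ t := by linarith [ht.1]
        rw [hΓ, hΓ', periodicConcat_of_mem hTT h0t hlt, periodicConcat_of_mem hTT h0t hlt,
          if_neg ht.1.not_gt, if_neg ht.1.not_gt]
        exact key _ ⟨by linarith [ht.1], by linarith⟩
    rw [dlog_congr hv]
    have := dlog_comp_add (fun t => κ' (t - (q - p)) ^ 2) (a := 0) (b := T) (q - p) hT.le
      (by fun_prop) (fun t ht => pow_ne_zero 2 (hκ0 _ ⟨by linarith [ht.1], by linarith [ht.2]⟩))
    rw [zero_add, add_comm T] at this
    rw [← this]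
    simp
  · intro t ht
    rcases ht.2.eq_or_lt with e | hlt
    · have hp1 : Γ t = Ψ (κ 0) := by
        rw [e, hΓ, periodicConcat_of_mem hTT h1.le (by linarith), if_neg (lt_irrefl _), sub_self]
      have hp2 : Γ' t = deriv Ψ (κ 0) * κ' 0 := by
        rw [e, hΓ', periodicConcat_of_mem hTT h1.le (by linarith), if_neg (lt_irrefl _), sub_self]
      rw [hp1, hp2, ← e1, ← e1', hγ.sq ⟨by linarith, hqb⟩, one_pow]
    · rw [hΓ, hΓ', periodicConcat_of_mem hTT ht.1 (by linarith),
        periodicConcat_of_mem hTT ht.1 (by linarith), if_pos hlt, if_pos hlt, hγ.sq (hm t ht), one_pow]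

/-- Otherwise the arc would be symmetric under `x ↦ s + t - x`, and at the midpoint its velocity
would be its own negative. -/
theorem IsTraj.no_reversal (hφ : DifferentiableOn ℂ φ disk) (hc : c ≠ 0) {a b : ℝ} {γ : ℝ → ℂ}
    (hγ : IsTraj φ c (Ioo a b) γ) {s t : ℝ} (hs : s ∈ Ioo a b) (ht : t ∈ Ioo a b)
    (e : γ s = γ t) : deriv γ s ≠ -deriv γ t := by
  intro e'
  have h2 : IsTraj φ c ((fun x => s + t - x) ⁻¹' Ioo a b) (fun x => γ (s + t - x)) :=
    hγ.comp_sub (s + t)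
  have hpre : ((fun x => s + t - x) ⁻¹' Ioo a b) = Ioo (s + t - b) (s + t - a) := by
    ext x; simp only [mem_preimage, mem_Ioo]; constructor <;> rintro ⟨h, h'⟩ <;> constructor <;> linarith
  rw [hpre] at h2
  have hI : IsOpen (Ioo a b ∩ Ioo (s + t - b) (s + t - a)) := isOpen_Ioo.inter isOpen_Ioo
  have hd : ∀ x, s + t - x ∈ Ioo a b → deriv (fun x => γ (s + t - x)) x = -deriv γ (s + t - x) :=
    fun x hx => ((hγ.hasDerivAt hx).comp_const_sub (s + t) x).deriv
  have hst : s + t - s = t := by ring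
  have heq := (hγ.mono (J := Ioo a b ∩ Ioo (s + t - b) (s + t - a)) inter_subset_left).eqOn hφ hI
    ((convex_Ioo _ _).inter (convex_Ioo _ _)).isPreconnected hc (h2.mono inter_subset_right)
    (t₀ := s) ⟨hs, by constructor <;> linarith [ht.1, ht.2]⟩ (by rw [hst, e])
    (by rw [hd s (by rw [hst]; exact ht), hst, e'])
  set m := (s + t) / 2 with hm
  have hmm : s + t - m = m := by rw [hm]; ring
  have hmI : m ∈ Ioo a b := ⟨by linarith [hs.1, ht.1], by linarith [hs.2, ht.2]⟩
  have hmJ : m ∈ Ioo a b ∩ Ioo (s + t - b) (s + t - a) :=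
    ⟨hmI, by linarith [hmI.2], by linarith [hmI.1]⟩
  have := (heq.eventuallyEq_of_mem (hI.mem_nhds hmJ)).deriv_eq
  rw [hd m (by rw [hmm]; exact hmI), hmm] at this
  exact hγ.deriv_ne hc hmI (self_eq_neg.1 this)

/-- An arc that passes a point twice in the same direction is periodic as far as it is defined. -/
theorem IsTraj.eq_shift (hφ : DifferentiableOn ℂ φ disk) (hc : c ≠ 0) {a b : ℝ} {γ : ℝ → ℂ}
    (hγ : IsTraj φ c (Ioo a b) γ) {s t : ℝ} (hs : s ∈ Ioo a b) (ht : t ∈ Ioo a b)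
    (e : γ s = γ t) (e' : deriv γ s = deriv γ t) {x : ℝ} (hx : x ∈ Ioo a b)
    (hx' : x + (t - s) ∈ Ioo a b) : γ x = γ (x + (t - s)) := by
  have h2 : IsTraj φ c ((fun x => x + (t - s)) ⁻¹' Ioo a b) (fun x => γ (x + (t - s))) :=
    hγ.comp_add (t - s)
  have hpre : ((fun x => x + (t - s)) ⁻¹' Ioo a b) = Ioo (a - (t - s)) (b - (t - s)) := by
    ext x; simp only [mem_preimage, mem_Ioo]; constructor <;> rintro ⟨h, h'⟩ <;> constructor <;> linarith
  have hst : s + (t - s) = t := by ring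
  have hd : deriv (fun x => γ (x + (t - s))) s = deriv γ t := by
    have := ((hγ.hasDerivAt (t := s + (t - s)) (by rw [hst]; exact ht)).comp_add_const s (t - s)).deriv
    rwa [hst] at this
  rw [hpre] at h2
  exact (hγ.mono (J := Ioo a b ∩ Ioo (a - (t - s)) (b - (t - s))) inter_subset_left).eqOn hφ
    (isOpen_Ioo.inter isOpen_Ioo)
    ((convex_Ioo _ _).inter (convex_Ioo _ _)).isPreconnected hc (h2.mono inter_subset_right)
    (t₀ := s) ⟨hs, by constructor <;> linarith [ht.1, ht.2]⟩ (by rw [hst, e]) (by rw [hd, e'])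
    ⟨hx, by constructor <;> linarith [hx'.1, hx'.2]⟩

/-- The direction of a straight arc in a chart. -/
theorem IsChart.exists_dir (h : IsChart φ r Ψ) {a b : ℝ} {γ : ℝ → ℂ}
    (hγ : IsTraj φ c (Ioo a b) γ) {t : ℝ} (ht : t ∈ Ioo a b) {ζ : ℂ} (hζ : ‖ζ‖ < r)
    (e : γ t = Ψ ζ) : ∃ d : ℂ, (d = c ∨ d = -c) ∧ deriv γ t = deriv Ψ ζ * d := by
  have hne := h.deriv_ne hζ
  refine ⟨deriv γ t / deriv Ψ ζ, ?_, by field_simp⟩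
  have h1 := hγ.sq ht
  have h2 := h.flat.sq (mem_ball_zero_iff.2 hζ)
  rw [e] at h1
  apply sq_eq_sq_iff_eq_or_eq_neg.1
  have h3 : φ (Ψ ζ) ≠ 0 := h.flat.ne one_ne_zero (mem_ball_zero_iff.2 hζ)
  rw [div_pow, div_eq_iff (pow_ne_zero 2 hne), ← mul_right_inj' h3]
  linear_combination h1 - c ^ 2 * h2

/-- A double point passed in the same direction could be shifted back to `t₁`, contrary to the
hypothesis; in opposite directions it is impossible anyway. This supplies the simplicity of the
loops to be closed. -/
theorem IsTraj.injOn_of_no_shift (hφ : DifferentiableOn ℂ φ disk) (hc : c ≠ 0) {a b t₁ p q : ℝ}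
    {γ : ℝ → ℂ} (hγ : IsTraj φ c (Ioo a b) γ) (ha : a < t₁) (hp : t₁ ≤ p) (hqb : q < b)
    (hno : ∀ t ∈ Ioc t₁ (t₁ + (q - p)), γ t₁ ≠ γ t) : InjOn γ (Icc p q) := by
  have key : ∀ s ∈ Icc p q, ∀ t ∈ Icc p q, s < t → γ s ≠ γ t := by
    intro s hs t ht hst e
    have hs' : s ∈ Ioo a b := ⟨by linarith [hs.1], by linarith [hs.2]⟩
    have ht' : t ∈ Ioo a b := ⟨by linarith [ht.1], by linarith [ht.2]⟩
    have h1 := hγ.sq hs'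
    have h2 := hγ.sq ht'
    rw [← h2, e] at h1
    rcases sq_eq_sq_iff_eq_or_eq_neg.1 (mul_left_cancel₀ (hγ.ne hc ht') h1) with h3 | h3
    · refine hno (t₁ + (t - s)) ⟨by linarith, by linarith [hs.1, ht.2]⟩
        (hγ.eq_shift hφ hc hs' ht' e h3 ⟨ha, by linarith [hs.1, hs.2]⟩
          ⟨by linarith, by linarith [hs.1, ht.2]⟩)
    · exact hγ.no_reversal hφ hc hs' ht' e h3
  intro s hs t ht e
  rcases lt_trichotomy s t with h | h | h
  · exact absurd e (key s hs t ht h)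
  · exact h
  · exact absurd e.symm (key t ht s hs h)

end TeichDisk
end

/-! ### Closing curves for an arc that returns to a transversal -/

noncomputable section
namespace TeichDisk

variable {φ : ℂ → ℂ} {r : ℝ} {Ψ : ℂ → ℂ} {c : ℂ}

theorem hasDerivAt_add_mul_I {X Y : ℝ → ℝ} {x' y' s : ℝ} (hX : HasDerivAt X x' s)
    (hY : HasDerivAt Y y' s) :
    HasDerivAt (fun s => (X s : ℂ) + Y s * Complex.I) (x' + y' * Complex.I) s :=
  hX.ofReal_comp.add (hY.ofReal_comp.mul_const Complex.I)

theorem abs_interp_lt {u v R x : ℝ} (hu : |u| < R) (hv : |v| < R) (hx : x ∈ Icc (-1) 1) :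
    |(u + v) / 2 + (u - v) / 2 * x| < R := by
  refine lt_of_le_of_lt ?_ (max_lt hu hv)
  have h1 := abs_le.1 (le_max_left |u| |v|)
  have h2 := abs_le.1 (le_max_right |u| |v|)
  have h3 : 0 ≤ 1 + x := by linarith [hx.1]
  have h4 : 0 ≤ 1 - x := by linarith [hx.2]
  rw [abs_le]
  constructor
  · nlinarith [mul_nonneg (sub_nonneg.2 h1.1) h3, mul_nonneg (sub_nonneg.2 h2.1) h4]
  · nlinarith [mul_nonneg (sub_nonneg.2 h1.2) h3, mul_nonneg (sub_nonneg.2 h2.2) h4]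

theorem dlog_sq {g : ℝ → ℂ} {a b : ℝ} (hab : a ≤ b) (hg : ContinuousOn g (Icc a b))
    (h0 : ∀ t ∈ Icc a b, g t ≠ 0) : dlog (fun t => g t ^ 2) a b = 2 * dlog g a b := by
  have : (fun t => g t ^ 2) = fun t => g t * g t := by ext t; ring
  rw [this, dlog_mul hab hg h0 hg h0]; ring

theorem norm_lt_of_re_im {z : ℂ} {x y r : ℝ} (hx : |z.re| ≤ x) (hy : |z.im| < y) (h : x + y ≤ r) :
    ‖z‖ < r :=
  (Complex.norm_le_abs_re_add_abs_im z).trans_lt (by linarith)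

theorem norm_I_mul_lt {u r : ℝ} (h : |u| < r) : ‖(u : ℂ) * Complex.I‖ < r := by simpa using h

/-- The closing curve for an arc which returns in the same direction. -/
theorem IsChart.no_return_same (hφ : DifferentiableOn ℂ φ disk) (h : IsChart φ r Ψ) {a b p q : ℝ}
    {γ : ℝ → ℂ} (hγ : IsTraj φ 1 (Ioo a b) γ) (hap : a < p) (hpq : p < q) (hqb : q < b)
    {ρ u₁ u₂ : ℝ} (hρ : 0 < ρ) (hρr : ρ ≤ r / 8) (hu₁ : |u₁| < r / 4) (hu₂ : |u₂| < r / 4)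
    (e1 : γ q = Ψ ((-ρ : ℝ) + u₂ * Complex.I)) (e1' : deriv γ q = deriv Ψ ((-ρ : ℝ) + u₂ * Complex.I))
    (e2 : γ p = Ψ (ρ + u₁ * Complex.I)) (e2' : deriv γ p = deriv Ψ (ρ + u₁ * Complex.I))
    (γi : InjOn γ (Icc p q))
    (hav : ∀ t ∈ Icc p q, ∀ κ : ℂ, |κ.re| < ρ → |κ.im| < r / 4 → γ t ≠ Ψ κ) : False := by
  -- A graph over `[-ρ, ρ]`: half a period of the sine leads from height `u₂` to height `u₁` with
  -- horizontal tangents at both ends, so that it fits to the arc.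
  set X : ℝ → ℝ := fun s => s - ρ with hX
  set Y : ℝ → ℝ := fun s => (u₁ + u₂) / 2 + (u₁ - u₂) / 2 * Real.sin (Real.pi * (s - ρ) / (2 * ρ))
    with hY
  set Y' : ℝ → ℝ := fun s => (u₁ - u₂) / 2 *
    (Real.cos (Real.pi * (s - ρ) / (2 * ρ)) * (Real.pi / (2 * ρ))) with hY'
  have hYd : ∀ s, HasDerivAt Y (Y' s) s := fun s => by
    have h1 : HasDerivAt (fun s => Real.pi * (s - ρ) / (2 * ρ)) (Real.pi / (2 * ρ)) s := by
      simpa using (((hasDerivAt_id s).sub_const ρ).const_mul Real.pi).div_const (2 * ρ)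
    exact (h1.sin.const_mul ((u₁ - u₂) / 2)).const_add _
  have hXd : ∀ s, HasDerivAt X 1 s := fun s => (hasDerivAt_id s).sub_const ρ
  have hYb : ∀ s, |Y s| < r / 4 := fun s => abs_interp_lt hu₁ hu₂ (Real.sin_mem_Icc _)
  set κ : ℝ → ℂ := fun s => (X s : ℂ) + Y s * Complex.I with hκ
  set κ' : ℝ → ℂ := fun s => ((1 : ℝ) : ℂ) + Y' s * Complex.I with hκ'
  have hre : ∀ s, (κ s).re = X s := fun s => by simp [hκ]
  have him : ∀ s, (κ s).im = Y s := fun s => by simp [hκ]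
  have hre' : ∀ s, (κ' s).re = 1 := fun s => by simp [hκ']
  have hκ'c : Continuous κ' := by
    have : Continuous Y' := by fun_prop
    fun_prop
  have hκ'0 : ∀ s, κ' s ≠ 0 := fun s h0 => by
    have := hre' s
    rw [h0] at this; simp at this
  have hT : 0 < 2 * ρ := by linarith
  have hs0 : Real.pi * (0 - ρ) / (2 * ρ) = -(Real.pi / 2) := by field_simp; ring
  have hs1 : Real.pi * (2 * ρ - ρ) / (2 * ρ) = Real.pi / 2 := by field_simp; ring
  have hκ0 : κ 0 = (-ρ : ℝ) + u₂ * Complex.I := by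
    simp only [hκ, hX, hY, hs0, Real.sin_neg, Real.sin_pi_div_two]; push_cast; ring
  have hκT : κ (2 * ρ) = ρ + u₁ * Complex.I := by
    simp only [hκ, hX, hY, hs1, Real.sin_pi_div_two]; push_cast; ring
  have hκ0' : κ' 0 = 1 := by
    simp only [hκ', hY', hs0, Real.cos_neg, Real.cos_pi_div_two]; simp
  have hκT' : κ' (2 * ρ) = 1 := by
    simp only [hκ', hY', hs1, Real.cos_pi_div_two]; simp
  refine h.no_closing hφ hγ hap hpq hqb hT (fun s _ => hasDerivAt_add_mul_I (hXd s) (hYd s))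
    hκ'c (fun s _ => hκ'0 s) (fun s hs => norm_lt_of_re_im (x := ρ) (y := r / 4) ?_ ?_
      (by linarith [h.pos])) ?_ ?_ ?_ ?_ γi
    ?_ (fun t ht s hs => hav t ht _ ?_ ?_) (k := 0) (by norm_num) ?_
  · change |(κ s).re| ≤ ρ
    rw [hre, abs_le]; constructor <;> linarith [hs.1, hs.2, h.pos]
  · change |(κ s).im| < _
    rw [him]; exact hYb s
  · change _ = Ψ (κ 0); rw [hκ0, e1]
  · change _ = deriv Ψ (κ 0) * κ' 0; rw [hκ0, e1', hκ0', mul_one]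
  · change Ψ (κ (2 * ρ)) = _; rw [hκT, e2]
  · change deriv Ψ (κ (2 * ρ)) * κ' (2 * ρ) = _; rw [hκT, e2', hκT', mul_one]
  · intro s _ t _ e
    have := congrArg Complex.re e
    change (κ s).re = (κ t).re at this
    rw [hre, hre] at this
    linarith
  · change |(κ s).re| < ρ
    rw [hre, abs_lt]; constructor <;> linarith [hs.1, hs.2]
  · change |(κ s).im| < _
    rw [him]; exact hYb s
  · change dlog (fun s => κ' s ^ 2) 0 (2 * ρ) = _
    rw [dlog_sq hT.le hκ'c.continuousOn fun s _ => hκ'0 s,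
      dlog_of_re_pos (k := 1) hT.le hκ'c.continuousOn fun s _ => by rw [one_mul, hre']; norm_num,
      hκ0', hκT']
    simp

/-- The closing curve for an arc which returns in the opposite direction. -/
theorem IsChart.no_return_opposite (hφ : DifferentiableOn ℂ φ disk) (h : IsChart φ r Ψ)
    {a b p q : ℝ} {γ : ℝ → ℂ} (hγ : IsTraj φ 1 (Ioo a b) γ) (hap : a < p) (hpq : p < q)
    (hqb : q < b) {ρ u₁ u₂ : ℝ} (hρ : 0 < ρ) (hρr : ρ ≤ r / 8) (hu₁ : |u₁| < r / 4)
    (hu₂ : |u₂| < r / 4) (hne : u₁ ≠ u₂)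
    (e1 : γ q = Ψ (ρ + u₂ * Complex.I)) (e1' : deriv γ q = -deriv Ψ (ρ + u₂ * Complex.I))
    (e2 : γ p = Ψ (ρ + u₁ * Complex.I)) (e2' : deriv γ p = deriv Ψ (ρ + u₁ * Complex.I))
    (γi : InjOn γ (Icc p q))
    (hav : ∀ t ∈ Icc p q, ∀ κ : ℂ, |κ.re| < ρ → |κ.im| < r / 4 → γ t ≠ Ψ κ) : False := by
  -- Half an ellipse opening to the right: it enters the box at height `u₂` with velocity `-1` and
  -- leaves it at height `u₁` with velocity `1`.
  set X : ℝ → ℝ := fun s => ρ - ρ * Real.sin (s / ρ) with hX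
  set X' : ℝ → ℝ := fun s => -Real.cos (s / ρ) with hX'
  set Y : ℝ → ℝ := fun s => (u₂ + u₁) / 2 + (u₂ - u₁) / 2 * Real.cos (s / ρ) with hY
  set D : ℝ := (u₂ - u₁) / 2 / ρ with hD
  have hD0 : D ≠ 0 := by
    simp only [hD]; exact div_ne_zero (div_ne_zero (sub_ne_zero.2 hne.symm) two_ne_zero) hρ.ne'
  set Y' : ℝ → ℝ := fun s => -(D * Real.sin (s / ρ)) with hY'
  have hdiv : ∀ s, HasDerivAt (fun s => s / ρ) (1 / ρ) s := fun s => (hasDerivAt_id s).div_const ρ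
  have hYd : ∀ s, HasDerivAt Y (Y' s) s := fun s => by
    refine (((hdiv s).cos.const_mul ((u₂ - u₁) / 2)).const_add _).congr_deriv ?_
    simp only [hY', hD]; field_simp
  have hXd : ∀ s, HasDerivAt X (X' s) s := fun s => by
    refine (((hdiv s).sin.const_mul ρ).const_sub ρ).congr_deriv ?_
    simp only [hX']; field_simp
  have hYb : ∀ s, |Y s| < r / 4 := fun s => abs_interp_lt hu₂ hu₁ (Real.cos_mem_Icc _)
  set κ : ℝ → ℂ := fun s => (X s : ℂ) + Y s * Complex.I with hκ
  set κ' : ℝ → ℂ := fun s => (X' s : ℂ) + Y' s * Complex.I with hκ'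
  have hre : ∀ s, (κ s).re = X s := fun s => by simp [hκ]
  have him : ∀ s, (κ s).im = Y s := fun s => by simp [hκ]
  have hre' : ∀ s, (κ' s).re = X' s := fun s => by simp [hκ']
  have him' : ∀ s, (κ' s).im = Y' s := fun s => by simp [hκ']
  have hκ'c : Continuous κ' := by
    have : Continuous Y' := by fun_prop
    have : Continuous X' := by fun_prop
    fun_prop
  have hκ'0 : ∀ s, κ' s ≠ 0 := fun s h0 => by
    have h1 := hre' s
    have h2 := him' s
    rw [h0] at h1 h2
    simp only [Complex.zero_re, Complex.zero_im, hX', hY'] at h1 h2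
    have h3 : Real.sin (s / ρ) = 0 := by
      have : D * Real.sin (s / ρ) = 0 := by linarith
      exact (mul_eq_zero.1 this).resolve_left hD0
    have := Real.sin_sq_add_cos_sq (s / ρ)
    rw [h3, show Real.cos (s / ρ) = 0 by linarith] at this
    norm_num at this
  set T := Real.pi * ρ with hTdef
  have hT : 0 < T := mul_pos Real.pi_pos hρ
  have hTρ : T / ρ = Real.pi := by rw [hTdef]; field_simp
  have hsin : ∀ s ∈ Icc 0 T, 0 ≤ Real.sin (s / ρ) := fun s hs =>
    Real.sin_nonneg_of_nonneg_of_le_pi (div_nonneg hs.1 hρ.le) (by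
      rw [← hTρ]; exact div_le_div_of_nonneg_right hs.2 hρ.le)
  have hκ0 : κ 0 = ρ + u₂ * Complex.I := by
    simp only [hκ, hX, hY, zero_div, Real.sin_zero, Real.cos_zero]; push_cast; ring
  have hκT : κ T = ρ + u₁ * Complex.I := by
    simp only [hκ, hX, hY, hTρ, Real.sin_pi, Real.cos_pi]; push_cast; ring
  have hκ0' : κ' 0 = -1 := by
    simp [hκ', hX', hY']
  have hκT' : κ' T = 1 := by
    simp only [hκ', hX', hY', hTρ, Real.sin_pi, Real.cos_pi]; simp
  have hdl : ∀ k : ℂ, (∀ s ∈ Icc 0 T, k * κ' s ∈ Complex.slitPlane) →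
      dlog (fun s => κ' s ^ 2) 0 T = 2 * (Complex.log k - Complex.log (-k)) := fun k hk => by
    have hk0 : k ≠ 0 := fun h0 => by
      have := hk 0 ⟨le_rfl, hT.le⟩
      rw [h0, zero_mul] at this
      exact Complex.slitPlane_ne_zero this rfl
    rw [dlog_sq hT.le hκ'c.continuousOn fun s _ => hκ'0 s,
      ← dlog_const_mul hk0 hT.le hκ'c.continuousOn fun s _ => hκ'0 s,
      dlog_of_slitPlane hT.le (by fun_prop) hk, hκT', hκ0']
    simp
  -- Rotation by `± i`, with the sign of `D`, moves the half turn of the velocity off the negative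
  -- real axis.
  have hslit : ∀ σ : ℝ, (σ = 1 ∨ σ = -1) → 0 < σ * D → ∀ s ∈ Icc 0 T,
      (σ * Complex.I) * κ' s ∈ Complex.slitPlane := fun σ hσ hσD s hs => by
    rw [Complex.mem_slitPlane_iff]
    have h1 : ((σ * Complex.I) * κ' s).re = σ * D * Real.sin (s / ρ) := by
      rw [Complex.mul_re]; simp [hre', him', hY']; ring
    have h2 : ((σ * Complex.I) * κ' s).im = - σ * Real.cos (s / ρ) := by
      rw [Complex.mul_im]; simp [hre', him', hX']
    rw [h1, h2]
    rcases (hsin s hs).eq_or_lt with h3 | h3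
    · right
      have h4 := Real.sin_sq_add_cos_sq (s / ρ)
      rw [← h3] at h4
      intro h5
      have h6 : σ ≠ 0 := by rcases hσ with h | h <;> rw [h] <;> norm_num
      have h7 : Real.cos (s / ρ) = 0 := by
        rcases mul_eq_zero.1 h5 with h | h
        · exact absurd (neg_eq_zero.1 h) h6
        · exact h
      rw [h7] at h4; norm_num at h4
    · left; positivity
  have main : ∀ k : ℤ, |k| ≤ 1 → dlog (fun s => κ' s ^ 2) 0 T ≠ k * (2 * Real.pi * Complex.I) := by
    intro k hk hdlog
    refine h.no_closing hφ hγ hap hpq hqb hT (fun s _ => hasDerivAt_add_mul_I (hXd s) (hYd s))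
      hκ'c (fun s _ => hκ'0 s) (fun s hs => norm_lt_of_re_im (x := ρ) (y := r / 4) ?_ ?_
        (by linarith [h.pos])) ?_ ?_ ?_ ?_ γi
      ?_ (fun t ht s hs => hav t ht _ ?_ ?_) (k := k) hk hdlog
    · change |(κ s).re| ≤ ρ
      rw [hre, abs_le]
      have := hsin s hs
      have := Real.sin_le_one (s / ρ)
      constructor <;> simp only [hX] <;> nlinarith
    · change |(κ s).im| < _
      rw [him]; exact hYb s
    · change _ = Ψ (κ 0); rw [hκ0, e1]
    · change _ = deriv Ψ (κ 0) * κ' 0; rw [hκ0, e1', hκ0', mul_neg_one]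
    · change Ψ (κ T) = _; rw [hκT, e2]
    · change deriv Ψ (κ T) * κ' T = _; rw [hκT, e2', hκT', mul_one]
    · intro s hs t ht e
      have := congrArg Complex.im e
      change (κ s).im = (κ t).im at this
      rw [him, him] at this
      have h2 : (u₂ - u₁) / 2 ≠ 0 := div_ne_zero (sub_ne_zero.2 hne.symm) two_ne_zero
      have h3 : Real.cos (s / ρ) = Real.cos (t / ρ) := by
        simp only [hY] at this
        exact mul_left_cancel₀ h2 (by linarith)
      have hm : ∀ s ∈ Icc 0 T, s / ρ ∈ Icc 0 Real.pi := fun s hs =>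
        ⟨div_nonneg hs.1 hρ.le, by rw [← hTρ]; exact div_le_div_of_nonneg_right hs.2 hρ.le⟩
      have := Real.injOn_cos (hm s hs) (hm t ht) h3
      exact (div_left_inj' hρ.ne').1 this
    · change |(κ s).re| < ρ
      rw [hre, abs_lt]
      have h3 : 0 < Real.sin (s / ρ) := Real.sin_pos_of_pos_of_lt_pi (div_pos hs.1 hρ) (by
        rw [← hTρ]; exact div_lt_div_of_pos_right hs.2 hρ)
      have := Real.sin_le_one (s / ρ)
      constructor <;> simp only [hX] <;> nlinarith
    · change |(κ s).im| < _
      rw [him]; exact hYb s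
  -- The velocity makes half a turn, hence its square makes one full turn, with sign depending on
  -- which end is higher.
  rcases hD0.lt_or_gt with hneg | hpos
  · refine main (-1) (by norm_num) ?_
    rw [hdl _ (hslit (-1) (Or.inr rfl) (by linarith))]
    have : ((-1 : ℝ) : ℂ) * Complex.I = -Complex.I := by push_cast; ring
    rw [this, neg_neg, Complex.log_I, Complex.log_neg_I]
    push_cast; ring
  · refine main 1 (by norm_num) ?_
    rw [hdl _ (hslit 1 (Or.inl rfl) (by linarith))]
    have : ((1 : ℝ) : ℂ) * Complex.I = Complex.I := by push_cast; ring
    rw [this, Complex.log_I, Complex.log_neg_I]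
    push_cast; ring

end TeichDisk
end

/-! ### Straight arcs cross a short transversal at most once -/

noncomputable section
namespace TeichDisk

variable {φ : ℂ → ℂ} {r : ℝ} {Ψ : ℂ → ℂ} {c : ℂ}

theorem norm_re_add_I_mul_lt {x u r : ℝ} (hx : |x| ≤ r / 2) (hu : |u| < r / 4) (hr : 0 < r) :
    ‖(x : ℂ) + u * Complex.I‖ < r :=
  norm_lt_of_re_im (x := r / 2) (y := r / 4) (by simpa using hx) (by simpa using hu) (by linarith)

/-- A unit speed arc which crosses the transversal is horizontal near the crossing. -/
theorem IsChart.hit_eq (hφ : DifferentiableOn ℂ φ disk) (h : IsChart φ r Ψ) {a b : ℝ}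
    {γ : ℝ → ℂ} (hγ : IsTraj φ 1 (Ioo a b) γ) {t : ℝ} (ht : t ∈ Ioo a b) {u : ℝ} (hu : |u| < r / 4)
    (e : γ t = Ψ (u * Complex.I)) : ∃ ε : ℝ, (ε = 1 ∨ ε = -1) ∧
      ∀ s ∈ Ioo a b, |s - t| ≤ r / 2 → γ s = Ψ ((ε * (s - t) : ℝ) + u * Complex.I) ∧
        deriv γ s = deriv Ψ ((ε * (s - t) : ℝ) + u * Complex.I) * ε := by
  have hr := h.pos
  have hn : ‖(u : ℂ) * Complex.I‖ < r := norm_I_mul_lt (by linarith)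
  obtain ⟨d, hd, e'⟩ := h.exists_dir hγ ht hn e
  have hex : ∃ ε : ℝ, (ε = 1 ∨ ε = -1) ∧ (ε : ℂ) = d := by
    rcases hd with hd | hd
    · exact ⟨1, Or.inl rfl, by rw [hd]; norm_num⟩
    · exact ⟨-1, Or.inr rfl, by rw [hd]; norm_num⟩
  obtain ⟨ε, hε, hεd⟩ := hex
  rw [← hεd] at e'
  refine ⟨ε, hε, fun s hs hst => ?_⟩
  have heq : (u : ℂ) * Complex.I + ε * (s - t) = (ε * (s - t) : ℝ) + u * Complex.I := by
    push_cast; ring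
  rw [← heq]
  refine h.traj_eq hφ one_ne_zero hγ ht hn e e' hs ?_
  rw [heq]
  refine norm_re_add_I_mul_lt ?_ hu hr
  rw [abs_mul]
  rcases hε with h1 | h1 <;> rw [h1] <;> simpa using hst

/-- Within time `r / 2` of a crossing the arc is a horizontal segment of the chart, and away from
the crossing that segment has nonzero real part. -/
theorem IsChart.hit_separated (hφ : DifferentiableOn ℂ φ disk) (h : IsChart φ r Ψ) {a b : ℝ}
    {γ : ℝ → ℂ} (hγ : IsTraj φ 1 (Ioo a b) γ) {s t : ℝ} (hs : s ∈ Ioo a b) (ht : t ∈ Ioo a b)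
    {u v : ℝ} (hu : |u| < r / 4) (hv : |v| < r / 4) (e : γ s = Ψ (u * Complex.I))
    (e' : γ t = Ψ (v * Complex.I)) (hne : s ≠ t) : r / 2 < |s - t| := by
  by_contra hle
  rw [not_lt] at hle
  obtain ⟨ε, hε, hl⟩ := h.hit_eq hφ hγ ht hv e'
  have hr := h.pos
  have h1 := h.inj (norm_I_mul_lt (by linarith)) (norm_re_add_I_mul_lt (by
    rw [abs_mul]; rcases hε with h1 | h1 <;> rw [h1] <;> simpa using hle) hv hr)
    (e.symm.trans (hl s hs hle).1)
  have h2 := congrArg Complex.re h1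
  simp only [Complex.add_re, Complex.re_ofReal_mul, Complex.I_re, Complex.ofReal_re, mul_zero,
    add_zero] at h2
  rcases hε with h3 | h3 <;> rw [h3] at h2
  · exact hne (by linarith)
  · exact hne (by linarith)

/-- No two consecutive crossings, the first one in the positive direction. -/
theorem IsChart.no_consecutive (hφ : DifferentiableOn ℂ φ disk) (h : IsChart φ r Ψ) {a b : ℝ}
    {γ : ℝ → ℂ} (hγ : IsTraj φ 1 (Ioo a b) γ) {t₁ t₂ : ℝ} (h1 : t₁ ∈ Ioo a b) (h2 : t₂ ∈ Ioo a b)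
    (hlt : t₁ < t₂) {u₁ u₂ : ℝ} (hu₁ : |u₁| < r / 4) (hu₂ : |u₂| < r / 4)
    (e1 : γ t₁ = Ψ (u₁ * Complex.I)) (e1' : deriv γ t₁ = deriv Ψ (u₁ * Complex.I))
    (e2 : γ t₂ = Ψ (u₂ * Complex.I))
    (hno : ∀ t ∈ Ioo t₁ t₂, ∀ u : ℝ, |u| < r / 4 → γ t ≠ Ψ (u * Complex.I)) : False := by
  have hr := h.pos
  have hsep := h.hit_separated hφ hγ h1 h2 hu₁ hu₂ e1 e2 hlt.ne
  rw [abs_sub_comm, abs_of_pos (sub_pos.2 hlt)] at hsep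
  obtain ⟨ε₁, hε₁, l1⟩ := h.hit_eq hφ hγ h1 hu₁ e1
  obtain ⟨ε₂, hε₂, l2⟩ := h.hit_eq hφ hγ h2 hu₂ e2
  have hε₁' : ε₁ = 1 := by
    have := (l1 t₁ h1 (by simp; positivity)).2
    rw [e1'] at this
    simp only [sub_self, mul_zero, Complex.ofReal_zero, zero_add] at this
    have h3 := h.deriv_ne (norm_I_mul_lt (u := u₁) (r := r) (by linarith))
    have h4 : (1 : ℂ) = ε₁ := mul_left_cancel₀ h3 (by rw [mul_one]; exact this)
    exact_mod_cast h4.symm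
  -- The arc is cut off at distance `r / 8` from the transversal, after the first crossing and
  -- before the second; the closing curve occupies the box of half width `r / 8`.
  set p := t₁ + r / 8 with hp
  set q := t₂ - r / 8 with hq
  have hpq : p < q := by linarith
  have hpm : p ∈ Ioo a b := ⟨by linarith [h1.1], by linarith [h2.2]⟩
  have hqm : q ∈ Ioo a b := ⟨by linarith [h1.1], by linarith [h2.2]⟩
  have lp := l1 p hpm (by rw [hp, add_sub_cancel_left, abs_of_pos] <;> linarith)
  have lq := l2 q hqm (by
    rw [hq, show t₂ - r / 8 - t₂ = -(r / 8) by ring, abs_neg, abs_of_pos] <;> linarith)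
  have hpe : ε₁ * (p - t₁) = r / 8 := by rw [hε₁', hp]; ring
  have hqe : ε₂ * (q - t₂) = -(ε₂ * (r / 8)) := by rw [hq]; ring
  rw [hpe, hε₁', Complex.ofReal_one, mul_one] at lp
  rw [hqe] at lq
  have γi : InjOn γ (Icc p q) := hγ.injOn_of_no_shift hφ one_ne_zero h1.1 (t₁ := t₁)
    (by linarith) (by linarith [h2.2]) fun t ht e => hno t ⟨ht.1, by linarith [ht.2]⟩ u₁ hu₁
      (e.symm.trans e1)
  -- From a point of the box the arc would run horizontally onto the transversal at a time strictly
  -- between the two consecutive crossings.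
  have hav : ∀ t ∈ Icc p q, ∀ κ : ℂ, |κ.re| < r / 8 → |κ.im| < r / 4 → γ t ≠ Ψ κ := by
    intro t ht κ hκ hκ' e
    have htm : t ∈ Ioo a b := ⟨by linarith [ht.1, h1.1], by linarith [ht.2, h2.2]⟩
    have hκn : ‖κ‖ < r := norm_lt_of_re_im (x := r / 2) (y := r / 4) (by linarith) hκ' (by linarith)
    obtain ⟨d, hd, e'⟩ := h.exists_dir hγ htm hκn e
    have hex : ∃ ε : ℝ, (ε = 1 ∨ ε = -1) ∧ (ε : ℂ) = d := by
      rcases hd with hd | hd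
      · exact ⟨1, Or.inl rfl, by rw [hd]; norm_num⟩
      · exact ⟨-1, Or.inr rfl, by rw [hd]; norm_num⟩
    obtain ⟨ε, hε, hεd⟩ := hex
    set s := t - ε * κ.re with hs
    have hst : |ε * κ.re| < r / 8 := by
      rw [abs_mul]; rcases hε with h1 | h1 <;> rw [h1] <;> simpa using hκ
    rw [abs_lt] at hst
    have hsI : s ∈ Ioo t₁ t₂ := ⟨by linarith [ht.1, hst.2], by linarith [ht.2, hst.1]⟩
    have heq : κ + d * (s - t) = (κ.im : ℂ) * Complex.I := by
      have h5 : (ε : ℂ) * ε = 1 := by rcases hε with h1 | h1 <;> rw [h1] <;> norm_num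
      rw [← hεd, hs]
      push_cast
      linear_combination Complex.re_add_im κ * (-1) - (κ.re : ℂ) * h5
    refine hno s hsI κ.im hκ' ?_
    rw [← heq]
    refine (h.traj_eq hφ one_ne_zero hγ htm hκn e e' ⟨by linarith [hsI.1, h1.1],
      by linarith [hsI.2, h2.2]⟩ ?_).1
    rw [heq]; exact norm_I_mul_lt (by linarith)
  -- The second crossing goes either in the same direction as the first or in the opposite one; each
  -- case has its own closing curve.
  rcases hε₂ with h3 | h3
  · rw [h3, one_mul, Complex.ofReal_one, mul_one] at lq
    exact h.no_return_same hφ hγ hpm.1 hpq hqm.2 (ρ := r / 8) (by positivity) le_rfl hu₁ hu₂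
      lq.1 lq.2 lp.1 lp.2 γi hav
  · rw [h3] at lq
    have h4 : -(-1 * (r / 8)) = r / 8 := by ring
    rw [h4] at lq
    refine h.no_return_opposite hφ hγ hpm.1 hpq hqm.2 (ρ := r / 8) (by positivity) le_rfl hu₁ hu₂ ?_
      lq.1 ?_ lp.1 lp.2 γi hav
    · intro hu
      refine hγ.no_reversal hφ one_ne_zero h1 h2 (e1.trans (by rw [e2, hu])) ?_
      have := (l2 t₂ h2 (by simp; positivity)).2
      rw [this, h3, e1', hu]
      simp
    · rw [lq.2]; push_cast; ring

/-- Crossings are more than `r / 2` apart, so induction on the elapsed time in units of `r / 2`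
reduces to consecutive crossings. If the first one goes in the negative direction, the chart is
rotated by a half turn. -/
theorem IsChart.hit_unique_of_lt (hφ : DifferentiableOn ℂ φ disk) (h : IsChart φ r Ψ) {a b : ℝ}
    {γ : ℝ → ℂ} (hγ : IsTraj φ 1 (Ioo a b) γ) (n : ℕ) : ∀ {t₁ t₂ : ℝ}, t₁ ∈ Ioo a b →
    t₂ ∈ Ioo a b → t₁ < t₂ → ∀ {u₁ u₂ : ℝ}, |u₁| < r / 4 → |u₂| < r / 4 →
    γ t₁ = Ψ (u₁ * Complex.I) → γ t₂ = Ψ (u₂ * Complex.I) → t₂ - t₁ < (n + 1) * (r / 2) → False := by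
  have hr := h.pos
  induction n with
  | zero =>
    intro t₁ t₂ h1 h2 hlt u₁ u₂ hu₁ hu₂ e1 e2 hn
    have hsep := h.hit_separated hφ hγ h1 h2 hu₁ hu₂ e1 e2 hlt.ne
    rw [abs_sub_comm, abs_of_pos (sub_pos.2 hlt)] at hsep
    simp only [Nat.cast_zero] at hn
    linarith
  | succ n ih =>
    intro t₁ t₂ h1 h2 hlt u₁ u₂ hu₁ hu₂ e1 e2 hn
    have hno : ∀ t ∈ Ioo t₁ t₂, ∀ u : ℝ, |u| < r / 4 → γ t ≠ Ψ (u * Complex.I) := by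
      intro t ht u hu e
      have htm : t ∈ Ioo a b := ⟨by linarith [ht.1, h1.1], by linarith [ht.2, h2.2]⟩
      have hsep := h.hit_separated hφ hγ htm h2 hu hu₂ e e2 ht.2.ne
      rw [abs_sub_comm, abs_of_pos (sub_pos.2 ht.2)] at hsep
      refine ih h1 htm ht.1 hu₁ hu e1 e ?_
      push_cast at hn
      linarith
    obtain ⟨ε₁, hε₁, l1⟩ := h.hit_eq hφ hγ h1 hu₁ e1
    have l := (l1 t₁ h1 (by simp; positivity)).2
    simp only [sub_self, mul_zero, Complex.ofReal_zero, zero_add] at l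
    rcases hε₁ with h3 | h3
    · exact h.no_consecutive hφ hγ h1 h2 hlt hu₁ hu₂ e1 (by rw [l, h3]; simp) e2 hno
    · have hneg : ∀ u : ℝ, -(((-u : ℝ) : ℂ) * Complex.I) = u * Complex.I := fun u => by
        push_cast; ring
      refine h.neg.no_consecutive hφ hγ h1 h2 hlt (u₁ := -u₁) (u₂ := -u₂) (by rwa [abs_neg])
        (by rwa [abs_neg]) ?_ ?_ ?_ fun t ht u hu => ?_
      · simp only [hneg]; exact e1
      · rw [h.deriv_neg (norm_I_mul_lt (by rw [abs_neg]; linarith)), hneg, l, h3]; simp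
      · simp only [hneg]; exact e2
      · have := hno t ht (-u) (by rwa [abs_neg])
        simpa using this

/-- A horizontal arc crosses a short transversal at most once. -/
theorem IsChart.hit_unique (hφ : DifferentiableOn ℂ φ disk) (h : IsChart φ r Ψ) {a b : ℝ}
    {γ : ℝ → ℂ} (hγ : IsTraj φ 1 (Ioo a b) γ) {t₁ t₂ : ℝ} (h1 : t₁ ∈ Ioo a b) (h2 : t₂ ∈ Ioo a b)
    {u₁ u₂ : ℝ} (hu₁ : |u₁| < r / 4) (hu₂ : |u₂| < r / 4) (e1 : γ t₁ = Ψ (u₁ * Complex.I))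
    (e2 : γ t₂ = Ψ (u₂ * Complex.I)) : t₁ = t₂ := by
  have hr := h.pos
  have key : ∀ x y : ℝ, ∃ n : ℕ, y - x < (n + 1) * (r / 2) := fun x y => by
    obtain ⟨n, hn⟩ := exists_nat_gt ((y - x) / (r / 2))
    refine ⟨n, ?_⟩
    rw [div_lt_iff₀ (by positivity)] at hn
    linarith
  rcases lt_trichotomy t₁ t₂ with hlt | he | hlt
  · obtain ⟨n, hn⟩ := key t₁ t₂
    exact (h.hit_unique_of_lt hφ hγ n h1 h2 hlt hu₁ hu₂ e1 e2 hn).elim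
  · exact he
  · obtain ⟨n, hn⟩ := key t₂ t₁
    exact (h.hit_unique_of_lt hφ hγ n h2 h1 hlt hu₂ hu₁ e2 e1 hn).elim

/-- Inside a small chart all parts of a unit speed arc belong to one horizontal segment. -/
theorem IsChart.no_return_one (hφ : DifferentiableOn ℂ φ disk) (h : IsChart φ r Ψ) {a b : ℝ}
    {γ : ℝ → ℂ} (hγ : IsTraj φ 1 (Ioo a b) γ) {x₀ x₁ : ℝ} (h0 : x₀ ∈ Ioo a b) (h1 : x₁ ∈ Ioo a b)
    {ζ₀ ζ₁ d : ℂ} (hζ₀ : ‖ζ₀‖ < r / 4) (hζ₁ : ‖ζ₁‖ < r / 4) (e0 : γ x₀ = Ψ ζ₀) (e1 : γ x₁ = Ψ ζ₁)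
    (e0' : deriv γ x₀ = deriv Ψ ζ₀ * d) : ζ₁ = ζ₀ + d * (x₁ - x₀) := by
  have hr := h.pos
  have hline : ∀ ζ d : ℂ, ‖ζ‖ < r / 4 → d ^ 2 = 1 → ∀ x : ℝ,
      IsTraj φ 1 (Ioo (x - r / 2) (x + r / 2)) (fun t : ℝ => Ψ ((ζ - d * x) + d * t)) ∧
      ∀ t ∈ Ioo (x - r / 2) (x + r / 2), ‖(ζ - d * x) + d * t‖ < r := by
    intro ζ d hζ hd x
    have hdn : ‖d‖ = 1 := by
      have := congrArg norm hd
      rw [norm_pow, norm_one] at this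
      exact (pow_eq_one_iff_of_nonneg (norm_nonneg d) two_ne_zero).1 this
    have hb : ∀ t ∈ Ioo (x - r / 2) (x + r / 2), ‖(ζ - d * x) + d * t‖ < r := fun t ht => by
      rw [show (ζ - d * x) + d * t = ζ + d * ((t - x : ℝ) : ℂ) by push_cast; ring]
      refine (norm_add_le _ _).trans_lt ?_
      rw [norm_mul, hdn, one_mul, Complex.norm_real, Real.norm_eq_abs]
      have : |t - x| < r / 2 := abs_lt.2 ⟨by linarith [ht.1], by linarith [ht.2]⟩
      linarith
    refine ⟨?_, hb⟩
    exact ((h.flat.line (ζ - d * x) d).mono fun t ht => mem_ball_zero_iff.2 (hb t ht)).congr_sq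
      (by rw [one_mul, hd, one_pow])
  obtain ⟨d', hd', e0''⟩ := h.exists_dir hγ h0 (by linarith) e0
  obtain ⟨d₁, hd₁, e1'⟩ := h.exists_dir hγ h1 (by linarith) e1
  have hdd : d' = d := mul_left_cancel₀ (h.deriv_ne (by linarith)) (e0''.symm.trans e0')
  rw [hdd] at hd'
  have hreal : ∀ d : ℂ, d = 1 ∨ d = -1 → ∃ ε : ℝ, (ε = 1 ∨ ε = -1) ∧ d = ε := fun d hd => by
    rcases hd with hd | hd
    · exact ⟨1, Or.inl rfl, by rw [hd]; norm_num⟩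
    · exact ⟨-1, Or.inr rfl, by rw [hd]; norm_num⟩
  obtain ⟨ε, hε, rfl⟩ := hreal d hd'
  obtain ⟨ε₁, hε₁, rfl⟩ := hreal d₁ hd₁
  have hsq : ∀ ε : ℝ, ε = 1 ∨ ε = -1 → (ε : ℂ) ^ 2 = 1 := fun ε hε => by
    rcases hε with h1 | h1 <;> rw [h1] <;> norm_num
  -- extend the arc by the segments of the chart at both points
  obtain ⟨l0, l0b⟩ := hline ζ₀ ε hζ₀ (hsq ε hε) x₀
  obtain ⟨l1, l1b⟩ := hline ζ₁ ε₁ hζ₁ (hsq ε₁ hε₁) x₁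
  have m0 : x₀ ∈ Ioo (x₀ - r / 2) (x₀ + r / 2) := ⟨by linarith, by linarith⟩
  have m1 : x₁ ∈ Ioo (x₁ - r / 2) (x₁ + r / 2) := ⟨by linarith, by linarith⟩
  obtain ⟨γ₁, g1, g1e, g1e'⟩ := hγ.exists_union hφ one_ne_zero l0 h0 m0 (by simp [e0]) (by
    rw [(h.flat.hasDerivAt_line _ _ (mem_ball_zero_iff.2 (l0b x₀ m0))).deriv, e0']; simp)
  have h1' : x₁ ∈ Ioo (min a (x₀ - r / 2)) (max b (x₀ + r / 2)) :=
    ⟨min_lt_of_left_lt h1.1, lt_max_of_lt_left h1.2⟩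
  obtain ⟨γ₂, g2, g2e, g2e'⟩ := g1.exists_union hφ one_ne_zero l1 h1' m1
    (by rw [g1e h1]; simp [e1]) (by
      rw [(g1e.eventuallyEq_of_mem (isOpen_Ioo.mem_nhds h1)).deriv_eq,
        (h.flat.hasDerivAt_line _ _ (mem_ball_zero_iff.2 (l1b x₁ m1))).deriv, e1']; simp)
  have him : ∀ ζ : ℂ, ‖ζ‖ < r / 4 → |ζ.im| < r / 4 := fun ζ h => (Complex.abs_im_le_norm ζ).trans_lt h
  have hre : ∀ ζ : ℂ, ‖ζ‖ < r / 4 → |ζ.re| < r / 4 := fun ζ h => (Complex.abs_re_le_norm ζ).trans_lt h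
  have hεabs : ∀ ε : ℝ, ε = 1 ∨ ε = -1 → ∀ ζ : ℂ, ‖ζ‖ < r / 4 → |ε * ζ.re| < r / 4 := by
    intro ε hε ζ hζ
    rw [abs_mul]; rcases hε with h1 | h1 <;> rw [h1] <;> simpa using hre ζ hζ
  have hhit : ∀ ε : ℝ, ε = 1 ∨ ε = -1 → ∀ (ζ : ℂ) (x : ℝ),
      (ζ - ε * x) + ε * ((x - ε * ζ.re : ℝ) : ℂ) = ζ.im * Complex.I := by
    intro ε hε ζ x
    have := hsq ε hε
    push_cast
    linear_combination Complex.re_add_im ζ * (-1) - (ζ.re : ℂ) * this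
  have a0 := abs_lt.1 (hεabs ε hε ζ₀ hζ₀)
  have a1 := abs_lt.1 (hεabs ε₁ hε₁ ζ₁ hζ₁)
  have t0m : x₀ - ε * ζ₀.re ∈ Ioo (x₀ - r / 2) (x₀ + r / 2) := ⟨by linarith, by linarith⟩
  have t1m : x₁ - ε₁ * ζ₁.re ∈ Ioo (x₁ - r / 2) (x₁ + r / 2) := ⟨by linarith, by linarith⟩
  have sub1 : Ioo (x₀ - r / 2) (x₀ + r / 2) ⊆ Ioo (min a (x₀ - r / 2)) (max b (x₀ + r / 2)) :=
    fun t ht => ⟨min_lt_of_right_lt ht.1, lt_max_of_lt_right ht.2⟩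
  have sub2 : Ioo (min a (x₀ - r / 2)) (max b (x₀ + r / 2)) ⊆
      Ioo (min (min a (x₀ - r / 2)) (x₁ - r / 2)) (max (max b (x₀ + r / 2)) (x₁ + r / 2)) :=
    fun t ht => ⟨min_lt_of_left_lt ht.1, lt_max_of_lt_left ht.2⟩
  have sub3 : Ioo (x₁ - r / 2) (x₁ + r / 2) ⊆
      Ioo (min (min a (x₀ - r / 2)) (x₁ - r / 2)) (max (max b (x₀ + r / 2)) (x₁ + r / 2)) :=
    fun t ht => ⟨min_lt_of_right_lt ht.1, lt_max_of_lt_right ht.2⟩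
  have hv0 : γ₂ (x₀ - ε * ζ₀.re) = Ψ (ζ₀.im * Complex.I) := by
    rw [g2e (sub1 t0m), g1e' t0m, ← hhit ε hε ζ₀ x₀]
  have hv1 : γ₂ (x₁ - ε₁ * ζ₁.re) = Ψ (ζ₁.im * Complex.I) := by
    rw [g2e' t1m, ← hhit ε₁ hε₁ ζ₁ x₁]
  -- Both points are slid horizontally to the transversal along the extended arc. Only one crossing
  -- is possible, so the two segments of the chart coincide.
  have ht := h.hit_unique hφ g2 (sub2 (sub1 t0m)) (sub3 t1m) (him _ hζ₀) (him _ hζ₁) hv0 hv1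
  have n0 : ‖(ζ₀.im : ℂ) * Complex.I‖ < r := norm_I_mul_lt (by linarith [him _ hζ₀])
  have n1 : ‖(ζ₁.im : ℂ) * Complex.I‖ < r := norm_I_mul_lt (by linarith [him _ hζ₁])
  have hI : (ζ₀.im : ℂ) * Complex.I = ζ₁.im * Complex.I := h.inj n0 n1 (by rw [← hv0, ht, hv1])
  have d0 : deriv γ₂ (x₀ - ε * ζ₀.re) = deriv Ψ (ζ₀.im * Complex.I) * ε := by
    have : γ₂ =ᶠ[𝓝 (x₀ - ε * ζ₀.re)] fun t : ℝ => Ψ ((ζ₀ - ε * x₀) + ε * t) := by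
      filter_upwards [isOpen_Ioo.mem_nhds t0m] with t ht
      rw [g2e (sub1 ht), g1e' ht]
    rw [this.deriv_eq, (h.flat.hasDerivAt_line _ _ (mem_ball_zero_iff.2 (l0b _ t0m))).deriv,
      hhit ε hε ζ₀ x₀]
  have d1 : deriv γ₂ (x₁ - ε₁ * ζ₁.re) = deriv Ψ (ζ₁.im * Complex.I) * ε₁ := by
    rw [(g2e'.eventuallyEq_of_mem (isOpen_Ioo.mem_nhds t1m)).deriv_eq,
      (h.flat.hasDerivAt_line _ _ (mem_ball_zero_iff.2 (l1b _ t1m))).deriv,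
      hhit ε₁ hε₁ ζ₁ x₁]
  have hee : (ε : ℂ) = ε₁ := by
    refine mul_left_cancel₀ (h.deriv_ne n0) ?_
    rw [← d0, ht, d1, hI]
  have hee' : ε = ε₁ := by exact_mod_cast hee
  rw [← hee'] at ht
  have ht' : ((x₀ - ε * ζ₀.re : ℝ) : ℂ) = ((x₁ - ε * ζ₁.re : ℝ) : ℂ) := by rw [ht]
  push_cast at ht'
  have := hsq ε hε
  linear_combination (-1) * Complex.re_add_im ζ₁ + Complex.re_add_im ζ₀ - hI + ε * ht' +
    (ζ₀.re - ζ₁.re) * this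

/-- A straight arc never comes back to a small chart. -/
theorem IsChart.no_return (hφ : DifferentiableOn ℂ φ disk) (h : IsChart φ r Ψ) (hc : c ≠ 0)
    {a b : ℝ} {γ : ℝ → ℂ} (hγ : IsTraj φ c (Ioo a b) γ) {x₀ x₁ : ℝ} (h0 : x₀ ∈ Ioo a b)
    (h1 : x₁ ∈ Ioo a b) {ζ₀ ζ₁ d : ℂ} (hζ₀ : ‖ζ₀‖ < r / 4) (hζ₁ : ‖ζ₁‖ < r / 4) (e0 : γ x₀ = Ψ ζ₀)
    (e1 : γ x₁ = Ψ ζ₁) (e0' : deriv γ x₀ = deriv Ψ ζ₀ * d) : ζ₁ = ζ₀ + d * (x₁ - x₀) := by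
  have hcn : 0 < ‖c‖ := norm_pos_iff.2 hc
  -- With respect to `φ / c²` the arc is horizontal with unit speed, and the chart `ζ ↦ Ψ (c ζ)` has
  -- radius `r / ‖c‖`.
  have hγ' : IsTraj (fun z => φ z / c ^ 2) 1 (Ioo a b) γ := fun t ht => by
    obtain ⟨p1, v, p2, p3⟩ := hγ t ht
    refine ⟨p1, v, p2, ?_⟩
    rw [div_mul_eq_mul_div, p3, div_self (pow_ne_zero 2 hc), one_pow]
  have hn : ∀ ζ : ℂ, ‖ζ‖ < r / 4 → ‖ζ / c‖ < r / ‖c‖ / 4 := fun ζ hζ => by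
    rw [norm_div, div_right_comm]; exact div_lt_div_of_pos_right hζ hcn
  have hd : deriv (fun ζ => Ψ (c * ζ)) (ζ₀ / c) = deriv Ψ ζ₀ * c := by
    have := (h.flat.hasDerivAt_affine 0 c (ζ := ζ₀ / c) (by
      rw [zero_add, mul_div_cancel₀ _ hc, mem_ball_zero_iff]; linarith [h.pos])).deriv
    simpa [mul_div_cancel₀ _ hc] using this
  have := (h.comp_mul hc).no_return_one (hφ.div_const _) hγ' h0 h1 (hn _ hζ₀) (hn _ hζ₁)
    (d := d / c) (by rw [mul_div_cancel₀ _ hc, e0]) (by rw [mul_div_cancel₀ _ hc, e1])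
    (by rw [hd, e0']; field_simp)
  field_simp at this
  linear_combination this

end TeichDisk
end

noncomputable section
namespace TeichDisk

/-! ### The flow of straight arcs through a transversal -/

variable {φ : ℂ → ℂ} {r : ℝ} {Ψ : ℂ → ℂ} {c : ℂ}

theorem preimage_dir_Ioo {ε : ℝ} (hε : ε = 1 ∨ ε = -1) (x x' a b : ℝ) (hx : x' ∈ Ioo a b) :
    ∃ a' b' : ℝ, x ∈ Ioo a' b' ∧ ∀ t, t ∈ Ioo a' b' ↔ x' + ε * (t - x) ∈ Ioo a b := by
  rcases hε with rfl | rfl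
  · refine ⟨a - x' + x, b - x' + x, ⟨by linarith [hx.1], by linarith [hx.2]⟩, fun t => ?_⟩
    constructor <;> rintro ⟨h1, h2⟩ <;> constructor <;> linarith
  · refine ⟨x' + x - b, x' + x - a, ⟨by linarith [hx.2], by linarith [hx.1]⟩, fun t => ?_⟩
    constructor <;> rintro ⟨h1, h2⟩ <;> constructor <;> linarith

/-- Straight arcs with a common point are parts of one straight arc. -/
theorem IsTraj.meet (hφ : DifferentiableOn ℂ φ disk) (hc : c ≠ 0) {a b a' b' : ℝ}
    {γ γ' : ℝ → ℂ} (h : IsTraj φ c (Ioo a b) γ) (h' : IsTraj φ c (Ioo a' b') γ') {x x' : ℝ}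
    (hx : x ∈ Ioo a b) (hx' : x' ∈ Ioo a' b') (e : γ x = γ' x') :
    ∃ ε : ℝ, (ε = 1 ∨ ε = -1) ∧ ∃ a₁ b₁ γ₁, IsTraj φ c (Ioo a₁ b₁) γ₁ ∧ Ioo a b ⊆ Ioo a₁ b₁ ∧
      EqOn γ₁ γ (Ioo a b) ∧ ∀ t ∈ Ioo a' b', x + ε * (t - x') ∈ Ioo a₁ b₁ ∧
        γ₁ (x + ε * (t - x')) = γ' t ∧ deriv γ₁ (x + ε * (t - x')) * ε = deriv γ' t := by
  have h1 := h.sq hx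
  have h2 := h'.sq hx'
  rw [← h2, e] at h1
  have hex : ∃ ε : ℝ, (ε = 1 ∨ ε = -1) ∧ deriv γ x * ε = deriv γ' x' := by
    rcases sq_eq_sq_iff_eq_or_eq_neg.1 (mul_left_cancel₀ (h'.ne hc hx') h1) with h3 | h3
    · exact ⟨1, Or.inl rfl, by rw [h3]; simp⟩
    · exact ⟨-1, Or.inr rfl, by rw [h3]; simp⟩
  obtain ⟨ε, hε, hd⟩ := hex
  have hεε : ε * ε = 1 := by rcases hε with rfl | rfl <;> norm_num
  have hεε' : (ε : ℂ) * ε = 1 := by exact_mod_cast hεε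
  obtain ⟨a₂, b₂, hxm, hpre⟩ := preimage_dir_Ioo hε x x' a' b' hx'
  have hder : ∀ t ∈ Ioo a₂ b₂, HasDerivAt (fun t => γ' (x' + ε * (t - x)))
      (deriv γ' (x' + ε * (t - x)) * ε) t := fun t ht => by
    have h3 : HasDerivAt (fun t => x' + ε * (t - x)) ε t := by
      simpa using (((hasDerivAt_id t).sub_const x).const_mul ε).const_add x'
    exact ((h'.hasDerivAt ((hpre t).1 ht)).scomp_of_eq t h3 rfl).congr_deriv (by simp [mul_comm])
  have hl : IsTraj φ c (Ioo a₂ b₂) (fun t => γ' (x' + ε * (t - x))) := fun t ht =>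
    ⟨(h' _ ((hpre t).1 ht)).1, _, hder t ht, by
      have := h'.sq ((hpre t).1 ht)
      linear_combination this + φ (γ' (x' + ε * (t - x))) * deriv γ' (x' + ε * (t - x)) ^ 2 * hεε'⟩
  obtain ⟨γ₁, g1, g2, g3⟩ := h.exists_union hφ hc hl hx hxm (by simpa using e) (by
    rw [(hder x hxm).deriv]
    simp only [sub_self, mul_zero, add_zero]
    rw [← hd]; linear_combination (-deriv γ x) * hεε')
  refine ⟨ε, hε, _, _, γ₁, g1, fun t ht => ⟨min_lt_of_left_lt ht.1, lt_max_of_lt_left ht.2⟩, g2,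
    fun t ht => ?_⟩
  have hcan : x' + ε * (x + ε * (t - x') - x) = t := by linear_combination (t - x') * hεε
  -- The reparametrization is an involution up to exchanging the base points, because `ε² = 1`.
  have htm : x + ε * (t - x') ∈ Ioo a₂ b₂ := (hpre _).2 (by rw [hcan]; exact ht)
  refine ⟨⟨min_lt_of_right_lt htm.1, lt_max_of_lt_right htm.2⟩, ?_, ?_⟩
  · rw [g3 htm]; simp only [hcan]
  · rw [(g3.eventuallyEq_of_mem (isOpen_Ioo.mem_nhds htm)).deriv_eq, (hder _ htm).deriv, hcan]
    linear_combination deriv γ' t * hεε'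

/-- `γ` is the straight arc in direction `c` which starts at the point `Ψ (i y)`. -/
structure IsFlowLine (φ : ℂ → ℂ) (Ψ : ℂ → ℂ) (c : ℂ) (y a b : ℝ) (γ : ℝ → ℂ) : Prop where
  traj : IsTraj φ c (Ioo a b) γ
  zero_mem : (0 : ℝ) ∈ Ioo a b
  map_zero : γ 0 = Ψ (y * Complex.I)
  deriv_zero : deriv γ 0 = deriv Ψ (y * Complex.I) * c

theorem IsFlowLine.eqOn (hφ : DifferentiableOn ℂ φ disk) (hc : c ≠ 0) {y a b a' b' : ℝ}
    {γ γ' : ℝ → ℂ} (h : IsFlowLine φ Ψ c y a b γ) (h' : IsFlowLine φ Ψ c y a' b' γ') :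
    EqOn γ γ' (Ioo a b ∩ Ioo a' b') :=
  (h.traj.mono inter_subset_left).eqOn hφ (isOpen_Ioo.inter isOpen_Ioo)
    ((convex_Ioo a b).inter (convex_Ioo a' b')).isPreconnected hc (h'.traj.mono inter_subset_right)
    ⟨h.zero_mem, h'.zero_mem⟩ (by rw [h.map_zero, h'.map_zero]) (by rw [h.deriv_zero, h'.deriv_zero])

/-- The domain of the flow. -/
def flowSet (φ : ℂ → ℂ) (Ψ : ℂ → ℂ) (c : ℂ) : Set ℂ :=
  {ξ | ∃ a b γ, IsFlowLine φ Ψ c ξ.im a b γ ∧ ξ.re ∈ Ioo a b}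

open Classical in
/-- The flow of straight arcs in direction `c` through the transversal `Ψ (i ℝ)`. -/
def flow (φ : ℂ → ℂ) (Ψ : ℂ → ℂ) (c : ℂ) (ξ : ℂ) : ℂ :=
  if h : ξ ∈ flowSet φ Ψ c then h.choose_spec.choose_spec.choose ξ.re else 0

theorem IsFlowLine.mem_flowSet {y a b x : ℝ} {γ : ℝ → ℂ} (h : IsFlowLine φ Ψ c y a b γ)
    (hx : x ∈ Ioo a b) : (⟨x, y⟩ : ℂ) ∈ flowSet φ Ψ c := ⟨a, b, γ, h, hx⟩

/-- The choice in the definition of `flow` does not matter, since flow lines with the same initial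
point agree where both exist. -/
theorem IsFlowLine.flow_eq (hφ : DifferentiableOn ℂ φ disk) (hc : c ≠ 0) {y a b x : ℝ} {γ : ℝ → ℂ}
    (h : IsFlowLine φ Ψ c y a b γ) (hx : x ∈ Ioo a b) : flow φ Ψ c ⟨x, y⟩ = γ x := by
  have hm := h.mem_flowSet hx
  rw [flow, dif_pos hm]
  obtain ⟨h1, h2⟩ := hm.choose_spec.choose_spec.choose_spec
  exact h1.eqOn hφ hc h ⟨h2, hx⟩

theorem flow_mem_disk (hφ : DifferentiableOn ℂ φ disk) (hc : c ≠ 0) {ξ : ℂ}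
    (h : ξ ∈ flowSet φ Ψ c) : flow φ Ψ c ξ ∈ disk ∧ φ (flow φ Ψ c ξ) ≠ 0 := by
  obtain ⟨a, b, γ, h1, h2⟩ := h
  have : flow φ Ψ c ξ = γ ξ.re := h1.flow_eq hφ hc h2
  rw [this]
  exact ⟨(h1.traj _ h2).1, h1.traj.ne hc h2⟩

/-- Distinct flow lines through a short transversal are disjoint. -/
theorem IsChart.flowLine_inj (hφ : DifferentiableOn ℂ φ disk) (h : IsChart φ r Ψ) (hc : c.re ≠ 0)
    {y y' a b a' b' x x' : ℝ} {γ γ' : ℝ → ℂ} (hy : |y| < r / 4) (hy' : |y'| < r / 4)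
    (hγ : IsFlowLine φ Ψ c y a b γ) (hγ' : IsFlowLine φ Ψ c y' a' b' γ') (hx : x ∈ Ioo a b)
    (hx' : x' ∈ Ioo a' b') (e : γ x = γ' x') : x = x' ∧ y = y' := by
  have hc0 : c ≠ 0 := fun h0 => by simp [h0] at hc
  have hr := h.pos
  obtain ⟨ε, hε, a₁, b₁, γ₁, g1, g2, g3, g4⟩ := hγ.traj.meet hφ hc0 hγ'.traj hx hx' e
  obtain ⟨k1, k2, k3⟩ := g4 0 hγ'.zero_mem
  have hd : deriv γ₁ 0 = deriv Ψ (y * Complex.I) * c := by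
    rw [(g3.eventuallyEq_of_mem (isOpen_Ioo.mem_nhds hγ.zero_mem)).deriv_eq, hγ.deriv_zero]
  -- The common straight arc passes both starting points on the transversal, so it returns to the
  -- chart; comparing real parts and using `c.re ≠ 0` shows that it does so at the same time.
  have hn := h.no_return hφ hc0 g1 (g2 hγ.zero_mem) k1 (norm_I_mul_lt hy) (norm_I_mul_lt hy')
    (by rw [g3 hγ.zero_mem, hγ.map_zero]) (by rw [k2, hγ'.map_zero]) hd
  have hre := congrArg Complex.re hn
  have him := congrArg Complex.im hn
  have hcast : ((x + ε * (0 - x') : ℝ) : ℂ) - ((0 : ℝ) : ℂ) = ((x + ε * (0 - x') : ℝ) : ℂ) := by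
    simp
  rw [hcast] at hre him
  simp only [Complex.add_re, Complex.re_ofReal_mul, Complex.I_re, Complex.re_mul_ofReal, mul_zero,
    zero_add, Complex.add_im, Complex.im_ofReal_mul, Complex.I_im, Complex.im_mul_ofReal,
    mul_one] at hre him
  have hz : x + ε * (0 - x') = 0 := by
    rcases mul_eq_zero.1 hre.symm with h1 | h1
    · exact absurd h1 hc
    · exact h1
  rw [hz, mul_zero, add_zero] at him
  refine ⟨?_, him.symm⟩
  rcases hε with rfl | rfl
  · linarith
  · exfalso
    -- Opposite orientations would make the nonzero initial velocity its own negative.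
    rw [hz, hd, hγ'.deriv_zero, him] at k3
    have h5 : deriv Ψ (y * Complex.I) * c ≠ 0 := mul_ne_zero (h.deriv_ne (norm_I_mul_lt (by linarith))) hc0
    refine h5 (self_eq_neg.1 (k3.symm.trans ?_))
    push_cast; ring

theorem IsChart.flow_injOn (hφ : DifferentiableOn ℂ φ disk) (h : IsChart φ r Ψ) (hc : c.re ≠ 0) :
    InjOn (flow φ Ψ c) (flowSet φ Ψ c ∩ {ξ | |ξ.im| < r / 4}) := by
  have hc0 : c ≠ 0 := fun h0 => by simp [h0] at hc
  rintro ξ ⟨⟨a, b, γ, h1, h2⟩, hy⟩ ξ' ⟨⟨a', b', γ', h1', h2'⟩, hy'⟩ e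
  have e1 : flow φ Ψ c ξ = γ ξ.re := h1.flow_eq hφ hc0 h2
  have e2 : flow φ Ψ c ξ' = γ' ξ'.re := h1'.flow_eq hφ hc0 h2'
  rw [e1, e2] at e
  obtain ⟨h3, h4⟩ := h.flowLine_inj hφ hc hy hy' h1 h1' h2 h2' e
  exact Complex.ext h3 h4

/-- The flow in flat coordinates along a flow line. -/
theorem IsFlowLine.exists_flat (hφ : DifferentiableOn ℂ φ disk) (h : IsChart φ r Ψ) (hc : c ≠ 0)
    {y₀ a b x₀ x₁ : ℝ} {γ : ℝ → ℂ} (hy₀ : |y₀| < r) (hγ : IsFlowLine φ Ψ c y₀ a b γ)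
    (ha : a < x₀) (h0 : x₀ ≤ 0) (h1 : 0 ≤ x₁) (hb : x₁ < b) :
    ∃ δ > 0, ∃ Ξ, IsFlat φ c {ζ | x₀ - δ < ζ.re ∧ ζ.re < x₁ + δ ∧ |ζ.im| < δ} Ξ ∧
      (∀ x ∈ Ioo (x₀ - δ) (x₁ + δ), Ξ x = γ x ∧ deriv Ξ x = deriv γ x) ∧
      ∃ ε > 0, (∀ y : ℝ, |y - y₀| < ε → ∀ x ∈ Ioo (x₀ - δ / 2) (x₁ + δ / 2),
        (y - y₀) * (Complex.I / c) + 1 * x ∈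
          {ζ : ℂ | x₀ - δ < ζ.re ∧ ζ.re < x₁ + δ ∧ |ζ.im| < δ}) ∧
      ∀ y : ℝ, |y - y₀| < ε → IsFlowLine φ Ψ c y (x₀ - δ / 2) (x₁ + δ / 2)
        (fun x : ℝ => Ξ ((y - y₀) * (Complex.I / c) + 1 * x)) := by
  obtain ⟨δ, hδ, ha', hb', Ξ, hΞ, hΞγ⟩ := hγ.traj.exists_flat hφ hc ha (h0.trans h1) hb
  set U := {ζ : ℂ | x₀ - δ < ζ.re ∧ ζ.re < x₁ + δ ∧ |ζ.im| < δ} with hU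
  have hcn : 0 < ‖c‖ := norm_pos_iff.2 hc
  set R := min δ ((r - |y₀|) / ‖c‖) with hR
  have hR0 : 0 < R := lt_min hδ (div_pos (by linarith) hcn)
  have h00 : (0 : ℝ) ∈ Ioo (x₀ - δ) (x₁ + δ) := ⟨by linarith, by linarith⟩
  have hballU : Metric.ball (0 : ℂ) R ⊆ U := fun ζ hζ => by
    rw [mem_ball_zero_iff] at hζ
    have hζ' := hζ.trans_le (min_le_left _ _)
    have e1 := abs_lt.1 ((Complex.abs_re_le_norm ζ).trans_lt hζ')
    have e2 := (Complex.abs_im_le_norm ζ).trans_lt hζ'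
    exact ⟨by linarith, by linarith, e2⟩
  have hballΨ : ∀ ζ ∈ Metric.ball (0 : ℂ) R, y₀ * Complex.I + c * ζ ∈ Metric.ball (0 : ℂ) r := fun ζ hζ => by
    rw [mem_ball_zero_iff] at hζ ⊢
    have hζ' := hζ.trans_le (min_le_right _ _)
    rw [lt_div_iff₀ hcn] at hζ'
    refine (norm_add_le _ _).trans_lt ?_
    rw [norm_mul, norm_mul, Complex.norm_real, Complex.norm_I, mul_one, Real.norm_eq_abs]
    linarith
  have hR0m : (0 : ℂ) ∈ Metric.ball (0 : ℂ) R := Metric.mem_ball_self hR0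
  have hΨaff : IsFlat φ c (Metric.ball 0 R) (fun ζ => Ψ (y₀ * Complex.I + c * ζ)) := by
    have := (h.flat.comp_affine (y₀ * Complex.I) c).mono (V := Metric.ball 0 R) hballΨ
    rwa [one_mul] at this
  have hΞ0 := hΞγ 0 h00
  rw [Complex.ofReal_zero] at hΞ0
  -- Near the starting point `Ξ` is the chart rescaled by `c`. Hence the vertical transversal
  -- becomes a line in direction `i / c`, and the flow line at height `y` starts at `(y - y₀) (i /
  -- c)`.
  have heq : EqOn Ξ (fun ζ => Ψ (y₀ * Complex.I + c * ζ)) (Metric.ball 0 R) :=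
    (hΞ.mono hballU).eqOn hφ Metric.isOpen_ball (convex_ball _ _) hc hΨaff hR0m
      (by rw [hΞ0.1, hγ.map_zero]; simp)
      (by rw [hΞ0.2, hγ.deriv_zero, (h.flat.hasDerivAt_affine _ c (hballΨ 0 hR0m)).deriv]; simp)
  set ε := ‖c‖ * (min R (δ / 2)) with hε
  have hε0 : 0 < ε := mul_pos hcn (lt_min hR0 (by positivity))
  have hs : ∀ y : ℝ, |y - y₀| < ε → ‖((y - y₀ : ℂ)) * (Complex.I / c)‖ < min R (δ / 2) := fun y hy => by
    rw [norm_mul, norm_div, Complex.norm_I, ← Complex.ofReal_sub, Complex.norm_real,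
      Real.norm_eq_abs, mul_one_div, div_lt_iff₀ hcn, mul_comm]
    exact hy
  have hmem : ∀ y : ℝ, |y - y₀| < ε → ∀ x ∈ Ioo (x₀ - δ / 2) (x₁ + δ / 2),
      (y - y₀) * (Complex.I / c) + 1 * x ∈ U := fun y hy x hx => by
    have h2 := (hs y hy).trans_le (min_le_right _ _)
    have e1 := abs_lt.1 ((Complex.abs_re_le_norm _).trans_lt h2)
    have e2 := (Complex.abs_im_le_norm _).trans_lt h2
    refine ⟨?_, ?_, ?_⟩
    · rw [one_mul, Complex.add_re, Complex.ofReal_re]; linarith [hx.1]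
    · rw [one_mul, Complex.add_re, Complex.ofReal_re]; linarith [hx.2]
    · rw [one_mul, Complex.add_im, Complex.ofReal_im, add_zero]; linarith
  refine ⟨δ, hδ, Ξ, hΞ, hΞγ, ε, hε0, hmem, fun y hy => ?_⟩
  have h2 := (hs y hy).trans_le (min_le_left _ _)
  have h0m : (0 : ℝ) ∈ Ioo (x₀ - δ / 2) (x₁ + δ / 2) := ⟨by linarith, by linarith⟩
  have hcan : (y₀ : ℂ) * Complex.I + c * ((y - y₀) * (Complex.I / c)) = y * Complex.I := by
    field_simp; ring
  refine ⟨?_, h0m, ?_, ?_⟩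
  · have := (hΞ.line ((y - y₀) * (Complex.I / c)) 1).mono (J := Ioo (x₀ - δ / 2) (x₁ + δ / 2))
      (hmem y hy)
    rwa [mul_one] at this
  · have := heq (mem_ball_zero_iff.2 h2)
    simp only [Complex.ofReal_zero, mul_zero, add_zero]
    rw [this]; simp only [hcan]
  · rw [(hΞ.hasDerivAt_line _ 1 (hmem y hy 0 h0m)).deriv]
    simp only [Complex.ofReal_zero, mul_zero, add_zero, mul_one]
    rw [(heq.eventuallyEq_of_mem (Metric.isOpen_ball.mem_nhds (mem_ball_zero_iff.2 h2))).deriv_eq,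
      (h.flat.hasDerivAt_affine _ c (hballΨ _ (mem_ball_zero_iff.2 h2))).deriv, hcan]

/-- The real linear map with `1 ↦ p` and `i ↦ q`. -/
def realLin (p q : ℂ) : ℂ →L[ℝ] ℂ :=
  Complex.reCLM.smulRight p + Complex.imCLM.smulRight q

theorem realLin_apply (p q ζ : ℂ) : realLin p q ζ = ζ.re * p + ζ.im * q := by
  simp [realLin]

theorem det_eq (L : ℂ →L[ℝ] ℂ) :
    L.det = (L 1).re * (L Complex.I).im - (L 1).im * (L Complex.I).re := by
  rw [ContinuousLinearMap.det, ← LinearMap.det_toMatrix Complex.basisOneI, Matrix.det_fin_two]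
  simp [LinearMap.toMatrix_apply]
  ring

/-- The derivative of the flow at a point of its domain. -/
theorem IsChart.flow_hasFDerivAt (hφ : DifferentiableOn ℂ φ disk) (h : IsChart φ r Ψ) (hc : c ≠ 0)
    {ξ : ℂ} (hξ : ξ ∈ flowSet φ Ψ c) (hr : |ξ.im| < r) :
    flowSet φ Ψ c ∈ 𝓝 ξ ∧ ∃ v : ℂ, φ (flow φ Ψ c ξ) * v ^ 2 = 1 ∧
      HasFDerivAt (flow φ Ψ c) (realLin (v * c) (v * Complex.I)) ξ ∧
      HasDerivAt (fun x : ℝ => flow φ Ψ c ⟨x, ξ.im⟩) (v * c) ξ.re := by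
  obtain ⟨a, b, γ, h1, h2⟩ := hξ
  have h0 := h1.zero_mem
  obtain ⟨δ, hδ, Ξ, hΞ, hΞγ, ε, hε, hmem, hline⟩ := h1.exists_flat hφ h hc hr
    (x₀ := min ξ.re 0) (x₁ := max ξ.re 0) (lt_min h2.1 h0.1) (min_le_right _ _) (le_max_right _ _)
    (max_lt h2.2 h0.2)
  have hnear : ∀ᶠ ζ : ℂ in 𝓝 ξ, |ζ.im - ξ.im| < ε ∧
      ζ.re ∈ Ioo (min ξ.re 0 - δ / 2) (max ξ.re 0 + δ / 2) := by
    have o1 : ContinuousAt (fun ζ : ℂ => |ζ.im - ξ.im|) ξ := by fun_prop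
    have o2 : ContinuousAt (fun ζ : ℂ => ζ.re) ξ := by fun_prop
    have m1 := min_le_left ξ.re 0
    have m2 := le_max_left ξ.re 0
    exact (o1.eventually (gt_mem_nhds (by simpa using hε))).and
      (o2.eventually (Ioo_mem_nhds (by linarith) (by linarith)))
  -- Near `ξ` the flow is the holomorphic map `Ξ` after a real affine map, which gives the
  -- derivative even far from the transversal.
  have hev : flow φ Ψ c =ᶠ[𝓝 ξ] fun ζ => Ξ ((ζ.im - ξ.im) * (Complex.I / c) + ζ.re) := by
    filter_upwards [hnear] with ζ hζ
    have := (hline ζ.im hζ.1).flow_eq hφ hc hζ.2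
    simpa only [one_mul] using this
  have hself := hnear.self_of_nhds
  have hmξ := hmem ξ.im hself.1 ξ.re hself.2
  simp only [sub_self, zero_mul, one_mul, zero_add] at hmξ
  have hval : flow φ Ψ c ξ = Ξ ξ.re := by rw [hev.self_of_nhds]; simp
  refine ⟨?_, deriv Ξ ξ.re / c, ?_, ?_, ?_⟩
  · filter_upwards [hnear] with ζ hζ
    exact (hline ζ.im hζ.1).mem_flowSet hζ.2
  · rw [hval, div_pow, mul_div_assoc', hΞ.sq hmξ, div_self (pow_ne_zero 2 hc)]
  · have hA : HasFDerivAt (fun ζ : ℂ => ((ζ.im - ξ.im : ℂ)) * (Complex.I / c) + ζ.re)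
        (realLin 1 (Complex.I / c)) ξ := by
      have : (fun ζ : ℂ => ((ζ.im - ξ.im : ℂ)) * (Complex.I / c) + ζ.re) =
          fun ζ => realLin 1 (Complex.I / c) ζ - ξ.im * (Complex.I / c) := by
        ext ζ; rw [realLin_apply]; ring
      rw [this]
      exact (realLin 1 (Complex.I / c)).hasFDerivAt.sub_const _
    have hΞd : HasDerivAt Ξ (deriv Ξ ξ.re) (((ξ.im : ℂ) - ξ.im) * (Complex.I / c) + ξ.re) := by
      simpa using hΞ.hasDerivAt hmξ
    have hcomp : HasFDerivAt (fun ζ : ℂ => Ξ (((ζ.im : ℂ) - ξ.im) * (Complex.I / c) + ζ.re)) _ ξ :=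
      (hΞd.hasFDerivAt.restrictScalars ℝ).comp ξ hA
    refine (hcomp.congr_of_eventuallyEq hev).congr_fderiv ?_
    ext ζ
    simp only [ContinuousLinearMap.comp_apply, ContinuousLinearMap.coe_restrictScalars',
      realLin_apply]
    simp
    field_simp
  · rw [div_mul_cancel₀ _ hc]
    have hl := (hline ξ.im hself.1)
    have he : (fun x : ℝ => flow φ Ψ c ⟨x, ξ.im⟩) =ᶠ[𝓝 ξ.re]
        fun x : ℝ => Ξ ((ξ.im - ξ.im) * (Complex.I / c) + 1 * x) := by
      filter_upwards [isOpen_Ioo.mem_nhds hself.2] with x hx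
      exact hl.flow_eq hφ hc hx
    have hd := hΞ.hasDerivAt_line ((ξ.im - ξ.im) * (Complex.I / c)) 1 (t := ξ.re) (by simpa using hmξ)
    have := hd.congr_of_eventuallyEq he
    simpa using this

theorem IsChart.isOpen_flowSet (hφ : DifferentiableOn ℂ φ disk) (h : IsChart φ r Ψ) (hc : c ≠ 0)
    {r' : ℝ} (hr : r' ≤ r) : IsOpen (flowSet φ Ψ c ∩ {ξ | |ξ.im| < r'}) := by
  rw [isOpen_iff_mem_nhds]
  rintro ξ ⟨h1, h2⟩
  refine inter_mem (h.flow_hasFDerivAt hφ hc h1 (lt_of_lt_of_le h2 hr)).1 ?_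
  have o1 : ContinuousAt (fun ζ : ℂ => |ζ.im|) ξ := by fun_prop
  exact o1.eventually (gt_mem_nhds h2)

end TeichDisk
end

noncomputable section
namespace TeichDisk

/-! ### A separation lemma -/

variable {φ : ℂ → ℂ} {r : ℝ} {Ψ : ℂ → ℂ} {c : ℂ}

/-- The change of argument along a curve in a disk, as seen from a point outside. -/
theorem exists_dlog_sub_eq {p₀ z : ℂ} {R : ℝ} (hz : z ∉ Metric.closedBall p₀ R) :
    ∃ l : ℂ → ℂ, ∀ (g : ℝ → ℂ) (a b : ℝ), a ≤ b → ContinuousOn g (Icc a b) →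
      (∀ t ∈ Icc a b, g t ∈ Metric.closedBall p₀ R) →
      dlog (fun t => g t - z) a b = l (g b) - l (g a) := by
  -- Multiplication by the conjugate of `p₀ - z` turns the disk, as seen from `z`, into a subset of
  -- the right half plane.
  set k := starRingEnd ℂ (p₀ - z) with hk
  refine ⟨fun w => Complex.log (k * (w - z)), fun g a b hab hg hb => ?_⟩
  refine dlog_of_re_pos (k := k) hab (hg.sub continuousOn_const) fun t ht => ?_
  have h1 : k * (g t - z) = k * (p₀ - z) + k * (g t - p₀) := by ring
  have h2 : k * (p₀ - z) = ((‖p₀ - z‖ ^ 2 : ℝ) : ℂ) := by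
    rw [hk, mul_comm, Complex.mul_conj, Complex.normSq_eq_norm_sq]
  have h3 : ‖k * (g t - p₀)‖ ≤ ‖p₀ - z‖ * R := by
    rw [norm_mul, hk, RCLike.norm_conj]
    exact mul_le_mul_of_nonneg_left (by simpa [dist_eq_norm] using hb t ht) (norm_nonneg _)
  have h4 : R < ‖p₀ - z‖ := by
    rw [Metric.mem_closedBall, not_le, dist_comm, dist_eq_norm] at hz; exact hz
  have h5 : (0 : ℝ) < ‖p₀ - z‖ := by
    have : 0 ≤ R := by
      have := hb t ht
      rw [Metric.mem_closedBall] at this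
      exact dist_nonneg.trans this
    linarith
  have h6 := (Complex.abs_re_le_norm (k * (g t - p₀))).trans h3
  rw [abs_le] at h6
  rw [h1, Complex.add_re, h2, Complex.ofReal_re]
  nlinarith

/-- A curve which crosses the transversal `Ψ (i [u₁, u₂])` once cannot begin and end outside of a
disk that contains a closed curve composed of the transversal and of a curve not met. -/
theorem IsChart.not_separated (h : IsChart φ r Ψ) {u₁ v u₂ : ℝ} (hu₁ : |u₁| < r) (hu₂ : |u₂| < r)
    (hv₁ : u₁ < v) (hv₂ : v < u₂) {P : ℝ → ℂ} {s₀ s₁ q : ℝ} (hq : q ∈ Ioo s₀ s₁)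
    (hP : ContinuousOn P (Icc s₀ s₁)) (hc : 0 < c.re)
    (hloc : ∀ᶠ x : ℝ in 𝓝 q, P x = Ψ (v * Complex.I + c * (x - q)))
    (hV : ∀ x ∈ Icc s₀ s₁, ∀ u ∈ Icc u₁ u₂, P x = Ψ (u * Complex.I) → x = q) {p₀ : ℂ} {R : ℝ}
    (hA : JoinedIn (Metric.closedBall p₀ R \ P '' Icc s₀ s₁) (Ψ (u₂ * Complex.I))
      (Ψ (u₁ * Complex.I)))
    (hVb : ∀ u ∈ Icc u₁ u₂, Ψ (u * Complex.I) ∈ Metric.closedBall p₀ R)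
    (h0 : P s₀ ∉ Metric.closedBall p₀ R) (h1 : P s₁ ∉ Metric.closedBall p₀ R) : False := by
  have huu : u₁ ≤ u₂ := by linarith
  obtain ⟨α, hα⟩ := hA
  set A : ℝ → ℂ := fun s => α.extend s with hAdef
  have hAc : Continuous A := α.extend.continuous
  have hA0 : A 0 = Ψ (u₂ * Complex.I) := α.extend_zero
  have hA1 : A 1 = Ψ (u₁ * Complex.I) := α.extend_one
  have hAmem : ∀ s, A s ∈ Metric.closedBall p₀ R \ P '' Icc s₀ s₁ := fun s => by
    have : α.extend s ∈ range α.extend := mem_range_self s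
    rw [α.extend_range] at this
    obtain ⟨y, hy⟩ := this
    change α.extend s ∈ _
    rw [← hy]; exact hα y
  have hPA : ∀ x ∈ Icc s₀ s₁, ∀ s ∈ Icc (0 : ℝ) 1, A s - P x ≠ 0 := fun x hx s _ h =>
    (hAmem s).2 ⟨x, hx, (sub_eq_zero.1 h).symm⟩
  have hlt : ∀ u ∈ Icc u₁ u₂, |u| < r := fun u hu => abs_lt.2
    ⟨by linarith [hu.1, (abs_lt.1 hu₁).1], by linarith [hu.2, (abs_lt.1 hu₂).2]⟩
  set V : ℝ → ℂ := fun u => Ψ (u * Complex.I) with hVdef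
  have hVc : ContinuousOn V (Icc u₁ u₂) := h.flat.continuousOn.comp (by fun_prop)
    fun u hu => mem_ball_zero_iff.2 (norm_I_mul_lt (hlt u hu))
  set B : ℝ → ℂ := fun x => dlog (fun s => A s - P x) 0 1 with hB
  set D : ℝ → ℂ := fun x => dlog (fun u => V u - P x) u₁ u₂ with hD
  -- the total change of argument does not change away from the crossing
  have hconst : ∀ a b, a ≤ b → Icc a b ⊆ Icc s₀ s₁ → q ∉ Icc a b → D a + B a = D b + B b := by
    intro a b hab hsub hqn
    have hPab := hP.mono hsub
    have r1 := dlog_rect (F := fun x u => V u - P x) hab huu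
      ((hVc.comp continuousOn_snd fun p hp => hp.2).sub (hPab.comp continuousOn_fst fun p hp => hp.1))
      (fun x hx u hu e => hqn (by
        have := hV x (hsub hx) u hu (sub_eq_zero.1 e).symm
        rwa [← this]))
    have r2 := dlog_rect (F := fun x s => A s - P x) hab zero_le_one
      ((hAc.comp continuous_snd).continuousOn.sub (hPab.comp continuousOn_fst fun p hp => hp.1))
      (fun x hx s hs => hPA x (hsub hx) s hs)
    simp only [hA0, hA1] at r2
    simp only [hVdef] at r1
    simp only [hD, hB, hVdef]
    linear_combination -r1 - r2
  -- The closed curve lies in the disk, so its winding number about a point outside is zero.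
  have hends : ∀ x, P x ∉ Metric.closedBall p₀ R → D x + B x = 0 := by
    intro x hx
    obtain ⟨l, hl⟩ := exists_dlog_sub_eq hx
    simp only [hD, hB]
    rw [hl V u₁ u₂ huu hVc hVb, hl A 0 1 zero_le_one hAc.continuousOn fun s _ => (hAmem s).1, hA0,
      hA1]
    ring
  have hzero : ∀ x ∈ Icc s₀ s₁, x ≠ q → D x = -B x := by
    intro x hx hxq
    rcases lt_or_gt_of_ne hxq with hlt | hlt
    · have := hconst s₀ x hx.1 (Icc_subset_Icc le_rfl hx.2) fun h => absurd h.2 (not_le.2 hlt)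
      rw [hends s₀ h0] at this
      linear_combination -this
    · have := hconst x s₁ hx.2 (Icc_subset_Icc hx.1 le_rfl) fun h => absurd h.1 (not_le.2 hlt)
      rw [hends s₁ h1] at this
      linear_combination this
  have hBc : ContinuousAt B q := by
    have : ContinuousOn B (Icc s₀ s₁) := dlog_continuousOn (F := fun x s => A s - P x)
      (by linarith [hq.1, hq.2]) zero_le_one
      ((hAc.comp continuous_snd).continuousOn.sub (hP.comp continuousOn_fst fun p hp => hp.1)) hPA
    exact this.continuousAt (Icc_mem_nhds hq.1 hq.2)
  -- the change of argument along the transversal near the crossing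
  set b : ℝ → ℂ := fun x => v * Complex.I + c * (x - q) with hb
  have hbc : Continuous b := by fun_prop
  have hbq : b q = v * Complex.I := by simp [hb]
  have hvr : |v| < r := hlt v ⟨hv₁.le, hv₂.le⟩
  -- A chord of the chart is its straight model times a factor in the right half plane. The
  -- logarithm of this factor is continuous, so the jump at the crossing comes from the model alone.
  set Q : ℝ → ℝ → ℂ := fun x u => (Ψ (u * Complex.I) - Ψ (b x)) /
    ((u * Complex.I - b x) * deriv Ψ 0) with hQ
  have hbr : ∀ᶠ x in 𝓝 q, ‖b x‖ < r := by
    have : ContinuousAt (fun x => ‖b x‖) q := hbc.norm.continuousAt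
    refine this.eventually (gt_mem_nhds ?_)
    change ‖b q‖ < r
    rw [hbq]; exact norm_I_mul_lt hvr
  have hd0 : deriv Ψ 0 ≠ 0 := h.deriv_ne (by simpa using h.pos)
  have hQpos : ∀ u ∈ Icc u₁ u₂, ∀ x, ‖b x‖ < r → (u : ℂ) * Complex.I ≠ b x → 0 < (Q x u).re :=
    fun u hu x hx hne => h.re_slope_pos (norm_I_mul_lt (hlt u hu)) hx hne
  have hΨb : ContinuousAt (fun x => Ψ (b x)) q := by
    refine ContinuousAt.comp (f := b) ?_ hbc.continuousAt
    exact (h.flat.hasDerivAt (mem_ball_zero_iff.2 (by rw [hbq]; exact norm_I_mul_lt hvr))).continuousAt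
  have hQlog : ∀ u ∈ Icc u₁ u₂, u ≠ v → ContinuousAt (fun x => Complex.log (Q x u)) q := by
    intro u hu huv
    have hne : (u : ℂ) * Complex.I ≠ b q := by
      rw [hbq]; intro e
      have := mul_right_cancel₀ Complex.I_ne_zero e
      exact huv (by exact_mod_cast this)
    refine ContinuousAt.clog ?_ (Or.inl (hQpos u hu q (by rw [hbq]; exact norm_I_mul_lt hvr) hne))
    exact (continuousAt_const.sub hΨb).div
      ((continuousAt_const.sub hbc.continuousAt).mul continuousAt_const)
      (mul_ne_zero (sub_ne_zero.2 hne) hd0)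
  have m1 : u₁ ∈ Icc u₁ u₂ := ⟨le_rfl, huu⟩
  have m2 : u₂ ∈ Icc u₁ u₂ := ⟨huu, le_rfl⟩
  have hre : ∀ u x : ℝ, ((u : ℂ) * Complex.I - b x).re = -(c.re * (x - q)) := fun u x => by
    have : (c * ((x : ℂ) - q)).re = c.re * (x - q) := by
      rw [← Complex.ofReal_sub, Complex.re_mul_ofReal]
    simp [hb, this]
  -- For `x` on one side of `q` the model vectors `u i - b x` have real part of constant sign; `σ`
  -- turns them into the right half plane.
  have hform : ∀ σ : ℝ, (σ = 1 ∨ σ = -1) → ∀ᶠ x in 𝓝 q, 0 < σ * (q - x) →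
      -B x = (Complex.log (Q x u₂) - Complex.log (Q x u₁)) +
        (Complex.log (σ * (u₂ * Complex.I - b x)) - Complex.log (σ * (u₁ * Complex.I - b x))) := by
    intro σ hσ
    filter_upwards [hloc, hbr, Icc_mem_nhds hq.1 hq.2] with x hx hxr hxI hσx
    have hxq : x ≠ q := fun e => by rw [e, sub_self, mul_zero] at hσx; exact lt_irrefl _ hσx
    have hne : ∀ u : ℝ, (u : ℂ) * Complex.I - b x ≠ 0 := fun u e => by
      have := hre u x
      rw [e, Complex.zero_re] at this
      rcases mul_eq_zero.1 (neg_eq_zero.1 this.symm) with h3 | h3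
      · exact hc.ne' h3
      · exact hxq (sub_eq_zero.1 h3)
    have hQc : ContinuousOn (Q x) (Icc u₁ u₂) := by
      refine (hVc.sub continuousOn_const).div (by fun_prop) fun u _ => mul_ne_zero (hne u) hd0
    have hQp : ∀ u ∈ Icc u₁ u₂, 0 < (1 * Q x u).re := fun u hu => by
      rw [one_mul]; exact hQpos u hu x hxr (sub_ne_zero.1 (hne u))
    have hfac : ∀ u ∈ Icc u₁ u₂, V u - P x = (Q x u * (u * Complex.I - b x)) * deriv Ψ 0 :=
      fun u hu => by
        have := hne u
        have hxb : P x = Ψ (b x) := hx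
        simp only [hQ, hVdef, hxb]
        field_simp
    have hlinc : ContinuousOn (fun u : ℝ => (u : ℂ) * Complex.I - b x) (Icc u₁ u₂) := by fun_prop
    have hQ0 : ∀ u ∈ Icc u₁ u₂, Q x u ≠ 0 := fun u hu e => by
      have := hQp u hu
      simp [e] at this
    rw [← hzero x hxI hxq]
    simp only [hD]
    rw [dlog_congr hfac, dlog_mul huu (f := fun u => Q x u * (u * Complex.I - b x))
      (g := fun _ => deriv Ψ 0) (hQc.mul hlinc) (fun u hu => mul_ne_zero (hQ0 u hu) (hne u))
      continuousOn_const (fun _ _ => hd0), dlog_const _ huu hd0, add_zero,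
      dlog_mul huu (f := Q x) hQc hQ0 hlinc (fun u _ => hne u),
      dlog_of_re_pos (k := 1) huu hQc hQp, dlog_of_re_pos (k := σ) huu hlinc, one_mul, one_mul]
    intro u _
    rw [Complex.re_ofReal_mul, hre]
    nlinarith
  have hlim : ∀ σ : ℝ, (σ = 1 ∨ σ = -1) → ∀ u : ℝ, u ≠ v →
      ContinuousAt (fun x => Complex.log (σ * (u * Complex.I - b x))) q := by
    intro σ hσ u huv
    refine ContinuousAt.clog (by fun_prop) (Or.inr ?_)
    rw [hbq, ← sub_mul, ← Complex.ofReal_sub, ← mul_assoc, ← Complex.ofReal_mul]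
    simp only [Complex.im_ofReal_mul, Complex.I_im, mul_one]
    exact mul_ne_zero (by rcases hσ with h | h <;> rw [h] <;> norm_num) (sub_ne_zero.2 huv)
  have hval : ∀ σ : ℝ, (σ = 1 ∨ σ = -1) →
      -B q = (Complex.log (Q q u₂) - Complex.log (Q q u₁)) +
        (Complex.log (σ * (u₂ * Complex.I - b q)) - Complex.log (σ * (u₁ * Complex.I - b q))) := by
    intro σ hσ
    have hfr : ∃ᶠ x in 𝓝 q, 0 < σ * (q - x) := by
      rcases hσ with rfl | rfl
      · have : ∃ᶠ x in 𝓝 q, x < q := Filter.Frequently.filter_mono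
          (Filter.Eventually.frequently (self_mem_nhdsWithin (a := q) (s := Iio q)))
          nhdsWithin_le_nhds
        exact this.mono fun x hx => by linarith
      · have : ∃ᶠ x in 𝓝 q, q < x := Filter.Frequently.filter_mono
          (Filter.Eventually.frequently (self_mem_nhdsWithin (a := q) (s := Ioi q)))
          nhdsWithin_le_nhds
        exact this.mono fun x hx => by linarith
    have hfr' := (hfr.and_eventually (hform σ hσ)).mono fun x hx => hx.2 hx.1
    have hcl := ((hQlog u₂ m2 hv₂.ne').sub (hQlog u₁ m1 hv₁.ne)).add
      ((hlim σ hσ u₂ hv₂.ne').sub (hlim σ hσ u₁ hv₁.ne))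
    by_contra hne
    have := (hBc.neg.prodMk hcl).eventually
      ((isOpen_ne_fun continuous_fst continuous_snd).mem_nhds hne)
    obtain ⟨x, hx, hx'⟩ := (hfr'.and_eventually this).exists
    exact hx' hx
  -- Letting `x` tend to `q` from the left and from the right gives two values for `-B q`. Their
  -- imaginary parts differ by `2π`, while `B` is continuous.
  have e1 := hval 1 (Or.inl rfl)
  have e2 := hval (-1) (Or.inr rfl)
  have e3 := congrArg Complex.im (e1.symm.trans e2)
  simp only [hbq] at e3
  have hlog : ∀ y : ℝ, (0 < y → (Complex.log (y * Complex.I)).im = Real.pi / 2) ∧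
      (y < 0 → (Complex.log (y * Complex.I)).im = -(Real.pi / 2)) := fun y => by
    constructor
    · intro hy
      rw [Complex.log_im, Complex.arg_real_mul _ hy, Complex.arg_I]
    · intro hy
      have : (y : ℂ) * Complex.I = ((-y : ℝ) : ℂ) * (-Complex.I) := by push_cast; ring
      rw [this, Complex.log_im, Complex.arg_real_mul _ (by linarith), Complex.arg_neg_I]
  have hs1 : ∀ u : ℝ, ((1 : ℝ) : ℂ) * (u * Complex.I - v * Complex.I) = ((u - v : ℝ) : ℂ) * Complex.I :=
    fun u => by push_cast; ring
  have hs2 : ∀ u : ℝ, ((-1 : ℝ) : ℂ) * (u * Complex.I - v * Complex.I) = ((v - u : ℝ) : ℂ) * Complex.I :=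
    fun u => by push_cast; ring
  simp only [hs1, hs2, Complex.add_im, Complex.sub_im] at e3
  rw [(hlog _).1 (sub_pos.2 hv₂), (hlog _).2 (sub_neg.2 hv₁), (hlog _).2 (sub_neg.2 hv₂),
    (hlog _).1 (sub_pos.2 hv₁)] at e3
  linarith [Real.pi_pos]

end TeichDisk
end

noncomputable section
namespace TeichDisk

/-! ### The flow preserves area -/

variable {φ : ℂ → ℂ} {r : ℝ} {Ψ : ℂ → ℂ} {c : ℂ}

/-- The density of the area `|φ| dx dy`. -/
def dens (φ : ℂ → ℂ) : ℂ → ℝ≥0∞ := disk.indicator fun z => ‖φ z‖ₑ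

theorem measurable_indicator_of_continuousOn {X : Type*} [TopologicalSpace X] [MeasurableSpace X]
    [OpensMeasurableSpace X] {s : Set X} (hs : MeasurableSet s) {f : X → ℂ}
    (hf : ContinuousOn f s) : Measurable (s.indicator f) := by
  classical
  rw [← piecewise_eq_indicator]
  exact hf.measurable_piecewise continuousOn_const hs

theorem measurable_dens (hφ : DifferentiableOn ℂ φ disk) : Measurable (dens φ) := by
  have h := measurable_indicator_of_continuousOn isOpen_disk.measurableSet hφ.continuousOn
  have : dens φ = disk.indicator fun z => ‖disk.indicator φ z‖ₑ := by
    ext z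
    by_cases hz : z ∈ disk <;> simp [dens, hz]
  rw [this]
  exact h.enorm.indicator isOpen_disk.measurableSet

theorem lintegral_dens_lt_top (hi : IntegrableOn φ disk) : ∫⁻ z, dens φ z < ⊤ := by
  rw [dens, lintegral_indicator isOpen_disk.measurableSet]
  exact hi.2

theorem dens_eq {z : ℂ} (hz : z ∈ disk) : dens φ z = ‖φ z‖ₑ := indicator_of_mem hz _

/-- With `Re c = 1` and `|φ| |v|² = 1` the Jacobian of the flow is `1 / |φ|`, whatever the slope.
This is why the flow preserves area. -/
theorem abs_det_realLin (v c : ℂ) :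
    (realLin (v * c) (v * Complex.I)).det = ‖v‖ ^ 2 * c.re := by
  rw [det_eq, realLin_apply, realLin_apply, ← Complex.normSq_eq_norm_sq, Complex.normSq_apply]
  simp
  ring

/-- The part of the domain of the flow over the transversal of half length `h`. -/
def flowDom (φ : ℂ → ℂ) (Ψ : ℂ → ℂ) (c : ℂ) (h : ℝ) : Set ℂ :=
  flowSet φ Ψ c ∩ {ξ | |ξ.im| < h}

theorem IsChart.isOpen_flowDom (hφ : DifferentiableOn ℂ φ disk) (hΨ : IsChart φ r Ψ) (hc : c.re = 1)
    {h : ℝ} (hr : h ≤ r / 4) : IsOpen (flowDom φ Ψ c h) := by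
  have hp := hΨ.pos
  exact hΨ.isOpen_flowSet hφ (fun h0 => by simp [h0] at hc) (by linarith)

theorem IsChart.injOn_flowDom (hφ : DifferentiableOn ℂ φ disk) (hΨ : IsChart φ r Ψ) (hc : c.re = 1)
    {h : ℝ} (hr : h ≤ r / 4) : InjOn (flow φ Ψ c) (flowDom φ Ψ c h) :=
  (hΨ.flow_injOn hφ (by rw [hc]; exact one_ne_zero)).mono
    (inter_subset_inter_right _ fun _ hξ => lt_of_lt_of_le hξ hr)

theorem IsChart.flowDom_hasFDerivAt (hφ : DifferentiableOn ℂ φ disk) (hΨ : IsChart φ r Ψ)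
    (hc : c.re = 1) {h : ℝ} (hr : h ≤ r / 4) {ξ : ℂ} (hξ : ξ ∈ flowDom φ Ψ c h) :
    ∃ v : ℂ, φ (flow φ Ψ c ξ) * v ^ 2 = 1 ∧
      HasFDerivAt (flow φ Ψ c) (realLin (v * c) (v * Complex.I)) ξ ∧
      HasDerivAt (fun x : ℝ => flow φ Ψ c ⟨x, ξ.im⟩) (v * c) ξ.re := by
  have hp := hΨ.pos
  exact (hΨ.flow_hasFDerivAt hφ (fun h0 => by simp [h0] at hc) hξ.1
    (lt_of_lt_of_le hξ.2 (by linarith))).2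

theorem IsChart.continuousOn_flow (hφ : DifferentiableOn ℂ φ disk) (hΨ : IsChart φ r Ψ)
    (hc : c.re = 1) {h : ℝ} (hr : h ≤ r / 4) : ContinuousOn (flow φ Ψ c) (flowDom φ Ψ c h) :=
  fun ξ hξ => by
    obtain ⟨v, -, hv, -⟩ := hΨ.flowDom_hasFDerivAt hφ hc hr hξ
    exact hv.continuousAt.continuousWithinAt

/-- The flow takes Lebesgue measure to the area measure of `φ`. -/
theorem IsChart.lintegral_flow (hφ : DifferentiableOn ℂ φ disk) (hΨ : IsChart φ r Ψ)
    (hc : c.re = 1) {h : ℝ} (hr : h ≤ r / 4) {W : Set ℂ} (hW : MeasurableSet W)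
    (hWs : W ⊆ flowDom φ Ψ c h) (g : ℂ → ℝ≥0∞) :
    ∫⁻ ξ in W, g (flow φ Ψ c ξ) = ∫⁻ z in flow φ Ψ c '' W, g z * dens φ z := by
  have hc0 : c ≠ 0 := fun h0 => by simp [h0] at hc
  have hex : ∀ ξ, ∃ v : ℂ, ξ ∈ W → φ (flow φ Ψ c ξ) * v ^ 2 = 1 ∧
      HasFDerivAt (flow φ Ψ c) (realLin (v * c) (v * Complex.I)) ξ := fun ξ => by
    by_cases hξ : ξ ∈ W
    · obtain ⟨v, h1, h2, -⟩ := hΨ.flowDom_hasFDerivAt hφ hc hr (hWs hξ)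
      exact ⟨v, fun _ => ⟨h1, h2⟩⟩
    · exact ⟨0, fun h => absurd h hξ⟩
  choose v hv using hex
  rw [lintegral_image_eq_lintegral_abs_det_fderiv_mul volume hW
    (f' := fun ξ => realLin (v ξ * c) (v ξ * Complex.I))
    (fun ξ hξ => (hv ξ hξ).2.hasFDerivWithinAt) ((hΨ.injOn_flowDom hφ hc hr).mono hWs)]
  refine setLIntegral_congr_fun hW fun ξ hξ => ?_
  change g _ = ENNReal.ofReal |(realLin (v ξ * c) (v ξ * Complex.I)).det| * _
  rw [dens_eq (flow_mem_disk hφ hc0 (hWs hξ).1).1, abs_det_realLin, hc, mul_one,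
    abs_of_nonneg (by positivity)]
  have h1 := congrArg enorm (hv ξ hξ).1
  rw [enorm_mul, enorm_pow, enorm_one] at h1
  have h2 : ENNReal.ofReal (‖v ξ‖ ^ 2) = ‖v ξ‖ₑ ^ 2 := by
    rw [ENNReal.ofReal_pow (norm_nonneg _), ofReal_norm]
  rw [h2, mul_left_comm, mul_comm (‖v ξ‖ₑ ^ 2), h1, mul_one]

theorem lintegral_complex_eq {F : ℂ → ℝ≥0∞} (hF : Measurable F) :
    ∫⁻ ξ, F ξ = ∫⁻ y : ℝ, ∫⁻ x : ℝ, F ⟨x, y⟩ := by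
  rw [← (Complex.volume_preserving_equiv_real_prod.symm).lintegral_comp hF]
  have hm : Measurable fun p : ℝ × ℝ => F (Complex.measurableEquivRealProd.symm p) :=
    hF.comp (MeasurableEquiv.measurable _)
  rw [Measure.volume_eq_prod, lintegral_prod_symm _ hm.aemeasurable]
  rfl

/-- A measurable version of the flow. -/
def mflow (φ : ℂ → ℂ) (Ψ : ℂ → ℂ) (c : ℂ) (h : ℝ) : ℂ → ℂ :=
  (flowDom φ Ψ c h).indicator (flow φ Ψ c)

theorem mflow_eq {h : ℝ} {ξ : ℂ} (hξ : ξ ∈ flowDom φ Ψ c h) :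
    mflow φ Ψ c h ξ = flow φ Ψ c ξ := indicator_of_mem hξ _

theorem IsChart.measurable_mflow (hφ : DifferentiableOn ℂ φ disk) (hΨ : IsChart φ r Ψ)
    (hc : c.re = 1) {h : ℝ} (hr : h ≤ r / 4) : Measurable (mflow φ Ψ c h) :=
  measurable_indicator_of_continuousOn (hΨ.isOpen_flowDom hφ hc hr).measurableSet
    (hΨ.continuousOn_flow hφ hc hr)

theorem IsChart.measurable_indicator_flow (hφ : DifferentiableOn ℂ φ disk) (hΨ : IsChart φ r Ψ)
    (hc : c.re = 1) {h : ℝ} (hr : h ≤ r / 4) {g : ℂ → ℝ≥0∞} (hg : Measurable g) :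
    Measurable ((flowDom φ Ψ c h).indicator fun ξ => g (flow φ Ψ c ξ)) := by
  have : ((flowDom φ Ψ c h).indicator fun ξ => g (flow φ Ψ c ξ)) =
      (flowDom φ Ψ c h).indicator fun ξ => g (mflow φ Ψ c h ξ) :=
    indicator_congr fun ξ hξ => by rw [mflow_eq hξ]
  rw [this]
  exact (hg.comp (hΨ.measurable_mflow hφ hc hr)).indicator
    (hΨ.isOpen_flowDom hφ hc hr).measurableSet

theorem IsChart.lintegral_flow_lines_le (hφ : DifferentiableOn ℂ φ disk) (hΨ : IsChart φ r Ψ)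
    (hc : c.re = 1) {h : ℝ} (hr : h ≤ r / 4) {g : ℂ → ℝ≥0∞} (hg : Measurable g) :
    ∫⁻ y : ℝ, ∫⁻ x : ℝ, (flowDom φ Ψ c h).indicator (fun ξ => g (flow φ Ψ c ξ)) ⟨x, y⟩ ≤
      ∫⁻ z, g z * dens φ z := by
  rw [← lintegral_complex_eq (hΨ.measurable_indicator_flow hφ hc hr hg),
    lintegral_indicator (hΨ.isOpen_flowDom hφ hc hr).measurableSet,
    hΨ.lintegral_flow hφ hc hr (hΨ.isOpen_flowDom hφ hc hr).measurableSet subset_rfl]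
  exact setLIntegral_le_lintegral _ _

theorem IsChart.ae_flow_line_lt_top (hφ : DifferentiableOn ℂ φ disk) (hΨ : IsChart φ r Ψ)
    (hc : c.re = 1) {h : ℝ} (hr : h ≤ r / 4) {g : ℂ → ℝ≥0∞} (hg : Measurable g)
    (hfin : ∫⁻ z, g z * dens φ z < ⊤) :
    ∀ᵐ y : ℝ, ∫⁻ x : ℝ, (flowDom φ Ψ c h).indicator (fun ξ => g (flow φ Ψ c ξ)) ⟨x, y⟩ < ⊤ := by
  refine ae_lt_top ?_ ((hΨ.lintegral_flow_lines_le hφ hc hr hg).trans_lt hfin).ne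
  have hm := hΨ.measurable_indicator_flow hφ hc hr hg
  have : Measurable fun p : ℝ × ℝ => (flowDom φ Ψ c h).indicator (fun ξ => g (flow φ Ψ c ξ))
      (⟨p.2, p.1⟩ : ℂ) := by
    refine hm.comp ?_
    exact (MeasurableEquiv.measurable Complex.measurableEquivRealProd.symm).comp measurable_swap
  exact this.lintegral_prod_right'

/-- The integrand for Euclidean length along a straight arc. -/
def speed (φ : ℂ → ℂ) (c : ℂ) (z : ℂ) : ℝ≥0∞ := ‖c‖ₑ * (dens φ z) ^ (-(1 / 2) : ℝ)

theorem measurable_speed (hφ : DifferentiableOn ℂ φ disk) : Measurable (speed φ c) :=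
  ((measurable_dens hφ).pow_const _).const_mul _

theorem enorm_deriv_eq_speed {z v : ℂ} (hz : z ∈ disk) (hv : φ z * v ^ 2 = c ^ 2) (hc : c ≠ 0) :
    ‖v‖ₑ = speed φ c z := by
  rw [speed, dens_eq hz]
  have h0 : φ z ≠ 0 := fun h => by rw [h, zero_mul] at hv; exact pow_ne_zero 2 hc hv.symm
  have h1 := congrArg enorm hv
  rw [enorm_mul, enorm_pow, enorm_pow] at h1
  have hp : ‖φ z‖ₑ ≠ 0 := enorm_ne_zero.2 h0
  have ht : ‖φ z‖ₑ ≠ ⊤ := enorm_ne_top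
  have h2 : ‖c‖ₑ = ‖φ z‖ₑ ^ (1 / 2 : ℝ) * ‖v‖ₑ := by
    have h3 : (‖c‖ₑ ^ 2) ^ (1 / 2 : ℝ) = ‖c‖ₑ := by
      rw [← ENNReal.rpow_natCast, ← ENNReal.rpow_mul]; norm_num
    have h4 : (‖v‖ₑ ^ 2) ^ (1 / 2 : ℝ) = ‖v‖ₑ := by
      rw [← ENNReal.rpow_natCast, ← ENNReal.rpow_mul]; norm_num
    rw [← h3, ← h1, ENNReal.mul_rpow_of_nonneg _ _ (by norm_num), h4]
  rw [h2, mul_right_comm, ← ENNReal.rpow_add _ _ hp ht]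
  norm_num

/-- The density of Euclidean length with respect to `φ`-area is a multiple of `|φ|^(-1/2)`, so the
Cauchy-Schwarz inequality bounds the integral by the roots of the two areas. -/
theorem lintegral_speed_le (hφ : DifferentiableOn ℂ φ disk) {S : Set ℂ} (hS : MeasurableSet S) :
    ∫⁻ z, S.indicator (speed φ c) z * dens φ z ≤
      ‖c‖ₑ * ((∫⁻ z in S, dens φ z) ^ (1 / 2 : ℝ) * volume S ^ (1 / 2 : ℝ)) := by
  have h1 : ∀ z, S.indicator (speed φ c) z * dens φ z ≤
      ‖c‖ₑ * S.indicator (fun z => (dens φ z) ^ (1 / 2 : ℝ) * 1) z := by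
    intro z
    by_cases hz : z ∈ S
    · rw [indicator_of_mem hz, indicator_of_mem hz, speed, mul_assoc, mul_one]
      gcongr
      have ht : dens φ z ≠ ⊤ := by
        by_cases hd : z ∈ disk
        · rw [dens_eq hd]; exact enorm_ne_top
        · rw [dens, indicator_of_notMem hd]; exact ENNReal.zero_ne_top
      -- At zeros of the density `speed` may be infinite, but its product with the density is `0` by
      -- convention.
      by_cases h0 : dens φ z = 0
      · rw [h0, mul_zero]; exact zero_le
      · nth_rewrite 2 [← ENNReal.rpow_one (dens φ z)]
        rw [← ENNReal.rpow_add _ _ h0 ht]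
        norm_num
    · rw [indicator_of_notMem hz, zero_mul]; exact zero_le
  refine (lintegral_mono h1).trans ?_
  have hm := measurable_dens hφ
  rw [lintegral_const_mul _ (((hm.pow_const _).mul_const _).indicator hS), lintegral_indicator hS]
  gcongr
  have := ENNReal.lintegral_mul_le_Lp_mul_Lq (volume.restrict S) Real.HolderConjugate.two_two
    (f := fun z => (dens φ z) ^ (1 / 2 : ℝ)) (g := fun _ => 1) (hm.pow_const _).aemeasurable
    aemeasurable_const
  refine this.trans (le_of_eq ?_)
  congr 2
  · refine lintegral_congr fun z => ?_
    rw [← ENNReal.rpow_mul]; norm_num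
  · simp

theorem IsTraj.enorm_sub_le (hφ : DifferentiableOn ℂ φ disk) (hc : c ≠ 0) {a b x₁ x₂ : ℝ}
    {γ : ℝ → ℂ} (h : IsTraj φ c (Ioo a b) γ) (ha : a < x₁) (hx : x₁ ≤ x₂) (hb : x₂ < b) :
    ‖γ x₂ - γ x₁‖ₑ ≤ ∫⁻ x in Ioc x₁ x₂, speed φ c (γ x) := by
  have hsub : ∀ x ∈ Icc x₁ x₂, x ∈ Ioo a b := fun x hx => ⟨by linarith [hx.1], by linarith [hx.2]⟩
  have hcont : ContinuousOn (deriv γ) (Icc x₁ x₂) := fun x hx =>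
    (h.continuousAt_deriv hφ isOpen_Ioo hc (hsub x hx)).continuousWithinAt
  have := intervalIntegral.integral_eq_sub_of_hasDerivAt (f := γ) (f' := deriv γ) (a := x₁) (b := x₂)
    (fun x hx' => h.hasDerivAt (hsub x (by rwa [uIcc_of_le hx] at hx')))
    (ContinuousOn.intervalIntegrable (by rwa [uIcc_of_le hx]))
  rw [← this, intervalIntegral.integral_of_le hx]
  refine (enorm_integral_le_lintegral_enorm _).trans (le_of_eq ?_)
  refine setLIntegral_congr_fun measurableSet_Ioc fun x hx' => ?_
  have hm := hsub x (Ioc_subset_Icc_self hx')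
  exact enorm_deriv_eq_speed (h x hm).1 (h.sq hm) hc

end TeichDisk
end

noncomputable section
namespace TeichDisk

/-! ### Maximal flow lines and their end points -/

variable {φ : ℂ → ℂ} {r : ℝ} {Ψ : ℂ → ℂ} {c : ℂ}

theorem IsChart.exists_flowLine (h : IsChart φ r Ψ) (hc : c ≠ 0) {y : ℝ} (hy : |y| < r) :
    ∃ a b γ, IsFlowLine φ Ψ c y a b γ := by
  have hcn : 0 < ‖c‖ := norm_pos_iff.2 hc
  set δ := (r - |y|) / ‖c‖ with hδ
  have hδ0 : 0 < δ := div_pos (by linarith) hcn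
  have hm : ∀ t ∈ Ioo (-δ) δ, (y : ℂ) * Complex.I + c * t ∈ Metric.ball (0 : ℂ) r := fun t ht => by
    have h1 : |t| < δ := abs_lt.2 ht
    rw [hδ, lt_div_iff₀ hcn] at h1
    rw [mem_ball_zero_iff]
    refine (norm_add_le _ _).trans_lt ?_
    rw [norm_mul, norm_mul, Complex.norm_real, Complex.norm_real, Complex.norm_I, mul_one,
      Real.norm_eq_abs, Real.norm_eq_abs]
    linarith
  have h0 : (0 : ℝ) ∈ Ioo (-δ) δ := ⟨by linarith, hδ0⟩
  refine ⟨-δ, δ, fun t : ℝ => Ψ (y * Complex.I + c * t), ?_, h0, by simp, ?_⟩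
  · have := (h.flat.line (y * Complex.I) c).mono (J := Ioo (-δ) δ) hm
    rwa [one_mul] at this
  · rw [(h.flat.hasDerivAt_line _ _ (hm 0 h0)).deriv]; simp

theorem uIcc_subset_slice {y x : ℝ} (hx : (⟨x, y⟩ : ℂ) ∈ flowSet φ Ψ c) :
    uIcc 0 x ⊆ {x | (⟨x, y⟩ : ℂ) ∈ flowSet φ Ψ c} := by
  obtain ⟨a, b, γ, h1, h2⟩ := hx
  intro t ht
  exact ⟨a, b, γ, h1, ordConnected_Ioo.uIcc_subset h1.zero_mem h2 ht⟩

/-- A maximal flow line of finite length. -/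
theorem IsChart.exists_maximal (hφ : DifferentiableOn ℂ φ disk) (h : IsChart φ r Ψ) (hc : c ≠ 0)
    {y : ℝ} (hy : |y| < r) (hfin : volume {x : ℝ | (⟨x, y⟩ : ℂ) ∈ flowSet φ Ψ c} < ⊤) :
    ∃ A B : ℝ, A < 0 ∧ 0 < B ∧ (∀ x : ℝ, (⟨x, y⟩ : ℂ) ∈ flowSet φ Ψ c ↔ x ∈ Ioo A B) ∧
      IsFlowLine φ Ψ c y A B (fun x => flow φ Ψ c ⟨x, y⟩) := by
  set X := {x : ℝ | (⟨x, y⟩ : ℂ) ∈ flowSet φ Ψ c} with hX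
  obtain ⟨a₀, b₀, γ₀, h₀⟩ := h.exists_flowLine hc hy
  have hX0 : (0 : ℝ) ∈ X := h₀.mem_flowSet h₀.zero_mem
  have hXo : IsOpen X := by
    rw [isOpen_iff_mem_nhds]
    rintro x ⟨a, b, γ, h1, h2⟩
    filter_upwards [isOpen_Ioo.mem_nhds h2] with t ht using ⟨a, b, γ, h1, ht⟩
  -- With `x` the whole interval between `0` and `x` belongs to the slice, so finite measure makes
  -- the slice bounded.
  have hbd : ∀ x ∈ X, |x| ≤ (volume X).toReal := fun x hx => by
    have h1 : volume (uIcc 0 x) ≤ volume X := measure_mono (uIcc_subset_slice hx)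
    rw [Real.volume_interval, sub_zero] at h1
    have := ENNReal.toReal_mono hfin.ne h1
    rwa [ENNReal.toReal_ofReal (abs_nonneg x)] at this
  have hba : BddAbove X := ⟨_, fun x hx => (le_abs_self x).trans (hbd x hx)⟩
  have hbb : BddBelow X := ⟨-(volume X).toReal, fun x hx => by
    linarith [neg_abs_le x, hbd x hx]⟩
  have hpc : IsPreconnected X := isPreconnected_of_forall 0 fun x hx =>
    ⟨uIcc 0 x, uIcc_subset_slice hx, left_mem_uIcc, right_mem_uIcc, isPreconnected_uIcc⟩
  have hXeq : X = Ioo (sInf X) (sSup X) := by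
    refine subset_antisymm (fun x hx => ?_) (IsConnected.Ioo_csInf_csSup_subset ⟨⟨0, hX0⟩, hpc⟩ hbb hba)
    obtain ⟨ε, hε, hball⟩ := Metric.isOpen_iff.1 hXo x hx
    have m1 : x + ε / 2 ∈ X := hball (by
      rw [Metric.mem_ball, Real.dist_eq, abs_lt]; constructor <;> linarith)
    have m2 : x - ε / 2 ∈ X := hball (by
      rw [Metric.mem_ball, Real.dist_eq, abs_lt]; constructor <;> linarith)
    exact ⟨by linarith [csInf_le hbb m2], by linarith [le_csSup hba m1]⟩
  have hmem : ∀ x : ℝ, (⟨x, y⟩ : ℂ) ∈ flowSet φ Ψ c ↔ x ∈ Ioo (sInf X) (sSup X) := fun x => by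
    rw [← hXeq]; rfl
  have h0m : (0 : ℝ) ∈ Ioo (sInf X) (sSup X) := (hmem 0).1 hX0
  have hloc : ∀ {a b : ℝ} {γ : ℝ → ℂ}, IsFlowLine φ Ψ c y a b γ →
      EqOn (fun x => flow φ Ψ c ⟨x, y⟩) γ (Ioo a b) := fun h1 x hx => h1.flow_eq hφ hc hx
  refine ⟨sInf X, sSup X, h0m.1, h0m.2, hmem, fun x hx => ?_, h0m, ?_, ?_⟩
  · obtain ⟨a, b, γ, h1, h2⟩ := (hmem x).2 hx
    exact h1.traj.congr_of_isOpen isOpen_Ioo (hloc h1) x h2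
  · rw [← h₀.map_zero]; exact hloc h₀ h₀.zero_mem
  · rw [← h₀.deriv_zero]
    exact ((hloc h₀).eventuallyEq_of_mem (isOpen_Ioo.mem_nhds h₀.zero_mem)).deriv_eq

/-- Finite Euclidean length makes the arc a Cauchy filter at its end. -/
theorem IsTraj.exists_tendsto (hφ : DifferentiableOn ℂ φ disk) (hc : c ≠ 0) {a b x₀ : ℝ}
    {γ : ℝ → ℂ} (h : IsTraj φ c (Ioo a b) γ) (ha : a < x₀) (hb : x₀ < b)
    (hfin : ∫⁻ x in Ioo x₀ b, speed φ c (γ x) < ⊤) :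
    ∃ p, ‖p‖ ≤ 1 ∧ Tendsto γ (𝓝[<] b) (𝓝 p) := by
  have hμ : Tendsto (fun x => (volume.restrict (Ioo x₀ b)) (Ioo x b)) (𝓝[<] b) (𝓝 0) := by
    refine tendsto_of_tendsto_of_tendsto_of_le_of_le tendsto_const_nhds
      (h := fun x => ENNReal.ofReal (b - x)) ?_ (fun _ => zero_le) fun x => ?_
    · have : Tendsto (fun x => ENNReal.ofReal (b - x)) (𝓝 b) (𝓝 (ENNReal.ofReal (b - b))) := by
        exact (ENNReal.continuous_ofReal.comp (continuous_const.sub continuous_id)).tendsto b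
      rw [sub_self, ENNReal.ofReal_zero] at this
      exact this.mono_left nhdsWithin_le_nhds
    · exact (Measure.restrict_apply_le _ _).trans (by rw [Real.volume_Ioo])
  have ht := tendsto_setLIntegral_zero hfin.ne hμ
  have hne : (𝓝[<] b).NeBot := inferInstance
  have hcauchy : Cauchy (map γ (𝓝[<] b)) := by
    rw [Metric.cauchy_iff]
    refine ⟨inferInstance, fun ε hε => ?_⟩
    obtain ⟨x₁, hx₁, hx₁'⟩ := ((ht.eventually (gt_mem_nhds (ENNReal.ofReal_pos.2 hε))).and
      (Ioo_mem_nhdsLT hb)).exists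
    refine ⟨γ '' Ioo x₁ b, image_mem_map (Ioo_mem_nhdsLT hx₁'.2), ?_⟩
    have key : ∀ s ∈ Ioo x₁ b, ∀ t ∈ Ioo x₁ b, s ≤ t → dist (γ t) (γ s) < ε := by
      intro s hs t ht hst
      have h1 := h.enorm_sub_le hφ hc (by linarith [hs.1, hx₁'.1]) hst ht.2
      have h2 : ∫⁻ x in Ioc s t, speed φ c (γ x) ≤
          ∫⁻ x in Ioo x₁ b, speed φ c (γ x) ∂(volume.restrict (Ioo x₀ b)) := by
        rw [Measure.restrict_restrict measurableSet_Ioo]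
        refine lintegral_mono_set fun x hx => ⟨⟨by linarith [hx.1, hs.1], by linarith [hx.2, ht.2]⟩,
          by linarith [hx.1, hs.1, hx₁'.1], by linarith [hx.2, ht.2]⟩
      have h3 := (h1.trans h2).trans_lt hx₁
      rw [dist_eq_norm]
      rw [← ofReal_norm, ENNReal.ofReal_lt_ofReal_iff hε] at h3
      exact h3
    rintro _ ⟨s, hs, rfl⟩ _ ⟨t, ht, rfl⟩
    rcases le_total s t with hst | hst
    · rw [dist_comm]; exact key s hs t ht hst
    · exact key t ht s hs hst
  obtain ⟨p, hp⟩ := CompleteSpace.complete hcauchy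
  refine ⟨p, ?_, hp⟩
  refine le_of_tendsto (tendsto_norm.comp hp) ?_
  filter_upwards [Ioo_mem_nhdsLT hb] with x hx
  have := (h x ⟨by linarith [hx.1], hx.2⟩).1
  rw [disk, mem_ball_zero_iff] at this
  exact this.le

/-- A straight arc which ends at a regular point can be continued. -/
theorem IsTraj.extend_right (hφ : DifferentiableOn ℂ φ disk) (hc : c ≠ 0) {a b : ℝ} (hab : a < b)
    {γ : ℝ → ℂ} (h : IsTraj φ c (Ioo a b) γ) {p : ℂ} (hp : Tendsto γ (𝓝[<] b) (𝓝 p))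
    (hpd : p ∈ disk) (hp0 : φ p ≠ 0) :
    ∃ b' > b, ∃ γ', IsTraj φ c (Ioo a b') γ' ∧ EqOn γ' γ (Ioo a b) := by
  have hcont : ContinuousAt φ p := (hφ.differentiableAt (isOpen_disk.mem_nhds hpd)).continuousAt
  obtain ⟨ε, hε, hball⟩ := Metric.nhds_basis_closedBall.mem_iff.1
    ((hcont.eventually_ne hp0).and (isOpen_disk.mem_nhds hpd))
  -- Flat disks have a uniform radius `r` near the regular point `p`, so the disk about a point
  -- reached later than `b - r` extends the arc beyond `b`.
  obtain ⟨r, hr, hu⟩ := exists_uniform_flat hφ hc (isCompact_closedBall p ε)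
    fun z hz => ⟨(hball hz).2, (hball hz).1⟩
  obtain ⟨x, hx1, hx2⟩ := ((hp.eventually (Metric.closedBall_mem_nhds p hε)).and
    (Ioo_mem_nhdsLT (max_lt hab (show b - r < b by linarith)))).exists
  have hxm : x ∈ Ioo a b := ⟨lt_of_le_of_lt (le_max_left _ _) hx2.1, hx2.2⟩
  have hxr : b - r < x := lt_of_le_of_lt (le_max_right _ _) hx2.1
  obtain ⟨Ξ, k1, k2, k3⟩ := hu (γ x) hx1 (deriv γ x) (h.sq hxm)
  have hm : ∀ t ∈ Ioo (x - r) (x + r), (-x : ℂ) + 1 * t ∈ Metric.ball (0 : ℂ) r := fun t ht => by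
    rw [mem_ball_zero_iff, show (-x : ℂ) + 1 * t = ((t - x : ℝ) : ℂ) by push_cast; ring,
      Complex.norm_real, Real.norm_eq_abs, abs_lt]
    constructor <;> linarith [ht.1, ht.2]
  have hl : IsTraj φ c (Ioo (x - r) (x + r)) (fun t : ℝ => Ξ (-x + 1 * t)) := by
    have := (k1.line (-x) 1).mono (J := Ioo (x - r) (x + r)) hm
    rwa [mul_one] at this
  have hxx : x ∈ Ioo (x - r) (x + r) := ⟨by linarith, by linarith⟩
  obtain ⟨γ₁, g1, g2, -⟩ := h.exists_union hφ hc hl hxm hxx (by simp [k2]) (by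
    rw [(k1.hasDerivAt_line _ 1 (hm x hxx)).deriv]; simp [k3])
  refine ⟨max b (x + r), lt_max_of_lt_right (by linarith), γ₁, g1.mono ?_, g2⟩
  exact Ioo_subset_Ioo_left (min_le_left _ _)

theorem IsFlowLine.extend_right (hφ : DifferentiableOn ℂ φ disk) (hc : c ≠ 0) {y a b : ℝ}
    {γ : ℝ → ℂ} (h : IsFlowLine φ Ψ c y a b γ) {p : ℂ} (hp : Tendsto γ (𝓝[<] b) (𝓝 p))
    (hpd : p ∈ disk) (hp0 : φ p ≠ 0) : (⟨b, y⟩ : ℂ) ∈ flowSet φ Ψ c := by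
  have h0 := h.zero_mem
  obtain ⟨b', hb', γ', h1, h2⟩ := h.traj.extend_right hφ hc (h0.1.trans h0.2) hp hpd hp0
  refine ⟨a, b', γ', ⟨h1, ⟨h0.1, h0.2.trans hb'⟩, by rw [h2 h0, h.map_zero], ?_⟩, ⟨h0.1.trans h0.2, hb'⟩⟩
  rw [(h2.eventuallyEq_of_mem (isOpen_Ioo.mem_nhds h0)).deriv_eq, h.deriv_zero]

/-- Turning the chart by a half turn exchanges the two ends of a flow line, so statements about
right ends imply those about left ends. -/
theorem IsFlowLine.neg (hΨ : IsChart φ r Ψ) {y a b : ℝ} (hy : |y| < r) {γ : ℝ → ℂ}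
    (h : IsFlowLine φ Ψ c y a b γ) :
    IsFlowLine φ (fun ζ => Ψ (-ζ)) c (-y) (-b) (-a) (fun x => γ (-x)) := by
  have h0 := h.zero_mem
  refine ⟨?_, ⟨by linarith [h0.2], by linarith [h0.1]⟩, ?_, ?_⟩
  · have := h.traj.comp_sub 0
    simp only [zero_sub] at this
    exact this.mono fun t ht => ⟨by linarith [ht.2], by linarith [ht.1]⟩
  · simp [h.map_zero]
  · rw [hΨ.deriv_neg (norm_I_mul_lt (by rwa [abs_neg])), deriv_comp_neg, neg_zero, h.deriv_zero]
    have : -(((-y : ℝ) : ℂ) * Complex.I) = y * Complex.I := by push_cast; ring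
    rw [this, neg_mul]

/-- Almost no flow line ends at a given point. -/
theorem IsChart.volume_land_eq_zero (hφ : DifferentiableOn ℂ φ disk) (hi : IntegrableOn φ disk)
    (hΨ : IsChart φ r Ψ) (hc : c.re = 1) (p : ℂ) :
    volume {y : ℝ | |y| < r / 4 ∧ ∃ a b γ, IsFlowLine φ Ψ c y a b γ ∧
      Tendsto γ (𝓝[<] b) (𝓝 p)} = 0 := by
  have hc0 : c ≠ 0 := fun h0 => by simp [h0] at hc
  have hr := hΨ.pos
  set N := {y : ℝ | |y| < r / 4 ∧ ∃ a b γ, IsFlowLine φ Ψ c y a b γ ∧ Tendsto γ (𝓝[<] b) (𝓝 p)}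
  have hm := measurable_dens hφ
  set F : ℝ → ℝ → ℝ≥0∞ := fun ρ y => ∫⁻ x : ℝ, (flowDom φ Ψ c (r / 4)).indicator
    (fun ξ => (Metric.ball p ρ).indicator (speed φ c) (flow φ Ψ c ξ)) ⟨x, y⟩ with hF
  -- From the last time at distance `ρ` from `p` to a time at distance below `ρ / 2` the line stays
  -- in the ball and covers Euclidean length at least `ρ / 2`.
  have hlow : ∀ ρ > 0, ∀ y ∈ N, ρ < dist (Ψ (y * Complex.I)) p → ENNReal.ofReal (ρ / 2) ≤ F ρ y := by
    rintro ρ hρ y ⟨hy, a, b, γ, h1, h2⟩ hyρ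
    have h0 := h1.zero_mem
    obtain ⟨x₂, hx₂, hx₂'⟩ := ((h2.eventually (Metric.ball_mem_nhds p (half_pos hρ))).and
      (Ioo_mem_nhdsLT h0.2)).exists
    have hcont : ContinuousOn (fun x => dist (γ x) p) (Icc 0 x₂) :=
      (continuous_id.dist continuous_const).comp_continuousOn (h1.traj.continuousOn.mono fun x hx =>
        ⟨by linarith [hx.1, h0.1], by linarith [hx.2, hx₂'.2]⟩)
    have hK : IsCompact (Icc 0 x₂ ∩ (fun x => dist (γ x) p) ⁻¹' Ici ρ) :=
      isCompact_Icc.of_isClosed_subset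
        (hcont.preimage_isClosed_of_isClosed isClosed_Icc isClosed_Ici) inter_subset_left
    obtain ⟨x₁, ⟨hx₁, hx₁ρ⟩, hmax⟩ := hK.exists_isGreatest
      ⟨0, ⟨le_rfl, hx₂'.1.le⟩, by
        change ρ ≤ dist (γ 0) p
        rw [h1.map_zero]; exact hyρ.le⟩
    have hlt : ∀ x ∈ Ioc x₁ x₂, γ x ∈ Metric.ball p ρ := fun x hx => by
      by_contra hno
      rw [Metric.mem_ball, not_lt] at hno
      exact absurd (hmax ⟨⟨hx₁.1.trans hx.1.le, hx.2⟩, hno⟩) (not_le.2 hx.1)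
    have h3 := h1.traj.enorm_sub_le hφ hc0 (by linarith [hx₁.1, h0.1]) hx₁.2 hx₂'.2
    have h4 : ENNReal.ofReal (ρ / 2) ≤ ‖γ x₂ - γ x₁‖ₑ := by
      rw [← ofReal_norm]
      refine ENNReal.ofReal_le_ofReal ?_
      have e1 : dist (γ x₁) p ≤ dist (γ x₁) (γ x₂) + dist (γ x₂) p := dist_triangle _ _ _
      have e2 : ρ ≤ dist (γ x₁) p := hx₁ρ
      have e3 : dist (γ x₂) p < ρ / 2 := hx₂
      have e4 : dist (γ x₁) (γ x₂) = ‖γ x₂ - γ x₁‖ := by rw [dist_comm, dist_eq_norm]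
      linarith
    refine h4.trans (h3.trans ?_)
    rw [hF, ← lintegral_indicator measurableSet_Ioc]
    refine lintegral_mono fun x => ?_
    by_cases hx : x ∈ Ioc x₁ x₂
    · have hxm : x ∈ Ioo a b := ⟨by linarith [hx.1, hx₁.1, h0.1], by linarith [hx.2, hx₂'.2]⟩
      rw [indicator_of_mem hx, indicator_of_mem (show (⟨x, y⟩ : ℂ) ∈ flowDom φ Ψ c (r / 4) from
        ⟨h1.mem_flowSet hxm, hy⟩), h1.flow_eq hφ hc0 hxm, indicator_of_mem (hlt x hx)]
    · rw [indicator_of_notMem hx]; exact zero_le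
  have hup : ∀ ρ > 0, ∫⁻ y, F ρ y ≤ ‖c‖ₑ * ((∫⁻ z in Metric.ball p ρ, dens φ z) ^ (1 / 2 : ℝ) *
      (ENNReal.ofReal ρ * NNReal.pi ^ (1 / 2 : ℝ))) := by
    intro ρ hρ
    refine (hΨ.lintegral_flow_lines_le hφ hc le_rfl
      ((measurable_speed hφ).indicator measurableSet_ball)).trans
      ((lintegral_speed_le hφ measurableSet_ball).trans (le_of_eq ?_))
    rw [Complex.volume_ball, ENNReal.mul_rpow_of_nonneg _ _ (by norm_num)]
    congr 3
    rw [← ENNReal.rpow_natCast, ← ENNReal.rpow_mul]; norm_num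
  -- The radius `ρ'` on the left cancels against the root of the Euclidean area of the ball. Only
  -- the root of its `φ`-area remains, which tends to zero with `ρ'`.
  have hmeas : ∀ ρ > 0, ∀ ρ' > 0, ρ' ≤ ρ →
      volume {y ∈ N | ρ < dist (Ψ (y * Complex.I)) p} ≤
      2 * (‖c‖ₑ * ((∫⁻ z in Metric.ball p ρ', dens φ z) ^ (1 / 2 : ℝ) * NNReal.pi ^ (1 / 2 : ℝ))) := by
    intro ρ hρ ρ' hρ' hle
    have h1 : ENNReal.ofReal (ρ' / 2) * volume {y ∈ N | ρ < dist (Ψ (y * Complex.I)) p} ≤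
        ∫⁻ y, F ρ' y := by
      refine le_trans ?_ (mul_meas_ge_le_lintegral₀ ?_ (ENNReal.ofReal (ρ' / 2)))
      · refine mul_le_mul' le_rfl (measure_mono ?_)
        rintro y ⟨hy1, hy2⟩
        exact hlow ρ' hρ' y hy1 (hle.trans_lt hy2)
      · have hmi := hΨ.measurable_indicator_flow hφ hc (le_refl (r / 4))
          ((measurable_speed (c := c) hφ).indicator (measurableSet_ball (x := p) (ε := ρ')))
        have : Measurable fun q : ℝ × ℝ => (flowDom φ Ψ c (r / 4)).indicator (fun ξ =>
            (Metric.ball p ρ').indicator (speed φ c) (flow φ Ψ c ξ)) (⟨q.2, q.1⟩ : ℂ) :=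
          hmi.comp ((MeasurableEquiv.measurable Complex.measurableEquivRealProd.symm).comp
            measurable_swap)
        exact this.lintegral_prod_right'.aemeasurable
    have h2 := h1.trans (hup ρ' hρ')
    have h3 : ENNReal.ofReal (ρ' / 2) ≠ 0 := by rw [Ne, ENNReal.ofReal_eq_zero, not_le]; linarith
    rw [← ENNReal.mul_le_mul_iff_right h3 ENNReal.ofReal_ne_top]
    refine h2.trans (le_of_eq ?_)
    have h4 : ENNReal.ofReal ρ' = ENNReal.ofReal (ρ' / 2) * 2 := by
      rw [show (2 : ℝ≥0∞) = ENNReal.ofReal 2 by norm_num, ← ENNReal.ofReal_mul (by linarith)]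
      congr 1; ring
    rw [h4]; ring
  have hNρ : ∀ ρ > 0, volume {y ∈ N | ρ < dist (Ψ (y * Complex.I)) p} = 0 := by
    intro ρ hρ
    have hball : Tendsto (fun ρ' => volume (Metric.ball p ρ')) (𝓝[>] 0) (𝓝 0) := by
      have : Tendsto (fun ρ' : ℝ => ENNReal.ofReal ρ' ^ 2 * (NNReal.pi : ℝ≥0∞)) (𝓝 0)
          (𝓝 (ENNReal.ofReal 0 ^ 2 * (NNReal.pi : ℝ≥0∞))) := by
        refine ENNReal.Tendsto.mul_const ?_ (Or.inr ENNReal.coe_ne_top)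
        exact (ENNReal.continuous_pow 2).continuousAt.tendsto.comp
          (ENNReal.continuous_ofReal.tendsto 0)
      simp only [Complex.volume_ball]
      simp only [ENNReal.ofReal_zero, ne_eq, OfNat.ofNat_ne_zero, not_false_eq_true, zero_pow,
        zero_mul] at this
      exact this.mono_left nhdsWithin_le_nhds
    have h1 := tendsto_setLIntegral_zero (lintegral_dens_lt_top hi).ne hball
    have h2 : Tendsto (fun ρ' => 2 * (‖c‖ₑ * ((∫⁻ z in Metric.ball p ρ', dens φ z) ^ (1 / 2 : ℝ) *
        (NNReal.pi : ℝ≥0∞) ^ (1 / 2 : ℝ)))) (𝓝[>] 0) (𝓝 (2 * (‖c‖ₑ * ((0 : ℝ≥0∞) ^ (1 / 2 : ℝ) *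
        (NNReal.pi : ℝ≥0∞) ^ (1 / 2 : ℝ))))) := by
      refine ENNReal.Tendsto.const_mul (ENNReal.Tendsto.const_mul (ENNReal.Tendsto.mul_const
        ((ENNReal.continuous_rpow_const.tendsto 0).comp h1) (Or.inr ?_)) (Or.inr enorm_ne_top))
        (Or.inr (by norm_num))
      exact ENNReal.rpow_ne_top_of_nonneg (by norm_num) ENNReal.coe_ne_top
    rw [ENNReal.zero_rpow_of_pos (by norm_num), zero_mul, mul_zero, mul_zero] at h2
    refine le_antisymm (ge_of_tendsto h2 ?_) zero_le
    filter_upwards [Ioc_mem_nhdsGT hρ] with ρ' hρ'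
    exact hmeas ρ hρ ρ' hρ'.1 hρ'.2
  -- The only height not covered by the estimates is the one, if any, where the transversal passes
  -- through `p` itself.
  have hcover : N ⊆ (⋃ n : ℕ, {y ∈ N | 1 / ((n : ℝ) + 1) < dist (Ψ (y * Complex.I)) p}) ∪
      {y : ℝ | |y| < r ∧ Ψ (y * Complex.I) = p} := by
    intro y hy
    by_cases he : Ψ (y * Complex.I) = p
    · exact Or.inr ⟨by linarith [hy.1], he⟩
    · obtain ⟨n, hn⟩ := exists_nat_one_div_lt (dist_pos.2 he)
      exact Or.inl (mem_iUnion.2 ⟨n, hy, hn⟩)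
  refine measure_mono_null hcover (measure_union_null (measure_iUnion_null fun n =>
    hNρ _ (by positivity)) ?_)
  refine Set.Subsingleton.measure_zero (fun y hy y' hy' => ?_) _
  have := hΨ.inj (norm_I_mul_lt hy.1) (norm_I_mul_lt hy'.1) (hy.2.trans hy'.2.symm)
  have := mul_right_cancel₀ Complex.I_ne_zero this
  exact_mod_cast this

end TeichDisk
end

/-! ### Almost every trajectory runs from the unit circle to the unit circle -/

noncomputable section
namespace TeichDisk

variable {φ : ℂ → ℂ} {r : ℝ} {Ψ : ℂ → ℂ} {c : ℂ}

theorem countable_zeros (hφ : DifferentiableOn ℂ φ disk) (hne : ∃ z ∈ disk, φ z ≠ 0) :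
    {z | z ∈ disk ∧ φ z = 0}.Countable := by
  have : {z | z ∈ disk ∧ φ z = 0} ⊆
      ⋃ n : ℕ, {z | z ∈ Metric.closedBall (0 : ℂ) (1 - 1 / ((n : ℝ) + 1)) ∧ φ z = 0} := by
    rintro z ⟨hz, h0⟩
    rw [disk, mem_ball_zero_iff] at hz
    obtain ⟨n, hn⟩ := exists_nat_one_div_lt (sub_pos.2 hz)
    refine mem_iUnion.2 ⟨n, ?_, h0⟩
    rw [mem_closedBall_zero_iff]; linarith
  refine (countable_iUnion fun n => (finite_zeros hφ hne ?_).countable).mono this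
  have : (0 : ℝ) < 1 / ((n : ℝ) + 1) := by positivity
  linarith

/-- A point of the transversal whose flow line ends at both sides on the unit circle, outside of
`S`. -/
structure FullLine (φ : ℂ → ℂ) (Ψ : ℂ → ℂ) (c : ℂ) (S : Set ℂ) (y A B : ℝ) (p q : ℂ) : Prop where
  left_neg : A < 0
  right_pos : 0 < B
  mem_iff : ∀ x : ℝ, (⟨x, y⟩ : ℂ) ∈ flowSet φ Ψ c ↔ x ∈ Ioo A B
  line : IsFlowLine φ Ψ c y A B (fun x => flow φ Ψ c ⟨x, y⟩)
  norm_left : ‖p‖ = 1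
  norm_right : ‖q‖ = 1
  left_notMem : p ∉ S
  right_notMem : q ∉ S
  left_tendsto : Tendsto (fun x : ℝ => flow φ Ψ c ⟨x, y⟩) (𝓝[>] A) (𝓝 p)
  right_tendsto : Tendsto (fun x : ℝ => flow φ Ψ c ⟨x, y⟩) (𝓝[<] B) (𝓝 q)

/-- The integral of the lengths over all heights is at most the total `φ`-area, which is finite. -/
theorem IsChart.ae_volume_slice_lt_top (hφ : DifferentiableOn ℂ φ disk)
    (hi : IntegrableOn φ disk) (hΨ : IsChart φ r Ψ) (hc : c.re = 1) :
    ∀ᵐ y : ℝ, |y| < r / 4 → volume {x : ℝ | (⟨x, y⟩ : ℂ) ∈ flowSet φ Ψ c} < ⊤ := by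
  have h1 := hΨ.ae_flow_line_lt_top hφ hc le_rfl (g := fun _ => 1) measurable_const
    (by simpa using lintegral_dens_lt_top hi)
  filter_upwards [h1] with y hy hyr
  refine lt_of_le_of_lt ?_ hy
  have hm : MeasurableSet {x : ℝ | (⟨x, y⟩ : ℂ) ∈ flowDom φ Ψ c (r / 4)} :=
    (hΨ.isOpen_flowDom hφ hc le_rfl).measurableSet.preimage
      ((MeasurableEquiv.measurable Complex.measurableEquivRealProd.symm).comp
        (measurable_id.prodMk measurable_const))
  have e1 : {x : ℝ | (⟨x, y⟩ : ℂ) ∈ flowSet φ Ψ c} =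
      {x : ℝ | (⟨x, y⟩ : ℂ) ∈ flowDom φ Ψ c (r / 4)} := by
    ext x; exact ⟨fun h => ⟨h, hyr⟩, fun h => h.1⟩
  rw [e1, ← lintegral_indicator_one hm]
  exact lintegral_mono fun x => le_rfl

/-- Almost every line has finite time and finite Euclidean length, hence an end point. The points of
`S` and the zeros of `φ` are countably many, so almost no line ends there, and a line ending at a
regular interior point would not be maximal. -/
theorem IsChart.ae_lands_right (hφ : DifferentiableOn ℂ φ disk) (hi : IntegrableOn φ disk)
    (hne : ∃ z ∈ disk, φ z ≠ 0) (hΨ : IsChart φ r Ψ) (hc : c.re = 1) {S : Set ℂ}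
    (hS : S.Countable) :
    ∀ᵐ y : ℝ, |y| < r / 4 → ∃ A B : ℝ, A < 0 ∧ 0 < B ∧
      (∀ x : ℝ, (⟨x, y⟩ : ℂ) ∈ flowSet φ Ψ c ↔ x ∈ Ioo A B) ∧
      IsFlowLine φ Ψ c y A B (fun x => flow φ Ψ c ⟨x, y⟩) ∧
      ∃ p, ‖p‖ = 1 ∧ p ∉ S ∧ Tendsto (fun x : ℝ => flow φ Ψ c ⟨x, y⟩) (𝓝[<] B) (𝓝 p) := by
  have hc0 : c ≠ 0 := fun h0 => by simp [h0] at hc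
  have hr := hΨ.pos
  have h2 := hΨ.ae_flow_line_lt_top hφ hc le_rfl
    ((measurable_speed (c := c) hφ).indicator isOpen_disk.measurableSet) (by
      refine (lintegral_speed_le hφ isOpen_disk.measurableSet).trans_lt ?_
      refine ENNReal.mul_lt_top enorm_lt_top (ENNReal.mul_lt_top ?_ ?_)
      · exact ENNReal.rpow_lt_top_of_nonneg (by norm_num)
          ((setLIntegral_le_lintegral _ _).trans_lt (lintegral_dens_lt_top hi)).ne
      · exact ENNReal.rpow_lt_top_of_nonneg (by norm_num) measure_ball_lt_top.ne)
  have h3 : ∀ᵐ y : ℝ, ∀ p ∈ S ∪ {z | z ∈ disk ∧ φ z = 0}, ¬ (|y| < r / 4 ∧ ∃ a b γ,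
      IsFlowLine φ Ψ c y a b γ ∧ Tendsto γ (𝓝[<] b) (𝓝 p)) := by
    rw [ae_ball_iff (hS.union (countable_zeros hφ hne))]
    intro p _
    rw [ae_iff]
    simp only [not_not]
    exact hΨ.volume_land_eq_zero hφ hi hc p
  filter_upwards [hΨ.ae_volume_slice_lt_top hφ hi hc, h2, h3] with y hy1 hy2 hy3 hyr
  obtain ⟨A, B, hA, hB, hmem, hl⟩ := hΨ.exists_maximal hφ hc0 (y := y) (by linarith) (hy1 hyr)
  refine ⟨A, B, hA, hB, hmem, hl, ?_⟩
  obtain ⟨p, hp1, hp⟩ := hl.traj.exists_tendsto hφ hc0 hA hB (x₀ := 0) (by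
    refine lt_of_le_of_lt ?_ hy2
    rw [← lintegral_indicator measurableSet_Ioo]
    refine lintegral_mono fun x => ?_
    by_cases hx : x ∈ Ioo 0 B
    · have hxm : (⟨x, y⟩ : ℂ) ∈ flowSet φ Ψ c := (hmem x).2 ⟨hA.trans hx.1, hx.2⟩
      rw [indicator_of_mem hx, indicator_of_mem (show (⟨x, y⟩ : ℂ) ∈ flowDom φ Ψ c (r / 4) from
        ⟨hxm, hyr⟩), indicator_of_mem (flow_mem_disk hφ hc0 hxm).1]
    · rw [indicator_of_notMem hx]; exact zero_le)
  have hno : p ∉ S ∪ {z | z ∈ disk ∧ φ z = 0} := fun h => hy3 p h ⟨hyr, A, B, _, hl, hp⟩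
  rw [mem_union, not_or] at hno
  refine ⟨p, ?_, hno.1, hp⟩
  refine le_antisymm hp1 (not_lt.1 fun hlt => ?_)
  have hpd : p ∈ disk := by rw [disk, mem_ball_zero_iff]; exact hlt
  have := hl.extend_right hφ hc0 hp hpd fun h0 => hno.2 ⟨hpd, h0⟩
  exact lt_irrefl B ((hmem B).1 this).2

theorem IsChart.neg_flowSet (hΨ : IsChart φ r Ψ) {y x : ℝ} (hy : |y| < r)
    (h : (⟨x, y⟩ : ℂ) ∈ flowSet φ Ψ c) :
    (⟨-x, -y⟩ : ℂ) ∈ flowSet φ (fun ζ => Ψ (-ζ)) c := by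
  obtain ⟨a, b, γ, h1, h2⟩ := h
  have h3 : IsFlowLine φ Ψ c y a b γ := h1
  exact (h3.neg hΨ hy).mem_flowSet ⟨by linarith [h2.2], by linarith [h2.1]⟩

theorem IsChart.neg_flowSet_iff (hΨ : IsChart φ r Ψ) {y x : ℝ} (hy : |y| < r) :
    (⟨-x, -y⟩ : ℂ) ∈ flowSet φ (fun ζ => Ψ (-ζ)) c ↔ (⟨x, y⟩ : ℂ) ∈ flowSet φ Ψ c := by
  refine ⟨fun h => ?_, hΨ.neg_flowSet hy⟩
  have := hΨ.neg.neg_flowSet (by rwa [abs_neg]) h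
  simpa using this

theorem IsChart.neg_flow (hφ : DifferentiableOn ℂ φ disk) (hc : c ≠ 0) (hΨ : IsChart φ r Ψ)
    {y x : ℝ} (hy : |y| < r) (h : (⟨x, y⟩ : ℂ) ∈ flowSet φ Ψ c) :
    flow φ (fun ζ => Ψ (-ζ)) c ⟨-x, -y⟩ = flow φ Ψ c ⟨x, y⟩ := by
  obtain ⟨a, b, γ, h1, h2⟩ := h
  have h3 : IsFlowLine φ Ψ c y a b γ := h1
  have h4 : x ∈ Ioo a b := h2
  rw [h3.flow_eq hφ hc h4, (h3.neg hΨ hy).flow_eq hφ hc ⟨by linarith [h4.2], by linarith [h4.1]⟩,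
    neg_neg]

/-- The statement on right ends is applied to the chart and to the chart turned by a half turn. -/
theorem IsChart.ae_fullLine (hφ : DifferentiableOn ℂ φ disk) (hi : IntegrableOn φ disk)
    (hne : ∃ z ∈ disk, φ z ≠ 0) (hΨ : IsChart φ r Ψ) (hc : c.re = 1) {S : Set ℂ}
    (hS : S.Countable) :
    ∀ᵐ y : ℝ, |y| < r / 4 → ∃ A B p q, FullLine φ Ψ c S y A B p q := by
  have hc0 : c ≠ 0 := fun h0 => by simp [h0] at hc
  have hr := hΨ.pos
  have h1 := hΨ.ae_lands_right hφ hi hne hc hS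
  have h2 := (Measure.measurePreserving_neg (volume : Measure ℝ)).quasiMeasurePreserving.ae
    (hΨ.neg.ae_lands_right hφ hi hne hc hS)
  filter_upwards [h1, h2] with y hy1 hy2 hyr
  obtain ⟨A, B, hA, hB, hmem, hl, q, hq1, hqS, hq⟩ := hy1 hyr
  obtain ⟨A', B', hA', hB', hmem', hl', p, hp1, hpS, hp⟩ := hy2 (by rwa [abs_neg])
  have hyr' : |y| < r := by linarith
  have hiff : ∀ x : ℝ, -x ∈ Ioo A' B' ↔ x ∈ Ioo A B := fun x => by
    rw [← hmem', ← hmem, hΨ.neg_flowSet_iff hyr']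
  -- Both descriptions belong to the same maximal interval, reflected at the origin, so the end
  -- points match.
  have hBA : B' = -A := by
    refine le_antisymm (le_of_forall_lt fun z hz => ?_) (le_of_forall_lt fun z hz => ?_)
    · by_contra hno
      rw [not_lt] at hno
      have : -(-(max z ((0 + B') / 2))) ∈ Ioo A' B' := by
        rw [neg_neg]
        exact ⟨by linarith [le_max_right z ((0 + B') / 2)], max_lt hz (by linarith)⟩
      have := ((hiff _).1 this).1
      linarith [le_max_left z ((0 + B') / 2)]
    · by_contra hno
      rw [not_lt] at hno
      have : -(max z ((0 + -A) / 2)) ∈ Ioo A B :=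
        ⟨by linarith [max_lt hz (show (0 + -A) / 2 < -A by linarith)],
          by linarith [le_max_right z ((0 + -A) / 2)]⟩
      have := ((hiff _).2 this).2
      rw [neg_neg] at this
      linarith [le_max_left z ((0 + -A) / 2)]
  refine ⟨A, B, p, q, hA, hB, hmem, hl, hp1, hq1, hpS, hqS, ?_, hq⟩
  rw [hBA] at hp
  have hneg : Tendsto (fun x : ℝ => -x) (𝓝[>] A) (𝓝[<] (-A)) := tendsto_neg_nhdsGT
  refine (hp.comp hneg).congr' ?_
  filter_upwards [Ioo_mem_nhdsGT (hA.trans hB)] with x hx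
  exact hΨ.neg_flow hφ hc0 hyr' ((hmem x).2 hx)

end TeichDisk
end

noncomputable section
namespace TeichDisk

/-! ### The horizontal trajectories that a slanted trajectory meets -/

variable {φ : ℂ → ℂ} {r : ℝ} {Ψ : ℂ → ℂ} {c : ℂ}

/-- In the coordinates given by the horizontal flow, slanted trajectories are straight lines. -/
theorem IsChart.eventually_flow_one (hφ : DifferentiableOn ℂ φ disk) (h : IsChart φ r Ψ)
    (hc : c ≠ 0) {a b : ℝ} {P : ℝ → ℂ} (hP : IsTraj φ c (Ioo a b) P) {x : ℝ} (hx : x ∈ Ioo a b)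
    {x' y' : ℝ} (hy' : |y'| < r) (hm : (⟨x', y'⟩ : ℂ) ∈ flowSet φ Ψ 1)
    (e : P x = flow φ Ψ 1 ⟨x', y'⟩) :
    ∃ d : ℂ, (d = c ∨ d = -c) ∧ ∀ᶠ t in 𝓝 x,
      (⟨x' + d.re * (t - x), y' + d.im * (t - x)⟩ : ℂ) ∈ flowSet φ Ψ 1 ∧
      P t = flow φ Ψ 1 ⟨x' + d.re * (t - x), y' + d.im * (t - x)⟩ := by
  obtain ⟨A, B, γ, h1, h2⟩ := hm
  simp only at h1 h2
  rw [h1.flow_eq hφ one_ne_zero h2] at e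
  obtain ⟨δ, hδ, Ξ, hΞ, hΞγ, ε, hε, hmem, hline⟩ := h1.exists_flat hφ h one_ne_zero hy'
    (lt_min h1.zero_mem.1 h2.1) (min_le_left 0 x') (le_max_left 0 x') (max_lt h1.zero_mem.2 h2.2)
  set U := {ζ : ℂ | min 0 x' - δ < ζ.re ∧ ζ.re < max 0 x' + δ ∧ |ζ.im| < δ} with hU
  have hUo : IsOpen U := by
    refine (isOpen_lt continuous_const Complex.continuous_re).inter
      ((isOpen_lt Complex.continuous_re continuous_const).inter ?_)
    exact isOpen_lt (continuous_abs.comp Complex.continuous_im) continuous_const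
  have hx'I : x' ∈ Ioo (min 0 x' - δ / 2) (max 0 x' + δ / 2) :=
    ⟨by linarith [min_le_right 0 x'], by linarith [le_max_right 0 x']⟩
  -- The map `Ξ` flattens a neighbourhood of the whole horizontal line from the transversal to the
  -- point `P x`, so the two straight directions can be compared at the point itself.
  have hx'U : (x' : ℂ) ∈ U := ⟨by rw [Complex.ofReal_re]; linarith [hx'I.1],
    by rw [Complex.ofReal_re]; linarith [hx'I.2], by simpa using hδ⟩
  obtain ⟨ρ, hρ, hρU, hch⟩ := hΞ.exists_chart hUo hx'U
  have e0 : P x = (fun ζ => Ξ (x' + ζ)) 0 := by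
    simp only [add_zero]
    rw [e, (hΞγ x' ⟨by linarith [hx'I.1], by linarith [hx'I.2]⟩).1]
  obtain ⟨d, hd, hd'⟩ := hch.exists_dir hP hx (ζ := 0) (by simpa using hρ) e0
  refine ⟨d, hd, ?_⟩
  have t1 : ∀ᶠ t in 𝓝 x, t ∈ Ioo a b := isOpen_Ioo.mem_nhds hx
  have t2 : ∀ᶠ t : ℝ in 𝓝 x, ‖0 + d * ((t : ℂ) - x)‖ < ρ := by
    have : ContinuousAt (fun t : ℝ => ‖0 + d * ((t : ℂ) - x)‖) x := by fun_prop
    exact this.eventually_lt continuousAt_const (by simpa using hρ)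
  have t3 : ∀ᶠ t : ℝ in 𝓝 x, |y' + d.im * (t - x) - y'| < ε := by
    have : ContinuousAt (fun t : ℝ => |y' + d.im * (t - x) - y'|) x := by fun_prop
    exact this.eventually_lt continuousAt_const (by simpa using hε)
  have t4 : ∀ᶠ t : ℝ in 𝓝 x, x' + d.re * (t - x) ∈ Ioo (min 0 x' - δ / 2) (max 0 x' + δ / 2) := by
    have : ContinuousAt (fun t : ℝ => x' + d.re * (t - x)) x := by fun_prop
    exact this (isOpen_Ioo.mem_nhds (by simpa using hx'I))
  filter_upwards [t1, t2, t3, t4] with t k1 k2 k3 k4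
  have hl := hline _ k3
  refine ⟨hl.mem_flowSet k4, ?_⟩
  rw [hl.flow_eq hφ one_ne_zero k4, (hch.traj_eq hφ hc hP hx (by simpa using hρ) e0 hd' k1 k2).1]
  congr 1
  apply Complex.ext <;> simp

/-- The horizontal lines met by a trajectory of slope `β` and length `ℓ` have width at most
`|β| ℓ`. -/
theorem IsChart.volume_crossed_le (hφ : DifferentiableOn ℂ φ disk) (h : IsChart φ r Ψ)
    (hc : c ≠ 0) {a b : ℝ} {P : ℝ → ℂ} (hP : IsTraj φ c (Ioo a b) P) :
    volume {y' : ℝ | |y'| < r / 4 ∧ ∃ x ∈ Ioo a b, ∃ x' : ℝ, (⟨x', y'⟩ : ℂ) ∈ flowSet φ Ψ 1 ∧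
      P x = flow φ Ψ 1 ⟨x', y'⟩} ≤ ENNReal.ofReal |c.im| * ENNReal.ofReal (b - a) := by
  have hr := h.pos
  set R : ℝ → ℂ → Prop := fun x ξ => ξ ∈ flowSet φ Ψ 1 ∧ |ξ.im| < r / 4 ∧ P x = flow φ Ψ 1 ξ
  set X := {x | x ∈ Ioo a b ∧ ∃ ξ, R x ξ} with hX
  have huniq : ∀ x ξ ξ', R x ξ → R x ξ' → ξ = ξ' := fun x ξ ξ' h1 h2 =>
    h.flow_injOn hφ (c := 1) (by simp) ⟨h1.1, h1.2.1⟩ ⟨h2.1, h2.2.1⟩ (h1.2.2.symm.trans h2.2.2)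
  -- `Z x` are the horizontal flow coordinates of `P x`. They are unique by injectivity of the flow,
  -- and their imaginary part is locally affine in `x` with slope `± Im c`.
  choose! Z hZ using fun x (hx : x ∈ X) => hx.2
  have key : ∀ x ∈ X, ∃ d : ℂ, (d = c ∨ d = -c) ∧ ∀ᶠ t in 𝓝 x, t ∈ X ∧
      (Z t).im = (Z x).im + d.im * (t - x) := fun x hx => by
    obtain ⟨k1, k2, k3⟩ := hZ x hx
    obtain ⟨d, hd, hev⟩ := h.eventually_flow_one hφ hc hP hx.1 (x' := (Z x).re) (y' := (Z x).im)
      (by linarith) k1 k3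
    refine ⟨d, hd, ?_⟩
    have t3 : ∀ᶠ t : ℝ in 𝓝 x, |(Z x).im + d.im * (t - x)| < r / 4 := by
      have : ContinuousAt (fun t : ℝ => |(Z x).im + d.im * (t - x)|) x := by fun_prop
      exact this.eventually_lt continuousAt_const (by simpa using k2)
    filter_upwards [hev, t3, isOpen_Ioo.mem_nhds hx.1] with t m1 m2 m3
    have hR : R t ⟨(Z x).re + d.re * (t - x), (Z x).im + d.im * (t - x)⟩ := ⟨m1.1, m2, m1.2⟩
    have htX : t ∈ X := ⟨m3, _, hR⟩
    exact ⟨htX, by rw [huniq t _ _ (hZ t htX) hR]⟩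
  choose! d hd hev using key
  have hXo : IsOpen X := isOpen_iff_mem_nhds.2 fun x hx => (hev x hx).mono fun t ht => ht.1
  have hder : ∀ x ∈ X, HasFDerivWithinAt (fun t => (Z t).im)
      (ContinuousLinearMap.toSpanSingleton ℝ (d x).im) X x := fun x hx => by
    have h1 : HasDerivAt (fun t : ℝ => (Z x).im + (d x).im * (t - x)) (d x).im x := by
      simpa using (((hasDerivAt_id x).sub_const x).const_mul (d x).im).const_add (Z x).im
    exact ((h1.congr_of_eventuallyEq ((hev x hx).mono fun t ht => ht.2)).hasFDerivAt).hasFDerivWithinAt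
  have hsub : {y' : ℝ | |y'| < r / 4 ∧ ∃ x ∈ Ioo a b, ∃ x' : ℝ, (⟨x', y'⟩ : ℂ) ∈ flowSet φ Ψ 1 ∧
      P x = flow φ Ψ 1 ⟨x', y'⟩} ⊆ (fun t => (Z t).im) '' X := by
    rintro y ⟨hy, x, hx, x', h1, h2⟩
    have hR : R x ⟨x', y⟩ := ⟨h1, hy, h2⟩
    have hxX : x ∈ X := ⟨hx, _, hR⟩
    exact ⟨x, hxX, by simp only [huniq x _ _ (hZ x hxX) hR]⟩
  refine (measure_mono hsub).trans ((addHaar_image_le_lintegral_abs_det_fderiv volume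
    hXo.measurableSet hder).trans ?_)
  have hb : ∀ x ∈ X, ENNReal.ofReal |(ContinuousLinearMap.toSpanSingleton ℝ (d x).im).det| =
      ENNReal.ofReal |c.im| := fun x hx => by
    rw [ContinuousLinearMap.det_toSpanSingleton]
    rcases hd x hx with e | e <;> rw [e] <;> simp
  rw [setLIntegral_congr_fun hXo.measurableSet hb, setLIntegral_const]
  refine mul_le_mul' le_rfl ((measure_mono fun x hx => hx.1).trans ?_)
  rw [Real.volume_Ioo]

end TeichDisk
end

noncomputable section
namespace TeichDisk

/-! ### Slanted trajectories stay close to horizontal ones -/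

variable {φ : ℂ → ℂ} {r : ℝ} {Ψ : ℂ → ℂ} {c : ℂ}

/-- In flat coordinates along the horizontal line the slanted one is `x ↦ c x`, valid as long as it
stays in the strip of half height `δ`. -/
theorem IsFlowLine.slant {y a b lo hi δ : ℝ} {γ : ℝ → ℂ} {Ξ : ℂ → ℂ}
    (h : IsFlowLine φ Ψ 1 y a b γ)
    (hΞ : IsFlat φ 1 {ζ | lo < ζ.re ∧ ζ.re < hi ∧ |ζ.im| < δ} Ξ) (h0 : (0 : ℝ) ∈ Ioo lo hi)
    (hΞγ : ∀ x ∈ Ioo lo hi, Ξ x = γ x ∧ deriv Ξ x = deriv γ x) (hc : c.re = 1)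
    (hcδ : ∀ x ∈ Ioo lo hi, |c.im * x| < δ) :
    IsFlowLine φ Ψ c y lo hi (fun x : ℝ => Ξ (0 + c * x)) := by
  have hm : ∀ x ∈ Ioo lo hi, 0 + c * (x : ℂ) ∈ {ζ : ℂ | lo < ζ.re ∧ ζ.re < hi ∧ |ζ.im| < δ} :=
    fun x hx => by
      refine ⟨?_, ?_, ?_⟩ <;> simp only [zero_add, Complex.re_mul_ofReal, Complex.im_mul_ofReal, hc,
        one_mul]
      exacts [hx.1, hx.2, hcδ x hx]
  have hg := hΞγ 0 h0
  rw [Complex.ofReal_zero] at hg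
  refine ⟨?_, h0, ?_, ?_⟩
  · have := (hΞ.line 0 c).mono (J := Ioo lo hi) hm
    rwa [one_mul] at this
  · simp [hg.1, h.map_zero]
  · rw [(hΞ.hasDerivAt_line 0 c (hm 0 h0)).deriv]
    simp [hg.2, h.deriv_zero]

/-- On a compact part of the horizontal line the slanted lines of small slope lie in one flat strip,
and uniform continuity of the flat map gives closeness. -/
theorem IsFlowLine.exists_close (hφ : DifferentiableOn ℂ φ disk) {y a b x₀ x₁ : ℝ} {γ : ℝ → ℂ}
    (h : IsFlowLine φ Ψ 1 y a b γ) (ha : a < x₀) (h0 : x₀ ≤ 0) (h1 : 0 ≤ x₁) (hb : x₁ < b) {η : ℝ}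
    (hη : 0 < η) :
    ∃ ε > 0, ∀ c : ℂ, c.re = 1 → |c.im| < ε → ∀ x ∈ Icc x₀ x₁,
      (⟨x, y⟩ : ℂ) ∈ flowSet φ Ψ c ∧ dist (flow φ Ψ c ⟨x, y⟩) (γ x) < η := by
  obtain ⟨δ, hδ, ha', hb', Ξ, hΞ, hΞγ⟩ := h.traj.exists_flat hφ one_ne_zero ha (h0.trans h1) hb
  have h00 : (0 : ℝ) ∈ Ioo (x₀ - δ) (x₁ + δ) := ⟨by linarith, by linarith⟩
  set M := |x₀ - δ| + |x₁ + δ| with hM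
  have hMb : ∀ x ∈ Icc (x₀ - δ) (x₁ + δ), |x| ≤ M := fun x hx => abs_le.2
    ⟨by linarith [neg_abs_le (x₀ - δ), abs_nonneg (x₁ + δ), hx.1],
      by linarith [le_abs_self (x₁ + δ), abs_nonneg (x₀ - δ), hx.2]⟩
  have hM0 : 0 ≤ M := by positivity
  have hcont : ContinuousOn Ξ (Icc x₀ x₁ ×ℂ Icc (-(δ / 2)) (δ / 2)) := hΞ.continuousOn.mono
    fun ζ hζ => ⟨by linarith [hζ.1.1], by linarith [hζ.1.2],
      (abs_le.2 hζ.2).trans_lt (by linarith)⟩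
  have huc := (isCompact_Icc.reProdIm isCompact_Icc).uniformContinuousOn_of_continuous hcont
  obtain ⟨ε, hε, hεc⟩ := Metric.uniformContinuousOn_iff.1 huc η hη
  refine ⟨min (δ / 2) ε / (M + 1), by positivity, fun c hc hcε x hx => ?_⟩
  rw [lt_div_iff₀ (by positivity)] at hcε
  have hcx : ∀ x ∈ Icc (x₀ - δ) (x₁ + δ), |c.im * x| < min (δ / 2) ε := fun x hx => by
    rw [abs_mul]
    refine lt_of_le_of_lt ?_ hcε
    exact mul_le_mul_of_nonneg_left ((hMb x hx).trans (by linarith)) (abs_nonneg _)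
  have hs := h.slant hΞ h00 hΞγ hc fun x hx =>
    (hcx x (Ioo_subset_Icc_self hx)).trans_le ((min_le_left _ _).trans (by linarith))
  have hxI : x ∈ Ioo (x₀ - δ) (x₁ + δ) := ⟨by linarith [hx.1], by linarith [hx.2]⟩
  have hc0 : c ≠ 0 := fun h0 => by simp [h0] at hc
  refine ⟨hs.mem_flowSet hxI, ?_⟩
  have hk := hcx x (Ioo_subset_Icc_self hxI)
  have hk1 := abs_le.1 (hk.le.trans (min_le_left _ _))
  rw [hs.flow_eq hφ hc0 hxI, ← (hΞγ x hxI).1]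
  refine hεc _ ?_ _ ?_ ?_
  · refine ⟨?_, ?_⟩
    · simp only [mem_preimage, zero_add, Complex.re_mul_ofReal, hc, one_mul]; exact hx
    · simp only [mem_preimage, zero_add, Complex.im_mul_ofReal]; exact hk1
  · refine ⟨by simpa using hx, ?_⟩
    simp only [mem_preimage, Complex.ofReal_im]; exact ⟨by linarith, by linarith⟩
  · have : 0 + c * (x : ℂ) - x = ((c.im * x : ℝ) : ℂ) * Complex.I := by
      apply Complex.ext <;> simp [hc]
    rw [Complex.dist_eq, this, norm_mul, Complex.norm_I, mul_one, Complex.norm_real]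
    exact hk.trans_le (min_le_right _ _)

/-! ### Slanted trajectories cannot escape from the end of a horizontal trajectory -/

/-- The segment between the two points is projected radially to the circle. Its points are within
`2η` of the circle, so the projection moves them by at most `2η`; the condition `2η < 1` keeps the
segment away from the origin. -/
theorem joinedIn_circle {p₀ p₁ p₂ : ℂ} {η : ℝ} (h1 : ‖p₁‖ = 1) (h2 : ‖p₂‖ = 1)
    (m1 : p₁ ∈ Metric.closedBall p₀ η) (m2 : p₂ ∈ Metric.closedBall p₀ η) (hη : 2 * η < 1) :
    JoinedIn (Metric.closedBall p₀ (3 * η) ∩ Metric.sphere 0 1) p₁ p₂ := by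
  have hz : ∀ z ∈ segment ℝ p₁ p₂, ‖z - p₁‖ ≤ 2 * η := fun z hz => by
    rw [← dist_eq_norm]
    refine (dist_triangle_right z p₁ p₀).trans ?_
    have := (convex_closedBall p₀ η).segment_subset m1 m2 hz
    rw [Metric.mem_closedBall] at this m1
    linarith
  have hz0 : ∀ z ∈ segment ℝ p₁ p₂, z ≠ 0 := fun z hz' h0 => by
    have := hz z hz'
    rw [h0, zero_sub, norm_neg, h1] at this; linarith
  have hpc : IsPathConnected ((fun z : ℂ => (‖z‖⁻¹ : ℝ) • z) '' segment ℝ p₁ p₂) := by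
    refine ((convex_segment p₁ p₂).isPathConnected ⟨p₁, left_mem_segment ..⟩).image' ?_
    exact ((continuousOn_id.norm).inv₀ fun z hz => norm_ne_zero_iff.2 (hz0 z hz)).smul continuousOn_id
  have := hpc.joinedIn p₁ ⟨p₁, left_mem_segment .., by simp [h1]⟩ p₂
    ⟨p₂, right_mem_segment .., by simp [h2]⟩
  refine this.mono ?_
  rintro _ ⟨z, hzs, rfl⟩
  have hzn := norm_pos_iff.2 (hz0 z hzs)
  refine ⟨?_, by simp [hzn.ne']⟩
  have e1 : ‖(‖z‖⁻¹ : ℝ) • z - z‖ = |1 - ‖z‖| := by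
    have : (‖z‖⁻¹ : ℝ) • z - z = (‖z‖⁻¹ - 1 : ℝ) • z := by rw [sub_smul, one_smul]
    rw [this, norm_smul, Real.norm_eq_abs, ← abs_of_pos hzn, ← abs_mul, abs_of_pos hzn, sub_mul,
      inv_mul_cancel₀ hzn.ne', one_mul]
  have e2 : |1 - ‖z‖| ≤ 2 * η := by
    rw [← h1, ← norm_sub_rev z] at *
    exact (abs_norm_sub_norm_le p₁ z).trans (by rw [norm_sub_rev]; exact hz z hzs)
  have e3 := (convex_closedBall p₀ η).segment_subset m1 m2 hzs
  rw [Metric.mem_closedBall, dist_eq_norm] at *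
  calc ‖(‖z‖⁻¹ : ℝ) • z - p₀‖ = ‖((‖z‖⁻¹ : ℝ) • z - z) + (z - p₀)‖ := by congr 1; ring
    _ ≤ _ := (norm_add_le _ _).trans (by linarith)

/-- From time `q` on, the horizontal trajectory at `y` stays in a small ball about `p₀` and tends
to a point `p` of the unit circle. -/
structure TailIn (φ : ℂ → ℂ) (Ψ : ℂ → ℂ) (q : ℝ) (p₀ : ℂ) (η y B : ℝ) (p : ℂ) : Prop where
  lt : q < B
  mem_flowSet : ∀ x ∈ Ico q B, (⟨x, y⟩ : ℂ) ∈ flowSet φ Ψ 1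
  mem_ball : ∀ x ∈ Ico q B, flow φ Ψ 1 ⟨x, y⟩ ∈ Metric.closedBall p₀ η
  cont : ContinuousOn (fun x : ℝ => flow φ Ψ 1 ⟨x, y⟩) (Ico q B)
  norm_eq : ‖p‖ = 1
  tendsto : Tendsto (fun x : ℝ => flow φ Ψ 1 ⟨x, y⟩) (𝓝[<] B) (𝓝 p)

theorem TailIn.mem_closedBall {q η y B : ℝ} {p₀ p : ℂ} (h : TailIn φ Ψ q p₀ η y B p) :
    p ∈ Metric.closedBall p₀ η := by
  refine Metric.isClosed_closedBall.mem_of_tendsto h.tendsto ?_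
  filter_upwards [Ioo_mem_nhdsLT h.lt] with x hx
  exact h.mem_ball x ⟨hx.1.le, hx.2⟩

/-- The tail, completed by its limit point, is the continuous image of a closed interval. -/
theorem TailIn.joinedIn {q η y B : ℝ} {p₀ p : ℂ} (h : TailIn φ Ψ q p₀ η y B p) :
    JoinedIn (insert p ((fun x : ℝ => flow φ Ψ 1 ⟨x, y⟩) '' Ico q B)) (flow φ Ψ 1 ⟨q, y⟩) p := by
  set g := Function.update (fun x : ℝ => flow φ Ψ 1 ⟨x, y⟩) B p with hg
  have hlt : ∀ x ∈ Ico q B, g x = flow φ Ψ 1 ⟨x, y⟩ := fun x hx =>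
    Function.update_of_ne hx.2.ne _ _
  have hgB : g B = p := Function.update_self ..
  have hcont : ContinuousOn g (Icc q B) := by
    refine continuousOn_update_iff.2 ⟨?_, fun _ => ?_⟩
    · rw [Icc_sdiff_right]; exact h.cont
    · rw [Icc_sdiff_right]
      exact h.tendsto.mono_left (nhdsWithin_mono _ fun x hx => hx.2)
  have hpc := ((convex_Icc q B).isPathConnected ⟨q, left_mem_Icc.2 h.lt.le⟩).image' hcont
  have := hpc.joinedIn (g q) ⟨q, left_mem_Icc.2 h.lt.le, rfl⟩ (g B) ⟨B, right_mem_Icc.2 h.lt.le, rfl⟩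
  rw [hgB, hlt q ⟨le_rfl, h.lt⟩] at this
  refine this.mono ?_
  rintro _ ⟨x, hx, rfl⟩
  rcases hx.2.eq_or_lt with rfl | hlt'
  · exact Or.inl hgB
  · exact Or.inr ⟨x, ⟨hx.1, hlt'⟩, (hlt x ⟨hx.1, hlt'⟩).symm⟩

end TeichDisk
end

/-! ### The fence formed by horizontal trajectories on both sides -/

noncomputable section
namespace TeichDisk

variable {φ : ℂ → ℂ} {r : ℝ} {Ψ : ℂ → ℂ} {c : ℂ}

/-- Half of the measure is given away: the interval next to `y` of that length can carry at most
this half. -/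
theorem exists_measure_Ioo_right {E : Set ℝ} {y δ : ℝ} (h : 0 < volume (E ∩ Ioo y (y + δ))) :
    ∃ m > 0, ENNReal.ofReal m ≤ volume (E ∩ Ioo (y + m) (y + δ)) := by
  have hfin : volume (E ∩ Ioo y (y + δ)) ≠ ⊤ :=
    ((measure_mono inter_subset_right).trans_lt (by rw [Real.volume_Ioo]; exact ENNReal.ofReal_lt_top)).ne
  set M := (volume (E ∩ Ioo y (y + δ))).toReal with hM
  have hM0 : 0 < M := ENNReal.toReal_pos h.ne' hfin
  refine ⟨M / 2, by positivity, ?_⟩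
  have hsub : E ∩ Ioo y (y + δ) ⊆ E ∩ Ioo (y + M / 2) (y + δ) ∪ Ioc y (y + M / 2) := fun x hx => by
    by_cases hxm : x ≤ y + M / 2
    · exact Or.inr ⟨hx.2.1, hxm⟩
    · exact Or.inl ⟨hx.1, not_le.1 hxm, hx.2.2⟩
  have h1 := (measure_mono hsub).trans (measure_union_le (μ := volume) _ _)
  rw [Real.volume_Ioc, ← ENNReal.ofReal_toReal hfin, ← hM, add_sub_cancel_left,
    ← tsub_le_iff_right, ← ENNReal.ofReal_sub _ (by positivity)] at h1
  rwa [sub_half] at h1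

theorem exists_measure_Ioo_left {E : Set ℝ} {y δ : ℝ} (h : 0 < volume (E ∩ Ioo (y - δ) y)) :
    ∃ m > 0, ENNReal.ofReal m ≤ volume (E ∩ Ioo (y - δ) (y - m)) := by
  have e : ∀ s t : ℝ, volume (Neg.neg ⁻¹' E ∩ Ioo (-t) (-s)) = volume (E ∩ Ioo s t) := fun s t => by
    rw [← Measure.measure_preimage_neg volume (E ∩ Ioo s t)]
    congr 1
    ext x
    simp only [mem_inter_iff, mem_preimage, mem_Ioo]
    constructor <;> rintro ⟨h1, h2, h3⟩ <;> exact ⟨h1, by linarith, by linarith⟩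
  obtain ⟨m, hm, h1⟩ := exists_measure_Ioo_right (E := Neg.neg ⁻¹' E) (y := -y) (δ := δ) (by
    rw [show -y + δ = -(y - δ) by ring, e]; exact h)
  refine ⟨m, hm, ?_⟩
  rwa [show -y + δ = -(y - δ) by ring, show -y + m = -(y - m) by ring, e] at h1

/-- Almost every point of a set is a point of positive measure of the set from both sides. -/
theorem ae_two_sided (E : Set ℝ) : ∀ᵐ y : ℝ, y ∈ E → ∀ δ > 0,
    0 < volume (E ∩ Ioo y (y + δ)) ∧ 0 < volume (E ∩ Ioo (y - δ) y) := by
  -- The set `E` need not be measurable, so the support of the restricted measure replaces density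
  -- points: its complement is null in `E`, and only countably many points of it are isolated from
  -- one side.
  set ν := (volume : Measure ℝ).restrict E with hν
  have hνI : ∀ s t : ℝ, ν (Ioo s t) = volume (E ∩ Ioo s t) := fun s t => by
    rw [hν, Measure.restrict_apply measurableSet_Ioo, inter_comm]
  have h1 : ∀ᵐ y : ℝ, y ∉ E ∩ ν.supportᶜ := by
    have := Measure.measure_compl_support (μ := ν)
    rw [hν, Measure.restrict_apply Measure.isOpen_compl_support.measurableSet, inter_comm] at this
    exact measure_eq_zero_iff_ae_notMem.1 this
  have hnull : ∀ s t : ℝ, ν (Ioo s t) = 0 → ν.support ∩ Ioo s t = ∅ := fun s t h => by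
    have := Measure.subset_compl_support_of_isOpen isOpen_Ioo h
    exact disjoint_iff_inter_eq_empty.1 (subset_compl_iff_disjoint_left.1 this)
  have h2 : ∀ᵐ y : ℝ, y ∉ _ := measure_eq_zero_iff_ae_notMem.1
    ((countable_setOfPred_isolated_right_within (s := ν.support)).measure_zero volume)
  have h3 : ∀ᵐ y : ℝ, y ∉ _ := measure_eq_zero_iff_ae_notMem.1
    ((countable_setOfPred_isolated_left_within (s := ν.support)).measure_zero volume)
  filter_upwards [h1, h2, h3] with y k1 k2 k3 hy δ hδ
  have hys : y ∈ ν.support := by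
    by_contra hno; exact k1 ⟨hy, hno⟩
  rw [← hνI, ← hνI]
  refine ⟨pos_iff_ne_zero.2 fun h0 => k2 ?_, pos_iff_ne_zero.2 fun h0 => k3 ?_⟩
  · refine ⟨hys, empty_mem_iff_bot.1 (mem_nhdsWithin.2 ⟨Iio (y + δ), isOpen_Iio,
      by simpa using hδ, ?_⟩)⟩
    rw [← hnull _ _ h0]
    exact fun x hx => ⟨hx.2.1, hx.2.2, hx.1⟩
  · refine ⟨hys, empty_mem_iff_bot.1 (mem_nhdsWithin.2 ⟨Ioi (y - δ), isOpen_Ioi,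
      by simpa using hδ, ?_⟩)⟩
    rw [← hnull _ _ h0]
    exact fun x hx => ⟨hx.2.1, hx.1, hx.2.2⟩

/-- If horizontal trajectories on both sides end near `p₀`, a slanted trajectory cannot leave a
neighbourhood of `p₀` at late times. -/
theorem IsFlowLine.trap (hφ : DifferentiableOn ℂ φ disk) (h : IsChart φ r Ψ) {y A B q η : ℝ}
    {γ : ℝ → ℂ} {p₀ : ℂ} (hy : |y| < r / 4) (hl : IsFlowLine φ Ψ 1 y A B γ) (hq : 0 < q) (hqB : q < B)
    (hη : 0 < η) (hη1 : 2 * η < 1) (hγq : γ q ∈ Metric.ball p₀ η)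
    (hy0 : Ψ (y * Complex.I) ∉ Metric.closedBall p₀ (3 * η)) {E : Set ℝ}
    (hE : ∀ y' ∈ E, |y'| < r / 4 ∧ ∃ B p, TailIn φ Ψ q p₀ η y' B p)
    (hd : ∀ δ > 0, 0 < volume (E ∩ Ioo y (y + δ)) ∧ 0 < volume (E ∩ Ioo (y - δ) y)) :
    ∃ ε > 0, ∀ c : ℂ, c.re = 1 → |c.im| < ε →
      ENNReal.ofReal |c.im| * volume {x : ℝ | (⟨x, y⟩ : ℂ) ∈ flowSet φ Ψ c} < ENNReal.ofReal ε →
      ∀ t : ℝ, q ≤ t → (⟨t, y⟩ : ℂ) ∈ flowSet φ Ψ c →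
        flow φ Ψ c ⟨t, y⟩ ∈ Metric.closedBall p₀ (3 * η) := by
  have hr := h.pos
  obtain ⟨δ, hδ, Ξ, hΞ, hΞγ, ε₀, hε₀, hmem, hline⟩ := hl.exists_flat hφ h one_ne_zero
    (by linarith) hl.zero_mem.1 le_rfl hq.le hqB
  set U := {ζ : ℂ | 0 - δ < ζ.re ∧ ζ.re < q + δ ∧ |ζ.im| < δ} with hU
  have hUo : IsOpen U := by
    refine (isOpen_lt continuous_const Complex.continuous_re).inter
      ((isOpen_lt Complex.continuous_re continuous_const).inter ?_)
    exact isOpen_lt (continuous_abs.comp Complex.continuous_im) continuous_const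
  have hqI : q ∈ Ioo (0 - δ) (q + δ) := ⟨by linarith, by linarith⟩
  have h0I : (0 : ℝ) ∈ Ioo (0 - δ) (q + δ) := ⟨by linarith, by linarith⟩
  have hqU : (q : ℂ) ∈ U := ⟨hqI.1, hqI.2, by simpa using hδ⟩
  obtain ⟨ρ, hρ, hρU, hch⟩ := hΞ.exists_chart hUo hqU
  obtain ⟨δ', hδ', hball⟩ : ∃ δ' > 0, ∀ u : ℝ, |u| < δ' → Ξ (q + u * Complex.I) ∈ Metric.ball p₀ η := by
    have hc1 : ContinuousAt (fun u : ℝ => Ξ (q + u * Complex.I)) 0 := by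
      have h2 : ContinuousAt Ξ (q + (0 : ℝ) * Complex.I) := by
        simpa using (hΞ.hasDerivAt hqU).continuousAt
      exact ContinuousAt.comp' h2 (by fun_prop)
    have h3 := hc1.preimage_mem_nhds (Metric.isOpen_ball.mem_nhds (x := Ξ (q + (0 : ℝ) * Complex.I))
      (by simpa [(hΞγ q hqI).1] using hγq))
    obtain ⟨δ', hδ', h4⟩ := Metric.mem_nhds_iff.1 h3
    exact ⟨δ', hδ', fun u hu => h4 (by simpa using hu)⟩
  set δ₁ := min (min ε₀ (ρ / 4)) δ' with hδ₁
  have hδ₁0 : 0 < δ₁ := by positivity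
  obtain ⟨m₂, hm₂, hM₂⟩ := exists_measure_Ioo_right (hd δ₁ hδ₁0).1
  obtain ⟨m₁, hm₁, hM₁⟩ := exists_measure_Ioo_left (hd δ₁ hδ₁0).2
  -- The denominator bounds the times up to `q + δ`. So the slanted line stays in the flat strip for
  -- these times, and at time `q` its height relative to `y` is below `m₁` and `m₂`.
  refine ⟨min (min m₁ m₂) δ / (q + δ + 1), by positivity, fun c hc hcε hvol t hqt ht => ?_⟩
  have hεm : min (min m₁ m₂) δ / (q + δ + 1) ≤ min (min m₁ m₂) δ :=
    div_le_self (by positivity) (by linarith)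
  rw [lt_div_iff₀ (by positivity)] at hcε
  by_contra hout
  have hc0 : c ≠ 0 := fun h0 => by simp [h0] at hc
  obtain ⟨a, b, P, hP, htI⟩ := ht
  simp only at hP htI
  rw [hP.flow_eq hφ hc0 htI] at hout
  have hvolP : ENNReal.ofReal |c.im| * ENNReal.ofReal (b - a) < ENNReal.ofReal (min m₁ m₂) := by
    refine lt_of_le_of_lt (mul_le_mul' le_rfl ?_) (hvol.trans_le (ENNReal.ofReal_le_ofReal
      (hεm.trans (min_le_left _ _))))
    rw [← Real.volume_Ioo]
    exact measure_mono fun x hx => hP.mem_flowSet hx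
  have hcross := (h.volume_crossed_le hφ hc0 hP.traj).trans_lt hvolP
  set C := {y' : ℝ | |y'| < r / 4 ∧ ∃ x ∈ Ioo a b, ∃ x' : ℝ, (⟨x', y'⟩ : ℂ) ∈ flowSet φ Ψ 1 ∧
      P x = flow φ Ψ 1 ⟨x', y'⟩} with hC
  -- The slanted trajectory crosses too thin a set of horizontal lines to meet all lines of the
  -- family on either side.
  have hpick : ∀ S : Set ℝ, ENNReal.ofReal (min m₁ m₂) ≤ volume S → ∃ y' ∈ S, y' ∉ C := fun S hS => by
    by_contra! hno
    exact absurd ((measure_mono hno).trans_lt hcross) (not_lt.2 hS)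
  obtain ⟨y₂, ⟨hy₂E, hy₂I⟩, hy₂C⟩ := hpick _
    ((ENNReal.ofReal_le_ofReal (min_le_right _ _)).trans hM₂)
  obtain ⟨y₁, ⟨hy₁E, hy₁I⟩, hy₁C⟩ := hpick _
    ((ENNReal.ofReal_le_ofReal (min_le_left _ _)).trans hM₁)
  have hcx : ∀ x ∈ Ioo (0 - δ) (q + δ), |c.im * x| < δ := fun x hx => by
    rw [abs_mul]
    refine lt_of_le_of_lt (mul_le_mul_of_nonneg_left (?_ : |x| ≤ q + δ + 1) (abs_nonneg _))
      (hcε.trans_le (min_le_right _ _))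
    exact abs_le.2 ⟨by linarith [hx.1], by linarith [hx.2]⟩
  have hs := hl.slant hΞ h0I hΞγ hc hcx
  have hPs : ∀ x ∈ Ioo a b, x ∈ Ioo (0 - δ) (q + δ) → P x = Ξ (0 + c * x) := fun x h1 h2 =>
    hP.eqOn hφ hc0 hs ⟨h1, h2⟩
  have hqab : q ∈ Ioo a b := ⟨hP.zero_mem.1.trans hq, hqt.trans_lt htI.2⟩
  set v := c.im * q with hv
  have hvm : |v| < min m₁ m₂ := by
    rw [hv, abs_mul, abs_of_pos hq]
    refine lt_of_le_of_lt (mul_le_mul_of_nonneg_left (?_ : q ≤ q + δ + 1) (abs_nonneg _))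
      (hcε.trans_le (min_le_left _ _))
    linarith
  have hvm' := abs_lt.1 hvm
  have hloc : ∀ x ∈ Ioo a b, x ∈ Ioo (0 - δ) (q + δ) →
      P x = (fun ζ => Ξ (q + ζ)) (v * Complex.I + c * (x - q)) := fun x h1 h2 => by
    rw [hPs x h1 h2]
    simp only
    congr 1
    apply Complex.ext <;> simp [hc, hv]
    ring
  have hsmall : ∀ u : ℝ, y₁ - y ≤ u → u ≤ y₂ - y → |u| < δ₁ := fun u h1 h2 =>
    abs_lt.2 ⟨by linarith [hy₁I.1], by linarith [hy₂I.2]⟩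
  have hu : ∀ u : ℝ, |u| < δ₁ → |u| < ρ / 4 := fun u hu =>
    hu.trans_le ((min_le_left _ _).trans (min_le_right _ _))
  have hv₁ : y₁ - y < v := by linarith [hy₁I.2, min_le_left m₁ m₂]
  have hv₂ : v < y₂ - y := by linarith [hy₂I.1, min_le_right m₁ m₂]
  have hvδ := hsmall v hv₁.le hv₂.le
  have hPev : ∀ᶠ x : ℝ in 𝓝 q, P x = (fun ζ => Ξ (q + ζ)) (v * Complex.I + c * (x - q)) := by
    filter_upwards [isOpen_Ioo.mem_nhds hqab, isOpen_Ioo.mem_nhds hqI] with x h1 h2 using hloc x h1 h2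
  have hqeq := hloc q hqab hqI
  have hqeq' : P q = (fun ζ => Ξ (q + ζ)) (v * Complex.I) := by rw [hqeq]; simp
  have hder : deriv P q = deriv (fun ζ => Ξ (q + ζ)) (v * Complex.I) * c := by
    have hm : (v : ℂ) * Complex.I ∈ Metric.ball (0 : ℂ) ρ :=
      mem_ball_zero_iff.2 (norm_I_mul_lt (by linarith [hu v hvδ]))
    have hm' : (v * Complex.I - c * q : ℂ) + c * q ∈ Metric.ball (0 : ℂ) ρ := by simpa using hm
    have := hch.flat.hasDerivAt_line (v * Complex.I - c * q) c hm'
    rw [sub_add_cancel] at this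
    refine (this.congr_of_eventuallyEq (hPev.mono fun x hx => ?_)).deriv
    rw [hx]; congr 1; ring
  have hmb : ∀ u ∈ Icc (y₁ - y) (y₂ - y), Ξ (q + u * Complex.I) ∈ Metric.ball p₀ η := fun u hu =>
    hball u ((hsmall u hu.1 hu.2).trans_le (min_le_right _ _))
  have hsub : Icc 0 t ⊆ Ioo a b := fun x hx => ⟨hP.zero_mem.1.trans_le hx.1, hx.2.trans_lt htI.2⟩
  -- A line of the family that is not crossed leads from the transversal to the unit circle inside
  -- the ball, without meeting the slanted trajectory.
  have htail : ∀ y' ∈ E, y' ∉ C → |y' - y| < δ₁ → ∃ p, ‖p‖ = 1 ∧ p ∈ Metric.closedBall p₀ η ∧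
      JoinedIn (Metric.closedBall p₀ (3 * η) \ P '' Icc 0 t) (Ξ (q + (y' - y : ℝ) * Complex.I)) p := by
    intro y' hy'E hy'C hy'
    obtain ⟨hy'r, B', p, hT⟩ := hE y' hy'E
    refine ⟨p, hT.norm_eq, hT.mem_closedBall, ?_⟩
    have hfl := (hline y' (hy'.trans_le ((min_le_left _ _).trans (min_le_left _ _)))).flow_eq hφ
      one_ne_zero (x := q) ⟨by linarith, by linarith⟩
    have e : Ξ (q + (y' - y : ℝ) * Complex.I) = flow φ Ψ 1 ⟨q, y'⟩ := by
      rw [hfl]; congr 1; push_cast; ring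
    rw [e]
    refine hT.joinedIn.mono (insert_subset ?_ ?_)
    · refine ⟨Metric.closedBall_subset_closedBall (by linarith) hT.mem_closedBall, ?_⟩
      rintro ⟨x, hx, rfl⟩
      have := (hP.traj x (hsub hx)).1
      rw [disk, mem_ball_zero_iff, hT.norm_eq] at this
      exact lt_irrefl _ this
    · rintro _ ⟨x, hx, rfl⟩
      refine ⟨Metric.closedBall_subset_closedBall (by linarith) (hT.mem_ball x hx), ?_⟩
      rintro ⟨x', hx', e'⟩
      exact hy'C ⟨hy'r, x', hsub hx', x, hT.mem_flowSet x hx, e'⟩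
  obtain ⟨p₂, hp₂, hp₂m, hj₂⟩ := htail y₂ hy₂E hy₂C (hsmall _ (by linarith) le_rfl)
  obtain ⟨p₁, hp₁, hp₁m, hj₁⟩ := htail y₁ hy₁E hy₁C (hsmall _ le_rfl (by linarith))
  have hj : JoinedIn (Metric.closedBall p₀ (3 * η) \ P '' Icc 0 t) p₂ p₁ := by
    refine (joinedIn_circle hp₂ hp₁ hp₂m hp₁m hη1).mono fun z hz => ⟨hz.1, ?_⟩
    rintro ⟨x, hx, rfl⟩
    have := (hP.traj x (hsub hx)).1
    rw [disk, mem_ball_zero_iff, mem_sphere_zero_iff_norm.1 hz.2] at this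
    exact lt_irrefl _ this
  have hqt' : q < t := by
    refine lt_of_le_of_ne hqt fun e => hout ?_
    rw [← e, hqeq']
    exact Metric.ball_subset_closedBall (Metric.ball_subset_ball (by linarith) (hmb v ⟨hv₁.le, hv₂.le⟩))
  -- The fence consists of the vertical segment at time `q`, two uncrossed tails and an arc of the
  -- unit circle. The slanted trajectory starts outside of the ball and, by assumption, ends
  -- outside.
  refine hch.not_separated (u₁ := y₁ - y) (v := v) (u₂ := y₂ - y)
    (by linarith [hu _ (hsmall (y₁ - y) le_rfl (by linarith))])
    (by linarith [hu _ (hsmall (y₂ - y) (by linarith) le_rfl)]) hv₁ hv₂ (P := P) (s₀ := 0) (s₁ := t)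
    ⟨hq, hqt'⟩ (hP.traj.continuousOn.mono hsub) (by rw [hc]; exact one_pos) hPev
    (fun x hx u hu' e => ?_) ((hj₂.trans hj).trans hj₁.symm)
    (fun u hu' => Metric.ball_subset_closedBall (Metric.ball_subset_ball (by linarith) (hmb u hu')))
    (by rw [hP.map_zero]; exact hy0) hout
  -- A second crossing of the vertical segment would be a return to the chart; comparing real parts
  -- shows that it happens at time `q`.
  have hn := hch.no_return hφ hc0 hP.traj hqab (hsub hx)
    (norm_I_mul_lt (hu v hvδ)) (norm_I_mul_lt (hu u (hsmall u hu'.1 hu'.2))) hqeq' e hder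
  have := congrArg Complex.re hn
  simp [hc] at this
  linarith

end TeichDisk
end

/-! ### Shadowing of horizontal trajectories up to their ends -/

noncomputable section
namespace TeichDisk

variable {φ : ℂ → ℂ} {r : ℝ} {Ψ : ℂ → ℂ} {c : ℂ}

/-- The trap needs neighbours on both sides whose tails lie in the same ball after the same time.
Centres from a dense sequence, radii `1 / (m + 3)` and rational times give countably many families,
and almost every height is two-sided in each family that contains it. -/
theorem IsChart.ae_trap_right (hφ : DifferentiableOn ℂ φ disk) (h : IsChart φ r Ψ) :
    ∀ᵐ y : ℝ, |y| < r / 4 → ∀ (A B : ℝ) (γ : ℝ → ℂ) (p : ℂ), IsFlowLine φ Ψ 1 y A B γ → ‖p‖ = 1 →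
      Tendsto γ (𝓝[<] B) (𝓝 p) → ∀ η > 0, ∃ x₁ ∈ Ioo 0 B, ∃ ε > 0, ∀ c : ℂ, c.re = 1 → |c.im| < ε →
      ENNReal.ofReal |c.im| * volume {x : ℝ | (⟨x, y⟩ : ℂ) ∈ flowSet φ Ψ c} < ENNReal.ofReal ε →
      ∀ t : ℝ, x₁ ≤ t → (⟨t, y⟩ : ℂ) ∈ flowSet φ Ψ c → dist (flow φ Ψ c ⟨t, y⟩) p < η := by
  set E : ℕ → ℕ → ℚ → Set ℝ := fun k m q => {y' | |y'| < r / 4 ∧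
    ∃ B p, TailIn φ Ψ q (TopologicalSpace.denseSeq ℂ k) (1 / (m + 3)) y' B p} with hE
  have hae : ∀ᵐ y : ℝ, ∀ k m q, y ∈ E k m q → ∀ δ > 0,
      0 < volume (E k m q ∩ Ioo y (y + δ)) ∧ 0 < volume (E k m q ∩ Ioo (y - δ) y) := by
    simp only [ae_all_iff]
    exact fun k m q => by simpa only [ae_all_iff] using ae_two_sided (E k m q)
  filter_upwards [hae] with y hy hyr A B γ p hl hp hγp η hη
  have hr := h.pos
  have hΨd : Ψ (y * Complex.I) ∈ disk := (h.flat _ (mem_ball_zero_iff.2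
    (norm_I_mul_lt (by linarith)))).1
  have hne : 0 < dist (Ψ (y * Complex.I)) p := dist_pos.2 fun e => by
    rw [e, disk, mem_ball_zero_iff, hp] at hΨd; exact lt_irrefl _ hΨd
  obtain ⟨m, hm⟩ := exists_nat_one_div_lt (show 0 < min η (dist (Ψ (y * Complex.I)) p) / 4 by positivity)
  set η' : ℝ := 1 / (m + 3) with hη'
  have hη'0 : 0 < η' := by positivity
  have hη'1 : η' ≤ 1 / 3 := one_div_le_one_div_of_le (by norm_num) (by linarith [(Nat.cast_nonneg m : (0:ℝ) ≤ m)])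
  have hη'2 : 4 * η' < min η (dist (Ψ (y * Complex.I)) p) := by
    have : η' ≤ 1 / (m + 1) := one_div_le_one_div_of_le (by positivity) (by linarith)
    linarith
  obtain ⟨k, hk⟩ := (TopologicalSpace.denseRange_denseSeq ℂ).exists_dist_lt p hη'0
  set p₀ := TopologicalSpace.denseSeq ℂ k with hp₀
  have hev : ∀ᶠ x in 𝓝[<] B, γ x ∈ Metric.ball p₀ η' :=
    hγp (Metric.isOpen_ball.mem_nhds (by rwa [Metric.mem_ball]))
  obtain ⟨q', hq', hq'2⟩ := (mem_nhdsLT_iff_exists_Ioo_subset' (hl.zero_mem.2)).1 hev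
  obtain ⟨q, hq1, hq2⟩ := exists_rat_btwn (max_lt hq' hl.zero_mem.2)
  have hq0 : (0 : ℝ) < q := (le_max_right _ _).trans_lt hq1
  have hqq : q' < q := (le_max_left _ _).trans_lt hq1
  have hco : ∀ x ∈ Ico (q : ℝ) B, x ∈ Ioo A B := fun x hx =>
    ⟨hl.zero_mem.1.trans (hq0.trans_le hx.1), hx.2⟩
  have hfl : ∀ x ∈ Ico (q : ℝ) B, flow φ Ψ 1 ⟨x, y⟩ = γ x := fun x hx =>
    hl.flow_eq hφ one_ne_zero (hco x hx)
  have hT : TailIn φ Ψ q p₀ η' y B p := by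
    refine ⟨hq2, fun x hx => hl.mem_flowSet (hco x hx), fun x hx => ?_, ?_, hp, ?_⟩
    · rw [hfl x hx]
      exact Metric.ball_subset_closedBall (hq'2 ⟨hqq.trans_le hx.1, hx.2⟩)
    · exact (hl.traj.continuousOn.mono hco).congr hfl
    · refine hγp.congr' ?_
      filter_upwards [Ioo_mem_nhdsLT hq2] with x hx using (hfl x ⟨hx.1.le, hx.2⟩).symm
  have hfar : Ψ (y * Complex.I) ∉ Metric.closedBall p₀ (3 * η') := fun hmem => by
    rw [Metric.mem_closedBall] at hmem
    rw [dist_comm] at hk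
    linarith [dist_triangle (Ψ (y * Complex.I)) p₀ p, min_le_right η (dist (Ψ (y * Complex.I)) p)]
  obtain ⟨ε, hε, H⟩ := hl.trap hφ h hyr hq0 hq2 hη'0 (by linarith) (hq'2 ⟨hqq, hq2⟩) hfar
    (E := E k m q) (fun y' hy' => hy') (hy k m q ⟨hyr, B, p, hT⟩)
  refine ⟨q, ⟨hq0, hq2⟩, ε, hε, fun c hc1 hc2 hc3 t ht1 ht2 => ?_⟩
  have h1 := H c hc1 hc2 hc3 t ht1 ht2
  rw [Metric.mem_closedBall] at h1
  rw [dist_comm] at hk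
  linarith [dist_triangle (flow φ Ψ c ⟨t, y⟩) p₀ p, min_le_left η (dist (Ψ (y * Complex.I)) p)]

/-- Slanted trajectories through almost every point stay close to the horizontal trajectory
through that point, up to the ends. -/
theorem IsChart.ae_shadow (hφ : DifferentiableOn ℂ φ disk) (h : IsChart φ r Ψ) :
    ∀ᵐ y : ℝ, |y| < r / 4 → ∀ (A B : ℝ) (γ : ℝ → ℂ) (p p' : ℂ), IsFlowLine φ Ψ 1 y A B γ →
      ‖p‖ = 1 → ‖p'‖ = 1 → Tendsto γ (𝓝[>] A) (𝓝 p) → Tendsto γ (𝓝[<] B) (𝓝 p') → ∀ η > 0,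
      ∃ x₀ ∈ Ioo A 0, ∃ x₁ ∈ Ioo 0 B, ∃ ε > 0, ∀ c : ℂ, c.re = 1 → |c.im| < ε →
      ENNReal.ofReal |c.im| * volume {x : ℝ | (⟨x, y⟩ : ℂ) ∈ flowSet φ Ψ c} < ENNReal.ofReal ε →
      (∀ t ∈ Icc x₀ x₁, (⟨t, y⟩ : ℂ) ∈ flowSet φ Ψ c ∧ dist (flow φ Ψ c ⟨t, y⟩) (γ t) < η) ∧
      ∀ t : ℝ, (⟨t, y⟩ : ℂ) ∈ flowSet φ Ψ c →
        (t ≤ x₀ → dist (flow φ Ψ c ⟨t, y⟩) p < η) ∧ (x₁ ≤ t → dist (flow φ Ψ c ⟨t, y⟩) p' < η) := by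
  have h2 := (Measure.measurePreserving_neg (volume : Measure ℝ)).quasiMeasurePreserving.ae
    (h.neg.ae_trap_right hφ)
  filter_upwards [h.ae_trap_right hφ, h2] with y hy1 hy2 hyr A B γ p p' hl hp hp' hγp hγp' η hη
  have hr := h.pos
  have hyr' : |y| < r := by linarith
  obtain ⟨x₁, hx₁, ε₁, hε₁, H1⟩ := hy1 hyr A B γ p' hl hp' hγp' η hη
  obtain ⟨x₀, hx₀, ε₀, hε₀, H0⟩ := hy2 (by rwa [abs_neg]) (-B) (-A) (fun x => γ (-x)) p
    (hl.neg h hyr') hp (hγp.comp (by simpa using tendsto_neg_nhdsLT (a := -A))) η hη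
  obtain ⟨ε₂, hε₂, H2⟩ := hl.exists_close hφ (x₀ := -x₀) (x₁ := x₁) (by linarith [hx₀.2])
    (by linarith [hx₀.1]) hx₁.1.le hx₁.2 hη
  refine ⟨-x₀, ⟨by linarith [hx₀.2], by linarith [hx₀.1]⟩, x₁, hx₁, min (min ε₁ ε₀) ε₂,
    by positivity, fun c hc1 hc2 hc3 => ⟨H2 c hc1 (hc2.trans_le (min_le_right _ _)), fun t ht =>
    ⟨fun h3 => ?_, fun h3 => ?_⟩⟩⟩
  · have hc0 : c ≠ 0 := fun h0 => by simp [h0] at hc1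
    rw [← h.neg_flow hφ hc0 hyr' ht]
    -- The left end is the right end for the turned chart; the slice of times is reflected, so its
    -- length is unchanged.
    refine H0 c hc1 (hc2.trans_le ((min_le_left _ _).trans (min_le_right _ _))) ?_ (-t)
      (by linarith) (h.neg_flowSet hyr' ht)
    refine lt_of_le_of_lt (mul_le_mul' le_rfl (le_of_eq ?_)) (hc3.trans_le (ENNReal.ofReal_le_ofReal
      ((min_le_left _ _).trans (min_le_right _ _))))
    rw [← Measure.measure_preimage_neg]
    congr 1
    ext x
    exact h.neg_flowSet_iff hyr'
  · exact H1 c hc1 (hc2.trans_le ((min_le_left _ _).trans (min_le_left _ _)))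
      (hc3.trans_le (ENNReal.ofReal_le_ofReal ((min_le_left _ _).trans (min_le_left _ _)))) t h3 ht

end TeichDisk
end

noncomputable section
namespace TeichDisk

/-! ### Weyl's lemma for the Cauchy-Riemann equation -/

-- The derivatives of the mollified function in `1` and `i` are integrals against derivatives of the
-- bump. The weak equation, tested with the translated bump, is the Cauchy-Riemann equation for it.
open scoped Convolution in
theorem differentiableAt_convolution {H H₀ : ℂ → ℂ} {ω₀ x : ℂ} {R : ℝ}
    (hloc : LocallyIntegrable H₀ volume) (hH₀ : EqOn H₀ H (Metric.ball ω₀ R))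
    (hw : ∀ η : ℂ → ℂ, ContDiff ℝ ∞ η → HasCompactSupport η → tsupport η ⊆ Metric.ball ω₀ R →
      ∫ z, H z * dzbar η z = 0) (b : ContDiffBump (0 : ℂ))
    (hb : Metric.closedBall x b.rOut ⊆ Metric.ball ω₀ R) :
    DifferentiableAt ℂ (b.normed volume ⋆[ContinuousLinearMap.lsmul ℝ ℝ, volume] H₀) x := by
  set χ := b.normed (volume : Measure ℂ) with hχ
  have hχs : ContDiff ℝ ∞ χ := b.contDiff_normed
  have hχc : HasCompactSupport χ := b.hasCompactSupport_normed
  have hd := hχc.hasFDerivAt_convolution_left (ContinuousLinearMap.lsmul ℝ ℝ) (hχs.of_le (by simp)) hloc x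
  have hex := (hχc.fderiv (𝕜 := ℝ)).convolutionExists_left
    ((ContinuousLinearMap.lsmul ℝ ℝ : ℝ →L[ℝ] ℂ →L[ℝ] ℂ).precompL ℂ)
    (hχs.continuous_fderiv (by simp)) hloc x
  have hint : Integrable (fun t => ((ContinuousLinearMap.lsmul ℝ ℝ : ℝ →L[ℝ] ℂ →L[ℝ] ℂ).precompL ℂ)
      (fderiv ℝ χ (x - t)) (H₀ t)) := by
    simpa [ConvolutionExistsAt] using hex.integrable_swap
  have hap : ∀ h : ℂ, (fderiv ℝ χ ⋆[(ContinuousLinearMap.lsmul ℝ ℝ).precompL ℂ, volume] H₀) x h =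
      ∫ t, (fderiv ℝ χ (x - t) h : ℂ) * H₀ t := fun h => by
    rw [convolution_eq_swap, ContinuousLinearMap.integral_apply hint]
    refine integral_congr_ae (Eventually.of_forall fun t => ?_)
    simp [ContinuousLinearMap.precompL_apply]
  have hinth : ∀ h : ℂ, Integrable (fun t => (fderiv ℝ χ (x - t) h : ℂ) * H₀ t) := fun h => by
    refine (hint.apply_continuousLinearMap h).congr (Eventually.of_forall fun t => ?_)
    simp [ContinuousLinearMap.precompL_apply]
  refine differentiableAt_complex_iff_differentiableAt_real.2 ⟨hd.differentiableAt, ?_⟩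
  rw [hd.fderiv, hap, hap, smul_eq_mul]
  set η : ℂ → ℂ := fun t => (χ (x - t) : ℂ) with hη
  have hηd : ∀ t h : ℂ, fderiv ℝ η t h = -(fderiv ℝ χ (x - t) h : ℂ) := fun t h => by
    have h1 : HasFDerivAt (fun t : ℂ => x - t) (-ContinuousLinearMap.id ℝ ℂ) t :=
      (hasFDerivAt_id t).const_sub x
    have h2 := ((hχs.differentiable (by simp)) (x - t)).hasFDerivAt.comp t h1
    have h3 := Complex.ofRealCLM.hasFDerivAt.comp t h2
    rw [show fderiv ℝ η t = _ from h3.fderiv]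
    simp
  have hηsupp : tsupport η ⊆ Metric.closedBall x b.rOut := by
    refine closure_minimal (fun t ht => ?_) Metric.isClosed_closedBall
    have : x - t ∈ Function.support χ := fun h0 => ht (by simp [hη, h0])
    rw [hχ, b.support_normed_eq, mem_ball_zero_iff] at this
    rw [mem_closedBall_iff_norm']; exact this.le
  have h0 := hw η (Complex.ofRealCLM.contDiff.comp (hχs.comp (contDiff_const.sub contDiff_id)))
    (HasCompactSupport.of_support_subset_isCompact (isCompact_closedBall x b.rOut)
      ((subset_tsupport η).trans hηsupp)) (hηsupp.trans hb)
  have hdz : ∀ t, H t * dzbar η t = -(1 / 2) * ((fderiv ℝ χ (x - t) 1 : ℂ) * H₀ t +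
      Complex.I * ((fderiv ℝ χ (x - t) Complex.I : ℂ) * H₀ t)) := fun t => by
    by_cases ht : t ∈ tsupport η
    · rw [hH₀ (hb (hηsupp ht)), dzbar, hηd, hηd]; ring
    · have : ∀ h : ℂ, (fderiv ℝ χ (x - t) h : ℂ) = 0 := fun h => by
        rw [← neg_eq_zero, ← hηd, image_eq_zero_of_notMem_tsupport
          (fun hm => ht (tsupport_fderiv_subset ℝ hm))]; rfl
      rw [dzbar, hηd, hηd, this, this]; simp
  simp only [hdz] at h0
  rw [integral_const_mul, integral_add (hinth 1) ((hinth Complex.I).const_mul _),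
    integral_const_mul] at h0
  have h0' := (mul_eq_zero.1 h0).resolve_left (by norm_num)
  have hI := Complex.I_mul_I
  linear_combination (-Complex.I) * h0' + (∫ t, (fderiv ℝ χ (x - t) Complex.I : ℂ) * H₀ t) * hI

/-- The mollifications are holomorphic and converge uniformly on the smaller ball. The factor `3`
leaves room for bumps of radius at most `R`. -/
theorem differentiableOn_of_weak {H : ℂ → ℂ} {ω₀ : ℂ} {R : ℝ} (hR : 0 < R)
    (hH : ContinuousOn H (Metric.closedBall ω₀ (3 * R)))
    (hw : ∀ η : ℂ → ℂ, ContDiff ℝ ∞ η → HasCompactSupport η → tsupport η ⊆ Metric.ball ω₀ (3 * R) →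
      ∫ z, H z * dzbar η z = 0) : DifferentiableOn ℂ H (Metric.ball ω₀ R) := by
  set H₀ := (Metric.closedBall ω₀ (3 * R)).indicator H with hH₀
  have hloc : LocallyIntegrable H₀ volume := ((integrable_indicator_iff
    Metric.isClosed_closedBall.measurableSet).2 (hH.integrableOn_compact
      (isCompact_closedBall _ _))).locallyIntegrable
  have heq : EqOn H₀ H (Metric.closedBall ω₀ (3 * R)) := fun z hz => indicator_of_mem hz _
  have huc := (isCompact_closedBall ω₀ (3 * R)).uniformContinuousOn_of_continuous hH
  have hrad : ∀ n : ℕ, 0 < R / (n + 1) := fun n => by positivity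
  let b : ℕ → ContDiffBump (0 : ℂ) := fun n =>
    ⟨R / (n + 1) / 2, R / (n + 1), by have := hrad n; positivity, by have := hrad n; linarith⟩
  have hbR : ∀ n, (b n).rOut ≤ R := fun n =>
    div_le_self hR.le (by linarith [(Nat.cast_nonneg n : (0 : ℝ) ≤ n)])
  have hdiff : ∀ n, DifferentiableOn ℂ (convolution ((b n).normed volume) H₀
      (ContinuousLinearMap.lsmul ℝ ℝ) volume) (Metric.ball ω₀ R) := fun n x hx => by
    refine (differentiableAt_convolution hloc (heq.mono Metric.ball_subset_closedBall) hw (b n)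
      fun z hz => ?_).differentiableWithinAt
    rw [Metric.mem_ball] at hx ⊢
    rw [Metric.mem_closedBall] at hz
    linarith [dist_triangle z x ω₀, hbR n]
  refine TendstoLocallyUniformlyOn.differentiableOn (φ := atTop) ?_ (Eventually.of_forall hdiff)
    Metric.isOpen_ball
  refine TendstoUniformlyOn.tendstoLocallyUniformlyOn (Metric.tendstoUniformlyOn_iff.2 fun ε hε => ?_)
  obtain ⟨δ, hδ, h1⟩ := Metric.uniformContinuousOn_iff.1 huc (ε / 2) (by positivity)
  have h2 : ∀ᶠ n : ℕ in atTop, R / (n + 1) < δ := by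
    have := (tendsto_one_div_add_atTop_nhds_zero_nat (𝕜 := ℝ)).const_mul R
    rw [mul_zero] at this
    filter_upwards [this.eventually_lt_const hδ] with n hn
    rwa [mul_one_div] at hn
  filter_upwards [h2] with n hn x hx
  rw [Metric.mem_ball] at hx
  have hx3 : x ∈ Metric.closedBall ω₀ (3 * R) := by rw [Metric.mem_closedBall]; linarith
  have hle := (b n).dist_normed_convolution_le (μ := volume) (g := H₀) (x₀ := x) (ε := ε / 2)
    hloc.aestronglyMeasurable fun z hz => by
      rw [Metric.mem_ball] at hz
      have hz3 : z ∈ Metric.closedBall ω₀ (3 * R) := by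
        rw [Metric.mem_closedBall]; linarith [dist_triangle z x ω₀, hbR n]
      rw [heq hz3, heq hx3]
      exact (h1 z hz3 x hx3 (hz.trans hn)).le
  rw [heq hx3, dist_comm] at hle
  exact hle.trans_lt (by linarith)

end TeichDisk
end

noncomputable section
namespace TeichDisk

/-! ### Differentiability of the quasiconformal map in natural coordinates -/

variable {φ : ℂ → ℂ}

/-- The linear map `ζ ↦ ζ + m ζ̄`. -/
def twist (m : ℂ) : ℂ →L[ℝ] ℂ :=
  ContinuousLinearMap.id ℝ ℂ + (m • (Complex.conjCLE : ℂ →L[ℝ] ℂ))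

theorem twist_apply (m ζ : ℂ) : twist m ζ = ζ + m * starRingEnd ℂ ζ := by simp [twist]

theorem twist_twist (m ζ : ℂ) :
    twist (-m) (twist m ζ) = (1 - m * starRingEnd ℂ m) * ζ := by
  simp only [twist_apply, map_add, map_mul, Complex.conj_conj]; ring

theorem one_sub_mul_conj (m : ℂ) : 1 - m * starRingEnd ℂ m = ((1 - ‖m‖ ^ 2 : ℝ) : ℂ) := by
  rw [Complex.mul_conj']; push_cast; rfl

theorem clm_eq_dz (L : ℂ →L[ℝ] ℂ) (k : ℂ) :
    L k = (L 1 - Complex.I * L Complex.I) / 2 * k +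
      (L 1 + Complex.I * L Complex.I) / 2 * starRingEnd ℂ k := by
  have h1 : L k = k.re * L 1 + k.im * L Complex.I := by
    conv_lhs => rw [← Complex.re_add_im k]
    rw [map_add, ← mul_one (k.re : ℂ), ← Complex.real_smul, ← Complex.real_smul, map_smul, map_smul]
    simp
  rw [h1, Complex.re_eq_add_conj, Complex.im_eq_sub_conj]
  have hI := Complex.I_mul_I
  field_simp
  linear_combination (k * L Complex.I - starRingEnd ℂ k * L Complex.I) * hI

theorem isTestFunction_indicator {U K : Set ℂ} (hU : IsOpen U) (hK : IsCompact K) (hKU : K ⊆ U)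
    (hUd : U ⊆ disk) {g : ℂ → ℂ} (hg : ContDiffOn ℝ ∞ g U) (h0 : ∀ z ∈ U, z ∉ K → g z = 0) :
    IsTestFunction (U.indicator g) ∧ ∀ z ∉ K, U.indicator g =ᶠ[𝓝 z] 0 := by
  have hz : ∀ z ∉ K, U.indicator g z = 0 := fun z hz => by
    by_cases hzU : z ∈ U
    · rw [indicator_of_mem hzU, h0 z hzU hz]
    · exact indicator_of_notMem hzU _
  have hev : ∀ z ∉ K, U.indicator g =ᶠ[𝓝 z] 0 := fun z hz' => by
    filter_upwards [hK.isClosed.isOpen_compl.mem_nhds hz'] with x hx using hz x hx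
  have hsupp : tsupport (U.indicator g) ⊆ K := closure_minimal (fun z hz' => by
    by_contra hno; exact hz' (hz z hno)) hK.isClosed
  refine ⟨⟨contDiff_iff_contDiffAt.2 fun z => ?_, HasCompactSupport.of_support_subset_isCompact hK
    ((subset_tsupport _).trans hsupp), hsupp.trans (hKU.trans hUd)⟩, hev⟩
  by_cases hzK : z ∈ K
  · refine (hg.contDiffAt (hU.mem_nhds (hKU hzK))).congr_of_eventuallyEq ?_
    filter_upwards [hU.mem_nhds (hKU hzK)] with x hx using indicator_of_mem hx _
  · exact contDiffAt_const.congr_of_eventuallyEq (hev z hzK)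

theorem integrable_mul_of_continuousOn {K : Set ℂ} (hK : IsCompact K) {f g : ℂ → ℂ}
    (hf : ContinuousOn f K) (hg : Continuous g) (h0 : ∀ z ∉ K, g z = 0) :
    Integrable fun z => f z * g z := by
  refine (integrableOn_iff_integrable_of_support_subset (s := K) fun z hz => ?_).1
    ((hf.mul hg.continuousOn).integrableOn_compact hK)
  by_contra hno
  exact hz (by simp [h0 z hno])

theorem norm_moebius_lt {w : ℂ} (hw : 0 < w.re) : ‖(1 - w) / (1 + w)‖ < 1 := by
  have h1 : (0 : ℝ) < ‖1 + w‖ := norm_pos_iff.2 fun h => by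
    have := congrArg Complex.re h; simp at this; linarith
  rw [norm_div, div_lt_one h1, ← sq_lt_sq₀ (norm_nonneg _) (norm_nonneg _), Complex.sq_norm,
    Complex.sq_norm, Complex.normSq_apply, Complex.normSq_apply]
  simp
  nlinarith

/-- The weak Beltrami equation in the coordinate `twist m ∘ Φ`. -/
theorem IsCoord.weak {z₀ : ℂ} {U : Set ℂ} {Φ S Ψ : ℂ → ℂ} {r : ℝ} (h : IsCoord φ z₀ U Φ S Ψ r)
    {f p q : ℂ → ℂ} {m : ℂ} (hm : ‖m‖ < 1) (hf : ContinuousOn f disk)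
    (hp : ∀ η, IsTestFunction η → ∫ z, f z * dz η z = - ∫ z, p z * η z)
    (hq : ∀ η, IsTestFunction η → ∫ z, f z * dzbar η z = - ∫ z, q z * η z)
    (hpq : ∀ᵐ z ∂(volume.restrict disk), q z = m * (starRingEnd ℂ (φ z) / (‖φ z‖ : ℂ)) * p z)
    {B : ℂ → ℂ} (hB : ∀ ζ, B (twist m ζ) = ζ) (hB' : ∀ ξ, twist m (B ξ) = ξ) (hBc : Continuous B)
    {η : ℂ → ℂ} (hη : ContDiff ℝ ∞ η) (hηc : HasCompactSupport η)
    (hηs : ∀ ξ ∈ tsupport η, B ξ ∈ Metric.ball (0 : ℂ) r) :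
    ∫ ξ, f (Ψ (B ξ)) * dzbar η ξ = 0 := by
  have hUo := h.isOpen
  set χ : ℂ → ℂ := fun z => twist m (Φ z) with hχ
  set K := (fun ξ => Ψ (B ξ)) '' tsupport η with hK
  have hΦd : DifferentiableOn ℂ Φ U := fun z hz => (h.deriv z hz).differentiableAt.differentiableWithinAt
  have hSd : DifferentiableOn ℂ S U := (hΦd.deriv hUo).congr fun z hz => (h.deriv z hz).deriv.symm
  have hKc : IsCompact K := by
    refine IsCompact.image_of_continuousOn hηc fun ξ hξ => ?_
    exact ((h.deriv_inv _ (hηs ξ hξ)).continuousAt.comp_of_eq hBc.continuousAt rfl).continuousWithinAt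
  have hKU : K ⊆ U := by
    rintro _ ⟨ξ, hξ, rfl⟩; exact h.map_inv _ (hηs ξ hξ)
  have hinv : ∀ z ∈ U, χ z ∈ tsupport η → Ψ (B (χ z)) = z := fun z hz hzη => by
    have h1 := hηs _ hzη
    rw [hχ] at h1 ⊢
    simp only [hB] at h1 ⊢
    exact h.left_inv hz h1
  have hzero : ∀ z ∈ U, z ∉ K → χ z ∉ tsupport η := fun z hz hzK hzη =>
    hzK ⟨χ z, hzη, hinv z hz hzη⟩
  have hχs : ContDiffOn ℝ ∞ χ U :=
    (twist m).contDiff.comp_contDiffOn ((hΦd.contDiffOn hUo).restrict_scalars ℝ)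
  have hSs : ContDiffOn ℝ ∞ S U := (hSd.contDiffOn hUo).restrict_scalars ℝ
  have hS's : ContDiffOn ℝ ∞ (fun z => starRingEnd ℂ (S z)) U :=
    Complex.conjCLE.contDiff.comp_contDiffOn hSs
  -- The test function `η ∘ χ` is weighted with `S` for the `z̄`-derivative and with its conjugate
  -- for the `z`-derivative. With `φ = S²` the Beltrami equation becomes `q η₁ = m p η₂`.
  obtain ⟨t1, e1⟩ := isTestFunction_indicator hUo hKc hKU h.subset
    ((hη.comp_contDiffOn hχs).mul hSs) fun z hz hzK => by
      simp [image_eq_zero_of_notMem_tsupport (hzero z hz hzK)]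
  obtain ⟨t2, e2⟩ := isTestFunction_indicator hUo hKc hKU h.subset
    ((hη.comp_contDiffOn hχs).mul hS's) fun z hz hzK => by
      simp [image_eq_zero_of_notMem_tsupport (hzero z hz hzK)]
  set η₁ := U.indicator fun z => (η ∘ χ) z * S z with hη₁
  set η₂ := U.indicator fun z => (η ∘ χ) z * starRingEnd ℂ (S z) with hη₂
  have hχd : ∀ z ∈ U, HasFDerivAt χ (twist m ∘L (S z • ContinuousLinearMap.id ℝ ℂ)) z := fun z hz => by
    refine (twist m).hasFDerivAt.comp z ?_
    have := (h.deriv z hz).hasFDerivAt.restrictScalars ℝ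
    refine this.congr_fderiv ?_
    ext <;> simp [mul_comm]
  -- `S` is holomorphic and its conjugate antiholomorphic, so no derivatives of the weights remain,
  -- and the terms with `∂η/∂z` cancel. What is left is `∂η/∂z̄` times the Jacobian of `χ`, ready
  -- for the change of variables.
  have hdet : ∀ z ∈ U, dzbar η₁ z - m * dz η₂ z =
      (S z * starRingEnd ℂ (S z) * (1 - m * starRingEnd ℂ m)) * dzbar η (χ z) := fun z hz => by
    have hD := ((hη.differentiable (by simp)) (χ z)).hasFDerivAt.comp z (hχd z hz)
    have hS1 := ((hSd z hz).differentiableAt (hUo.mem_nhds hz)).hasDerivAt.hasFDerivAt.restrictScalars ℝ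
    have hS2 := (Complex.conjCLE : ℂ →L[ℝ] ℂ).hasFDerivAt.comp z hS1
    have f1 : HasFDerivAt η₁ _ z := (hD.mul hS1).congr_of_eventuallyEq (by
      filter_upwards [hUo.mem_nhds hz] with x hx
      rw [hη₁, indicator_of_mem hx]; rfl)
    have f2 : HasFDerivAt η₂ _ z := (hD.mul hS2).congr_of_eventuallyEq (by
      filter_upwards [hUo.mem_nhds hz] with x hx
      rw [hη₂, indicator_of_mem hx]; rfl)
    rw [dzbar, dz, f1.fderiv, f2.fderiv]
    simp only [add_apply, smul_apply,
      ContinuousLinearMap.comp_apply, ContinuousLinearMap.id_apply, smul_eq_mul,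
      ContinuousLinearMap.coe_restrictScalars', ContinuousLinearMap.toSpanSingleton_apply,
      ContinuousLinearEquiv.coe_coe, Complex.conjCLE_apply, map_mul, Complex.conj_I, map_one,
      Function.comp_apply]
    rw [clm_eq_dz (fderiv ℝ η (χ z)) (twist m (S z * 1)),
      clm_eq_dz (fderiv ℝ η (χ z)) (twist m (S z * Complex.I)), ← dz, ← dzbar]
    simp only [twist_apply, map_add, map_mul, map_neg, Complex.conj_conj, Complex.conj_I, map_one]
    generalize dz η (χ z) = P
    generalize dzbar η (χ z) = Q
    have hI : Complex.I ^ 2 = -1 := Complex.I_sq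
    ring_nf
    simp only [hI]
    ring
  have hsub : ∀ z, z ∉ U → f z * dzbar η₁ z - m * (f z * dz η₂ z) = 0 := fun z hz => by
    rw [dzbar, dz, (e1 z fun hzK => hz (hKU hzK)).fderiv_eq,
      (e2 z fun hzK => hz (hKU hzK)).fderiv_eq]
    simp
  have hfK : ContinuousOn f K := hf.mono (hKU.trans h.subset)
  have hfd : ∀ {g : ℂ → ℂ} (k : ℂ), ContDiff ℝ ∞ g → Continuous fun z => fderiv ℝ g z k := fun k hg =>
    (hg.continuous_fderiv (by simp)).clm_apply continuous_const
  have i1 : Integrable fun z => f z * dzbar η₁ z := by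
    refine integrable_mul_of_continuousOn hKc hfK ?_ fun z hz => ?_
    · exact ((hfd 1 t1.1).add (continuous_const.mul (hfd Complex.I t1.1))).div_const 2
    · rw [dzbar, (e1 z hz).fderiv_eq]; simp
  have i2 : Integrable fun z => f z * dz η₂ z := by
    refine integrable_mul_of_continuousOn hKc hfK ?_ fun z hz => ?_
    · exact ((hfd 1 t2.1).sub (continuous_const.mul (hfd Complex.I t2.1))).div_const 2
    · rw [dz, (e2 z hz).fderiv_eq]; simp
  have hmain : ∫ z, f z * dzbar η₁ z - m * (f z * dz η₂ z) = 0 := by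
    rw [integral_sub i1 (i2.const_mul m), integral_const_mul, hq _ t1, hp _ t2]
    have : ∫ z, q z * η₁ z = ∫ z, m * (p z * η₂ z) := by
      refine integral_congr_ae ?_
      have hpq' := (ae_restrict_iff' (by exact measurableSet_ball)).1 hpq
      filter_upwards [hpq'] with z hz
      by_cases hzU : z ∈ U
      · rw [hz (h.subset hzU), hη₁, hη₂, indicator_of_mem hzU, indicator_of_mem hzU,
          ← h.sq z hzU, norm_pow, map_pow]
        have hS := h.ne z hzU
        have hS' : (starRingEnd ℂ) (S z) ≠ 0 := by simpa using hS
        have : ((‖S z‖ ^ 2 : ℝ) : ℂ) = S z * starRingEnd ℂ (S z) := by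
          rw [Complex.mul_conj']; push_cast; rfl
        rw [this]
        field_simp
      · rw [hη₁, hη₂, indicator_of_notMem hzU, indicator_of_notMem hzU]; simp
    rw [this, integral_const_mul]; ring
  rw [← setIntegral_eq_integral_of_forall_compl_eq_zero (s := U) hsub] at hmain
  have hχinj : InjOn χ U := fun z hz z' hz' e => h.inj hz hz' (by
    rw [← hB (Φ z), ← hB (Φ z')]; exact congrArg B e)
  have hcov := integral_image_eq_integral_abs_det_fderiv_smul volume hUo.measurableSet
    (fun z hz => (hχd z hz).hasFDerivWithinAt) hχinj (fun ξ => f (Ψ (B ξ)) * dzbar η ξ)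
  have hout : ∀ ξ, ξ ∉ tsupport η → dzbar η ξ = 0 := fun ξ hξ => by
    have : ∀ k, fderiv ℝ η ξ k = 0 := fun k => by
      rw [image_eq_zero_of_notMem_tsupport (fun hm => hξ (tsupport_fderiv_subset ℝ hm))]; rfl
    rw [dzbar, this, this]; simp
  rw [← setIntegral_eq_integral_of_forall_compl_eq_zero (s := χ '' U), hcov]
  · rw [← hmain]
    refine setIntegral_congr_fun hUo.measurableSet fun z hz => ?_
    have hd : (twist m ∘L (S z • ContinuousLinearMap.id ℝ ℂ)).det = ‖S z‖ ^ 2 * (1 - ‖m‖ ^ 2) := by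
      rw [det_eq, Complex.sq_norm, Complex.sq_norm, Complex.normSq_apply, Complex.normSq_apply]
      simp [twist_apply]
      ring
    simp only [hd]
    have hpos : 0 ≤ ‖S z‖ ^ 2 * (1 - ‖m‖ ^ 2) := by
      have := norm_nonneg m
      have : ‖m‖ ^ 2 ≤ 1 := pow_le_one₀ this hm.le
      exact mul_nonneg (by positivity) (by linarith)
    have hcast : ((‖S z‖ ^ 2 * (1 - ‖m‖ ^ 2) : ℝ) : ℂ) =
        S z * starRingEnd ℂ (S z) * (1 - m * starRingEnd ℂ m) := by
      rw [one_sub_mul_conj, Complex.mul_conj']; push_cast; rfl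
    rw [abs_of_nonneg hpos, Complex.real_smul, hcast,
      show f z * dzbar η₁ z - m * (f z * dz η₂ z) = f z * (dzbar η₁ z - m * dz η₂ z) by ring,
      hdet z hz]
    by_cases hzη : χ z ∈ tsupport η
    · rw [hinv z hz hzη]; ring
    · rw [hout _ hzη]; ring
  · intro ξ hξ
    rw [hout ξ fun hξη => hξ ⟨Ψ (B ξ), h.map_inv _ (hηs ξ hξη), by
      simp only [hχ]; rw [h.inv _ (hηs ξ hξη), hB']⟩, mul_zero]

/-- In a natural parameter the Beltrami coefficient is the constant `m`, so after a linear change of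
coordinates the map is weakly, hence truly, holomorphic. It is therefore differentiable at every
regular point, not only almost everywhere. -/
theorem IsQuasiconformal.hasFDerivAt (hφ : DifferentiableOn ℂ φ disk) {w : ℂ} (hw : 0 < w.re)
    {f : OpenPartialHomeomorph ℂ ℂ} (hf : IsQuasiconformal (beltrami φ w) f) {z₀ : ℂ}
    (hz : z₀ ∈ disk) (h0 : φ z₀ ≠ 0) : ∃ s a : ℂ, s ^ 2 = φ z₀ ∧ ∃ L : ℂ →L[ℝ] ℂ,
      HasFDerivAt f L z₀ ∧ ∀ h, L h = a * twist ((1 - w) / (1 + w)) (s * h) := by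
  obtain ⟨hsrc, htgt, -, p, q, -, -, hp, hq, hpq⟩ := hf
  set m := (1 - w) / (1 + w) with hm
  have hm1 : ‖m‖ < 1 := norm_moebius_lt hw
  have hfc : ContinuousOn f disk := hsrc ▸ f.continuousOn
  obtain ⟨U, Φ, S, Ψ, r, h⟩ := exists_coord hφ hz h0
  have hm2 : 1 - m * starRingEnd ℂ m ≠ 0 := by
    rw [one_sub_mul_conj, Complex.ofReal_ne_zero]
    have : ‖m‖ ^ 2 < 1 := pow_lt_one₀ (norm_nonneg _) hm1 (by norm_num)
    linarith
  have hm2' : starRingEnd ℂ (1 - m * starRingEnd ℂ m) = 1 - m * starRingEnd ℂ m := by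
    rw [one_sub_mul_conj, Complex.conj_ofReal]
  -- The inverse of `twist m`: the composition of `twist (-m)` and `twist m` is multiplication by
  -- the real number `1 - |m|²`.
  set B : ℂ → ℂ := fun ξ => (1 - m * starRingEnd ℂ m)⁻¹ * twist (-m) ξ with hBdef
  have hB : ∀ ζ, B (twist m ζ) = ζ := fun ζ => by
    simp only [hBdef, twist_twist]; field_simp
  have hB' : ∀ ξ, twist m (B ξ) = ξ := fun ξ => by
    simp only [hBdef]
    have : twist m ((1 - m * starRingEnd ℂ m)⁻¹ * twist (-m) ξ) =
        (1 - m * starRingEnd ℂ m)⁻¹ * twist m (twist (-m) ξ) := by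
      rw [twist_apply, twist_apply m (twist (-m) ξ), map_mul, map_inv₀, hm2']; ring
    have h2 := twist_twist (-m) ξ
    rw [neg_neg, map_neg, neg_mul_neg] at h2
    rw [this, h2]; field_simp
  have hBc : Continuous B := continuous_const.mul (twist (-m)).continuous
  have hB0 : B 0 = 0 := by simp [hBdef]
  have hnhds : B ⁻¹' Metric.ball 0 r ∈ 𝓝 (0 : ℂ) :=
    hBc.continuousAt.preimage_mem_nhds (Metric.isOpen_ball.mem_nhds (by simpa [hB0] using h.pos))
  obtain ⟨R', hR', hR'B⟩ := Metric.nhds_basis_closedBall.mem_iff.1 hnhds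
  obtain ⟨R, hR, rfl⟩ : ∃ R > 0, R' = 3 * R := ⟨R' / 3, by positivity, by ring⟩
  have hH : DifferentiableOn ℂ (fun ξ => f (Ψ (B ξ))) (Metric.ball 0 R) := by
    refine differentiableOn_of_weak hR (fun ξ hξ => ?_) fun η h1 h2 h3 =>
      h.weak hm1 hfc hp hq hpq hB hB' hBc h1 h2 fun ξ hξ =>
        hR'B (Metric.ball_subset_closedBall (h3 hξ))
    have k1 := h.deriv_inv _ (hR'B hξ)
    have k2 := h.subset (h.map_inv _ (hR'B hξ))
    have k3 : ContinuousAt f (Ψ (B ξ)) := hfc.continuousAt (Metric.isOpen_ball.mem_nhds k2)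
    exact (k3.comp_of_eq (k1.continuousAt.comp_of_eq hBc.continuousAt rfl) rfl).continuousWithinAt
  have hd := (hH.differentiableAt (Metric.isOpen_ball.mem_nhds (Metric.mem_ball_self hR))).hasDerivAt
  have hχd : HasFDerivAt (fun z => twist m (Φ z)) (twist m ∘L (S z₀ • ContinuousLinearMap.id ℝ ℂ)) z₀ := by
    refine (twist m).hasFDerivAt.comp z₀ ?_
    refine ((h.deriv z₀ h.mem).hasFDerivAt.restrictScalars ℝ).congr_fderiv ?_
    ext <;> simp [mul_comm]
  have hχ0 : twist m (Φ z₀) = 0 := by rw [h.map_center, map_zero]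
  set a := deriv (fun ξ => f (Ψ (B ξ))) 0
  have hcomp := HasFDerivAt.comp z₀ (hχ0.symm ▸ hd.hasFDerivAt.restrictScalars ℝ) hχd
  refine ⟨S z₀, a, h.sq z₀ h.mem, _, hcomp.congr_of_eventuallyEq ?_, fun k => ?_⟩
  · have k1 : ∀ᶠ z in 𝓝 z₀, Φ z ∈ Metric.ball (0 : ℂ) r :=
      (h.deriv z₀ h.mem).continuousAt (Metric.isOpen_ball.mem_nhds (by
        rw [h.map_center]; exact Metric.mem_ball_self h.pos))
    filter_upwards [k1, h.isOpen.mem_nhds h.mem] with z h1 h2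
    simp only [Function.comp_apply, hB]
    rw [h.left_inv h2 h1]
  · simp [mul_comm]

end TeichDisk
end

noncomputable section
namespace TeichDisk

/-! ### Dilatation of the map along slanted trajectories -/

variable {φ : ℂ → ℂ} {r : ℝ} {Ψ : ℂ → ℂ} {c : ℂ}

/-- The direction that the quasiconformal map of parameter `w` contracts most. -/
def slant (w : ℂ) : ℂ := ⟨1, w.im / Complex.normSq w⟩

theorem slant_re (w : ℂ) : (slant w).re = 1 := rfl

/-- The twist takes the direction `slant w` to `2 w k / (1 + w)` with `k = Re w / |w|²`, while `1 -
|m|² = 4 Re w / |1 + w|²`. -/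
theorem sq_norm_twist_slant {w : ℂ} (hw : 0 < w.re) :
    ‖twist ((1 - w) / (1 + w)) (slant w)‖ ^ 2 =
      w.re / Complex.normSq w * (1 - ‖(1 - w) / (1 + w)‖ ^ 2) := by
  have hw0 : w ≠ 0 := fun h => by simp [h] at hw
  have hN : 0 < Complex.normSq w := Complex.normSq_pos.2 hw0
  have h1 : 1 + w ≠ 0 := fun h => by
    have := congrArg Complex.re h; simp at this; linarith
  have hM : 0 < Complex.normSq (1 + w) := Complex.normSq_pos.2 h1
  have hk : w.re * (w.re / Complex.normSq w) + w.im / Complex.normSq w * w.im = 1 := by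
    field_simp; rw [Complex.normSq_apply]; ring
  have e : twist ((1 - w) / (1 + w)) (slant w) = 2 * w * (w.re / Complex.normSq w : ℝ) / (1 + w) := by
    rw [twist_apply, eq_div_iff h1, add_mul, mul_right_comm, div_mul_cancel₀ _ h1]
    have e1 : w.im / Complex.normSq w * w.re = w.im * (w.re / Complex.normSq w) := by ring
    generalize hkk : w.re / Complex.normSq w = k at *
    simp only [slant]
    generalize w.im / Complex.normSq w = t at *
    apply Complex.ext <;> simp
    · linear_combination (-2) * hk
    · linear_combination 2 * e1
  have h2 : Complex.normSq (1 - w) = Complex.normSq (1 + w) - 4 * w.re := by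
    simp [Complex.normSq_apply]; ring
  rw [e, Complex.sq_norm, Complex.sq_norm, Complex.normSq_div, Complex.normSq_div,
    Complex.normSq_mul, Complex.normSq_mul, Complex.normSq_ofReal, h2]
  have : Complex.normSq 2 = 4 := by simp; norm_num
  rw [this]
  field_simp
  ring

/-- In flow coordinates the first basis vector is the slanted direction. The conformal factor enters
both sides squared and drops out, so the ratio of squared stretch and Jacobian is `Re w / |w|²` at
every point. -/
theorem IsChart.hasFDerivAt_comp_flow (hφ : DifferentiableOn ℂ φ disk) (hΨ : IsChart φ r Ψ) {w : ℂ}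
    (hw : 0 < w.re) {f : OpenPartialHomeomorph ℂ ℂ} (hf : IsQuasiconformal (beltrami φ w) f) {h : ℝ}
    (hr : h ≤ r / 4) {ξ : ℂ} (hξ : ξ ∈ flowDom φ Ψ (slant w) h) :
    ∃ D : ℂ →L[ℝ] ℂ, HasFDerivAt (fun ξ => f (flow φ Ψ (slant w) ξ)) D ξ ∧ 0 ≤ D.det ∧
      ‖D 1‖ ^ 2 = w.re / Complex.normSq w * D.det := by
  obtain ⟨v, hv, hd, -⟩ := hΨ.flowDom_hasFDerivAt hφ (slant_re w) hr hξ
  have hc0 : slant w ≠ 0 := fun h0 => by have := congrArg Complex.re h0; simp [slant_re] at this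
  obtain ⟨hz, hz0⟩ := flow_mem_disk hφ hc0 hξ.1
  obtain ⟨s, a, hs, L, hL, hLa⟩ := hf.hasFDerivAt hφ hw hz hz0
  have hσ : (s * v) ^ 2 = 1 := by rw [mul_pow, hs, hv]
  set m := (1 - w) / (1 + w) with hm
  have hm1 : ‖m‖ < 1 := norm_moebius_lt hw
  refine ⟨L ∘L realLin (v * slant w) (v * Complex.I), hL.comp ξ hd, ?_⟩
  obtain ⟨b, hb, hDb⟩ : ∃ b : ℂ, ‖b‖ = ‖a‖ ∧ ∀ k : ℂ,
      L (v * k) = b * twist m k := by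
    rcases (sq_eq_sq_iff_eq_or_eq_neg.1 (hσ.trans (one_pow 2).symm)) with h1 | h1
    · exact ⟨a, rfl, fun k => by rw [hLa, ← mul_assoc, h1, one_mul]⟩
    · exact ⟨-a, norm_neg a, fun k => by rw [hLa, ← mul_assoc, h1, neg_one_mul, map_neg]; ring⟩
  have e1 : (L ∘L realLin (v * slant w) (v * Complex.I)) 1 = b * twist m (slant w) := by
    simp [realLin_apply, hDb]
  have e2 : (L ∘L realLin (v * slant w) (v * Complex.I)) Complex.I = b * twist m Complex.I := by
    simp [realLin_apply, hDb]
  have hdet : (L ∘L realLin (v * slant w) (v * Complex.I)).det = ‖b‖ ^ 2 * (1 - ‖m‖ ^ 2) := by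
    rw [det_eq, e1, e2, Complex.sq_norm, Complex.sq_norm, Complex.normSq_apply,
      Complex.normSq_apply]
    simp [twist_apply, slant]
    ring
  rw [hdet, e1, norm_mul, mul_pow, sq_norm_twist_slant hw]
  refine ⟨mul_nonneg (by positivity) ?_, by ring⟩
  have : ‖m‖ ^ 2 ≤ 1 := pow_le_one₀ (norm_nonneg m) hm1.le
  linarith

/-! ### Length of differentiable curves -/

/-- The points where the Lipschitz bound holds within distance `1 / (n + 1)` form an increasing
family that exhausts `A`. Cutting it into cells of that size gives true Lipschitz pieces, and as the
cells are measurable, additivity needs no measurability of `A`. -/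
theorem hausdorff_image_le_of_local {g : ℝ → ℂ} {A : Set ℝ} {K : NNReal}
    (h : ∀ x ∈ A, ∀ᶠ y in 𝓝 x, dist (g y) (g x) ≤ K * dist y x) :
    (Measure.hausdorffMeasure 1 : Measure ℂ) (g '' A) ≤ K * volume A := by
  set An : ℕ → Set ℝ := fun n => {x ∈ A | ∀ y, dist y x < 1 / (n + 1) →
    dist (g y) (g x) ≤ K * dist y x} with hAn
  have hmono : Monotone An := fun n m hnm x hx => ⟨hx.1, fun y hy => hx.2 y (hy.trans_le
    (one_div_le_one_div_of_le (by positivity) (by exact_mod_cast Nat.add_le_add_right hnm 1)))⟩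
  have hU : ⋃ n, An n = A := by
    refine subset_antisymm (iUnion_subset fun n x hx => hx.1) fun x hx => ?_
    obtain ⟨δ, hδ, hδ'⟩ := Metric.eventually_nhds_iff.1 (h x hx)
    obtain ⟨n, hn⟩ := exists_nat_one_div_lt hδ
    exact mem_iUnion.2 ⟨n, hx, fun y hy => hδ' (hy.trans hn)⟩
  have hstep : ∀ n, (Measure.hausdorffMeasure 1 : Measure ℂ) (g '' An n) ≤ K * volume (An n) := fun n => by
    have hn : (0 : ℝ) < n + 1 := by positivity
    set I : ℤ → Set ℝ := fun j => {x | ⌊(n + 1) * x⌋ = j} with hI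
    have hIm : ∀ j, MeasurableSet (I j) := fun j =>
      (Int.measurable_floor.comp (measurable_const_mul _)) (measurableSet_singleton j)
    have hcov : An n = ⋃ j, An n ∩ I j := by
      ext x; simp [hI]
    have hdisj : Pairwise (Function.onFun Disjoint I) := fun i j hij =>
      disjoint_left.2 fun x hx hx' => hij (hx.symm.trans hx')
    have hpiece : ∀ j, (Measure.hausdorffMeasure 1 : Measure ℂ) (g '' (An n ∩ I j)) ≤
        K * volume (An n ∩ I j) := fun j => by
      have hlip : LipschitzOnWith K g (An n ∩ I j) := LipschitzOnWith.of_dist_le_mul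
        fun x hx y hy => hy.1.2 x (by
          have h1 := Int.abs_sub_lt_one_of_floor_eq_floor (hx.2.trans hy.2.symm)
          rw [← mul_sub, abs_mul, abs_of_pos hn] at h1
          rwa [Real.dist_eq, lt_div_iff₀ hn, mul_comm])
      have := hlip.hausdorffMeasure_image_le (d := 1) zero_le_one
      rwa [ENNReal.rpow_one, hausdorffMeasure_real] at this
    calc (Measure.hausdorffMeasure 1 : Measure ℂ) (g '' An n)
        ≤ ∑' j, (Measure.hausdorffMeasure 1 : Measure ℂ) (g '' (An n ∩ I j)) := by
          conv_lhs => rw [hcov, image_iUnion]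
          exact measure_iUnion_le _
      _ ≤ ∑' j, K * volume (An n ∩ I j) := ENNReal.tsum_le_tsum hpiece
      _ = K * volume (An n) := by
          rw [ENNReal.tsum_mul_left]
          congr 1
          have := measure_iUnion (μ := (volume : Measure ℝ).restrict (An n)) hdisj hIm
          have h2 : ⋃ j, I j = univ := by ext x; simp [hI]
          rw [h2, Measure.restrict_apply_univ] at this
          rw [this]
          exact tsum_congr fun j => by rw [Measure.restrict_apply (hIm j), inter_comm]
  rw [← hU, image_iUnion, Monotone.measure_iUnion fun n m hnm => image_mono (hmono hnm)]
  exact iSup_le fun n => (hstep n).trans (mul_le_mul' le_rfl (measure_mono (subset_iUnion An n)))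

/-- The domain is sliced by the size of the derivative in steps of `δ`; on each slice the local
Lipschitz bound is at most `δ` too large. -/
theorem hausdorff_image_le_lintegral {g : ℝ → ℂ} {A : Set ℝ} (hA : MeasurableSet A)
    (hAf : volume A ≠ ⊤) (hg : ∀ x ∈ A, DifferentiableAt ℝ g x) :
    (Measure.hausdorffMeasure 1 : Measure ℂ) (g '' A) ≤ ∫⁻ x in A, ‖deriv g x‖ₑ := by
  have hmeas : Measurable fun x => ‖deriv g x‖ := (measurable_deriv g).norm
  have key : ∀ δ : NNReal, 0 < δ → (Measure.hausdorffMeasure 1 : Measure ℂ) (g '' A) ≤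
      (∫⁻ x in A, ‖deriv g x‖ₑ) + δ * volume A := fun δ hδ => by
    have hδ' : (0 : ℝ) < δ := hδ
    set Ak : ℕ → Set ℝ := fun k => A ∩ {x | ⌊‖deriv g x‖ / δ⌋₊ = k} with hAk
    have hAkm : ∀ k, MeasurableSet (Ak k) := fun k =>
      hA.inter ((Nat.measurable_floor.comp (hmeas.div_const _)) (measurableSet_singleton k))
    have hcov : A = ⋃ k, Ak k := by ext x; simp [hAk]
    have hdisj : Pairwise (Function.onFun Disjoint Ak) := fun i j hij =>
      disjoint_left.2 fun x hx hx' => hij (hx.2.symm.trans hx'.2)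
    have hpiece : ∀ k, (Measure.hausdorffMeasure 1 : Measure ℂ) (g '' Ak k) ≤
        ∫⁻ x in Ak k, (‖deriv g x‖ₑ + δ) := fun k => by
      have hK : ∀ x ∈ Ak k, ‖deriv g x‖ < ((k + 1) * δ : NNReal) := fun x hx => by
        have := Nat.lt_floor_add_one (‖deriv g x‖ / δ)
        rw [hx.2, div_lt_iff₀ hδ'] at this
        push_cast; exact this
      refine (hausdorff_image_le_of_local (K := (k + 1) * δ) fun x hx => ?_).trans ?_
      · have h2 := (hg x hx.1).hasDerivAt.hasFDerivAt
        obtain ⟨C', hC1, hC2⟩ := exists_between (hK x hx)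
        have h4 := hasFDerivAt_iff_isLittleO.1 h2
        filter_upwards [h4.def (sub_pos.2 hC1)] with y hy
        rw [dist_eq_norm, dist_eq_norm]
        calc ‖g y - g x‖ ≤ ‖g y - g x - (ContinuousLinearMap.toSpanSingleton ℝ (deriv g x)) (y - x)‖ +
              ‖(ContinuousLinearMap.toSpanSingleton ℝ (deriv g x)) (y - x)‖ := by
              simpa using norm_add_le (g y - g x - (ContinuousLinearMap.toSpanSingleton ℝ
                (deriv g x)) (y - x)) ((ContinuousLinearMap.toSpanSingleton ℝ (deriv g x)) (y - x))
          _ ≤ (C' - ‖deriv g x‖) * ‖y - x‖ + ‖deriv g x‖ * ‖y - x‖ := by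
              refine add_le_add hy (le_of_eq ?_)
              rw [ContinuousLinearMap.toSpanSingleton_apply, norm_smul, mul_comm]
          _ = C' * ‖y - x‖ := by ring
          _ ≤ _ := mul_le_mul_of_nonneg_right hC2.le (norm_nonneg _)
      · rw [← setLIntegral_const]
        refine setLIntegral_mono' (hAkm k) fun x hx => ?_
        have h5 : (k : ℝ) * δ ≤ ‖deriv g x‖ := by
          have := Nat.floor_le (div_nonneg (norm_nonneg (deriv g x)) hδ'.le)
          rwa [hx.2, le_div_iff₀ hδ'] at this
        have h6 : ((k * δ : NNReal) : ℝ≥0∞) ≤ ‖deriv g x‖ₑ := by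
          rw [← ofReal_norm, ENNReal.le_ofReal_iff_toReal_le ENNReal.coe_ne_top (norm_nonneg _)]
          simpa using h5
        rw [add_mul, one_mul, ENNReal.coe_add]
        exact add_le_add h6 le_rfl
    calc (Measure.hausdorffMeasure 1 : Measure ℂ) (g '' A)
        ≤ ∑' k, (Measure.hausdorffMeasure 1 : Measure ℂ) (g '' Ak k) := by
          conv_lhs => rw [hcov, image_iUnion]
          exact measure_iUnion_le _
      _ ≤ ∑' k, ∫⁻ x in Ak k, (‖deriv g x‖ₑ + δ) := ENNReal.tsum_le_tsum hpiece
      _ = ∫⁻ x in A, (‖deriv g x‖ₑ + δ) := by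
          conv_rhs => rw [hcov]
          rw [lintegral_iUnion hAkm hdisj]
      _ = _ := by rw [lintegral_add_right _ measurable_const, setLIntegral_const]
  refine ENNReal.le_of_forall_pos_le_add fun ε hε _ => ?_
  obtain ⟨δ, hδ, h1⟩ := ENNReal.exists_nnreal_pos_mul_lt hAf (ENNReal.coe_pos.2 hε).ne'
  exact (key δ hδ).trans (add_le_add le_rfl h1.le)

/-- Arc length on the image is dominated by the image of `‖g'‖ dx`. One inequality suffices, as it
bounds the length of an arc in the metric `ρ` from above. -/
theorem lintegral_image_le {g : ℝ → ℂ} {a b : ℝ}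
    (hg : ∀ x ∈ Ioo a b, DifferentiableAt ℝ g x) {ρ : ℂ → ℝ≥0∞} (hρ : Measurable ρ) :
    ∫⁻ z in g '' Ioo a b, ρ z ∂(Measure.hausdorffMeasure 1 : Measure ℂ) ≤
      ∫⁻ x in Ioo a b, ρ (g x) * ‖deriv g x‖ₑ := by
  have hgm : AEMeasurable g (volume.restrict (Ioo a b)) :=
    ContinuousOn.aemeasurable (fun x hx => (hg x hx).continuousAt.continuousWithinAt) measurableSet_Ioo
  set ν := (volume.restrict (Ioo a b)).withDensity fun x => ‖deriv g x‖ₑ with hν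
  have hdm : Measurable fun x => ‖deriv g x‖ₑ := (measurable_deriv g).enorm
  have hgν : AEMeasurable g ν := hgm.mono_ac (withDensity_absolutelyContinuous _ _)
  have hle : (Measure.hausdorffMeasure 1 : Measure ℂ).restrict (g '' Ioo a b) ≤ ν.map g := by
    refine Measure.le_iff.2 fun T hT => ?_
    rw [Measure.restrict_apply hT, Measure.map_apply_of_aemeasurable hgν hT]
    have hm : MeasurableSet (Ioo a b ∩ g ⁻¹' T) := by
      have h1 := measurable_indicator_of_continuousOn measurableSet_Ioo
        (fun x (hx : x ∈ Ioo a b) => (hg x hx).continuousAt.continuousWithinAt)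
      convert measurableSet_Ioo.inter (h1 hT) using 1
      ext x
      simp only [mem_inter_iff, mem_preimage]
      exact and_congr_right fun hx => by rw [indicator_of_mem hx]
    calc _ ≤ (Measure.hausdorffMeasure 1 : Measure ℂ) (g '' (Ioo a b ∩ g ⁻¹' T)) := by
          refine measure_mono ?_
          rintro _ ⟨hzT, x, hx, rfl⟩
          exact ⟨x, ⟨hx, hzT⟩, rfl⟩
      _ ≤ ∫⁻ x in Ioo a b ∩ g ⁻¹' T, ‖deriv g x‖ₑ :=
          hausdorff_image_le_lintegral hm ((measure_mono inter_subset_left).trans_lt (by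
            rw [Real.volume_Ioo]; exact ENNReal.ofReal_lt_top)).ne fun x hx => hg x hx.1
      _ = ν (Ioo a b ∩ g ⁻¹' T) := by
          rw [hν, withDensity_apply _ hm, Measure.restrict_restrict hm,
            inter_eq_left.2 (inter_subset_left : Ioo a b ∩ g ⁻¹' T ⊆ Ioo a b)]
      _ ≤ _ := measure_mono inter_subset_right
  calc _ ≤ ∫⁻ z, ρ z ∂(ν.map g) := lintegral_mono' hle le_rfl
    _ = ∫⁻ x, ρ (g x) ∂ν := lintegral_map' hρ.aemeasurable hgν
    _ = _ := by
      rw [hν, lintegral_withDensity_eq_lintegral_mul_non_measurable _ hdm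
        (Eventually.of_forall fun x => enorm_lt_top)]
      exact lintegral_congr fun x => mul_comm _ _

end TeichDisk
end

noncomputable section
namespace TeichDisk

/-! ### Slanted trajectories as arcs of the connecting family -/

variable {φ : ℂ → ℂ} {r : ℝ} {Ψ : ℂ → ℂ} {c : ℂ}

theorem exists_param {A B : ℝ} (hAB : A < B) : ∃ ψ : ℝ → ℝ, Continuous ψ ∧ Function.Injective ψ ∧
    range ψ = Ioo A B ∧ Tendsto ψ atBot (𝓝[>] A) ∧ Tendsto ψ atTop (𝓝[<] B) := by
  have hπ := Real.pi_pos
  set l : ℝ → ℝ := fun u => A + (B - A) * (u / Real.pi + 1 / 2) with hl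
  have hlc : Continuous l := by fun_prop
  have hlm : StrictMono l := fun u v huv => by
    have : u / Real.pi < v / Real.pi := div_lt_div_of_pos_right huv hπ
    have := mul_lt_mul_of_pos_left this (sub_pos.2 hAB)
    simp only [hl]; linarith
  have h1 : l (-(Real.pi / 2)) = A := by simp only [hl]; field_simp; ring
  have h2 : l (Real.pi / 2) = B := by simp only [hl]; field_simp; ring
  have hmem : ∀ t : ℝ, l (Real.arctan t) ∈ Ioo A B := fun t => by
    rw [← h1, ← h2]; exact ⟨hlm (Real.neg_pi_div_two_lt_arctan t), hlm (Real.arctan_lt_pi_div_two t)⟩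
  refine ⟨fun t => l (Real.arctan t), hlc.comp Real.continuous_arctan,
    hlm.injective.comp Real.arctan_strictMono.injective, ?_, ?_, ?_⟩
  · refine subset_antisymm (range_subset_iff.2 hmem) fun x hx => ?_
    set u := ((x - A) / (B - A) - 1 / 2) * Real.pi with hu
    have hlu : l u = x := by
      have := (sub_pos.2 hAB).ne'
      simp only [hl, hu]; field_simp; ring
    have hu1 : -(Real.pi / 2) < u := hlm.lt_iff_lt.1 (by rw [h1, hlu]; exact hx.1)
    have hu2 : u < Real.pi / 2 := hlm.lt_iff_lt.1 (by rw [h2, hlu]; exact hx.2)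
    exact ⟨Real.tan u, by simp only [Real.arctan_tan hu1 hu2, hlu]⟩
  · refine tendsto_nhdsWithin_iff.2 ⟨?_, Eventually.of_forall fun t => (hmem t).1⟩
    have := (hlc.tendsto (-(Real.pi / 2))).comp (Real.tendsto_arctan_atBot.mono_right nhdsWithin_le_nhds)
    rwa [h1] at this
  · refine tendsto_nhdsWithin_iff.2 ⟨?_, Eventually.of_forall fun t => (hmem t).2⟩
    have := (hlc.tendsto (Real.pi / 2)).comp (Real.tendsto_arctan_atTop.mono_right nhdsWithin_le_nhds)
    rwa [h2] at this

theorem exists_connectingArc {P : ℝ → ℂ} {A B : ℝ} (hAB : A < B) (hP : ContinuousOn P (Ioo A B))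
    (hi : InjOn P (Ioo A B)) (hd : ∀ x ∈ Ioo A B, P x ∈ disk) {E F : Set ℂ} {p q : ℂ}
    (hp : Tendsto P (𝓝[>] A) (𝓝 p)) (hq : Tendsto P (𝓝[<] B) (𝓝 q))
    (hEF : p ∈ E ∧ q ∈ F ∨ p ∈ F ∧ q ∈ E) :
    ∃ γ ∈ connectingArcs E F, range γ = P '' Ioo A B := by
  obtain ⟨ψ, h1, h2, h3, h4, h5⟩ := exists_param hAB
  have hm : ∀ t, ψ t ∈ Ioo A B := fun t => h3 ▸ mem_range_self t
  have hc : Continuous (P ∘ ψ) := hP.comp_continuous h1 hm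
  have hinj : Function.Injective (P ∘ ψ) := fun s t e => h2 (hi (hm s) (hm t) e)
  have hr : range (P ∘ ψ) = P '' Ioo A B := by rw [range_comp, h3]
  rcases hEF with ⟨hpE, hqF⟩ | ⟨hpF, hqE⟩
  · exact ⟨P ∘ ψ, ⟨hc, hinj, fun t => hd _ (hm t), ⟨p, hpE, hp.comp h4⟩, ⟨q, hqF, hq.comp h5⟩⟩, hr⟩
  · refine ⟨(P ∘ ψ) ∘ Neg.neg, ⟨hc.comp continuous_neg, hinj.comp neg_injective, fun t => hd _ (hm _),
      ⟨q, hqE, (hq.comp h5).comp tendsto_neg_atBot_atTop⟩,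
      ⟨p, hpF, (hp.comp h4).comp tendsto_neg_atTop_atBot⟩⟩, ?_⟩
    rw [range_comp, neg_surjective.range_eq, image_univ, hr]

/-- The energy density of the metric `ρ` along slanted trajectories. -/
def energy (φ : ℂ → ℂ) (Ψ : ℂ → ℂ) (w : ℂ) (f : ℂ → ℂ) (ρ : ℂ → ℝ≥0∞) (ξ : ℂ) : ℝ≥0∞ :=
  ENNReal.ofReal (w.re / Complex.normSq w) *
    (ENNReal.ofReal |(fderiv ℝ (fun ξ => f (flow φ Ψ (slant w) ξ)) ξ).det| *
      ρ (f (flow φ Ψ (slant w) ξ)) ^ 2)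

/-- The Cauchy-Schwarz inequality against the constant `1`. -/
theorem inv_le_of_one_le_lintegral {a b : ℝ} {G : ℝ → ℝ≥0∞}
    (hG : AEMeasurable G (volume.restrict (Ioo a b))) (h : 1 ≤ ∫⁻ x in Ioo a b, G x) :
    (ENNReal.ofReal (b - a))⁻¹ ≤ ∫⁻ x in Ioo a b, G x ^ 2 := by
  have h1 := ENNReal.lintegral_mul_le_Lp_mul_Lq (volume.restrict (Ioo a b))
    (Real.HolderConjugate.two_two) hG (aemeasurable_const (b := (1 : ℝ≥0∞)))
  simp only [Pi.mul_apply, mul_one, one_pow, lintegral_const, Measure.restrict_apply_univ,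
    Real.volume_Ioo, one_mul, ENNReal.rpow_two] at h1
  rw [← ENNReal.mul_rpow_of_nonneg _ _ (by norm_num)] at h1
  have h2 := h.trans h1
  have h3 : 1 ≤ (∫⁻ x in Ioo a b, G x ^ 2) * ENNReal.ofReal (b - a) := by
    by_contra hlt
    exact absurd h2 (not_le.2 (ENNReal.rpow_lt_one (not_le.1 hlt) (by norm_num)))
  rw [← one_div]
  exact ENNReal.div_le_of_le_mul h3

/-- The image of the line has `ρ`-length at least one; its speed squared is the factor `Re w / |w|²`
times the Jacobian, so the square of the integrand is `energy`. -/
theorem FullLine.inv_length_le (hφ : DifferentiableOn ℂ φ disk) (hΨ : IsChart φ r Ψ) {w : ℂ}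
    (hw : 0 < w.re) {f : OpenPartialHomeomorph ℂ ℂ} (hf : IsQuasiconformal (beltrami φ w) f)
    {S : Set ℂ} {y A B : ℝ} {p q : ℂ} (hy : |y| < r / 4) (hl : FullLine φ Ψ (slant w) S y A B p q)
    {E F : Set ℂ} (hEF : p ∈ E ∧ q ∈ F ∨ p ∈ F ∧ q ∈ E) {ρ : ℂ → ℝ≥0∞}
    (hρ : Allowable (imageFamily f (connectingArcs E F)) ρ) :
    (ENNReal.ofReal (B - A))⁻¹ ≤ ∫⁻ x in Ioo A B, energy φ Ψ w f ρ ⟨x, y⟩ := by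
  have hAB : A < B := hl.left_neg.trans hl.right_pos
  have hmem : ∀ x ∈ Ioo A B, (⟨x, y⟩ : ℂ) ∈ flowDom φ Ψ (slant w) (r / 4) := fun x hx =>
    ⟨(hl.mem_iff x).2 hx, hy⟩
  set P : ℝ → ℂ := fun x => flow φ Ψ (slant w) ⟨x, y⟩ with hP
  set g : ℝ → ℂ := fun x => f (P x) with hg
  have hinj : InjOn P (Ioo A B) := fun x hx x' hx' e => by
    have := hΨ.injOn_flowDom hφ (slant_re w) le_rfl (hmem x hx) (hmem x' hx') e
    exact congrArg Complex.re this
  obtain ⟨γ, hγ, hγr⟩ := exists_connectingArc hAB hl.line.traj.continuousOn hinj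
    (fun x hx => (hl.line.traj x hx).1) hl.left_tendsto hl.right_tendsto hEF
  have hadm := hρ.2 _ ⟨γ, hγ, rfl⟩
  have hder : ∀ x ∈ Ioo A B, DifferentiableAt ℝ g x ∧ ‖deriv g x‖ ^ 2 = w.re / Complex.normSq w *
      |(fderiv ℝ (fun ξ => f (flow φ Ψ (slant w) ξ)) ⟨x, y⟩).det| := fun x hx => by
    obtain ⟨D, hD, hD0, hD1⟩ := hΨ.hasFDerivAt_comp_flow hφ hw hf le_rfl (hmem x hx)
    have h1 : HasDerivAt (fun x : ℝ => (⟨x, y⟩ : ℂ)) 1 x := by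
      have h2 : HasDerivAt (fun x : ℝ => (x : ℂ) + y * Complex.I) 1 x :=
        (Complex.ofRealCLM.hasDerivAt (x := x)).add_const _
      refine h2.congr_of_eventuallyEq (Eventually.of_forall fun x => ?_)
      apply Complex.ext <;> simp
    have h3 := hD.comp_hasDerivAt x h1
    have h4 : deriv g x = D 1 := h3.deriv
    exact ⟨h3.differentiableAt, by rw [h4, hD.fderiv, hD1, abs_of_nonneg hD0]⟩
  have hrange : range (f ∘ γ) = g '' Ioo A B := by rw [range_comp, hγr, ← image_comp]; rfl
  rw [lineIntegral, hrange] at hadm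
  have hgc : ContinuousOn g (Ioo A B) := fun x hx => (hder x hx).1.continuousAt.continuousWithinAt
  have hmeas : AEMeasurable (fun x => ρ (g x) * ‖deriv g x‖ₑ) (volume.restrict (Ioo A B)) :=
    (hρ.1.comp_aemeasurable (hgc.aemeasurable measurableSet_Ioo)).mul
      (measurable_deriv g).enorm.aemeasurable
  refine (inv_le_of_one_le_lintegral hmeas (hadm.trans (lintegral_image_le
    (fun x hx => (hder x hx).1) hρ.1))).trans (le_of_eq (setLIntegral_congr_fun measurableSet_Ioo
      fun x hx => ?_))
  have h0 : 0 ≤ w.re / Complex.normSq w := div_nonneg hw.le (Complex.normSq_nonneg w)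
  simp only [energy, hg, hP]
  rw [mul_pow, ← ofReal_norm, ← ENNReal.ofReal_pow (norm_nonneg _), (hder x hx).2,
    ENNReal.ofReal_mul h0]
  ring

end TeichDisk
end

noncomputable section
namespace TeichDisk

/-! ### Energy of a finite family of strips of slanted trajectories -/

variable {φ : ℂ → ℂ} {ι : Type*} {r k : ι → ℝ} {Ψ : ι → ℂ → ℂ}

/-- The slanted flow lines through the compact vertical arc of heights at most `k`. -/
def strip (φ : ℂ → ℂ) (Ψ : ℂ → ℂ) (c : ℂ) (r k : ℝ) : Set ℂ :=
  flowDom φ Ψ c (r / 4) ∩ {ξ | |ξ.im| ≤ k}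

/-- The part of the `i`-th strip that does not meet the other strips of the family. -/
def ownStrip (φ : ℂ → ℂ) (Ψ : ι → ℂ → ℂ) (c : ℂ) (r k : ι → ℝ) (i : ι) : Set ℂ :=
  {ξ ∈ strip φ (Ψ i) c (r i) (k i) |
    ∀ j ≠ i, flow φ (Ψ i) c ξ ∉ flow φ (Ψ j) c '' strip φ (Ψ j) c (r j) (k j)}

variable {c : ℂ}

theorem measurableSet_strip (hφ : DifferentiableOn ℂ φ disk) (hΨ : ∀ i, IsChart φ (r i) (Ψ i))
    (hc : c.re = 1) (i : ι) : MeasurableSet (strip φ (Ψ i) c (r i) (k i)) :=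
  ((hΨ i).isOpen_flowDom hφ hc le_rfl).measurableSet.inter
    (measurableSet_le (by fun_prop) measurable_const)

theorem measurableSet_ownStrip [Finite ι] (hφ : DifferentiableOn ℂ φ disk)
    (hΨ : ∀ i, IsChart φ (r i) (Ψ i)) (hc : c.re = 1) (i : ι) :
    MeasurableSet (ownStrip φ Ψ c r k i) := by
  have him : ∀ j, MeasurableSet (flow φ (Ψ j) c '' strip φ (Ψ j) c (r j) (k j)) := fun j =>
    (measurableSet_strip hφ hΨ hc j).image_of_continuousOn_injOn
      (((hΨ j).continuousOn_flow hφ hc le_rfl).mono inter_subset_left)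
      (((hΨ j).injOn_flowDom hφ hc le_rfl).mono inter_subset_left)
  have hm := (hΨ i).measurable_mflow hφ hc (h := r i / 4) le_rfl
  have hU : MeasurableSet (⋃ j, ⋃ _ : j ≠ i, flow φ (Ψ j) c '' strip φ (Ψ j) c (r j) (k j)) :=
    MeasurableSet.iUnion fun j => MeasurableSet.iUnion fun _ => him j
  convert (measurableSet_strip (k := k) hφ hΨ hc i).diff (hm hU) using 1
  ext ξ
  simp only [ownStrip, Set.mem_sdiff, Set.mem_ofPred_eq]
  refine and_congr_right fun h1 => ?_
  rw [mem_preimage, mflow_eq h1.1, mem_iUnion₂]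
  push Not
  rfl

theorem measurable_indicator_energy [Finite ι] (hφ : DifferentiableOn ℂ φ disk)
    (hΨ : ∀ i, IsChart φ (r i) (Ψ i)) {w : ℂ} {f : OpenPartialHomeomorph ℂ ℂ} (hf : f.source = disk)
    {ρ : ℂ → ℝ≥0∞} (hρ : Measurable ρ) (i : ι) :
    Measurable ((ownStrip φ Ψ (slant w) r k i).indicator (energy φ (Ψ i) w f ρ)) := by
  have hX := measurableSet_ownStrip (k := k) hφ hΨ (slant_re w) i
  have hc0 : slant w ≠ 0 := fun h0 => by have := congrArg Complex.re h0; simp [slant_re] at this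
  have hfl : ContinuousOn (fun ξ => f (flow φ (Ψ i) (slant w) ξ)) (ownStrip φ Ψ (slant w) r k i) := by
    have h1 : ContinuousOn f disk := hf ▸ f.continuousOn
    exact h1.comp (((hΨ i).continuousOn_flow hφ (slant_re w) le_rfl).mono fun ξ hξ => hξ.1.1)
      fun ξ hξ => (flow_mem_disk hφ hc0 hξ.1.1.1).1
  have hm := hρ.comp (measurable_indicator_of_continuousOn hX hfl)
  have hdet : Measurable fun ξ =>
      ENNReal.ofReal |(fderiv ℝ (fun ξ => f (flow φ (Ψ i) (slant w) ξ)) ξ).det| :=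
    ENNReal.measurable_ofReal.comp ((ContinuousLinearMap.continuous_det.measurable.comp
      (measurable_fderiv ℝ _)).abs)
  have := ((hdet.mul (hm.pow_const 2)).const_mul
    (ENNReal.ofReal (w.re / Complex.normSq w))).indicator hX
  convert this using 1
  ext ξ
  by_cases hξ : ξ ∈ ownStrip φ Ψ (slant w) r k i
  · simp [indicator_of_mem hξ, energy]
  · simp [indicator_of_notMem hξ]

/-- The Jacobian in `energy` is undone by the change of variables. Parts lying on other strips have
been removed and the map is injective, so the images are disjoint and the integrals of `ρ²` add up
to at most the total. -/
theorem sum_lintegral_energy_le [Fintype ι] (hφ : DifferentiableOn ℂ φ disk)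
    (hΨ : ∀ i, IsChart φ (r i) (Ψ i)) {w : ℂ} (hw : 0 < w.re) {f : OpenPartialHomeomorph ℂ ℂ}
    (hf : IsQuasiconformal (beltrami φ w) f) {ρ : ℂ → ℝ≥0∞} (hρ : Measurable ρ) :
    ∑ i, ∫⁻ y : ℝ, ∫⁻ x : ℝ, (ownStrip φ Ψ (slant w) r k i).indicator
      (energy φ (Ψ i) w f ρ) ⟨x, y⟩ ≤
      ENNReal.ofReal (w.re / Complex.normSq w) * ∫⁻ z, ρ z ^ 2 := by
  have hc0 : slant w ≠ 0 := fun h0 => by have := congrArg Complex.re h0; simp [slant_re] at this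
  set G : ι → ℂ → ℂ := fun i ξ => f (flow φ (Ψ i) (slant w) ξ) with hG
  set X := ownStrip φ Ψ (slant w) r k with hXd
  have hX := fun i => measurableSet_ownStrip (k := k) hφ hΨ (slant_re w) i
  have hder : ∀ i, ∀ ξ ∈ X i, HasFDerivWithinAt (G i) (fderiv ℝ (G i) ξ) (X i) ξ := fun i ξ hξ => by
    obtain ⟨D, hD, -⟩ := (hΨ i).hasFDerivAt_comp_flow hφ hw hf le_rfl hξ.1.1
    exact hD.differentiableAt.hasFDerivAt.hasFDerivWithinAt
  have hfi : InjOn f disk := hf.1 ▸ f.injOn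
  have hdisk : ∀ i, ∀ ξ ∈ X i, flow φ (Ψ i) (slant w) ξ ∈ disk := fun i ξ hξ =>
    (flow_mem_disk hφ hc0 hξ.1.1.1).1
  have hinj : ∀ i, InjOn (G i) (X i) := fun i ξ hξ ξ' hξ' e =>
    (hΨ i).injOn_flowDom hφ (slant_re w) le_rfl hξ.1.1 hξ'.1.1
      (hfi (hdisk i ξ hξ) (hdisk i ξ' hξ') e)
  have h1 : ∀ i, ∫⁻ y : ℝ, ∫⁻ x : ℝ, (X i).indicator (energy φ (Ψ i) w f ρ) ⟨x, y⟩ =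
      ENNReal.ofReal (w.re / Complex.normSq w) * ∫⁻ z in G i '' X i, ρ z ^ 2 := fun i => by
    rw [← lintegral_complex_eq (measurable_indicator_energy hφ hΨ hf.1 hρ i),
      lintegral_indicator (hX i), lintegral_image_eq_lintegral_abs_det_fderiv_mul volume (hX i)
        (hder i) (hinj i), ← lintegral_const_mul' _ _ ENNReal.ofReal_ne_top]
    rfl
  rw [Finset.sum_congr rfl fun i _ => h1 i, ← Finset.mul_sum]
  refine mul_le_mul' le_rfl ?_
  rw [← lintegral_biUnion_finset]
  · exact setLIntegral_le_lintegral _ _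
  · refine fun i _ j _ hij => disjoint_left.2 ?_
    rintro _ ⟨ξ, hξ, rfl⟩ ⟨ξ', hξ', e⟩
    exact hξ.2 j hij.symm ⟨ξ', hξ'.1, hfi (hdisk j ξ' hξ') (hdisk i ξ hξ) e⟩
  · exact fun i _ => measurable_image_of_fderivWithin (hX i) (hder i) (hinj i)

/-! ### Time spent near the unit circle -/

/-- The time that the slanted trajectory at height `y` spends in `T`. -/
def timeIn (φ : ℂ → ℂ) (Ψ : ℂ → ℂ) (c : ℂ) (r : ℝ) (T : Set ℂ) (y : ℝ) : ℝ≥0∞ :=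
  ∫⁻ x : ℝ, (flowDom φ Ψ c (r / 4)).indicator (fun ξ => T.indicator 1 (flow φ Ψ c ξ)) ⟨x, y⟩

theorem measurable_slice {F : ℂ → ℝ≥0∞} (hF : Measurable F) :
    Measurable fun y : ℝ => ∫⁻ x : ℝ, F ⟨x, y⟩ := by
  have h : Measurable fun q : ℝ × ℝ => F ⟨q.2, q.1⟩ :=
    hF.comp (Complex.measurableEquivRealProd.symm.measurable.comp measurable_swap)
  exact h.lintegral_prod_right'

variable {r : ℝ} {Ψ : ℂ → ℂ}

theorem measurable_timeIn (hφ : DifferentiableOn ℂ φ disk) (hΨ : IsChart φ r Ψ) (hc : c.re = 1)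
    {T : Set ℂ} (hT : MeasurableSet T) : Measurable (timeIn φ Ψ c r T) :=
  measurable_slice (hΨ.measurable_indicator_flow hφ hc le_rfl (measurable_one.indicator hT))

theorem lintegral_timeIn_le (hφ : DifferentiableOn ℂ φ disk) (hΨ : IsChart φ r Ψ) (hc : c.re = 1)
    {T : Set ℂ} (hT : MeasurableSet T) : ∫⁻ y, timeIn φ Ψ c r T y ≤ ∫⁻ z in T, dens φ z := by
  refine (hΨ.lintegral_flow_lines_le hφ hc le_rfl (measurable_one.indicator hT)).trans (le_of_eq ?_)
  rw [← lintegral_indicator hT]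
  refine lintegral_congr fun z => ?_
  by_cases hz : z ∈ T <;> simp [hz]

theorem timeIn_eq {y : ℝ} (hy : |y| < r / 4) {T : Set ℂ} {A B : ℝ}
    (h : ∀ x : ℝ, (⟨x, y⟩ : ℂ) ∈ flowSet φ Ψ c ↔ x ∈ Ioo A B)
    (hT : MeasurableSet (Ioo A B ∩ {x : ℝ | flow φ Ψ c ⟨x, y⟩ ∈ T})) :
    timeIn φ Ψ c r T y = volume (Ioo A B ∩ {x : ℝ | flow φ Ψ c ⟨x, y⟩ ∈ T}) := by
  rw [← lintegral_indicator_one hT, timeIn]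
  refine lintegral_congr fun x => ?_
  by_cases hx : x ∈ Ioo A B
  · have h1 : (⟨x, y⟩ : ℂ) ∈ flowDom φ Ψ c (r / 4) := ⟨(h x).2 hx, hy⟩
    by_cases hxT : flow φ Ψ c ⟨x, y⟩ ∈ T <;> simp [h1, hxT, hx.1, hx.2, indicator]
  · have h1 : (⟨x, y⟩ : ℂ) ∉ flowDom φ Ψ c (r / 4) := fun h2 => hx ((h x).1 h2.1)
    rw [indicator_of_notMem h1, indicator_of_notMem fun h2 => hx h2.1]

theorem tendsto_lintegral_annulus (hφ : DifferentiableOn ℂ φ disk) (hi : IntegrableOn φ disk) :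
    Tendsto (fun m : ℕ => ∫⁻ z in {z : ℂ | 1 - 1 / (m + 1 : ℝ) < ‖z‖}, dens φ z) atTop (𝓝 0) := by
  have hT : ∀ m : ℕ, MeasurableSet {z : ℂ | 1 - 1 / (m + 1 : ℝ) < ‖z‖} := fun m =>
    measurableSet_lt measurable_const measurable_norm
  simp only [← lintegral_indicator (hT _)]
  rw [← lintegral_zero (μ := (volume : Measure ℂ))]
  refine tendsto_lintegral_of_dominated_convergence (dens φ)
    (fun m => (measurable_dens hφ).indicator (hT m))
    (fun m => Eventually.of_forall fun z => indicator_le_self _ _ z)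
    (lintegral_dens_lt_top hi).ne (Eventually.of_forall fun z => ?_)
  by_cases hz : z ∈ disk
  · have h1 : ‖z‖ < 1 := by rwa [disk, mem_ball_zero_iff] at hz
    have h2 := (tendsto_one_div_add_atTop_nhds_zero_nat (𝕜 := ℝ)).const_sub 1
    rw [sub_zero] at h2
    refine tendsto_const_nhds.congr' ?_
    filter_upwards [(tendsto_order.1 h2).1 _ h1] with m hm
    rw [eq_comm, indicator_apply_eq_zero]
    exact fun h3 => absurd h3 (lt_asymm hm)
  · refine tendsto_const_nhds.congr fun m => ?_
    rw [eq_comm, indicator_apply_eq_zero]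
    exact fun _ => indicator_of_notMem hz _

/-- If the slopes are summable, slope times length tends to zero on almost every line. -/
theorem ae_tendsto_slope_mul_length (hφ : DifferentiableOn ℂ φ disk) (hi : IntegrableOn φ disk)
    (hΨ : IsChart φ r Ψ) {c : ℕ → ℂ} (hc : ∀ n, (c n).re = 1) (hs : ∀ n, |(c n).im| ≤ (1 / 2) ^ n) :
    ∀ᵐ y : ℝ, |y| < r / 4 → Tendsto (fun n => ENNReal.ofReal |(c n).im| *
      volume {x : ℝ | (⟨x, y⟩ : ℂ) ∈ flowSet φ Ψ (c n)}) atTop (𝓝 0) := by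
  have hm : ∀ n, Measurable fun y => ENNReal.ofReal |(c n).im| * timeIn φ Ψ (c n) r univ y := fun n =>
    (measurable_timeIn hφ hΨ (hc n) MeasurableSet.univ).const_mul _
  -- The integral of the lengths is at most the `φ`-area for every slope, so slopes below `2⁻ⁿ` give
  -- a summable series, finite almost everywhere.
  have hfin : ∫⁻ y, ∑' n, ENNReal.ofReal |(c n).im| * timeIn φ Ψ (c n) r univ y < ⊤ := by
    rw [lintegral_tsum fun n => (hm n).aemeasurable]
    have hb : ∀ n, ∫⁻ y, ENNReal.ofReal |(c n).im| * timeIn φ Ψ (c n) r univ y ≤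
        2⁻¹ ^ n * ∫⁻ z, dens φ z := fun n => by
      rw [lintegral_const_mul _ (measurable_timeIn hφ hΨ (hc n) MeasurableSet.univ)]
      refine mul_le_mul' ?_ ((lintegral_timeIn_le hφ hΨ (hc n) MeasurableSet.univ).trans
        (setLIntegral_le_lintegral _ _))
      refine (ENNReal.ofReal_le_ofReal (hs n)).trans (le_of_eq ?_)
      rw [ENNReal.ofReal_pow (by norm_num), one_div, ENNReal.ofReal_inv_of_pos (by norm_num)]
      simp
    refine (ENNReal.tsum_le_tsum hb).trans_lt ?_
    rw [ENNReal.tsum_mul_right, ENNReal.tsum_geometric]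
    refine ENNReal.mul_lt_top ?_ (lintegral_dens_lt_top hi)
    rw [ENNReal.one_sub_inv_two, inv_inv]
    exact ENNReal.ofNat_lt_top
  filter_upwards [ae_lt_top (Measurable.tsum hm) hfin.ne] with y hy hyr
  refine (ENNReal.tendsto_atTop_zero_of_tsum_ne_top hy.ne).congr fun n => ?_
  congr 1
  have hpre : MeasurableSet {x : ℝ | (⟨x, y⟩ : ℂ) ∈ flowSet φ Ψ (c n)} := by
    have h1 := (hΨ.isOpen_flowDom hφ (hc n) (h := r / 4) le_rfl).measurableSet
    have h2 : Measurable fun x : ℝ => (⟨x, y⟩ : ℂ) :=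
      Complex.measurableEquivRealProd.symm.measurable.comp (measurable_id.prodMk measurable_const)
    convert h2 h1 using 1
    ext x
    exact ⟨fun h3 => ⟨h3, hyr⟩, fun h3 => h3.1⟩
  rw [← lintegral_indicator_one hpre, timeIn]
  refine lintegral_congr fun x => ?_
  by_cases hx : (⟨x, y⟩ : ℂ) ∈ flowSet φ Ψ (c n)
  · have h1 : (⟨x, y⟩ : ℂ) ∈ flowDom φ Ψ (c n) (r / 4) := ⟨hx, hyr⟩
    rw [indicator_of_mem h1, indicator_of_mem (mem_univ _),
      indicator_of_mem (show x ∈ {x : ℝ | (⟨x, y⟩ : ℂ) ∈ flowSet φ Ψ (c n)} from hx)]; rfl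
  · have h1 : (⟨x, y⟩ : ℂ) ∉ flowDom φ Ψ (c n) (r / 4) := fun h2 => hx h2.1
    rw [indicator_of_notMem h1,
      indicator_of_notMem (show x ∉ {x : ℝ | (⟨x, y⟩ : ℂ) ∈ flowSet φ Ψ (c n)} from hx)]

end TeichDisk
end

noncomputable section
namespace TeichDisk

/-! ### Complete horizontal trajectories and the vertical trajectories of `-φ` -/

variable {φ : ℂ → ℂ} {r : ℝ} {Ψ : ℂ → ℂ} {c : ℂ} {S : Set ℂ} {y A B : ℝ} {p q : ℂ}

/-- A trajectory that meets a complete one is part of it. -/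
theorem FullLine.meet (hφ : DifferentiableOn ℂ φ disk) (hc : c ≠ 0)
    (h : FullLine φ Ψ c S y A B p q) {a b x t : ℝ} {γ : ℝ → ℂ} (hγ : IsTraj φ c (Ioo a b) γ)
    (hx : x ∈ Ioo A B) (ht : t ∈ Ioo a b) (e : flow φ Ψ c ⟨x, y⟩ = γ t) :
    ∃ ε : ℝ, (ε = 1 ∨ ε = -1) ∧
      deriv (fun x : ℝ => flow φ Ψ c ⟨x, y⟩) x * ε = deriv γ t ∧ ∀ s ∈ Ioo a b,
      x + ε * (s - t) ∈ Ioo A B ∧ flow φ Ψ c ⟨x + ε * (s - t), y⟩ = γ s := by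
  obtain ⟨ε, hε, a₁, b₁, γ₁, h1, h2, h3, h4⟩ := h.line.traj.meet hφ hc hγ hx ht e
  have h0 := h.line.zero_mem
  have hev := fun {x} (hx : x ∈ Ioo A B) =>
    (h3.eventuallyEq_of_mem (isOpen_Ioo.mem_nhds hx)).deriv_eq
  have hfl : IsFlowLine φ Ψ c y a₁ b₁ γ₁ := ⟨h1, h2 h0, (h3 h0).trans h.line.map_zero,
    (hev h0).trans h.line.deriv_zero⟩
  refine ⟨ε, hε, ?_, fun s hs => ?_⟩
  · have := (h4 t ht).2.2
    rwa [sub_self, mul_zero, add_zero, hev hx] at this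
  · obtain ⟨k1, k2, -⟩ := h4 s hs
    have := hfl.flow_eq hφ hc k1
    exact ⟨(h.mem_iff _).1 (hfl.mem_flowSet k1), by rw [this, k2]⟩

/-- The times have a cluster point in `[A, B]`. It cannot be interior, as there the trajectory takes
values inside the open disk while the limit lies on the circle. -/
theorem FullLine.end_eq {ι : Type*} (h : FullLine φ Ψ c S y A B p q) {l : Filter ι} [l.NeBot]
    {u : ι → ℝ} {γ : ι → ℂ}
    (hu : ∀ᶠ s in l, u s ∈ Ioo A B ∧ flow φ Ψ c ⟨u s, y⟩ = γ s) {q' : ℂ} (hq' : ‖q'‖ = 1)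
    (hγ : Tendsto γ l (𝓝 q')) : MapClusterPt A l u ∧ q' = p ∨ MapClusterPt B l u ∧ q' = q := by
  set P := fun x : ℝ => flow φ Ψ c ⟨x, y⟩ with hP
  obtain ⟨x, hx, hcl⟩ := isCompact_Icc.exists_mapClusterPt (f := l) (u := u) (s := Icc A B)
    (tendsto_principal.2 (hu.mono fun s hs => Ioo_subset_Icc_self hs.1))
  have key : ∀ {z : ℂ}, Tendsto P (𝓝[Ioo A B] x) (𝓝 z) → q' = z := by
    intro z hz
    have hle : 𝓝 x ⊓ map u l ≤ 𝓝[Ioo A B] x :=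
      inf_le_inf_left _ (tendsto_principal.2 (hu.mono fun s hs => hs.1))
    have h1 := hcl.tendsto_comp' (hz.mono_left hle)
    have h2 : Tendsto (P ∘ u) l (𝓝 q') := hγ.congr' (hu.mono fun s hs => hs.2.symm)
    exact (eq_of_nhds_neBot (ClusterPt.mono h1 h2)).symm
  rcases hx.1.eq_or_lt with rfl | hA
  · exact Or.inl ⟨hcl, key (h.left_tendsto.mono_left (nhdsWithin_mono _ Ioo_subset_Ioi_self))⟩
  rcases hx.2.eq_or_lt with rfl | hB
  · exact Or.inr ⟨hcl, key (h.right_tendsto.mono_left (nhdsWithin_mono _ Ioo_subset_Iio_self))⟩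
  have h1 := h.line.traj x ⟨hA, hB⟩
  have h2 : ‖P x‖ < 1 := by
    have := h1.1; rwa [disk, mem_ball_zero_iff] at this
  have h3 : q' = P x := key (h.line.traj.continuousOn x ⟨hA, hB⟩)
  rw [← h3, hq'] at h2
  exact absurd h2 (lt_irrefl _)

theorem comap_coe_nhdsLT {α β : EReal} (h : α < β) :
    (comap ((↑) : ℝ → EReal) (𝓝[<] β)).NeBot ∧
      ∀ᶠ s : ℝ in comap ((↑) : ℝ → EReal) (𝓝[<] β), α < s ∧ (s : EReal) < β := by
  refine ⟨comap_neBot fun t ht => ?_, preimage_mem_comap (Ioo_mem_nhdsLT h)⟩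
  obtain ⟨l, hl, hlt⟩ := (mem_nhdsLT_iff_exists_Ioo_subset' h).1 ht
  obtain ⟨s, h1, h2⟩ := EReal.lt_iff_exists_real_btwn.1 (Set.mem_Iio.1 hl)
  exact ⟨s, hlt ⟨h1, h2⟩⟩

theorem comap_coe_nhdsGT {α β : EReal} (h : α < β) :
    (comap ((↑) : ℝ → EReal) (𝓝[>] α)).NeBot ∧
      ∀ᶠ s : ℝ in comap ((↑) : ℝ → EReal) (𝓝[>] α), α < s ∧ (s : EReal) < β := by
  refine ⟨comap_neBot fun t ht => ?_, preimage_mem_comap (Ioo_mem_nhdsGT h)⟩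
  obtain ⟨l, hl, hlt⟩ := (mem_nhdsGT_iff_exists_Ioo_subset' h).1 ht
  obtain ⟨s, h1, h2⟩ := EReal.lt_iff_exists_real_btwn.1 (Set.mem_Ioi.1 hl)
  exact ⟨s, hlt ⟨h1, h2⟩⟩

/-- The end points of a complete trajectory that lies on a connecting trajectory. -/
theorem FullLine.ends_mem (hφ : DifferentiableOn ℂ φ disk) (h : FullLine φ Ψ 1 S y A B p q)
    {E F : Set ℂ} (hE : ∀ z ∈ E, ‖z‖ = 1) (hF : ∀ z ∈ F, ‖z‖ = 1)
    (hz : Ψ (y * Complex.I) ∈ connectingTrajectories (fun z => -φ z) E F) :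
    p ∈ E ∧ q ∈ F ∨ p ∈ F ∧ q ∈ E := by
  obtain ⟨α, β, γ, ⟨hαβ, hγ⟩, ⟨p', hp'E, hp'⟩, ⟨q', hq'F, hq'⟩, t, ht1, ht2, ht⟩ := hz
  have hγt : ∀ a b : ℝ, α < a → (b : EReal) < β → IsTraj φ 1 (Ioo a b) γ := fun a b ha hb s hs => by
    obtain ⟨h1, v, h2, h3⟩ := hγ s (ha.trans (EReal.coe_lt_coe_iff.2 hs.1))
      ((EReal.coe_lt_coe_iff.2 hs.2).trans hb)
    exact ⟨h1, v, h2, by linear_combination -h3⟩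
  have hder : deriv (fun x : ℝ => flow φ Ψ 1 ⟨x, y⟩) 0 ≠ 0 :=
    h.line.traj.deriv_ne one_ne_zero h.line.zero_mem
  have hloc : ∀ s : ℝ, α < s → (s : EReal) < β → ∃ ε : ℝ, (ε = 1 ∨ ε = -1) ∧
      deriv (fun x : ℝ => flow φ Ψ 1 ⟨x, y⟩) 0 * ε = deriv γ t ∧
      0 + ε * (s - t) ∈ Ioo A B ∧ flow φ Ψ 1 ⟨0 + ε * (s - t), y⟩ = γ s := fun s hs1 hs2 => by
    obtain ⟨a, ha1, ha2⟩ := EReal.lt_iff_exists_real_btwn.1 (lt_min ht1 hs1)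
    obtain ⟨b, hb1, hb2⟩ := EReal.lt_iff_exists_real_btwn.1 (max_lt ht2 hs2)
    rw [lt_min_iff, EReal.coe_lt_coe_iff, EReal.coe_lt_coe_iff] at ha2
    rw [max_lt_iff, EReal.coe_lt_coe_iff, EReal.coe_lt_coe_iff] at hb1
    obtain ⟨ε, h1, h2, h3⟩ := h.meet hφ one_ne_zero (hγt a b ha1 hb2) h.line.zero_mem
      ⟨ha2.1, hb1.1⟩ (h.line.map_zero.trans ht.symm)
    exact ⟨ε, h1, h2, h3 s ⟨ha2.2, hb1.2⟩⟩
  obtain ⟨ε, hε, hεd, -⟩ := hloc t ht1 ht2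
  -- The orientation was obtained on bounded subintervals; it is the same for all of them, since the
  -- velocity at time `t` determines it.
  have hall : ∀ s : ℝ, α < s → (s : EReal) < β →
      ε * (s - t) ∈ Ioo A B ∧ flow φ Ψ 1 ⟨ε * (s - t), y⟩ = γ s := fun s hs1 hs2 => by
    obtain ⟨ε', -, h2, h3⟩ := hloc s hs1 hs2
    have : (ε : ℂ) = ε' := mul_left_cancel₀ hder (hεd.trans h2.symm)
    rw [← Complex.ofReal_injective this, zero_add] at h3
    exact h3
  obtain ⟨n1, e1⟩ := comap_coe_nhdsGT ht1
  obtain ⟨n2, e2⟩ := comap_coe_nhdsLT ht2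
  have hL := h.end_eq (u := fun s => ε * (s - t)) (e1.mono fun s hs => hall s hs.1 (hs.2.trans ht2))
    (hE p' hp'E) hp'
  have hR := h.end_eq (u := fun s => ε * (s - t)) (e2.mono fun s hs => hall s (ht1.trans hs.1) hs.2)
    (hF q' hq'F) hq'
  have hA := h.left_neg
  have hB := h.right_pos
  -- Times of one sign cannot cluster at the end of the other side, so the orientation `ε` decides
  -- which end belongs to which arc.
  have pos : ∀ {l : Filter ℝ} {u : ℝ → ℝ}, (∀ᶠ s in l, 0 ≤ u s) → ¬ MapClusterPt A l u :=
    fun hu hcl => absurd hA (not_lt.2 (isClosed_Ici.mem_of_mapClusterPt hcl hu))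
  have neg : ∀ {l : Filter ℝ} {u : ℝ → ℝ}, (∀ᶠ s in l, u s ≤ 0) → ¬ MapClusterPt B l u :=
    fun hu hcl => absurd hB (not_lt.2 (isClosed_Iic.mem_of_mapClusterPt hcl hu))
  have l1 : ∀ᶠ s : ℝ in comap ((↑) : ℝ → EReal) (𝓝[>] α), s - t ≤ 0 := e1.mono fun s hs => by
    linarith [EReal.coe_lt_coe_iff.1 hs.2]
  have l2 : ∀ᶠ s : ℝ in comap ((↑) : ℝ → EReal) (𝓝[<] β), 0 ≤ s - t := e2.mono fun s hs => by
    linarith [EReal.coe_lt_coe_iff.1 hs.1]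
  rcases hε with rfl | rfl
  · left
    refine ⟨?_, ?_⟩
    · rcases hL with ⟨-, rfl⟩ | ⟨hc, -⟩
      · exact hp'E
      · exact absurd hc (neg (l1.mono fun s hs => by linarith))
    · rcases hR with ⟨hc, -⟩ | ⟨-, rfl⟩
      · exact absurd hc (pos (l2.mono fun s hs => by linarith))
      · exact hq'F
  · right
    refine ⟨?_, ?_⟩
    · rcases hR with ⟨-, rfl⟩ | ⟨hc, -⟩
      · exact hq'F
      · exact absurd hc (neg (l2.mono fun s hs => by linarith))
    · rcases hL with ⟨hc, -⟩ | ⟨-, rfl⟩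
      · exact absurd hc (pos (l1.mono fun s hs => by linarith))
      · exact hp'E

/-- Only this inequality is needed: it bounds the integrand `1 / l` of the trajectory measure from
above. -/
theorem FullLine.le_verticalLength (h : FullLine φ Ψ 1 S y A B p q) :
    ENNReal.ofReal (B - A) ≤ verticalLength (fun z => -φ z) (Ψ (y * Complex.I)) := by
  have hv : IsVerticalArc (fun z => -φ z) A B (fun x : ℝ => flow φ Ψ 1 ⟨x, y⟩) := by
    refine ⟨EReal.coe_lt_coe_iff.2 (h.left_neg.trans h.right_pos), fun t h1 h2 => ?_⟩
    obtain ⟨k1, v, k2, k3⟩ := h.line.traj t ⟨EReal.coe_lt_coe_iff.1 h1, EReal.coe_lt_coe_iff.1 h2⟩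
    exact ⟨k1, v, k2, by linear_combination -k3⟩
  refine le_trans (le_of_eq ?_) (le_iSup₂_of_le (A : EReal) (B : EReal) (le_iSup₂_of_le _ hv
    (le_iSup_of_le ⟨0, EReal.coe_lt_coe_iff.2 h.left_neg, EReal.coe_lt_coe_iff.2 h.right_pos,
      h.line.map_zero⟩ le_rfl)))
  rw [← EReal.coe_sub, EReal.toENNReal_of_ne_top (EReal.coe_ne_top _), EReal.toReal_coe]

/-- The segment of the chart through the starting point has length `r`. So inverse lengths stay
bounded on each transversal. -/
theorem FullLine.le_length (hΨ : IsChart φ r Ψ) (hy : |y| < r / 4)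
    (h : FullLine φ Ψ 1 S y A B p q) : r ≤ B - A := by
  have hr := hΨ.pos
  have hm : ∀ x ∈ Ioo (-(r / 2)) (r / 2), (y : ℂ) * Complex.I + 1 * x ∈ Metric.ball (0 : ℂ) r :=
    fun x hx => by
      rw [mem_ball_zero_iff]
      refine norm_lt_of_re_im (x := r / 2) (y := r / 4) ?_ ?_ (by linarith)
      · simpa using (abs_lt.2 hx).le
      · simpa using hy
  have h0 : (0 : ℝ) ∈ Ioo (-(r / 2)) (r / 2) := ⟨by linarith, by linarith⟩
  have hfl : IsFlowLine φ Ψ 1 y (-(r / 2)) (r / 2) (fun x : ℝ => Ψ (y * Complex.I + 1 * x)) := by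
    refine ⟨?_, h0, by simp, ?_⟩
    · have := (hΨ.flat.line (y * Complex.I) 1).mono (J := Ioo (-(r / 2)) (r / 2)) hm
      rwa [one_mul] at this
    · rw [(hΨ.flat.hasDerivAt_line _ 1 (hm 0 h0)).deriv]; simp
  have hle : ∀ x ∈ Ioo (-(r / 2)) (r / 2), x ∈ Ioo A B := fun x hx =>
    (h.mem_iff x).1 (hfl.mem_flowSet hx)
  have hsub := (Ioo_subset_Ioo_iff (by linarith : -(r / 2) < r / 2)).1 hle
  linarith

/-- The error made by lengthening `b` by `τ` is linear in `τ`, hence integrable against the time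
spent in the annulus. -/
theorem inv_le_inv_add_add {b τ : ℝ≥0∞} (hb : b ≠ 0) (hb' : b ≠ ⊤) :
    b⁻¹ ≤ (b + τ)⁻¹ + b⁻¹ ^ 2 * τ := by
  rcases eq_or_ne τ ⊤ with rfl | hτ
  · rw [ENNReal.mul_top (pow_ne_zero 2 (ENNReal.inv_ne_zero.2 hb')), add_top]; exact le_top
  · lift b to NNReal using hb'
    lift τ to NNReal using hτ
    have hb0 : b ≠ 0 := by simpa using hb
    have hb1 : 0 < b := pos_iff_ne_zero.2 hb0
    rw [← ENNReal.coe_add, ← ENNReal.coe_inv hb0, ← ENNReal.coe_inv (by positivity)]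
    norm_cast
    rw [← NNReal.coe_le_coe]
    push_cast
    have h1 : (0 : ℝ) < b := hb1
    have h2 : (0 : ℝ) ≤ τ := τ.2
    rw [← sub_nonneg]
    have : ((b : ℝ) + τ)⁻¹ + (b : ℝ)⁻¹ ^ 2 * τ - (b : ℝ)⁻¹ = τ ^ 2 / (b ^ 2 * (b + τ)) := by
      field_simp; ring
    rw [this]; positivity

end TeichDisk
end

noncomputable section
namespace TeichDisk

/-! ### Comparison of a horizontal trajectory with nearby slanted trajectories -/

section

variable {φ : ℂ → ℂ} {r : ℝ} {Ψ : ℂ → ℂ} {c : ℂ} {S : Set ℂ} {y A B : ℝ} {p q : ℂ}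

/-- A complete trajectory with its end points has positive distance from a compact set that it does
not meet. -/
theorem FullLine.exists_le_dist (h : FullLine φ Ψ c S y A B p q) {K : Set ℂ} (hK : IsCompact K)
    (hKd : K ⊆ disk) (hd : ∀ x ∈ Ioo A B, flow φ Ψ c ⟨x, y⟩ ∉ K) :
    ∃ η > 0, ∀ z ∈ K, η ≤ dist p z ∧ η ≤ dist q z ∧
      ∀ x ∈ Ioo A B, η ≤ dist (flow φ Ψ c ⟨x, y⟩) z := by
  have hAB : A < B := h.left_neg.trans h.right_pos
  set P : ℝ → ℂ := fun x => flow φ Ψ c ⟨x, y⟩ with hP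
  have hPc : ContinuousOn P (Ioo A B) := h.line.traj.continuousOn
  -- With its two limits the trajectory becomes a compact set, so disjointness from `K` gives a
  -- positive distance.
  set Q := extendFrom (Ioo A B) P with hQ
  have hQc : ContinuousOn Q (Icc A B) :=
    continuousOn_Icc_extendFrom_Ioo hPc h.left_tendsto h.right_tendsto
  have hQA : Q A = p := eq_lim_at_left_extendFrom_Ioo hAB h.left_tendsto
  have hQB : Q B = q := eq_lim_at_right_extendFrom_Ioo hAB h.right_tendsto
  have hQP : ∀ x ∈ Ioo A B, Q x = P x := fun x hx =>
    extendFrom_eq (subset_closure hx) (hPc x hx)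
  have hnorm : ∀ z : ℂ, ‖z‖ = 1 → z ∉ K := fun z hz hzK => by
    have := hKd hzK
    rw [disk, mem_ball_zero_iff, hz] at this
    exact lt_irrefl _ this
  have hdisj : Disjoint (Q '' Icc A B) K := by
    rw [disjoint_left]
    rintro _ ⟨x, hx, rfl⟩
    rcases hx.1.eq_or_lt with rfl | hA
    · rw [hQA]; exact hnorm _ h.norm_left
    rcases hx.2.eq_or_lt with rfl | hB
    · rw [hQB]; exact hnorm _ h.norm_right
    rw [hQP x ⟨hA, hB⟩]
    exact hd x ⟨hA, hB⟩
  obtain ⟨η, hη, hthick⟩ := Metric.exists_pos_forall_lt_edist (isCompact_Icc.image_of_continuousOn hQc)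
    hK.isClosed hdisj
  have key : ∀ x ∈ Icc A B, ∀ z ∈ K, (η : ℝ) ≤ dist (Q x) z := fun x hx z hz => by
    have := hthick _ (mem_image_of_mem Q hx) z hz
    rw [edist_nndist, ENNReal.coe_lt_coe] at this
    exact_mod_cast this.le
  refine ⟨η, hη, fun z hz => ⟨?_, ?_, fun x hx => ?_⟩⟩
  · rw [← hQA]; exact key A (left_mem_Icc.2 hAB.le) z hz
  · rw [← hQB]; exact key B (right_mem_Icc.2 hAB.le) z hz
  · have := key x (Ioo_subset_Icc_self hx) z hz
    rwa [hQP x hx] at this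

end

variable {φ : ℂ → ℂ} {ι : Type*} {r k : ι → ℝ} {Ψ : ι → ℂ → ℂ}

/-- If a complete slanted trajectory stays close to a complete horizontal one, then the inverse
length of the horizontal one is bounded by the energy of the slanted one. -/
theorem FullLine.inv_length_le_energy (hφ : DifferentiableOn ℂ φ disk)
    (hΨ : ∀ i, IsChart φ (r i) (Ψ i)) {w : ℂ} (hw : 0 < w.re) {f : OpenPartialHomeomorph ℂ ℂ}
    (hf : IsQuasiconformal (beltrami φ w) f) {i : ι} {S S' : Set ℂ} {y A B A' B' : ℝ} {p q p' q' : ℂ}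
    (hk : k i < r i / 4) (hy : |y| ≤ k i) (h : FullLine φ (Ψ i) 1 S y A B p q)
    (h' : FullLine φ (Ψ i) (slant w) S' y A' B' p' q') {E F : Set ℂ} {ρ : ℂ → ℝ≥0∞}
    (hρ : Allowable (imageFamily f (connectingArcs E F)) ρ) {η : ℝ}
    (hEF : ∀ p' q' : ℂ, ‖p'‖ = 1 → ‖q'‖ = 1 → dist p' p ≤ η → dist q' q ≤ η →
      p' ∈ E ∧ q' ∈ F ∨ p' ∈ F ∧ q' ∈ E)
    (hK : ∀ j ≠ i, ∀ u : ℝ, |u| ≤ k j → η ≤ dist p (Ψ j (u * Complex.I)) ∧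
      η ≤ dist q (Ψ j (u * Complex.I)) ∧
      ∀ x ∈ Ioo A B, η ≤ dist (flow φ (Ψ i) 1 ⟨x, y⟩) (Ψ j (u * Complex.I)))
    {m : ℕ} (hm : η ≤ 1 / (m + 1 : ℝ)) {x₀ x₁ : ℝ} (hx₀ : x₀ ∈ Ioo A 0) (hx₁ : x₁ ∈ Ioo 0 B)
    (h1 : ∀ t ∈ Icc x₀ x₁, (⟨t, y⟩ : ℂ) ∈ flowSet φ (Ψ i) (slant w) ∧
      dist (flow φ (Ψ i) (slant w) ⟨t, y⟩) (flow φ (Ψ i) 1 ⟨t, y⟩) < η)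
    (h2 : ∀ t : ℝ, (⟨t, y⟩ : ℂ) ∈ flowSet φ (Ψ i) (slant w) →
      (t ≤ x₀ → dist (flow φ (Ψ i) (slant w) ⟨t, y⟩) p < η) ∧
      (x₁ ≤ t → dist (flow φ (Ψ i) (slant w) ⟨t, y⟩) q < η)) :
    (ENNReal.ofReal (B - A))⁻¹ ≤
      (∫⁻ x : ℝ, (ownStrip φ Ψ (slant w) r k i).indicator (energy φ (Ψ i) w f ρ) ⟨x, y⟩) +
      (ENNReal.ofReal (r i))⁻¹ ^ 2 *
        timeIn φ (Ψ i) (slant w) (r i) {z : ℂ | 1 - 1 / (m + 1 : ℝ) < ‖z‖} y := by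
  have hc0 : slant w ≠ 0 := fun h0 => by have := congrArg Complex.re h0; simp [slant_re] at this
  have hyr : |y| < r i / 4 := hy.trans_lt hk
  have hm0 : x₀ ∈ Ioo A' B' := (h'.mem_iff _).1 (h1 x₀ ⟨le_rfl, (hx₀.2.trans hx₁.1).le⟩).1
  have hm1 : x₁ ∈ Ioo A' B' := (h'.mem_iff _).1 (h1 x₁ ⟨(hx₀.2.trans hx₁.1).le, le_rfl⟩).1
  have hAB' : A' < B' := h'.left_neg.trans h'.right_pos
  have hp : dist p' p ≤ η := by
    refine le_of_tendsto (h'.left_tendsto.dist tendsto_const_nhds) ?_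
    filter_upwards [Ioo_mem_nhdsGT hm0.1] with t ht
    exact ((h2 t ((h'.mem_iff t).2 ⟨ht.1, ht.2.trans hm0.2⟩)).1 ht.2.le).le
  have hq : dist q' q ≤ η := by
    refine le_of_tendsto (h'.right_tendsto.dist tendsto_const_nhds) ?_
    filter_upwards [Ioo_mem_nhdsLT hm1.2] with t ht
    exact ((h2 t ((h'.mem_iff t).2 ⟨hm1.1.trans ht.1, ht.2⟩)).2 ht.1.le).le
  -- If the slanted line met another strip, it would pass the transversal of that strip. But all its
  -- points are within `η` of the horizontal trajectory or of its ends, and these are at distance at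
  -- least `η` from the other transversals.
  have hown : ∀ x ∈ Ioo A' B', (⟨x, y⟩ : ℂ) ∈ ownStrip φ Ψ (slant w) r k i := by
    refine fun x hx => ⟨⟨⟨(h'.mem_iff x).2 hx, hyr⟩, hy⟩, fun j hj => ?_⟩
    rintro ⟨ξ, ⟨⟨⟨a, b, γ, hγ, hξ⟩, -⟩, hξk⟩, e⟩
    have e1 : flow φ (Ψ j) (slant w) ξ = γ ξ.re := hγ.flow_eq hφ hc0 hξ
    obtain ⟨ε, -, -, hmeet⟩ := h'.meet hφ hc0 hγ.traj hx hξ (e.symm.trans e1)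
    obtain ⟨g1, g2⟩ := hmeet 0 hγ.zero_mem
    rw [hγ.map_zero] at g2
    set s := x + ε * (0 - ξ.re) with hs
    obtain ⟨k1, k2, k3⟩ := hK j hj ξ.im hξk
    rw [← g2, dist_comm] at k1 k2
    simp only [← g2] at k3
    rcases le_total s x₀ with hs0 | hs0
    · exact absurd ((h2 s ((h'.mem_iff s).2 g1)).1 hs0) (not_lt.2 k1)
    rcases le_total x₁ s with hs1 | hs1
    · exact absurd ((h2 s ((h'.mem_iff s).2 g1)).2 hs1) (not_lt.2 k2)
    · have := (h1 s ⟨hs0, hs1⟩).2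
      rw [dist_comm] at this
      exact absurd this (not_lt.2 (k3 s ⟨hx₀.1.trans_le hs0, hs1.trans_lt hx₁.2⟩))
  set T := {z : ℂ | 1 - 1 / (m + 1 : ℝ) < ‖z‖} with hT
  have hTo : IsOpen T := isOpen_lt continuous_const continuous_norm
  set τ := timeIn φ (Ψ i) (slant w) (r i) T y with hτ
  have hτe : τ = volume (Ioo A' B' ∩ {x : ℝ | flow φ (Ψ i) (slant w) ⟨x, y⟩ ∈ T}) :=
    timeIn_eq hyr h'.mem_iff
      (h'.line.traj.continuousOn.isOpen_inter_preimage isOpen_Ioo hTo).measurableSet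
  have hnear : ∀ z u : ℂ, ‖u‖ = 1 → dist z u < η → z ∈ T := fun z u hu hz => by
    have h3 := norm_sub_norm_le u z
    rw [hu, ← dist_eq_norm, dist_comm] at h3
    show 1 - 1 / (m + 1 : ℝ) < ‖z‖
    linarith
  -- Before `x₀` and after `x₁` the slanted line is within `η ≤ 1 / (m + 1)` of a point of the
  -- circle, so the time outside `(A, B)` is spent in the annulus.
  have hlen : ENNReal.ofReal (B' - A') ≤ ENNReal.ofReal (B - A) + τ := by
    rw [← Real.volume_Ioo, ← Real.volume_Ioo (a := A) (b := B), hτe]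
    refine (measure_mono fun x hx => ?_).trans (measure_union_le _ _)
    by_cases hx' : x ∈ Ioo A B ∧ x₀ ≤ x ∧ x ≤ x₁
    · exact Or.inl hx'.1
    refine Or.inr ⟨hx, ?_⟩
    rcases le_total x x₀ with h3 | h3
    · exact hnear _ p h.norm_left ((h2 x ((h'.mem_iff x).2 hx)).1 h3)
    rcases le_total x₁ x with h4 | h4
    · exact hnear _ q h.norm_right ((h2 x ((h'.mem_iff x).2 hx)).2 h4)
    · exact absurd ⟨⟨hx₀.1.trans_le h3, h4.trans_lt hx₁.2⟩, h3, h4⟩ hx'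
  have hrb : ENNReal.ofReal (r i) ≤ ENNReal.ofReal (B - A) :=
    ENNReal.ofReal_le_ofReal (h.le_length (hΨ i) hyr)
  have hb0 : ENNReal.ofReal (B - A) ≠ 0 :=
    ((ENNReal.ofReal_pos.2 (hΨ i).pos).trans_le hrb).ne'
  refine (inv_le_inv_add_add (τ := τ) hb0 ENNReal.ofReal_ne_top).trans (add_le_add ?_ ?_)
  · refine (ENNReal.inv_le_inv.2 hlen).trans ?_
    refine (h'.inv_length_le hφ (hΨ i) hw hf hyr
      (hEF p' q' h'.norm_left h'.norm_right hp hq) hρ).trans ?_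
    rw [← lintegral_indicator measurableSet_Ioo]
    refine lintegral_mono fun x => ?_
    by_cases hx : x ∈ Ioo A' B'
    · rw [indicator_of_mem hx, indicator_of_mem (hown x hx)]
    · rw [indicator_of_notMem hx]; exact zero_le
  · gcongr

end TeichDisk
end

noncomputable section
namespace TeichDisk

/-! ### The lower bound for a finite family of transversals -/

/-- This direction holds without measurability, which is not known for the length of trajectories as
a function of the height. -/
theorem sum_lintegral_le_lintegral_sum {α ι : Type*} [MeasurableSpace α] {ν : Measure α}
    (s : Finset ι) (g : ι → α → ℝ≥0∞) : ∑ i ∈ s, ∫⁻ x, g i x ∂ν ≤ ∫⁻ x, ∑ i ∈ s, g i x ∂ν := by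
  classical
  induction s using Finset.induction_on with
  | empty => simp
  | insert i s hi ih =>
    simp only [Finset.sum_insert hi]
    exact (add_le_add le_rfl ih).trans (le_lintegral_add _ _)

variable {φ : ℂ → ℂ} {ι : Type*} {r k : ι → ℝ} {Ψ : ι → ℂ → ℂ}

/-- No horizontal trajectory meets two of the transversals of the family. -/
def Separated (φ : ℂ → ℂ) (k : ι → ℝ) (Ψ : ι → ℂ → ℂ) : Prop :=
  ∀ i j, i ≠ j → ∀ (a b : ℝ) (γ : ℝ → ℂ), IsTraj φ 1 (Ioo a b) γ → ∀ s ∈ Ioo a b, ∀ t ∈ Ioo a b,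
    ∀ u v : ℝ, |u| ≤ k i → |v| ≤ k j → γ s = Ψ i (u * Complex.I) → γ t ≠ Ψ j (v * Complex.I)

/-- `E` is a neighbourhood in the unit circle of each of its points outside of `S`. -/
def OpenOffCorners (E S : Set ℂ) : Prop :=
  ∀ p ∈ E, p ∉ S → ∃ η > 0, ∀ p' : ℂ, ‖p'‖ = 1 → dist p' p < η → p' ∈ E

/-- The finitely many other transversals form a compact set which, by separation, the trajectory
does not meet. -/
theorem FullLine.exists_le_dist_transversals [Finite ι]
    (hΨ : ∀ i, IsChart φ (r i) (Ψ i)) (hk : ∀ i, k i < r i / 4) (hsep : Separated φ k Ψ) {i : ι}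
    {S : Set ℂ} {y A B : ℝ} {p q : ℂ} (hy : |y| ≤ k i) (h : FullLine φ (Ψ i) 1 S y A B p q) :
    ∃ η > 0, ∀ j ≠ i, ∀ u : ℝ, |u| ≤ k j → η ≤ dist p (Ψ j (u * Complex.I)) ∧
      η ≤ dist q (Ψ j (u * Complex.I)) ∧
      ∀ x ∈ Ioo A B, η ≤ dist (flow φ (Ψ i) 1 ⟨x, y⟩) (Ψ j (u * Complex.I)) := by
  have hmem : ∀ j, ∀ u : ℝ, |u| ≤ k j → (u : ℂ) * Complex.I ∈ Metric.ball (0 : ℂ) (r j) :=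
    fun j u hu => mem_ball_zero_iff.2
      (norm_I_mul_lt (by linarith [hk j, (hΨ j).pos]))
  set K : Set ℂ := ⋃ j ∈ {j | j ≠ i}, (fun u : ℝ => Ψ j (u * Complex.I)) '' Icc (-k j) (k j) with hKd
  have hK : IsCompact K := by
    refine (Set.toFinite _).isCompact_biUnion fun j _ => isCompact_Icc.image_of_continuousOn ?_
    exact (hΨ j).flat.continuousOn.comp (by fun_prop) fun u hu => hmem j u (abs_le.2 hu)
  obtain ⟨η, hη, H⟩ := h.exists_le_dist hK (fun z hz => by
      obtain ⟨j, -, u, hu, rfl⟩ := mem_iUnion₂.1 hz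
      exact ((hΨ j).flat _ (hmem j u (abs_le.2 hu))).1) (fun x hx hz => by
      obtain ⟨j, hj, u, hu, e⟩ := mem_iUnion₂.1 hz
      exact hsep i j (Ne.symm hj) A B _ h.line.traj 0 h.line.zero_mem x hx y u hy (abs_le.2 hu)
        h.line.map_zero e.symm)
  exact ⟨η, hη, fun j hj u hu => H _ (mem_iUnion₂.2 ⟨j, hj, u, abs_le.1 hu, rfl⟩)⟩

theorem OpenOffCorners.exists_ends {E F S : Set ℂ} (hE : OpenOffCorners E S)
    (hF : OpenOffCorners F S) {p q : ℂ} (hp : p ∉ S) (hq : q ∉ S) (h : p ∈ E ∧ q ∈ F ∨ p ∈ F ∧ q ∈ E) :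
    ∃ η > 0, ∀ p' q' : ℂ, ‖p'‖ = 1 → ‖q'‖ = 1 → dist p' p < η → dist q' q < η →
      p' ∈ E ∧ q' ∈ F ∨ p' ∈ F ∧ q' ∈ E := by
  rcases h with ⟨h1, h2⟩ | ⟨h1, h2⟩
  · obtain ⟨η, hη, H⟩ := hE p h1 hp
    obtain ⟨η', hη', H'⟩ := hF q h2 hq
    exact ⟨min η η', lt_min hη hη', fun p' q' hp' hq' d d' => Or.inl
      ⟨H p' hp' (d.trans_le (min_le_left _ _)), H' q' hq' (d'.trans_le (min_le_right _ _))⟩⟩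
  · obtain ⟨η, hη, H⟩ := hF p h1 hp
    obtain ⟨η', hη', H'⟩ := hE q h2 hq
    exact ⟨min η η', lt_min hη hη', fun p' q' hp' hq' d d' => Or.inr
      ⟨H p' hp' (d.trans_le (min_le_left _ _)), H' q' hq' (d'.trans_le (min_le_right _ _))⟩⟩

variable {E F S : Set ℂ} {w : ℕ → ℂ} {f : ℕ → OpenPartialHomeomorph ℂ ℂ} {ρ : ℕ → ℂ → ℝ≥0∞}

/-- For almost every height the horizontal trajectory is complete and avoids `S` at its ends, all
slanted ones are complete, and the latter shadow the former from some index on. The tolerance `η`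
keeps the ends inside the arcs, the line off the other transversals and the excess in the annulus.
-/
theorem ae_eventually_inv_verticalLength_le [Finite ι] (hφ : DifferentiableOn ℂ φ disk)
    (hi : IntegrableOn φ disk) (hne : ∃ z ∈ disk, φ z ≠ 0) (hΨ : ∀ i, IsChart φ (r i) (Ψ i))
    (hk : ∀ i, k i < r i / 4) (hsep : Separated φ k Ψ) (hE1 : ∀ z ∈ E, ‖z‖ = 1)
    (hF1 : ∀ z ∈ F, ‖z‖ = 1) (hS : S.Countable) (hE : OpenOffCorners E S) (hF : OpenOffCorners F S)
    (hw : ∀ n, 0 < (w n).re) (hs : ∀ n, |(slant (w n)).im| ≤ (1 / 2) ^ n)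
    (hf : ∀ n, IsQuasiconformal (beltrami φ (w n)) (f n))
    (hρ : ∀ n, Allowable (imageFamily (f n) (connectingArcs E F)) (ρ n)) (i : ι) (m : ℕ) :
    ∀ᵐ y : ℝ, |y| ≤ k i → Ψ i (y * Complex.I) ∈ connectingTrajectories (fun z => -φ z) E F →
      ∀ᶠ n in atTop, (verticalLength (fun z => -φ z) (Ψ i (y * Complex.I)))⁻¹ ≤
      (∫⁻ x : ℝ, (ownStrip φ Ψ (slant (w n)) r k i).indicator
        (energy φ (Ψ i) (w n) (f n) (ρ n)) ⟨x, y⟩) +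
      (ENNReal.ofReal (r i))⁻¹ ^ 2 *
        timeIn φ (Ψ i) (slant (w n)) (r i) {z : ℂ | 1 - 1 / (m + 1 : ℝ) < ‖z‖} y := by
  filter_upwards [(hΨ i).ae_fullLine hφ hi hne (c := 1) rfl hS,
    ae_all_iff.2 fun n => (hΨ i).ae_fullLine hφ hi hne (slant_re (w n)) countable_empty,
    (hΨ i).ae_shadow hφ, ae_tendsto_slope_mul_length hφ hi (hΨ i) (fun n => slant_re (w n)) hs]
    with y h1 h2 h3 h4 hy hc
  have hyr : |y| < r i / 4 := hy.trans_lt (hk i)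
  obtain ⟨A, B, p, q, hl⟩ := h1 hyr
  obtain ⟨η₁, hη₁, H1⟩ := hl.exists_le_dist_transversals hΨ hk hsep hy
  obtain ⟨η₂, hη₂, H2⟩ := hE.exists_ends hF hl.left_notMem hl.right_notMem
    (hl.ends_mem hφ hE1 hF1 hc)
  set η := min (min η₁ (η₂ / 2)) (1 / (m + 1 : ℝ)) with hη
  have hη0 : 0 < η := by positivity
  have hle1 : η ≤ η₁ := (min_le_left _ _).trans (min_le_left _ _)
  have hle2 : η < η₂ := by
    have : η ≤ η₂ / 2 := (min_le_left _ _).trans (min_le_right _ _)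
    linarith
  obtain ⟨x₀, hx₀, x₁, hx₁, ε, hε, H3⟩ := h3 hyr A B _ p q hl.line hl.norm_left hl.norm_right
    hl.left_tendsto hl.right_tendsto η hη0
  have hsm : ∀ᶠ n in atTop, |(slant (w n)).im| < ε := by
    filter_upwards [(tendsto_order.1 (tendsto_pow_atTop_nhds_zero_of_lt_one
      (show (0 : ℝ) ≤ 1 / 2 by norm_num) (by norm_num))).2 ε hε] with n hn
    exact (hs n).trans_lt hn
  filter_upwards [hsm, (tendsto_order.1 (h4 hyr)).2 _ (ENNReal.ofReal_pos.2 hε)] with n hn1 hn2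
  obtain ⟨A', B', p', q', hl'⟩ := h2 n hyr
  obtain ⟨g1, g2⟩ := H3 (slant (w n)) (slant_re _) hn1 hn2
  refine (ENNReal.inv_le_inv.2 hl.le_verticalLength).trans
    (hl.inv_length_le_energy hφ hΨ (hw n) (hf n) (hk i) hy hl' (hρ n) (η := η) ?_ ?_
      (min_le_right _ _) hx₀ hx₁ g1 g2)
  · exact fun p' q' n1 n2 d1 d2 => H2 p' q' n1 n2 (d1.trans_lt hle2) (d2.trans_lt hle2)
  · intro j hj u hu
    obtain ⟨k1, k2, k3⟩ := H1 j hj u hu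
    exact ⟨hle1.trans k1, hle1.trans k2, fun x hx => hle1.trans (k3 x hx)⟩

/-- Fatou's lemma turns the pointwise bound, valid eventually for each height, into a bound of the
integrals; the error term is at most a constant times the `φ`-area of the annulus. -/
theorem sum_lintegral_inv_verticalLength_le [Fintype ι] (hφ : DifferentiableOn ℂ φ disk)
    (hi : IntegrableOn φ disk) (hne : ∃ z ∈ disk, φ z ≠ 0) (hΨ : ∀ i, IsChart φ (r i) (Ψ i))
    (hk : ∀ i, k i < r i / 4) (hsep : Separated φ k Ψ) (hE1 : ∀ z ∈ E, ‖z‖ = 1)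
    (hF1 : ∀ z ∈ F, ‖z‖ = 1) (hS : S.Countable) (hE : OpenOffCorners E S) (hF : OpenOffCorners F S)
    (hw : ∀ n, 0 < (w n).re) (hs : ∀ n, |(slant (w n)).im| ≤ (1 / 2) ^ n)
    (hf : ∀ n, IsQuasiconformal (beltrami φ (w n)) (f n))
    (hρ : ∀ n, Allowable (imageFamily (f n) (connectingArcs E F)) (ρ n)) {M : ℝ≥0∞}
    (hM : ∀ n, ENNReal.ofReal ((w n).re / Complex.normSq (w n)) * ∫⁻ z, ρ n z ^ 2 ≤ M) :
    ∑ i, ∫⁻ y in Icc (-k i) (k i), (connectingTrajectories (fun z => -φ z) E F).indicator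
      (fun z => (verticalLength (fun z => -φ z) z)⁻¹) (Ψ i (y * Complex.I)) ≤ M := by
  set g : ι → ℝ → ℝ≥0∞ := fun i => (Icc (-k i) (k i)).indicator fun y : ℝ =>
    (connectingTrajectories (fun z => -φ z) E F).indicator
      (fun z => (verticalLength (fun z => -φ z) z)⁻¹) (Ψ i (y * Complex.I)) with hg
  set T : ℕ → Set ℂ := fun m => {z : ℂ | 1 - 1 / (m + 1 : ℝ) < ‖z‖} with hT
  have hTm : ∀ m, MeasurableSet (T m) := fun m => measurableSet_lt measurable_const measurable_norm
  set C : ι → ℝ≥0∞ := fun i => (ENNReal.ofReal (r i))⁻¹ ^ 2 with hC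
  set H : ℕ → ι → ℝ → ℝ≥0∞ := fun n i y => ∫⁻ x : ℝ, (ownStrip φ Ψ (slant (w n)) r k i).indicator
    (energy φ (Ψ i) (w n) (f n) (ρ n)) ⟨x, y⟩ with hH
  set τ : ℕ → ℕ → ι → ℝ → ℝ≥0∞ := fun m n i => timeIn φ (Ψ i) (slant (w n)) (r i) (T m) with hτ
  have hHm : ∀ n i, Measurable (H n i) := fun n i =>
    measurable_slice (measurable_indicator_energy hφ hΨ (hf n).1 (hρ n).1 i)
  have hτm : ∀ m n i, Measurable (τ m n i) := fun m n i =>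
    measurable_timeIn hφ (hΨ i) (slant_re _) (hTm m)
  have hGm : ∀ m n i, Measurable fun y => H n i y + C i * τ m n i y := fun m n i =>
    (hHm n i).add ((hτm m n i).const_mul _)
  have key : ∀ m, ∑ i, ∫⁻ y, g i y ≤ M + (∑ i, C i) * ∫⁻ z in T m, dens φ z := fun m => by
    refine (sum_lintegral_le_lintegral_sum _ _).trans ?_
    have hae : ∀ᵐ y : ℝ, ∑ i, g i y ≤ liminf (fun n => ∑ i, (H n i y + C i * τ m n i y)) atTop := by
      filter_upwards [ae_all_iff.2 fun i => ae_eventually_inv_verticalLength_le hφ hi hne hΨ hk hsep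
        hE1 hF1 hS hE hF hw hs hf hρ i m] with y hy
      refine le_liminf_of_le (by isBoundedDefault) ?_
      have : ∀ i, ∀ᶠ n in atTop, g i y ≤ H n i y + C i * τ m n i y := fun i => by
        by_cases h1 : y ∈ Icc (-k i) (k i)
        · by_cases h2 : Ψ i (y * Complex.I) ∈ connectingTrajectories (fun z => -φ z) E F
          · filter_upwards [hy i (abs_le.2 h1) h2] with n hn
            simpa only [hg, indicator_of_mem h1, indicator_of_mem h2] using hn
          · exact Eventually.of_forall fun n => by
              simp only [hg, indicator_of_mem h1, indicator_of_notMem h2, zero_le]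
        · exact Eventually.of_forall fun n => by simp only [hg, indicator_of_notMem h1, zero_le]
      filter_upwards [eventually_all.2 this] with n hn
      exact Finset.sum_le_sum fun i _ => hn i
    refine (lintegral_mono_ae hae).trans ((lintegral_liminf_le fun n =>
      Finset.measurable_fun_sum _ fun i _ => hGm m n i).trans ?_)
    refine liminf_le_of_frequently_le' (Eventually.frequently (Eventually.of_forall fun n => ?_))
    rw [lintegral_finsetSum _ fun i _ => hGm m n i]
    simp only [lintegral_add_left (hHm n _), lintegral_const_mul _ (hτm m n _)]
    rw [Finset.sum_add_distrib, Finset.sum_mul]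
    refine add_le_add ((sum_lintegral_energy_le hφ hΨ (hw n) (hf n) (hρ n).1).trans (hM n))
      (Finset.sum_le_sum fun i _ => mul_le_mul' le_rfl
        (lintegral_timeIn_le hφ (hΨ i) (slant_re _) (hTm m)))
  have hCf : ∑ i, C i ≠ ⊤ := ENNReal.sum_ne_top.2 fun i _ => by
    simp [hC, ENNReal.pow_eq_top_iff, (hΨ i).pos]
  -- The sequence index was eliminated first, by Fatou; only now does the annulus shrink to the
  -- circle.
  have hlim := (ENNReal.Tendsto.const_mul (tendsto_lintegral_annulus hφ hi) (Or.inr hCf)).const_add M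
  rw [mul_zero, add_zero] at hlim
  have := ge_of_tendsto' hlim key
  simpa only [hg, lintegral_indicator measurableSet_Icc] using this

end TeichDisk
end

noncomputable section
namespace TeichDisk

/-! ### Arcs of the unit circle -/

theorem norm_of_mem_circleArc {a b : ℝ} {z : ℂ} (h : z ∈ circleArc a b) : ‖z‖ = 1 := by
  obtain ⟨θ, -, rfl⟩ := h
  exact Complex.norm_exp_ofReal_mul_I θ

/-- For a point strictly between the end points, a nearby point of the circle differs by a small
argument, which is added to the angle. -/
theorem openOffCorners_circleArc {a b : ℝ} {S : Set ℂ} (ha : Complex.exp (a * Complex.I) ∈ S)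
    (hb : Complex.exp (b * Complex.I) ∈ S) : OpenOffCorners (circleArc a b) S := by
  rintro _ ⟨θ, hθ, rfl⟩ hS
  have h1 : a < θ := hθ.1.lt_of_ne fun e => hS (by subst e; exact ha)
  have h2 : θ < b := hθ.2.lt_of_ne fun e => hS (by subst e; exact hb)
  set p := Complex.exp (θ * Complex.I) with hp
  have hp0 : p ≠ 0 := Complex.exp_ne_zero _
  have hp1 : ‖p‖ = 1 := Complex.norm_exp_ofReal_mul_I θ
  have hc : ContinuousAt (fun z => Complex.arg (z / p)) p := by
    have : ContinuousAt Complex.arg (p / p) := by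
      rw [div_self hp0]; exact Complex.continuousAt_arg (by simp)
    exact this.comp (f := fun z => z / p) (by fun_prop)
  obtain ⟨η, hη, H⟩ := Metric.continuousAt_iff.1 hc (min (θ - a) (b - θ))
    (lt_min (by linarith) (by linarith))
  refine ⟨η, hη, fun p' hp' hd => ?_⟩
  have h3 := H hd
  rw [div_self hp0, Complex.arg_one, Real.dist_eq, sub_zero, lt_min_iff, abs_lt, abs_lt] at h3
  refine ⟨θ + Complex.arg (p' / p), ⟨by linarith [h3.1.1], by linarith [h3.2.2]⟩, ?_⟩
  have h4 := Complex.norm_mul_exp_arg_mul_I (p' / p)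
  rw [norm_div, hp', hp1, div_one, Complex.ofReal_one, one_mul] at h4
  simp only [Complex.ofReal_add, add_mul, Complex.exp_add]
  rw [h4, ← hp, mul_div_cancel₀ _ hp0]

/-! ### Parameters tending to infinity -/

/-- The slope `|t| / (s² + t²)` is at most `2 / (s + |t|)`, so it tends to zero along every approach
to infinity. -/
theorem tendsto_slant : Tendsto (fun w => |(slant w).im|) toInfinity (𝓝 0) := by
  have h1 : Tendsto (fun w : ℂ => w.re + |w.im|) toInfinity atTop := tendsto_comap.mono_left inf_le_left
  have h2 : Tendsto (fun w : ℂ => 2 / (w.re + |w.im|)) toInfinity (𝓝 0) :=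
    h1.const_div_atTop 2
  have h3 : ∀ᶠ w in toInfinity, w ∈ {w : ℂ | 0 < w.re} := mem_inf_of_right (mem_principal_self _)
  refine squeeze_zero' (Eventually.of_forall fun w => abs_nonneg _) ?_ h2
  filter_upwards [h3] with w hw
  have hw : 0 < w.re := hw
  have hn : 0 < Complex.normSq w := Complex.normSq_pos.2 fun h0 => by simp [h0] at hw
  show |w.im / Complex.normSq w| ≤ _
  rw [abs_div, abs_of_pos hn, div_le_div_iff₀ hn (by positivity), Complex.normSq_apply]
  nlinarith [abs_nonneg w.im, abs_mul_abs_self w.im, sq_nonneg (w.re - |w.im|)]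

/-- The bound `M` is undercut at parameters arbitrarily far out, so slopes below `2⁻ⁿ` can be
demanded. The normalization is rewritten by `s + t² / s = |w|² / s`. -/
theorem exists_sequence {Γ : ℂ → Set (ℝ → ℂ)} {M : ℝ≥0∞}
    (h : liminf (fun w : ℂ => modulus (Γ w) / ENNReal.ofReal (w.re + w.im ^ 2 / w.re)) toInfinity < M) :
    ∃ (w : ℕ → ℂ) (ρ : ℕ → ℂ → ℝ≥0∞), (∀ n, 0 < (w n).re) ∧
      (∀ n, |(slant (w n)).im| ≤ (1 / 2) ^ n) ∧ (∀ n, Allowable (Γ (w n)) (ρ n)) ∧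
      ∀ n, ENNReal.ofReal ((w n).re / Complex.normSq (w n)) * ∫⁻ z, ρ n z ^ 2 ≤ M := by
  have hfr := frequently_lt_of_liminf_lt (by isBoundedDefault) h
  have h3 : ∀ᶠ w in toInfinity, w ∈ {w : ℂ | 0 < w.re} := mem_inf_of_right (mem_principal_self _)
  have : ∀ n : ℕ, ∃ w : ℂ, ∃ ρ : ℂ → ℝ≥0∞, 0 < w.re ∧ |(slant w).im| ≤ (1 / 2) ^ n ∧
      Allowable (Γ w) ρ ∧
      ENNReal.ofReal (w.re / Complex.normSq w) * ∫⁻ z, ρ z ^ 2 ≤ M := fun n => by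
    obtain ⟨w, hwM, hw, hws⟩ := (hfr.and_eventually (h3.and
      ((tendsto_order.1 tendsto_slant).2 ((1 / 2) ^ n) (by positivity)))).exists
    have hw : 0 < w.re := hw
    have hn : 0 < Complex.normSq w := Complex.normSq_pos.2 fun h0 => by simp [h0] at hw
    have he : w.re + w.im ^ 2 / w.re = (w.re / Complex.normSq w)⁻¹ := by
      rw [inv_div, Complex.normSq_apply]; field_simp
    have hpos : 0 < w.re / Complex.normSq w := by positivity
    rw [he, ENNReal.ofReal_inv_of_pos hpos, ENNReal.div_eq_inv_mul, inv_inv] at hwM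
    have h0 : ENNReal.ofReal (w.re / Complex.normSq w) ≠ 0 := (ENNReal.ofReal_pos.2 hpos).ne'
    have h4 : modulus (Γ w) < M / ENNReal.ofReal (w.re / Complex.normSq w) := by
      rw [ENNReal.lt_div_iff_mul_lt (Or.inl h0) (Or.inl ENNReal.ofReal_ne_top), mul_comm]
      exact hwM
    obtain ⟨ρ, h5⟩ := iInf_lt_iff.1 h4
    obtain ⟨hρ, h6⟩ := iInf_lt_iff.1 h5
    refine ⟨w, ρ, hw, hws.le, hρ, ?_⟩
    have := ENNReal.mul_le_of_le_div h6.le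
    rwa [mul_comm] at this
  choose w ρ h1 h2 h3 h4 using this
  exact ⟨w, ρ, h1, h2, h3, h4⟩

/-! ### Transversal systems -/

variable {φ : ℂ → ℂ}

theorem IsHorizontalSegment.exists_chart (hφ : DifferentiableOn ℂ φ disk) {h : ℝ} {σ : ℝ → ℂ}
    (hσ : IsHorizontalSegment (fun z => -φ z) h σ) {x : ℝ} (hx : x ∈ Ioo 0 h) :
    ∃ r Ψ R, IsChart φ r Ψ ∧ 0 < R ∧ R ≤ r / 4 ∧ R ≤ x ∧ R ≤ h - x ∧
      ∀ u : ℝ, |u| < R → σ (x + u) = Ψ (u * Complex.I) := by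
  have hl : IsTraj φ Complex.I (Ioo 0 h) σ := fun t ht => by
    obtain ⟨h1, v, h2, h3⟩ := hσ t (Ioo_subset_Icc_self ht)
    refine ⟨h1, v, h2.hasDerivAt (Icc_mem_nhds ht.1 ht.2), ?_⟩
    rw [Complex.I_sq]; linear_combination -h3
  have hv : φ (σ x) * (deriv σ x / Complex.I) ^ 2 = 1 := by
    rw [div_pow, ← mul_div_assoc, hl.sq hx, div_self (pow_ne_zero 2 Complex.I_ne_zero)]
  obtain ⟨r, Ψ, hΨ, h0, h0'⟩ := TeichDisk.exists_chart hφ (hl x hx).1 hv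
  have hr := hΨ.pos
  refine ⟨r, Ψ, min (r / 4) (min x (h - x)), hΨ,
    lt_min (by linarith) (lt_min hx.1 (by linarith [hx.2])), min_le_left _ _,
    (min_le_right _ _).trans (min_le_left _ _), (min_le_right _ _).trans (min_le_right _ _),
    fun u hu => ?_⟩
  rw [lt_min_iff, lt_min_iff, abs_lt, abs_lt, abs_lt] at hu
  have := (hΨ.traj_eq hφ Complex.I_ne_zero hl hx (ζ₀ := 0) (by simpa using hr) h0.symm
    (e := Complex.I) (by rw [h0', div_mul_cancel₀ _ Complex.I_ne_zero]) (t := x + u)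
    ⟨by linarith [hu.2.1.1], by linarith [hu.2.2.2]⟩ (by
      have : |u| < r := abs_lt.2 ⟨by linarith [hu.1.1], by linarith [hu.1.2]⟩
      simpa using this)).1
  rw [this]
  congr 1
  push_cast
  ring

/-- Each transversal is covered, up to a null set, by countably many disjoint closed intervals, each
inside a single chart. A sum over countably many intervals is the supremum over finite families, to
which the bound for separated transversals applies. -/
theorem trajectoryMeasure_le (hφ : DifferentiableOn ℂ φ disk) (hi : IntegrableOn φ disk)
    (hne : ∃ z ∈ disk, φ z ≠ 0) {E F S : Set ℂ} (hE1 : ∀ z ∈ E, ‖z‖ = 1)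
    (hF1 : ∀ z ∈ F, ‖z‖ = 1) (hS : S.Countable) (hE : OpenOffCorners E S) (hF : OpenOffCorners F S)
    {w : ℕ → ℂ} {f : ℕ → OpenPartialHomeomorph ℂ ℂ} {ρ : ℕ → ℂ → ℝ≥0∞}
    (hw : ∀ n, 0 < (w n).re) (hs : ∀ n, |(slant (w n)).im| ≤ (1 / 2) ^ n)
    (hf : ∀ n, IsQuasiconformal (beltrami φ (w n)) (f n))
    (hρ : ∀ n, Allowable (imageFamily (f n) (connectingArcs E F)) (ρ n)) {M : ℝ≥0∞}
    (hM : ∀ n, ENNReal.ofReal ((w n).re / Complex.normSq (w n)) * ∫⁻ z, ρ n z ^ 2 ≤ M) :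
    trajectoryMeasure (fun z => -φ z) E F ≤ M := by
  refine iSup₂_le fun σ h => iSup_le fun hsys => ?_
  set G : ℂ → ℝ≥0∞ := (connectingTrajectories (fun z => -φ z) E F).indicator
    (fun z => (verticalLength (fun z => -φ z) z)⁻¹) with hG
  have hch := fun k x (hx : x ∈ Ioo 0 (h k)) => (hsys.1 k).exists_chart hφ hx
  choose! r Ψ R hΨ hR0 hRr hRx hRh hσ using hch
  -- The Besicovitch covering theorem. Disjointness is essential: it makes intervals of the same
  -- transversal separated in the sense of `Separated`.
  have hcov : ∀ k, ∃ (T : Set ℝ) (ρ : ℝ → ℝ), T.Countable ∧ T ⊆ Ioo 0 (h k) ∧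
      (∀ x ∈ T, ρ x ∈ univ ∩ Ioo 0 (R k x)) ∧
      volume (Ioo 0 (h k) \ ⋃ x ∈ T, Metric.closedBall x (ρ x)) = 0 ∧
      T.PairwiseDisjoint fun x => Metric.closedBall x (ρ x) := fun k =>
    Besicovitch.exists_disjoint_closedBall_covering_ae volume (fun _ => univ) (Ioo 0 (h k))
      (fun x _ δ hδ => by rw [univ_inter]; exact nonempty_Ioo.2 hδ) (R k) (hR0 k)
  choose T κ hTc hTs hκ hT0 hTd using hcov
  have hκ0 : ∀ i : Σ k, T k, 0 < κ i.1 i.2 := fun i => (hκ i.1 i.2 i.2.2).2.1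
  have hκR : ∀ i : Σ k, T k, κ i.1 i.2 < R i.1 i.2 := fun i => (hκ i.1 i.2 i.2.2).2.2
  have hmem : ∀ i : Σ k, T k, (i.2 : ℝ) ∈ Ioo 0 (h i.1) := fun i => hTs i.1 i.2.2
  have hpiece : ∀ i : Σ k, T k, ∫⁻ t in Metric.closedBall (i.2 : ℝ) (κ i.1 i.2), G (σ i.1 t) =
      ∫⁻ u in Icc (-κ i.1 i.2) (κ i.1 i.2), G (Ψ i.1 i.2 (u * Complex.I)) := fun i => by
    rw [← (measurePreserving_add_left volume (i.2 : ℝ)).setLIntegral_comp_preimage_emb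
      (measurableEmbedding_addLeft (i.2 : ℝ)), preimage_add_closedBall, sub_self,
      Real.closedBall_eq_Icc, zero_sub, zero_add]
    refine setLIntegral_congr_fun measurableSet_Icc fun u hu => ?_
    simp only [hσ _ _ (hmem i) u ((abs_le.2 hu).trans_lt (hκR i))]
  have hle : ∀ k, ∫⁻ t in Icc 0 (h k), G (σ k t) ≤
      ∑' x : T k, ∫⁻ t in Metric.closedBall (x : ℝ) (κ k x), G (σ k t) := fun k => by
    have := (hTc k).to_subtype
    rw [← setLIntegral_congr Ioo_ae_eq_Icc]
    refine le_trans ?_ (lintegral_iUnion_le (fun x : T k => Metric.closedBall (x : ℝ) (κ k x)) _)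
    refine lintegral_mono' (Measure.restrict_mono_ae ?_) le_rfl
    have := hT0 k
    rw [biUnion_eq_iUnion] at this
    exact ae_le_set.2 this
  refine (ENNReal.tsum_le_tsum hle).trans ?_
  rw [← ENNReal.tsum_sigma (fun k (x : T k) =>
    ∫⁻ t in Metric.closedBall (x : ℝ) (κ k x), G (σ k t)), ENNReal.tsum_eq_iSup_sum]
  refine iSup_le fun s => ?_
  rw [Finset.sum_congr rfl fun i _ => hpiece i, ← Finset.sum_coe_sort]
  refine sum_lintegral_inv_verticalLength_le (r := fun i : s => r i.1.1 i.1.2)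
    (k := fun i : s => κ i.1.1 i.1.2) (Ψ := fun i : s => Ψ i.1.1 i.1.2) hφ hi hne
    (fun i => hΨ _ _ (hmem i.1)) (fun i => (hκR i.1).trans_le (hRr _ _ (hmem i.1))) ?_ hE1 hF1 hS hE hF
    hw hs hf hρ hM
  rintro ⟨i, his⟩ ⟨j, hjs⟩ hij a b γ hγ s hs t ht u v hu hv e1 e2
  have hv1 : IsVerticalArc (fun z => -φ z) a b γ := by
    refine ⟨EReal.coe_lt_coe_iff.2 (hs.1.trans hs.2), fun t h1 h2 => ?_⟩
    obtain ⟨k1, v, k2, k3⟩ := hγ t ⟨EReal.coe_lt_coe_iff.1 h1, EReal.coe_lt_coe_iff.1 h2⟩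
    exact ⟨k1, v, k2, by linear_combination -k3⟩
  have hτ : ∀ (i : Σ k, T k) (u : ℝ), |u| ≤ κ i.1 i.2 → (i.2 : ℝ) + u ∈ Icc 0 (h i.1) ∧
      σ i.1 (i.2 + u) = Ψ i.1 i.2 (u * Complex.I) := fun i u hu => by
    have h1 := hu.trans_lt (hκR i)
    have h2 := abs_lt.1 h1
    have h3 := hRx _ _ (hmem i)
    have h4 := hRh _ _ (hmem i)
    exact ⟨⟨by linarith, by linarith⟩, hσ _ _ (hmem i) u h1⟩
  obtain ⟨m1, n1⟩ := hτ i u hu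
  obtain ⟨m2, n2⟩ := hτ j v hv
  -- A trajectory meets the system in one point only, so both intervals contain the same point of
  -- the same transversal.
  obtain ⟨hk, hx⟩ := hsys.2 a b γ hv1 s t (EReal.coe_lt_coe_iff.2 hs.1) (EReal.coe_lt_coe_iff.2 hs.2)
    (EReal.coe_lt_coe_iff.2 ht.1) (EReal.coe_lt_coe_iff.2 ht.2) i.1 j.1 _ m1 _ m2
    (e1.trans n1.symm) (e2.trans n2.symm)
  obtain ⟨k, x⟩ := i
  obtain ⟨k', x'⟩ := j
  obtain rfl : k = k' := hk
  refine hij ?_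
  have hxx : x = x' := by
    by_contra hne
    have hd : Disjoint (Metric.closedBall (x : ℝ) (κ k x)) (Metric.closedBall (x' : ℝ) (κ k x')) :=
      hTd k x.2 x'.2 fun e => hne (Subtype.ext e)
    have hx : (x : ℝ) + u = x' + v := hx
    have h1 : (x : ℝ) + u ∈ Metric.closedBall (x : ℝ) (κ k x) := by
      simpa [Real.dist_eq] using hu
    have h2 : (x' : ℝ) + v ∈ Metric.closedBall (x' : ℝ) (κ k x') := by
      simpa [Real.dist_eq] using hv
    exact Set.disjoint_left.1 hd h1 (hx ▸ h2)
  subst hxx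
  rfl

end TeichDisk
end

theorem mainTheorem4
    (φ : ℂ → ℂ)
    (hφ_hol : DifferentiableOn ℂ φ TeichDisk.disk)
    (hφ_int : IntegrableOn φ TeichDisk.disk volume)
    (hφ_ne : ∃ z ∈ TeichDisk.disk, φ z ≠ 0)
    (f : ℂ → OpenPartialHomeomorph ℂ ℂ)
    (hf : ∀ w : ℂ, 0 < w.re → TeichDisk.IsQuasiconformal (TeichDisk.beltrami φ w) (f w))
    (a b c d : ℝ) (hab : a < b) (hbc : b < c) (hcd : c < d) (hda : d < a + 2 * Real.pi) :
    TeichDisk.trajectoryMeasure (fun z => -φ z)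
        (TeichDisk.circleArc a b) (TeichDisk.circleArc c d) ≤
      Filter.liminf
        (fun w : ℂ =>
          TeichDisk.modulus
              (TeichDisk.imageFamily (f w)
                (TeichDisk.connectingArcs
                  (TeichDisk.circleArc a b) (TeichDisk.circleArc c d))) /
            ENNReal.ofReal (w.re + w.im ^ 2 / w.re))
        TeichDisk.toInfinity := by
  -- Almost no trajectory ends at one of the four corners of the box, and off the corners the arcs
  -- are neighbourhoods of their points in the circle.
  set S : Set ℂ := {Complex.exp (a * Complex.I), Complex.exp (b * Complex.I),
    Complex.exp (c * Complex.I), Complex.exp (d * Complex.I)} with hS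
  by_contra! hlt
  obtain ⟨M, hM1, hM2⟩ := exists_between hlt
  obtain ⟨w, ρ, hw, hs, hρ, hM⟩ := TeichDisk.exists_sequence hM1
  refine absurd (TeichDisk.trajectoryMeasure_le hφ_hol hφ_int hφ_ne (S := S)
    (fun _ => TeichDisk.norm_of_mem_circleArc) (fun _ => TeichDisk.norm_of_mem_circleArc)
    (Set.toFinite S).countable
    (TeichDisk.openOffCorners_circleArc (by simp [hS]) (by simp [hS]))
    (TeichDisk.openOffCorners_circleArc (by simp [hS]) (by simp [hS]))
    hw hs (fun n => hf _ (hw n)) hρ hM) (not_le.2 hM2)
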